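/- **Setting.** Let $Q(\vec x)\,{:}{-}\,R_1(\vec x_1),\dots,R_\ell(\vec x_\ell)$ be a full conjunctive query (self-joins allowed, all variables in the head). A database $D$ for $Q$ assigns to every relation symbol of $Q$ a finite set of tuples of natural numbers, stored as an array, and to every tuple $r$ a weight $w(r)\in W$, where $(W,\oplus,\otimes,\bar 0,\bar 1)$ is a selective dioid: a semiring with commutative $\otimes$ in which $x\oplus y\in\{x,y\}$ for all $x,y$; it is ordered by $x\le y \iff x\oplus y=x$. Let $n(D)$ be the maximal cardinality of a relation of $D$. A result of $Q$ on $D$ is an assignment of the variables $\vec x$ whose restriction $r_i$ to $\vec x_i$ lies in $R_i$ for each $i$; its weight is $\bigotimes_{i=1}^{\ell} w(r_i)$. Algorithms are finite programs of a unit-cost random access machine whose memory cells are addressed by vectors of fixed length (so that tuple lookup takes constant time), and in which moving, composing ($\oplus,\otimes$) and comparing dioid elements takes unit time. Space is the number of memory cells in use, including those of the input. A *decomposition schema* $\Delta$ of $Q$ is a finite list of trees, each a finite family of sets of variables of $Q$ (bags) that forms an $\alpha$-acyclic hypergraph and in which every $\vec x_i$ is contained in some bag. A *decomposition algorithm* $\mathcal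 A$ for $Q$ with schema $\Delta$, time $T$ and space $S$ is a program that on every input $D$ halts within $T(D)$ steps, uses at most $S(D)$ memory cells, and writes to memory a relation for each bag of each tree, such that the set of results of $Q$ on $D$ is the union, over all trees, of the outputs of the acyclic full conjunctive queries that join the bags of the tree (these outputs may overlap). It is understood that $T(D)\ge n(D)$. **Theorem.** For every full conjunctive query $Q$ and every decomposition schema $\Delta$ of $Q$ there is a constant $C$ such that for every program $\mathcal A$ there is a program $P$ with the following property. Whenever $W$ is a selective dioid and $\mathcal A$ is a decomposition algorithm for $Q$ with schema $\Delta$, time $T$ and space $S$ (on the databases with weights in $W$), then on every such database $D$ the program $P$ outputs every result of $Q$ on $D$ exactly once, in non-decreasing order of weight, and halts. Moreover, let $TT(k)$ be the time at which $P$ outputs its $k$-th result (the time at which $P$ halts, if there are fewer than $k$ results). Then $$TT(1)\le C\,T(D),\qquad TT(k)-TT(k-1)\le C\,(\lfloor\log_2 k\rfloor+1)\quad(k\ge 2),$$ and for every $k\ge1$ at most $C\,(S(D)+k)$ memory cells are in use up to time $TT(k)$. That is, ranked enumeration has time-to-first $O(T(\mathcal A))$, delay $O(\log k)$ and memory $O(S(\mathcal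 A)+k)$ in data complexity. -/

import Mathlib

namespace RankedEnum

/-! ## Full conjunctive queries, databases, results and their weights -/

/-- A full conjunctive query `Q(x) :- g_1(x_1), ..., g_ℓ(x_ℓ)`. Its variables are
`Fin numVars`, its relation symbols `Fin numRels`; different atoms may refer to the same
relation (self-joins). All variables are in the head. -/
structure CQ where
  numVars : ℕ
  numRels : ℕ
  numAtoms : ℕ
  arity : Fin numRels → ℕ
  rel : Fin numAtoms → Fin numRels
  args : (i : Fin numAtoms) → Fin (arity (rel i)) → Fin numVars
  /-- every relation symbol occurs in the query -/
  rel_surjective : Function.Surjective rel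
  /-- every variable occurs in some atom -/
  var_occurs : ∀ x, ∃ i c, args i c = x

/-- The set of variables of an atom (a hyperedge of the query's hypergraph). -/
def CQ.atomVars (Q : CQ) (i : Fin Q.numAtoms) : Finset (Fin Q.numVars) :=
  Finset.univ.image (Q.args i)

/-- A weighted input database for `Q`: every relation is an array of distinct tuples, and every
tuple has a weight in `W`. -/
structure Database (Q : CQ) (W : Type*) where
  rows : (r : Fin Q.numRels) → List (Fin (Q.arity r) → ℕ)
  nodup : ∀ r, (rows r).Nodup
  weight : (r : Fin Q.numRels) → (Fin (Q.arity r) → ℕ) → W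

namespace Database

variable {Q : CQ} {W : Type*}

/-- `n`, the maximal cardinality of an input relation. -/
def maxCard (D : Database Q W) : ℕ := Finset.univ.sup fun r => (D.rows r).length

/-- `v` is a result (answer) of `Q` on `D`. -/
def IsResult (D : Database Q W) (v : Fin Q.numVars → ℕ) : Prop :=
  ∀ i, v ∘ Q.args i ∈ D.rows (Q.rel i)

/-- The weight of a result: `⨂ᵢ w(rᵢ)` over its witness `(r_1, ..., r_ℓ)`. The dioid operations
`⊕, ⊗` are written `+, *`. -/
def resultWeight [CommSemiring W] (D : Database Q W) (v : Fin Q.numVars → ℕ) : W :=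
  (List.ofFn fun i => D.weight (Q.rel i) (v ∘ Q.args i)).prod

end Database

/-- `⊕` is selective: together with `CommSemiring W` this makes `W` a selective dioid. -/
def Selective (W : Type*) [CommSemiring W] : Prop := ∀ x y : W, x + y = x ∨ x + y = y

/-- The order induced by a selective `⊕`: `x ≤ y` iff `x ⊕ y = x`. -/
def wle {W : Type*} [CommSemiring W] (x y : W) : Prop := x + y = x

/-! ## Acyclicity and decompositions at the schema level -/

/-- `e` is an ear of the hypergraph with edges `e` and `H`: the vertices which `e` shares with `H`
all lie in one edge of `H` (or there are no such vertices). -/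
def IsEar {V : Type*} (e : Finset V) (H : Multiset (Finset V)) : Prop :=
  (∀ x ∈ e, ∀ f ∈ H, x ∉ f) ∨ ∃ f ∈ H, ∀ x ∈ e, (∃ f' ∈ H, x ∈ f') → x ∈ f

/-- Alpha-acyclicity: the (GYO) reduction by successive removal of ears empties the hypergraph. -/
inductive AlphaAcyclic {V : Type*} : Multiset (Finset V) → Prop
  | empty : AlphaAcyclic 0
  | ear (e : Finset V) (H : Multiset (Finset V)) :
      IsEar e H → AlphaAcyclic H → AlphaAcyclic (e ::ₘ H)

/-- The schema of a decomposition of `Q` into a union of acyclic full queries ("trees"), whose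
atoms are the "bags". It depends on the query only. (A choice of trees that depends on the data is
covered: list all candidate trees and leave the bags of the unused ones empty.) Every atom of `Q`
lies in some bag of every tree, as in every tree decomposition. -/
structure Schema (Q : CQ) where
  numTrees : ℕ
  numBags : Fin numTrees → ℕ
  bag : (τ : Fin numTrees) → Fin (numBags τ) → Finset (Fin Q.numVars)
  acyclic : ∀ τ, AlphaAcyclic (Finset.univ.val.map (bag τ))
  covers : ∀ τ i, ∃ b, Q.atomVars i ⊆ bag τ b

/-! ## The RAM

Finite structured programs over registers and a random-access memory. Numbers (which serve as data
values, addresses and counters) and dioid elements are kept in separate registers and memory cells;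
dioid elements can only be moved, combined by `⊕, ⊗` and compared. A cell is addressed by a
short vector of numbers, whose length is fixed by the instruction: an ordinary array is the
case of a vector that consists of a constant and an index, and this form of addressing also
provides dictionaries with constant-time tuple lookup. Every step costs one time unit. -/

inductive Operand
  | const (n : ℕ)
  | reg (r : ℕ)

inductive Cond
  | eq (a b : Operand)
  | lt (a b : Operand)
  /-- compares two weight registers -/
  | wle (w w' : ℕ)

inductive Program
  | set (r : ℕ) (a : Operand)
  | add (r : ℕ) (a b : Operand)
  | sub (r : ℕ) (a b : Operand)
  | half (r : ℕ) (a : Operand)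
  | load (r : ℕ) (addr : List Operand)
  | store (addr : List Operand) (a : Operand)
  | wzero (w : ℕ)
  | wone (w : ℕ)
  | wadd (w w₁ w₂ : ℕ)
  | wmul (w w₁ w₂ : ℕ)
  | wload (w : ℕ) (addr : List Operand)
  | wstore (addr : List Operand) (w : ℕ)
  | output (vals : List Operand)
  | seq (p q : Program)
  | ite (b : Cond) (p q : Program)
  | while (b : Cond) (p : Program)

/-- A machine configuration; `todo` is the control stack of program parts still to be executed,
`none` is a cell that has never been written, `out` is the list of tuples emitted so far. -/
structure Config (W : Type*) where
  todo : List Program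
  reg : ℕ → ℕ
  wreg : ℕ → W
  mem : List ℕ → Option ℕ
  wmem : List ℕ → Option W
  out : List (List ℕ)

namespace Config

variable {W : Type*}

def val (c : Config W) : Operand → ℕ
  | .const n => n
  | .reg r => c.reg r

def addr (c : Config W) (a : List Operand) : List ℕ := a.map c.val

def holds [CommSemiring W] (c : Config W) : Cond → Prop
  | .eq a b => c.val a = c.val b
  | .lt a b => c.val a < c.val b
  | .wle w w' => RankedEnum.wle (c.wreg w) (c.wreg w')

def halted (c : Config W) : Prop := c.todo = []

/-- The number of memory cells in use. Cells are never freed, so this never decreases. -/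
noncomputable def space (c : Config W) : ℕ∞ :=
  {a | c.mem a ≠ none}.encard + {a | c.wmem a ≠ none}.encard

open Classical in
/-- One step of the machine. A number cell that has never been written reads as `0`, a weight cell
as `1̄`. A halted configuration does not change. -/
noncomputable def step [CommSemiring W] (c : Config W) : Config W :=
  match c.todo with
  | [] => c
  | .set r a :: K => { c with todo := K, reg := Function.update c.reg r (c.val a) }
  | .add r a b :: K => { c with todo := K, reg := Function.update c.reg r (c.val a + c.val b) }
  | .sub r a b :: K => { c with todo := K, reg := Function.update c.reg r (c.val a - c.val b) }
  | .half r a :: K => { c with todo := K, reg := Function.update c.reg r (c.val a / 2) }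
  | .load r p :: K =>
      { c with todo := K, reg := Function.update c.reg r ((c.mem (c.addr p)).getD 0) }
  | .store p a :: K =>
      { c with todo := K, mem := Function.update c.mem (c.addr p) (some (c.val a)) }
  | .wzero w :: K => { c with todo := K, wreg := Function.update c.wreg w 0 }
  | .wone w :: K => { c with todo := K, wreg := Function.update c.wreg w 1 }
  | .wadd w w₁ w₂ :: K =>
      { c with todo := K, wreg := Function.update c.wreg w (c.wreg w₁ + c.wreg w₂) }
  | .wmul w w₁ w₂ :: K =>
      { c with todo := K, wreg := Function.update c.wreg w (c.wreg w₁ * c.wreg w₂) }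
  | .wload w p :: K =>
      { c with todo := K, wreg := Function.update c.wreg w ((c.wmem (c.addr p)).getD 1) }
  | .wstore p w :: K =>
      { c with todo := K, wmem := Function.update c.wmem (c.addr p) (some (c.wreg w)) }
  | .output vs :: K => { c with todo := K, out := c.out ++ [vs.map c.val] }
  | .seq p q :: K => { c with todo := p :: q :: K }
  | .ite b p q :: K => { c with todo := (if c.holds b then p else q) :: K }
  | .while b p :: K =>
      { c with todo := if c.holds b then p :: .while b p :: K else K }

end Config

section Runs

variable {Q : CQ} {W : Type*}

/-- Number cells that hold the input: `[0, r]` holds the number of tuples of relation `r`, and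
`[0, r, j, c]` the entry in column `c` of its `j`-th tuple. -/
def inputMem (D : Database Q W) : List ℕ → Option ℕ
  | [0, r] => if hr : r < Q.numRels then some (D.rows ⟨r, hr⟩).length else none
  | [0, r, j, c] =>
      if hr : r < Q.numRels then
        if hj : j < (D.rows ⟨r, hr⟩).length then
          if hc : c < Q.arity ⟨r, hr⟩ then some ((D.rows ⟨r, hr⟩)[j] ⟨c, hc⟩) else none
        else none
      else none
  | _ => none

/-- Weight cells that hold the input: `[0, r, j]` holds the weight of the `j`-th tuple of
relation `r`. -/
def inputWMem (D : Database Q W) : List ℕ → Option W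
  | [0, r, j] =>
      if hr : r < Q.numRels then
        if hj : j < (D.rows ⟨r, hr⟩).length then
          some (D.weight ⟨r, hr⟩ (D.rows ⟨r, hr⟩)[j])
        else none
      else none
  | _ => none

variable [CommSemiring W]

/-- The initial configuration of program `P` on input `D`. -/
def start (P : Program) (D : Database Q W) : Config W where
  todo := [P]
  reg := fun _ => 0
  wreg := fun _ => 1
  mem := inputMem D
  wmem := inputWMem D
  out := []

/-- The configuration of program `P` on input `D` after `t` time units. -/
noncomputable def run (P : Program) (D : Database Q W) (t : ℕ) : Config W :=
  Config.step^[t] (start P D)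

/-- The memory of `c` holds the relations `R τ b` as arrays of distinct tuples: `[1, τ, b]` holds
the number of tuples of bag `b` of tree `τ`, and `[1, τ, b, j, x]` the value of the variable `x` in
its `j`-th tuple. -/
def StoresBags (Δ : Schema Q) (c : Config W)
    (R : (τ : Fin Δ.numTrees) → (b : Fin (Δ.numBags τ)) → List (Δ.bag τ b → ℕ)) : Prop :=
  ∀ τ b, (R τ b).Nodup ∧
    c.mem [1, (τ : ℕ), (b : ℕ)] = some (R τ b).length ∧
    ∀ (j : Fin (R τ b).length) (x : Δ.bag τ b),
      c.mem [1, (τ : ℕ), (b : ℕ), (j : ℕ), ((x : Fin Q.numVars) : ℕ)] = some ((R τ b)[j] x)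

/-- `A` is a decomposition algorithm for `Q` with schema `Δ`, time `T` and space `S`: on every
input `D` it halts within `T D` steps, never uses more than `S D` memory cells (including those of
the input), and leaves in memory bag relations such that the union over all trees of the outputs
of the acyclic queries is the output of `Q` on `D`. -/
def IsDecompositionAlgorithm (Δ : Schema Q) (A : Program) (T S : Database Q W → ℕ) : Prop :=
  ∀ D : Database Q W,
    (∀ t, (run A D t).space ≤ (S D : ℕ∞)) ∧
    ∃ t ≤ T D, (run A D t).halted ∧
      ∃ R : (τ : Fin Δ.numTrees) → (b : Fin (Δ.numBags τ)) → List (Δ.bag τ b → ℕ),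
        StoresBags Δ (run A D t) R ∧
        ∀ v : Fin Q.numVars → ℕ, D.IsResult v ↔ ∃ τ, ∀ b, (fun x : Δ.bag τ b => v x) ∈ R τ b

/-- `P` performs ranked enumeration on `D`: it halts, having emitted every result of `Q` on `D`
exactly once, in the order of the weights. -/
def RanksResults (P : Program) (D : Database Q W) : Prop :=
  ∃ t, (run P D t).halted ∧
    ∃ L : List (Fin Q.numVars → ℕ),
      (run P D t).out = L.map List.ofFn ∧ L.Nodup ∧ (∀ v, v ∈ L ↔ D.IsResult v) ∧
      L.Pairwise fun u v => wle (D.resultWeight u) (D.resultWeight v)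

/-- `t` is `TT(k)`, the first moment when `P` has emitted `k` results; if there are fewer
than `k` results, it is the moment when `P` halts. -/
def IsTimeTo (P : Program) (D : Database Q W) (k t : ℕ) : Prop :=
  IsLeast {s | k ≤ (run P D s).out.length ∨ (run P D s).halted} t

end Runs

end RankedEnum

open RankedEnum

/-! The program copies the input into a private region of memory, runs the decomposition algorithm
there, indexes every tree of bags, and then searches the solutions of all trees together in
best-first order.

Index. A GYO elimination read backwards numbers the bags of a tree so that the variables which a bag
shares with all earlier bags lie in a single earlier bag, its parent (`exists_gyo_order`). Each atom
is charged to one bag that contains its variables (`Schema.prod_atoms`), so every row of a bag gets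
a weight. Multiplying it by the best weights of the matching groups in the child bags gives the best
weight of a solution of the subtree below the row. Rows of a bag that agree on the separator form a
group, stored as a heap ordered by best weight. Sorting would cost a logarithmic factor, and a heap
suffices: all that is needed is that every row except the head has a unique predecessor of no larger
weight, and every row at most two successors. The heap is the Cartesian tree of the group, built in
one scan with its right spine as a stack. Every row leaves a spine at most once, so indexing is
linear (`spec_popLoop`, `spec_indexRow`, `spec_indexBag`).

Search space. A solution of a tree is a choice of one row per bag. Suppose that all its rows after
bag `d` are heads of their groups. Its children arise by choosing a bag `j ≥ d`, replacing the row
there by its left or right heap child, and completing with heads. The bag `j` is the last one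
without a head, and heap parents are unique, so a solution has at most one parent and the all-heads
solution has none (`IsChild.inj`, `IsChild.not_greedy`). A child is not lighter than its parent
(`IsChild.wt_le`), which rests on distributivity. Therefore repeated extraction of a lightest
candidate from a priority queue, followed by generation of its children, visits solutions in order
of weight and without repetition inside a tree (`Inv.addChild`, `Inv.pop`), and no solution is
missed (`Inv.complete`).

Duplicates. A result may be a solution of several trees, but only once of each, since the rows of a
bag are distinct. So the number of extracted candidates is at most the number of trees times the
number of distinct results found (`Found.card_le`). A round extracts as many candidates as there are
trees, appends the new results to a list, and outputs one element of the list (`spec_round`). Until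
the queue is exhausted this always finds something to output, so duplicates cost a constant factor
of the delay only. After `k` rounds there are `O(k)` candidates, and an operation on the tournament
tree takes `O(log k)` steps.

Time and space. Apart from one possible empty tuple, the tuples of a bag occupy cells which the
decomposition algorithm itself has written. So bag sizes are bounded both by its time and by its
space (`encard_new_le`, `length_bag_le`). A step uses at most one new cell, hence linear indexing
time also means space `O(S)`. All programs are verified with the time-bounded triples `Spec`; pieces
without loops are executed symbolically by `eval`. -/

namespace RankedEnum

universe u

/-! ### A program logic with time bounds, and the growth of space and output along a run. -/

section Framework

/-- The data part of a machine configuration. -/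
structure St (W : Type u) where
  reg : ℕ → ℕ
  wreg : ℕ → W
  mem : List ℕ → Option ℕ
  wmem : List ℕ → Option W
  out : List (List ℕ)

variable {W : Type u}

namespace St

/-- The configuration with data `σ` and control stack `K`. -/
def cfg (σ : St W) (K : List Program) : Config W :=
  ⟨K, σ.reg, σ.wreg, σ.mem, σ.wmem, σ.out⟩

def val (σ : St W) : Operand → ℕ
  | .const n => n
  | .reg r => σ.reg r

/-- The content of a number cell as read by the machine. -/
def rd (σ : St W) (a : List ℕ) : ℕ := (σ.mem a).getD 0

/-- The content of a weight cell as read by the machine. -/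
def wrd [One W] (σ : St W) (a : List ℕ) : W := (σ.wmem a).getD 1

def holds [CommSemiring W] (σ : St W) : Cond → Prop
  | .eq a b => σ.val a = σ.val b
  | .lt a b => σ.val a < σ.val b
  | .wle w w' => RankedEnum.wle (σ.wreg w) (σ.wreg w')

noncomputable def space (σ : St W) : ℕ∞ :=
  {a | σ.mem a ≠ none}.encard + {a | σ.wmem a ≠ none}.encard

@[simp] theorem val_const (σ : St W) (n : ℕ) : σ.val (.const n) = n := rfl
@[simp] theorem val_reg (σ : St W) (r : ℕ) : σ.val (.reg r) = σ.reg r := rfl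

end St

variable [CommSemiring W]

open Classical in
/-- The effect of a program without loops. -/
noncomputable def eval : Program → St W → St W
  | .set r a, σ => { σ with reg := Function.update σ.reg r (σ.val a) }
  | .add r a b, σ => { σ with reg := Function.update σ.reg r (σ.val a + σ.val b) }
  | .sub r a b, σ => { σ with reg := Function.update σ.reg r (σ.val a - σ.val b) }
  | .half r a, σ => { σ with reg := Function.update σ.reg r (σ.val a / 2) }
  | .load r p, σ => { σ with reg := Function.update σ.reg r (σ.rd (p.map σ.val)) }
  | .store p a, σ => { σ with mem := Function.update σ.mem (p.map σ.val) (some (σ.val a)) }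
  | .wzero w, σ => { σ with wreg := Function.update σ.wreg w 0 }
  | .wone w, σ => { σ with wreg := Function.update σ.wreg w 1 }
  | .wadd w w₁ w₂, σ => { σ with wreg := Function.update σ.wreg w (σ.wreg w₁ + σ.wreg w₂) }
  | .wmul w w₁ w₂, σ => { σ with wreg := Function.update σ.wreg w (σ.wreg w₁ * σ.wreg w₂) }
  | .wload w p, σ => { σ with wreg := Function.update σ.wreg w (σ.wrd (p.map σ.val)) }
  | .wstore p w, σ => { σ with wmem := Function.update σ.wmem (p.map σ.val) (some (σ.wreg w)) }
  | .output vs, σ => { σ with out := σ.out ++ [vs.map σ.val] }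
  | .seq p q, σ => eval q (eval p σ)
  | .ite b p q, σ => if σ.holds b then eval p σ else eval q σ
  | .while _ _, σ => σ

def LoopFree : Program → Prop
  | .seq p q => LoopFree p ∧ LoopFree q
  | .ite _ p q => LoopFree p ∧ LoopFree q
  | .while _ _ => False
  | _ => True

/-- An upper bound on the running time of a program without loops. -/
def cost : Program → ℕ
  | .seq p q => cost p + cost q + 1
  | .ite _ p q => cost p + cost q + 1
  | _ => 1

/-- `p` transforms `σ` into `σ'` in exactly `t` steps. -/
def Runs (p : Program) (σ σ' : St W) (t : ℕ) : Prop :=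
  ∀ K, Config.step^[t] (σ.cfg (p :: K)) = σ'.cfg K

theorem Runs.seq {p q : Program} {σ σ' σ'' : St W} {t t' : ℕ} (h : Runs p σ σ' t)
    (h' : Runs q σ' σ'' t') : Runs (.seq p q) σ σ'' (t' + t + 1) := by
  intro K
  rw [Function.iterate_succ_apply, Function.iterate_add_apply]
  show Config.step^[t'] (Config.step^[t] (σ.cfg (p :: q :: K))) = _
  rw [h, h']

open Classical in
theorem step_ite (σ : St W) (b : Cond) (p q : Program) (K : List Program) :
    Config.step (σ.cfg (.ite b p q :: K)) = σ.cfg ((if σ.holds b then p else q) :: K) := by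
  simp only [Config.step, St.cfg]
  congr 2

open Classical in
theorem step_while (σ : St W) (b : Cond) (p : Program) (K : List Program) :
    Config.step (σ.cfg (.while b p :: K)) =
      σ.cfg (if σ.holds b then p :: .while b p :: K else K) := by
  simp only [Config.step, St.cfg]
  congr 1

theorem Runs.ite_true {b : Cond} {p q : Program} {σ σ' : St W} {t : ℕ} (hb : σ.holds b)
    (h : Runs p σ σ' t) : Runs (.ite b p q) σ σ' (t + 1) := by
  intro K
  rw [Function.iterate_succ_apply, step_ite, if_pos hb, h]

theorem Runs.ite_false {b : Cond} {p q : Program} {σ σ' : St W} {t : ℕ} (hb : ¬ σ.holds b)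
    (h : Runs q σ σ' t) : Runs (.ite b p q) σ σ' (t + 1) := by
  intro K
  rw [Function.iterate_succ_apply, step_ite, if_neg hb, h]

theorem Runs.while_true {b : Cond} {p : Program} {σ σ' σ'' : St W} {t t' : ℕ} (hb : σ.holds b)
    (h : Runs p σ σ' t) (h' : Runs (.while b p) σ' σ'' t') :
    Runs (.while b p) σ σ'' (t' + t + 1) := by
  intro K
  rw [Function.iterate_succ_apply, step_while, if_pos hb, Function.iterate_add_apply, h, h']

theorem Runs.while_false {b : Cond} {p : Program} {σ : St W} (hb : ¬ σ.holds b) :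
    Runs (.while b p) σ σ 1 := by
  intro K
  rw [Function.iterate_one, step_while, if_neg hb]

/-- Without loops, the effect is a function of the state, and the length of the text bounds the time
whichever branches are taken. This reduces the correctness of every straight-line block to a
computation with `eval`. -/
theorem runs_eval (p : Program) (hp : LoopFree p) (σ : St W) :
    ∃ t ≤ cost p, Runs p σ (eval p σ) t := by
  induction p generalizing σ with
  | seq p q ihp ihq =>
    obtain ⟨t, ht, h⟩ := ihp hp.1 σ
    obtain ⟨t', ht', h'⟩ := ihq hp.2 (eval p σ)
    exact ⟨_, by simp only [cost]; omega, h.seq h'⟩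
  | ite b p q ihp ihq =>
    by_cases hb : σ.holds b
    · obtain ⟨t, ht, h⟩ := ihp hp.1 σ
      refine ⟨t + 1, by simp only [cost]; omega, ?_⟩
      simpa only [eval, if_pos hb] using h.ite_true hb
    · obtain ⟨t, ht, h⟩ := ihq hp.2 σ
      refine ⟨t + 1, by simp only [cost]; omega, ?_⟩
      simpa only [eval, if_neg hb] using h.ite_false hb
  | _ =>
    first
      | exact hp.elim
      | refine ⟨1, le_rfl, fun K => ?_⟩
        simp only [Function.iterate_one, Config.step, St.cfg, eval, St.rd, St.wrd]
        try rfl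

/-- Started in `σ`, the program `p` finishes within `t` steps in a state that satisfies `Post`. -/
def Spec (p : Program) (t : ℕ) (σ : St W) (Post : St W → Prop) : Prop :=
  ∃ σ' t', t' ≤ t ∧ Runs p σ σ' t' ∧ Post σ'

theorem Spec.of_eval {p : Program} {σ : St W} {Post : St W → Prop} (hp : LoopFree p)
    (h : Post (eval p σ)) : Spec p (cost p) σ Post := by
  obtain ⟨t, ht, hr⟩ := runs_eval p hp σ
  exact ⟨_, t, ht, hr, h⟩

theorem Spec.mono {p : Program} {t t' : ℕ} {σ : St W} {Post Post' : St W → Prop}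
    (h : Spec p t σ Post) (ht : t ≤ t') (hP : ∀ σ', Post σ' → Post' σ') : Spec p t' σ Post' := by
  obtain ⟨σ', s, hs, hr, hp⟩ := h
  exact ⟨σ', s, hs.trans ht, hr, hP _ hp⟩

theorem Spec.seq {p q : Program} {t t' : ℕ} {σ : St W} {Post : St W → Prop}
    (h : Spec p t σ fun σ' => Spec q t' σ' Post) : Spec (.seq p q) (t + t' + 1) σ Post := by
  obtain ⟨σ', s, hs, hr, σ'', s', hs', hr', hp⟩ := h
  exact ⟨σ'', _, by omega, hr.seq hr', hp⟩

theorem Spec.ite {b : Cond} {p q : Program} {t : ℕ} {σ : St W} {Post : St W → Prop}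
    (h : σ.holds b → Spec p t σ Post) (h' : ¬ σ.holds b → Spec q t σ Post) :
    Spec (.ite b p q) (t + 1) σ Post := by
  by_cases hb : σ.holds b
  · obtain ⟨σ', s, hs, hr, hp⟩ := h hb
    exact ⟨σ', _, by omega, hr.ite_true hb, hp⟩
  · obtain ⟨σ', s, hs, hr, hp⟩ := h' hb
    exact ⟨σ', _, by omega, hr.ite_false hb, hp⟩

/-- The remaining iterations are specified inside the postcondition of the body. So a loop can be
verified by induction on any measure, and every iteration may have a time bound of its own, as
amortised analysis requires. -/
theorem Spec.while_true {b : Cond} {p : Program} {t t' : ℕ} {σ : St W} {Post : St W → Prop}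
    (hb : σ.holds b) (h : Spec p t σ fun σ' => Spec (.while b p) t' σ' Post) :
    Spec (.while b p) (t + t' + 1) σ Post := by
  obtain ⟨σ', s, hs, hr, σ'', s', hs', hr', hp⟩ := h
  exact ⟨σ'', _, by omega, hr.while_true hb hr', hp⟩

theorem Spec.while_false {b : Cond} {p : Program} {σ : St W} {Post : St W → Prop}
    (hb : ¬ σ.holds b) (h : Post σ) : Spec (.while b p) 1 σ Post :=
  ⟨σ, 1, le_rfl, Runs.while_false hb, h⟩

/-! ### Unrolled sequences -/

def skip : Program := .set 0 (.reg 0)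

def seqs : List Program → Program
  | [] => skip
  | p :: l => .seq p (seqs l)

@[simp] theorem eval_skip (σ : St W) : eval skip σ = σ := by
  simp [skip, eval]

@[simp] theorem eval_seqs_nil (σ : St W) : eval (seqs []) σ = σ := by simp [seqs]

@[simp] theorem eval_seqs_cons (p : Program) (l : List Program) (σ : St W) :
    eval (seqs (p :: l)) σ = eval (seqs l) (eval p σ) := rfl

theorem eval_seqs_append (l l' : List Program) (σ : St W) :
    eval (seqs (l ++ l')) σ = eval (seqs l') (eval (seqs l) σ) := by
  induction l generalizing σ with
  | nil => simp
  | cons p l ih => simp [ih]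

theorem loopFree_seqs {l : List Program} : LoopFree (seqs l) ↔ ∀ p ∈ l, LoopFree p := by
  induction l with
  | nil => simp [seqs, skip, LoopFree]
  | cons p l ih => simp [seqs, LoopFree, ih]

/-- Invariant rule for an unrolled loop over a list. -/
theorem eval_seqs_map {ι : Type*} (f : ι → Program) (I : List ι → St W → Prop) (l : List ι)
    (σ : St W) (h0 : I [] σ)
    (hs : ∀ done a rest, l = done ++ a :: rest → ∀ σ, I done σ → I (done ++ [a]) (eval (f a) σ)) :
    I l (eval (seqs (l.map f)) σ) := by
  suffices H : ∀ rest done σ, l = done ++ rest → I done σ → I l (eval (seqs (rest.map f)) σ) from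
    H l [] σ rfl h0
  intro rest
  induction rest with
  | nil => intro done σ hl h; simpa [hl] using h
  | cons a rest ih =>
    intro done σ hl h
    simp only [List.map_cons, eval_seqs_cons]
    exact ih (done ++ [a]) _ (by simp [hl]) (hs done a rest hl σ h)

theorem eval_seqs_range (f : ℕ → Program) (I : ℕ → St W → Prop) (m : ℕ) (σ : St W) (h0 : I 0 σ)
    (hs : ∀ i < m, ∀ σ, I i σ → I (i + 1) (eval (f i) σ)) :
    I m (eval (seqs ((List.range m).map f)) σ) := by
  induction m with
  | zero => simpa using h0
  | succ m ih =>
    rw [List.range_succ, List.map_append, eval_seqs_append, List.map_singleton, eval_seqs_cons,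
      eval_seqs_nil]
    exact hs m (by omega) _ (ih fun i hi => hs i (by omega))

theorem spec_skip {σ : St W} {Post : St W → Prop} (h : Post σ) : Spec skip 1 σ Post :=
  Spec.of_eval (p := skip) trivial (by simpa using h)

/-- Invariant rule for an unrolled loop over a list. -/
theorem spec_seqs_map {ι : Type*} (f : ι → Program) (I : List ι → St W → Prop) (l : List ι)
    (t : ℕ) (σ : St W) (h0 : I [] σ)
    (hs : ∀ done a rest, l = done ++ a :: rest → ∀ σ, I done σ →
      Spec (f a) t σ (I (done ++ [a]))) :
    Spec (seqs (l.map f)) (l.length * (t + 1) + 1) σ (I l) := by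
  suffices H : ∀ rest done σ, l = done ++ rest → I done σ →
      Spec (seqs (rest.map f)) (rest.length * (t + 1) + 1) σ (I l) from H l [] σ rfl h0
  intro rest
  induction rest with
  | nil => intro done σ hl h; exact Spec.mono (spec_skip h) (by simp) (by simp [hl])
  | cons a rest ih =>
    intro done σ hl h
    have h1 := (hs done a rest hl σ h).mono le_rfl
      fun σ' h' => ih (done ++ [a]) σ' (by simp [hl]) h'
    exact (Spec.seq h1).mono (by simp only [List.length_cons]; ring_nf; omega) fun _ h => h

theorem spec_seqs_range (f : ℕ → Program) (I : ℕ → St W → Prop) (m t : ℕ) (σ : St W)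
    (h0 : I 0 σ) (hs : ∀ i < m, ∀ σ, I i σ → Spec (f i) t σ (I (i + 1))) :
    Spec (seqs ((List.range m).map f)) (m * (t + 1) + 1) σ (I m) := by
  have := spec_seqs_map f (fun l => I l.length) (List.range m) t σ h0 (by
    intro done a rest hl σ h
    have h1 : done.length < m := by
      have := congrArg List.length hl
      simp at this; omega
    have h2 : a = done.length := by
      have h3 : (List.range m)[done.length]'(by simpa using h1) = a := by simp [hl]
      simpa using h3.symm
    subst h2
    simpa using hs _ h1 σ h)
  simpa using this

/-! ### Space and output along a run -/

/-- All comparisons of space with time rest on this: a step writes at most one cell of one of the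
two memories. -/
theorem step_mem_cases (c : Config W) :
    (∃ a x, c.step.mem = Function.update c.mem a (some x) ∧ c.step.wmem = c.wmem) ∨
    (∃ a x, c.step.wmem = Function.update c.wmem a (some x) ∧ c.step.mem = c.mem) ∨
    (c.step.mem = c.mem ∧ c.step.wmem = c.wmem) := by
  rcases c with ⟨todo, reg, wreg, mem, wmem, out⟩
  rcases todo with _ | ⟨p, K⟩
  · exact .inr (.inr ⟨rfl, rfl⟩)
  cases p
  case store a x => exact .inl ⟨_, _, rfl, rfl⟩
  case wstore a x => exact .inr (.inl ⟨_, _, rfl, rfl⟩)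
  all_goals exact .inr (.inr ⟨rfl, rfl⟩)

theorem setOf_update_ne_none {α β : Type*} [DecidableEq α] (f : α → Option β) (a : α) (x : β) :
    {b | Function.update f a (some x) b ≠ none} = insert a {b | f b ≠ none} := by
  ext b
  by_cases h : b = a <;> simp [h, Function.update_apply]

theorem space_step_le (c : Config W) : c.step.space ≤ c.space + 1 := by
  unfold Config.space
  rcases step_mem_cases c with ⟨a, x, h, h'⟩ | ⟨a, x, h, h'⟩ | ⟨h, h'⟩
  · rw [h, h', setOf_update_ne_none, add_right_comm]
    exact add_le_add (Set.encard_insert_le _ _) le_rfl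
  · rw [h, h', setOf_update_ne_none, add_assoc]
    exact add_le_add le_rfl (Set.encard_insert_le _ _)
  · rw [h, h']; exact le_self_add

theorem space_le_step (c : Config W) : c.space ≤ c.step.space := by
  unfold Config.space
  rcases step_mem_cases c with ⟨a, x, h, h'⟩ | ⟨a, x, h, h'⟩ | ⟨h, h'⟩
  · rw [h, h', setOf_update_ne_none]
    exact add_le_add (Set.encard_le_encard (Set.subset_insert _ _)) le_rfl
  · rw [h, h', setOf_update_ne_none]
    exact add_le_add le_rfl (Set.encard_le_encard (Set.subset_insert _ _))
  · rw [h, h']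

theorem space_iterate_le (c : Config W) (t : ℕ) : (Config.step^[t] c).space ≤ c.space + t := by
  induction t with
  | zero => simp
  | succ t ih =>
    rw [Function.iterate_succ_apply']
    calc _ ≤ _ := space_step_le _
      _ ≤ c.space + t + 1 := add_le_add ih le_rfl
      _ = _ := by push_cast; ring

theorem Runs.space_le {p : Program} {σ σ' : St W} {t : ℕ} (h : Runs p σ σ' t) :
    σ'.space ≤ σ.space + t := by
  have := space_iterate_le (σ.cfg [p]) t
  rw [h []] at this
  exact this

/-- A cell that was empty at the start has to be written before it is in use, and a step writes one
cell. Applied to the decomposition algorithm, this bounds the sizes of its bags by its running time.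
-/
theorem encard_new_le (c : Config W) (t : ℕ) :
    {a | (Config.step^[t] c).mem a ≠ none ∧ c.mem a = none}.encard ≤ t := by
  induction t with
  | zero => simp
  | succ t ih =>
    rw [Function.iterate_succ_apply']
    set d := Config.step^[t] c
    rcases step_mem_cases d with ⟨a, x, h, -⟩ | ⟨a, x, -, h⟩ | ⟨h, -⟩
    · rw [h]
      refine le_trans (Set.encard_le_encard (t := insert a {b | d.mem b ≠ none ∧ c.mem b = none})
        ?_) ((Set.encard_insert_le _ _).trans ?_)
      · rintro b ⟨hb, hb'⟩
        by_cases hba : b = a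
        · exact Or.inl hba
        · exact Or.inr ⟨by simpa [hba] using hb, hb'⟩
      · push_cast; exact add_le_add ih le_rfl
    all_goals
      rw [h]; refine ih.trans ?_; exact_mod_cast Nat.le_succ t

theorem out_step (c : Config W) : ∃ l, c.step.out = c.out ++ l := by
  rcases c with ⟨todo, reg, wreg, mem, wmem, out⟩
  rcases todo with _ | ⟨p, K⟩
  · exact ⟨[], by simp [Config.step]⟩
  cases p
  case output vs => exact ⟨_, rfl⟩
  all_goals exact ⟨[], by simp [Config.step]⟩

theorem step_of_halted {c : Config W} (h : c.halted) : c.step = c := by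
  unfold Config.halted at h
  unfold Config.step
  rw [h]

section Runs

variable {Q : CQ} {P : Program} {D : Database Q W}

theorem run_succ (t : ℕ) : run P D (t + 1) = (run P D t).step :=
  Function.iterate_succ_apply' _ _ _

theorem run_add (s t : ℕ) : run P D (s + t) = Config.step^[t] (run P D s) := by
  rw [add_comm, run, Function.iterate_add_apply]; rfl

theorem out_length_mono {s t : ℕ} (h : s ≤ t) :
    (run P D s).out.length ≤ (run P D t).out.length := by
  refine monotone_nat_of_le_succ (f := fun t => (run P D t).out.length) (fun t => ?_) h
  obtain ⟨l, hl⟩ := out_step (run P D t)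
  simp [run_succ, hl]

theorem space_mono {s t : ℕ} (h : s ≤ t) : (run P D s).space ≤ (run P D t).space := by
  refine monotone_nat_of_le_succ (f := fun t => (run P D t).space) (fun t => ?_) h
  simpa only [run_succ] using space_le_step _

theorem run_of_halted {s t : ℕ} (hs : (run P D s).halted) (h : s ≤ t) :
    run P D t = run P D s := by
  obtain ⟨d, rfl⟩ := Nat.exists_eq_add_of_le h
  rw [run_add]
  exact Function.iterate_fixed (step_of_halted hs) d

end Runs

end Framework
end RankedEnum

namespace RankedEnum

universe u

section Embedding

/-! ### Running a program inside an arena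

The registers of the embedded program are shifted, its addresses are prefixed by `5`, and its
outputs are suppressed. -/

def Operand.embed (s : ℕ) : Operand → Operand
  | .const n => .const n
  | .reg r => .reg (r + s)

def embedAddr (s : ℕ) (a : List Operand) : List Operand := .const 5 :: a.map (Operand.embed s)

def Cond.embed (s : ℕ) : Cond → Cond
  | .eq a b => .eq (a.embed s) (b.embed s)
  | .lt a b => .lt (a.embed s) (b.embed s)
  | .wle w w' => .wle (w + s) (w' + s)

def Program.embed (s : ℕ) : Program → Program
  | .set r a => .set (r + s) (a.embed s)
  | .add r a b => .add (r + s) (a.embed s) (b.embed s)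
  | .sub r a b => .sub (r + s) (a.embed s) (b.embed s)
  | .half r a => .half (r + s) (a.embed s)
  | .load r p => .load (r + s) (embedAddr s p)
  | .store p a => .store (embedAddr s p) (a.embed s)
  | .wzero w => .wzero (w + s)
  | .wone w => .wone (w + s)
  | .wadd w w₁ w₂ => .wadd (w + s) (w₁ + s) (w₂ + s)
  | .wmul w w₁ w₂ => .wmul (w + s) (w₁ + s) (w₂ + s)
  | .wload w p => .wload (w + s) (embedAddr s p)
  | .wstore p w => .wstore (embedAddr s p) (w + s)
  | .output _ => skip
  | .seq p q => .seq (p.embed s) (q.embed s)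
  | .ite b p q => .ite (b.embed s) (p.embed s) (q.embed s)
  | .while b p => .while (b.embed s) (p.embed s)

variable {W : Type u}

/-- The state in which the arena holds the data of `c` and the rest is as in `σ`. -/
def St.over (s : ℕ) (σ : St W) (c : Config W) : St W where
  reg r := if r < s then σ.reg r else c.reg (r - s)
  wreg r := if r < s then σ.wreg r else c.wreg (r - s)
  mem | 5 :: a => c.mem a
      | a => σ.mem a
  wmem | 5 :: a => c.wmem a
       | a => σ.wmem a
  out := σ.out

/-- With `over_update_mem`, this lets every writing instruction commute with `St.over`. -/
theorem over_update_reg {X : Type*} (s r : ℕ) (f g : ℕ → X) (x : X) :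
    Function.update (fun r => if r < s then f r else g (r - s)) (r + s) x =
      fun r' => if r' < s then f r' else Function.update g r x (r' - s) := by
  funext r'
  by_cases h : r' = r + s
  · subst h; simp
  · rw [Function.update_of_ne h]
    by_cases h' : r' < s
    · simp [h']
    · rw [if_neg h', if_neg h', Function.update_of_ne (by omega)]

theorem over_update_mem {X : Type*} (a : List ℕ) (f g : List ℕ → X) (x : X) :
    Function.update (fun | 5 :: a => g a | a => f a) (5 :: a) x =
      fun | 5 :: b => Function.update g a x b | b => f b := by
  funext b
  by_cases h : b = 5 :: a
  · subst h; simp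
  · rw [Function.update_of_ne h]
    split
    · rename_i b'
      rw [Function.update_of_ne (by simpa using h)]
    · rfl

theorem over_val (s : ℕ) (σ : St W) (c : Config W) (a : Operand) :
    (σ.over s c).val (a.embed s) = c.val a := by
  cases a <;> simp [Operand.embed, St.val, Config.val, St.over]

theorem over_addr (s : ℕ) (σ : St W) (c : Config W) (a : List Operand) :
    (embedAddr s a).map (σ.over s c).val = 5 :: c.addr a := by
  simp [embedAddr, Config.addr, over_val, Function.comp_def]

variable [CommSemiring W]

theorem over_holds (s : ℕ) (σ : St W) (c : Config W) (b : Cond) :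
    (σ.over s c).holds (b.embed s) ↔ c.holds b := by
  cases b <;> simp only [Cond.embed, St.holds, Config.holds, over_val]
  simp [St.over]

theorem eval_over_cfg {p : Program} (hp : ∀ b q, p ≠ .while b q) (hp' : ∀ b q r, p ≠ .ite b q r)
    (hp'' : ∀ q r, p ≠ .seq q r) (σ : St W) (K : List Program) :
    Config.step (σ.cfg (p :: K)) = (eval p σ).cfg K := by
  have hl : LoopFree p := by cases p <;> simp_all [LoopFree]
  have hc : cost p = 1 := by cases p <;> simp_all [cost]
  obtain ⟨t, ht, h⟩ := runs_eval p hl σ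
  -- Zero steps are impossible, since they would leave `p` on the control stack.
  have h1 : t = 1 := by
    rcases t with _ | t
    · have := congrArg Config.todo (h [])
      simp [St.cfg] at this
    · omega
  subst h1
  exact h K

-- The simulation is in lockstep: even a suppressed output is replaced by a `skip` of one step.
-- Halted configurations are excluded because there the host would already go on with `K`.
open Classical in
theorem step_over (s : ℕ) (σ : St W) (c : Config W) (hc : ¬ c.halted) (K : List Program) :
    Config.step ((σ.over s c).cfg (c.todo.map (Program.embed s) ++ K)) =
      (σ.over s c.step).cfg (c.step.todo.map (Program.embed s) ++ K) := by
  rcases c with ⟨todo, reg, wreg, mem, wmem, out⟩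
  rcases todo with _ | ⟨p, L⟩
  · exact absurd rfl hc
  have e : ∀ c : Config W, (σ.over s c).mem = (fun | 5 :: a => c.mem a | a => σ.mem a) :=
    fun _ => rfl
  have e' : ∀ c : Config W, (σ.over s c).wmem = (fun | 5 :: a => c.wmem a | a => σ.wmem a) :=
    fun _ => rfl
  have er : ∀ c : Config W, (σ.over s c).reg = (fun r => if r < s then σ.reg r else c.reg (r - s)) :=
    fun _ => rfl
  have er' : ∀ c : Config W,
      (σ.over s c).wreg = (fun r => if r < s then σ.wreg r else c.wreg (r - s)) := fun _ => rfl
  have ew : ∀ (c : Config W) w, (σ.over s c).wreg (w + s) = c.wreg w := by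
    intro c w; simp [St.over]
  have em : ∀ (c : Config W) a, (σ.over s c).mem (5 :: a) = c.mem a := fun _ _ => rfl
  have em' : ∀ (c : Config W) a, (σ.over s c).wmem (5 :: a) = c.wmem a := fun _ _ => rfl
  cases p
  case seq p q => rfl
  case ite b p q =>
    simp only [List.map_cons, List.cons_append, Program.embed, step_ite, over_holds]
    simp only [Config.step]
    split <;> simp_all <;> rfl
  all_goals
    simp only [List.map_cons, List.cons_append, Program.embed, skip]
    first
      | simp only [step_while, over_holds]
        simp only [Config.step]
        split <;> simp_all [Program.embed] <;> rfl
      | rw [eval_over_cfg (by simp) (by simp) (by simp)]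
        simp only [eval, Config.step, over_val, over_addr, St.rd, St.wrd, e, e', er, er',
          over_update_reg, over_update_mem, ew, em, em']
        simp [St.over, St.cfg]

/-- A terminating run of a program is reproduced inside the arena. -/
theorem runs_embed {Q : CQ} (s : ℕ) (σ : St W) (A : Program) (D : Database Q W) (t : ℕ)
    (ht : (run A D t).halted) (hσ : σ.over s (start A D) = σ) :
    ∃ t' ≤ t, Runs (A.embed s) σ (σ.over s (run A D t)) t' := by
  classical
  have hex : ∃ t, (run A D t).halted := ⟨t, ht⟩
  -- The first halting time is needed: up to it the simulation is in lockstep, whereas afterwards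
  -- the host proceeds with `K` while the simulated run stands still.
  refine ⟨Nat.find hex, Nat.find_min' hex ht, fun K => ?_⟩
  rw [run_of_halted (Nat.find_spec hex) (Nat.find_min' hex ht)]
  have H : ∀ n ≤ Nat.find hex, Config.step^[n] (σ.cfg (A.embed s :: K)) =
      (σ.over s (run A D n)).cfg ((run A D n).todo.map (Program.embed s) ++ K) := by
    intro n
    induction n with
    | zero =>
      intro _
      show σ.cfg (A.embed s :: K) = (σ.over s (start A D)).cfg _
      rw [hσ]; rfl
    | succ n ih =>
      intro hn
      rw [Function.iterate_succ_apply', ih (by omega), run_succ]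
      exact step_over s σ _ (Nat.find_min hex (by omega)) K
  rw [H _ le_rfl, show (run A D (Nat.find hex)).todo = [] from Nat.find_spec hex]
  rfl

end Embedding
end RankedEnum

namespace RankedEnum

universe u

/-! ### The order of a selective dioid. -/

section Dioid

variable {W : Type u} [CommSemiring W]

theorem wle_refl (hW : Selective W) (x : W) : wle x x := by
  rcases hW x x with h | h <;> exact h

theorem wle_trans {x y z : W} (h : wle x y) (h' : wle y z) : wle x z := by
  unfold wle at *
  rw [← h, add_assoc, h']

theorem wle_total (hW : Selective W) (x y : W) : wle x y ∨ wle y x := by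
  rcases hW x y with h | h
  · exact .inl h
  · right; unfold wle; rw [add_comm]; exact h

/-- This is where distributivity enters. There is neither cancellation nor an inverse, and none is
needed. -/
theorem wle_mul {x y : W} (h : wle x y) (z : W) : wle (z * x) (z * y) := by
  unfold wle at *
  rw [← mul_add, h]

end Dioid

/-! ### Heap-ordered binary trees and their construction along the right spine. -/

section HeapTree

variable {L R U : ℕ → ℕ} {le : ℕ → ℕ → Prop}

/-- The pointers `L`, `R` form below `x` a binary tree with in-order traversal `l` that is
ordered as a heap. The null pointer is `0`. -/
inductive HeapTree (L R : ℕ → ℕ) (le : ℕ → ℕ → Prop) : ℕ → List ℕ → Prop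
  | nil : HeapTree L R le 0 []
  | node (x : ℕ) (l r : List ℕ) : x ≠ 0 → HeapTree L R le (L x) l → HeapTree L R le (R x) r →
      (∀ y ∈ l, le x y) → (∀ y ∈ r, le x y) → HeapTree L R le x (l ++ x :: r)

/-- The left (`false`) or right (`true`) child. -/
def child (L R : ℕ → ℕ) (side : Bool) (x : ℕ) : ℕ := if side then R x else L x

theorem HeapTree.root_ne_zero_iff {x : ℕ} {l : List ℕ} (h : HeapTree L R le x l) :
    x ≠ 0 ↔ l ≠ [] := by
  cases h <;> simp_all

theorem HeapTree.root_mem {x : ℕ} {l : List ℕ} (h : HeapTree L R le x l) (hx : x ≠ 0) : x ∈ l := by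
  cases h <;> simp_all

theorem HeapTree.child_mem {x : ℕ} {l : List ℕ} (h : HeapTree L R le x l) {y : ℕ} (hy : y ∈ l)
    {side : Bool} (hc : child L R side y ≠ 0) :
    child L R side y ∈ l ∧ le y (child L R side y) := by
  induction h with
  | nil => simp at hy
  | node x l r hx hl hr hle hre ihl ihr =>
    simp only [List.mem_append, List.mem_cons] at hy ⊢
    rcases hy with hy | rfl | hy
    · exact ⟨.inl (ihl hy).1, (ihl hy).2⟩
    · cases side
      · have := hl.root_mem hc
        exact ⟨.inl this, hle _ this⟩
      · have := hr.root_mem hc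
        exact ⟨.inr (.inr this), hre _ this⟩
    · exact ⟨.inr (.inr (ihr hy).1), (ihr hy).2⟩

/-- For the enumeration this means that a row reached by a move in a heap is never the head of its
group, so the bag of the last move can be read off a solution. -/
theorem HeapTree.child_ne_root {x : ℕ} {l : List ℕ} (h : HeapTree L R le x l) (hn : l.Nodup)
    {y : ℕ} (hy : y ∈ l) {side : Bool} (hc : child L R side y ≠ 0) : child L R side y ≠ x := by
  cases h with
  | nil => simp at hy
  | node x l r hx hl hr hle hre =>
    rw [List.nodup_append] at hn
    obtain ⟨-, h2, h3⟩ := hn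
    rw [List.nodup_cons] at h2
    simp only [List.mem_append, List.mem_cons] at hy
    intro e
    rcases hy with hy | rfl | hy
    · exact h3 _ (hl.child_mem hy hc).1 x (by simp) e
    · cases side
      · exact h3 _ (hl.root_mem hc) y (by simp) e
      · exact h2.1 (e ▸ hr.root_mem hc)
    · exact h2.1 (e ▸ (hr.child_mem hy hc).1)

/-- Different subtrees are disjoint, so at most one pointer leads to a node. Hence the row before a
heap move, and the side of the move, can be recovered from the row after it. -/
theorem HeapTree.child_inj {x : ℕ} {l : List ℕ} (h : HeapTree L R le x l) (hn : l.Nodup)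
    {y z : ℕ} (hy : y ∈ l) (hz : z ∈ l) {s s' : Bool} (hc : child L R s y ≠ 0)
    (he : child L R s y = child L R s' z) : y = z ∧ s = s' := by
  induction h with
  | nil => simp at hy
  | node x l r hx hl hr hle hre ihl ihr =>
    have hn' := hn
    rw [List.nodup_append] at hn
    obtain ⟨h1, h2, h3⟩ := hn
    rw [List.nodup_cons] at h2
    have hc' : child L R s' z ≠ 0 := he ▸ hc
    simp only [List.mem_append, List.mem_cons] at hy hz
    have key : ∀ {y s}, y ∈ l → child L R s y ≠ 0 → child L R s y ∈ l :=
      fun hy hc => (hl.child_mem hy hc).1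
    have key' : ∀ {y s}, y ∈ r → child L R s y ≠ 0 → child L R s y ∈ r :=
      fun hy hc => (hr.child_mem hy hc).1
    have disj : ∀ {a}, a ∈ l → a ∈ r → False := fun ha hb => h3 _ ha _ (by simp [hb]) rfl
    rcases hy with hy | rfl | hy <;> rcases hz with hz | rfl | hz
    · exact ihl h1 hy hz
    · cases s'
      · exact absurd he (hl.child_ne_root h1 hy hc)
      · exact (disj (key hy hc) (he ▸ hr.root_mem hc')).elim
    · exact (disj (key hy hc) (he ▸ key' hz hc')).elim
    · cases s
      · exact absurd he.symm (hl.child_ne_root h1 hz hc')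
      · exact (disj (key hz hc') (he ▸ hr.root_mem hc)).elim
    · refine ⟨rfl, ?_⟩
      cases s <;> cases s'
      · rfl
      · have e : L z = R z := he
        exact (disj (hl.root_mem hc) (e ▸ hr.root_mem hc')).elim
      · have e : R z = L z := he
        exact (disj (hl.root_mem hc') (e ▸ hr.root_mem hc)).elim
      · rfl
    · cases s
      · exact (disj (he ▸ hl.root_mem hc) (key' hz hc')).elim
      · exact absurd he.symm (hr.child_ne_root h2.2 hz hc')
    · exact (disj (key hz hc') (he ▸ key' hy hc)).elim
    · cases s'
      · exact (disj (he ▸ hl.root_mem hc') (key' hy hc)).elim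
      · exact absurd he (hr.child_ne_root h2.2 hy hc)
    · exact ihr h2.2 hy hz

/-- Induction along the pointers from the root. `Inv.complete` uses it to reach an arbitrary row of
a group through generated candidates. -/
theorem HeapTree.reach {x : ℕ} {l : List ℕ} (h : HeapTree L R le x l) {P : ℕ → Prop} (h0 : P x)
    (hs : ∀ y ∈ l, P y → ∀ side, child L R side y ≠ 0 → P (child L R side y)) : ∀ y ∈ l, P y := by
  induction h with
  | nil => simp
  | node x l r hx hl hr hle hre ihl ihr =>
    intro y hy
    have hl' : ∀ y ∈ l, P y := by
      by_cases hL : L x = 0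
      · rw [hL] at hl; cases hl
        · simp
        · simp_all
      · exact ihl (hs x (by simp) h0 false hL) fun y hy => hs y (by simp [hy])
    have hr' : ∀ y ∈ r, P y := by
      by_cases hR : R x = 0
      · rw [hR] at hr; cases hr
        · simp
        · simp_all
      · exact ihr (hs x (by simp) h0 true hR) fun y hy => hs y (by simp [hy])
    simp only [List.mem_append, List.mem_cons] at hy
    rcases hy with hy | rfl | hy
    exacts [hl' y hy, h0, hr' y hy]

theorem HeapTree.congr {L' R' : ℕ → ℕ} {x : ℕ} {l : List ℕ} (h : HeapTree L R le x l)
    (hL : ∀ y ∈ l, L' y = L y) (hR : ∀ y ∈ l, R' y = R y) : HeapTree L' R' le x l := by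
  induction h with
  | nil => exact .nil
  | node x l r hx hl hr hle hre ihl ihr =>
    refine .node x l r hx ?_ ?_ hle hre
    · rw [hL x (by simp)]
      exact ihl (fun y hy => hL y (by simp [hy])) fun y hy => hR y (by simp [hy])
    · rw [hR x (by simp)]
      exact ihr (fun y hy => hL y (by simp [hy])) fun y hy => hR y (by simp [hy])

/-- The right spine from the root of a tree down to `x`, read upwards along `U`, with the left
subtrees that hang off it; `l` is the in-order traversal of this part of the tree. The nodes of
the spine lie in `O`. -/
inductive Spine (L R U : ℕ → ℕ) (le : ℕ → ℕ → Prop) (O : Set ℕ) (root : ℕ) : ℕ → List ℕ → Prop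
  | nil : Spine L R U le O root 0 []
  | cons (x : ℕ) (l ll : List ℕ) : x ≠ 0 → x ∈ O → Spine L R U le O root (U x) l →
      HeapTree L R le (L x) ll → (∀ y ∈ ll, le x y) →
      (U x ≠ 0 → R (U x) = x ∧ le (U x) x) → (U x = 0 → root = x) →
      Spine L R U le O root x (l ++ (ll ++ [x]))

theorem Spine.top_mem {O : Set ℕ} {root x : ℕ} {l : List ℕ} (h : Spine L R U le O root x l)
    (hx : x ≠ 0) : x ∈ l := by
  cases h <;> simp_all

theorem Spine.eq_nil {O : Set ℕ} {root : ℕ} {l : List ℕ} (h : Spine L R U le O root 0 l) :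
    l = [] := by
  cases h <;> simp_all

/-- The right pointer of the lowest node may change freely, because the spine constrains a right
pointer only if another spine node lies below. This is what allows a new node to be attached there.
-/
theorem Spine.congr {L' R' U' : ℕ → ℕ} {O O' : Set ℕ} {root x : ℕ} {l : List ℕ}
    (h : Spine L R U le O root x l) (hn : l.Nodup) (hL : ∀ y ∈ l, L' y = L y)
    (hU : ∀ y ∈ l, U' y = U y) (hR : ∀ y ∈ l, y ≠ x → R' y = R y) (hO : ∀ y ∈ l, y ∈ O → y ∈ O') :
    Spine L' R' U' le O' root x l := by
  induction h with
  | nil => exact .nil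
  | cons x l ll hx hxO hs hl hle hU1 hU0 ih =>
    have hux : U' x = U x := hU x (by simp)
    have hlx : L' x = L x := hL x (by simp)
    rw [List.nodup_append] at hn
    obtain ⟨hn1, hn2, hn3⟩ := hn
    rw [List.nodup_append] at hn2
    have hne : U x ≠ 0 → U x ≠ x := fun h0 => hn3 _ (hs.top_mem h0) x (by simp)
    refine .cons x l ll hx (hO x (by simp) hxO) ?_ ?_ hle ?_ ?_
    · rw [hux]
      refine ih hn1 (fun y hy => hL y (by simp [hy])) (fun y hy => hU y (by simp [hy])) ?_
        fun y hy => hO y (by simp [hy])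
      intro y hy _
      exact hR y (by simp [hy]) (hn3 y hy x (by simp))
    · rw [hlx]
      refine hl.congr (fun y hy => hL y (by simp [hy])) fun y hy => hR y (by simp [hy]) ?_
      exact hn2.2.2 y hy x (by simp)
    · rw [hux]
      intro h0
      rw [hR _ (by simp [hs.top_mem h0]) (hne h0)]
      exact hU1 h0
    · rw [hux]; exact hU0

/-- Closing the spine: the whole structure is a heap-ordered tree. -/
theorem Spine.heapTree (htr : ∀ a b c, le a b → le b c → le a c) {O : Set ℕ} {root x : ℕ}
    {l : List ℕ} (h : Spine L R U le O root x l) :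
    ∀ y r, HeapTree L R le y r → (x ≠ 0 → R x = y) → (x = 0 → root = y) →
      (x ≠ 0 → ∀ z ∈ r, le x z) → HeapTree L R le root (l ++ r) := by
  induction h with
  | nil => intro y r hr _ h0 _; simpa [h0 rfl] using hr
  | cons x l ll hx hxO hs hl hle hU1 hU0 ih =>
    intro y r hr hxy _ hle'
    have e : l ++ (ll ++ [x]) ++ r = l ++ (ll ++ x :: r) := by simp
    rw [e]
    refine ih x _ (.node x ll r hx hl (hxy hx ▸ hr) hle (hle' hx)) (fun h => (hU1 h).1) hU0 ?_
    intro h0 z hz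
    simp only [List.mem_append, List.mem_cons] at hz
    rcases hz with hz | rfl | hz
    · exact htr _ _ _ (hU1 h0).2 (hle z hz)
    · exact (hU1 h0).2
    · exact htr _ _ _ (hU1 h0).2 (hle' hx z hz)

/-- The situation while a new last element `x` is being inserted: the nodes below `cur` have been
taken off the spine and form the tree `prev`. -/
structure Popping (L R U : ℕ → ℕ) (le : ℕ → ℕ → Prop) (O : Set ℕ) (root x cur prev : ℕ)
    (lc lp : List ℕ) : Prop where
  spine : Spine L R U le O root cur lc
  tree : HeapTree L R le prev lp
  link : cur ≠ 0 → R cur = prev ∧ ∀ y ∈ lp, le cur y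
  link_root : cur = 0 → root = prev
  le_prev : ∀ y ∈ lp, le x y

/-- The node `cur` need not stay above `x`, which is no heavier. It keeps its left subtree, has the
nodes taken off before as right subtree, and is finished for the time being. Membership in `O` is
reported since it pays for the step. -/
theorem Popping.pop (htr : ∀ a b c, le a b → le b c → le a c) {O : Set ℕ} {root x cur prev : ℕ}
    {lc lp : List ℕ} (h : Popping L R U le O root x cur prev lc lp) (h0 : cur ≠ 0)
    (hx : le x cur) : ∃ lc' ll, lc = lc' ++ (ll ++ [cur]) ∧ cur ∈ O ∧
      Popping L R U le O root x (U cur) cur lc' (ll ++ cur :: lp) := by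
  obtain ⟨hs, ht, hl, hr, hle⟩ := h
  cases hs with
  | nil => exact absurd rfl h0
  | cons _ l ll _ hxO hs hlt hle' hU1 hU0 =>
    refine ⟨l, ll, rfl, hxO, hs, .node cur ll lp h0 hlt ((hl h0).1 ▸ ht) hle' (hl h0).2, ?_,
      hU0, ?_⟩
    · intro hu
      refine ⟨(hU1 hu).1, ?_⟩
      intro z hz
      simp only [List.mem_append, List.mem_cons] at hz
      rcases hz with hz | rfl | hz
      · exact htr _ _ _ (hU1 hu).2 (hle' z hz)
      · exact (hU1 hu).2
      · exact htr _ _ _ (hU1 hu).2 ((hl h0).2 z hz)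
    · intro z hz
      simp only [List.mem_append, List.mem_cons] at hz
      rcases hz with hz | rfl | hz
      · exact htr _ _ _ hx (hle' z hz)
      · exact hx
      · exact hle z hz

/-- The nodes taken off become the left subtree of `x`, and `x` becomes the lowest spine node below
`cur`; so the traversal grows at its end. The new set `O'` may forget the nodes taken off but has to
keep those of the spine. -/
theorem Popping.push {O O' : Set ℕ} {root x cur prev : ℕ} {lc lp : List ℕ}
    (h : Popping L R U le O root x cur prev lc lp) (hn : (lc ++ lp).Nodup) (hx0 : x ≠ 0)
    (hx : x ∉ lc ++ lp) (hcur : cur ≠ 0 → le cur x) (hO : ∀ y ∈ lc, y ∈ O → y ∈ O')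
    (hxO : x ∈ O') :
    Spine (Function.update L x prev) (if cur = 0 then R else Function.update R cur x)
      (Function.update U x cur) le O' (if cur = 0 then x else root) x (lc ++ lp ++ [x]) := by
  obtain ⟨hs, ht, hl, hr, hle⟩ := h
  rw [List.nodup_append] at hn
  simp only [List.mem_append, not_or] at hx
  have hcx : cur ≠ 0 → cur ≠ x := fun h e => hx.1 (e ▸ hs.top_mem h)
  rw [List.append_assoc]
  refine .cons x lc lp hx0 hxO ?_ ?_ hle ?_ ?_
  · rw [Function.update_self]
    by_cases h0 : cur = 0
    · subst h0
      rw [hs.eq_nil]; exact .nil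
    · rw [if_neg h0, if_neg h0]
      refine hs.congr hn.1 ?_ ?_ ?_ hO
      · intro y hy; exact Function.update_of_ne (fun e : y = x => hx.1 (e ▸ hy)) _ _
      · intro y hy; exact Function.update_of_ne (fun e : y = x => hx.1 (e ▸ hy)) _ _
      · intro y _ hne; exact Function.update_of_ne hne _ _
  · rw [Function.update_self]
    refine ht.congr ?_ ?_
    · intro y hy; exact Function.update_of_ne (fun e : y = x => hx.2 (e ▸ hy)) _ _
    · intro y hy
      split
      · rfl
      · rename_i h0
        exact Function.update_of_ne (fun e => hn.2.2 _ (hs.top_mem h0) y hy e.symm) _ _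
  · rw [Function.update_self]
    intro h0
    simp [h0, hcur h0]
  · rw [Function.update_self]
    intro h0
    simp [h0]

end HeapTree
end RankedEnum

namespace RankedEnum

universe u

/-! ### Solutions of an indexed join tree and the weights of their best completions. -/

section IndexedTree

/-- A join tree with its data and the index built on it. The bags are numbered from the root on,
`par` is the parent, `sep` the variables shared with earlier bags. Rows of a bag are numbered
from `1`; `root i k`, `left i`, `right i` are the heap of the rows of bag `i` with key `k`;
`w` is the weight of a row and `bw` the least weight of a solution of the subtree below it. -/
structure Tree (W : Type u) where
  m : ℕ
  vars : ℕ → List ℕ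
  sep : ℕ → List ℕ
  par : ℕ → ℕ
  len : ℕ → ℕ
  val : ℕ → ℕ → ℕ → ℕ
  root : ℕ → List ℕ → ℕ
  left : ℕ → ℕ → ℕ
  right : ℕ → ℕ → ℕ
  w : ℕ → ℕ → W
  bw : ℕ → ℕ → W

variable {W : Type u}

/-- The children of the bag `i` in a tree with parent function `par`. -/
def kidsOf (m : ℕ) (par : ℕ → ℕ) (i : ℕ) : List ℕ :=
  (List.range m).filter fun c => i < c ∧ par c = i

namespace Tree

variable (T : Tree W)

/-- The value of an assignment on the separator of the bag `c`. -/
def key (c : ℕ) (v : ℕ → ℕ) : List ℕ := (T.sep c).map v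

/-- The row `r` of the bag `i` has a matching row in every child bag. -/
def Alive (i r : ℕ) : Prop := ∀ c ∈ kidsOf T.m T.par i, T.root c (T.key c (T.val i r)) ≠ 0

/-- The row `r` of bag `i` belongs to the group with key `k`. -/
def InGrp (i : ℕ) (k : List ℕ) (r : ℕ) : Prop := T.Alive i r ∧ T.key i (T.val i r) = k

open Classical in
/-- The group with key `k` among the first `n` rows of bag `i`. -/
noncomputable def grp (i : ℕ) (k : List ℕ) (n : ℕ) : List ℕ :=
  (List.range' 1 n).filter fun r => T.InGrp i k r

theorem grp_nodup (i : ℕ) (k : List ℕ) (n : ℕ) : (T.grp i k n).Nodup :=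
  (List.nodup_range').filter _

theorem mem_grp {i : ℕ} {k : List ℕ} {n r : ℕ} :
    r ∈ T.grp i k n ↔ (1 ≤ r ∧ r ≤ n) ∧ T.InGrp i k r := by
  simp only [grp, List.mem_filter, List.mem_range'_1, decide_eq_true_eq]
  constructor <;> rintro ⟨h, h'⟩ <;> exact ⟨by omega, h'⟩

variable [CommSemiring W]

/-- `sep_par` and `sep_shared` together express the running intersection property, and `bw_eq` is
the recursion of dynamic programming over the tree. -/
structure Valid : Prop where
  par_lt : ∀ c, 0 < c → c < T.m → T.par c < c
  sep_zero : T.sep 0 = []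
  sep_par : ∀ c, 0 < c → c < T.m → ∀ x ∈ T.sep c, x ∈ T.vars (T.par c)
  sep_self : ∀ c < T.m, ∀ x ∈ T.sep c, x ∈ T.vars c
  sep_shared : ∀ i c, i < c → c < T.m → ∀ x ∈ T.vars i, x ∈ T.vars c → x ∈ T.sep c
  distinct : ∀ i < T.m, ∀ r r', 1 ≤ r → r ≤ T.len i → 1 ≤ r' → r' ≤ T.len i →
    (∀ x ∈ T.vars i, T.val i r x = T.val i r' x) → r = r'
  heap : ∀ i < T.m, ∀ k, HeapTree (T.left i) (T.right i) (fun a b => wle (T.bw i a) (T.bw i b))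
    (T.root i k) (T.grp i k (T.len i))
  bw_eq : ∀ i < T.m, ∀ r, 1 ≤ r → r ≤ T.len i → T.bw i r =
    T.w i r * ((kidsOf T.m T.par i).map fun c => T.bw c (T.root c (T.key c (T.val i r)))).prod

/-- The rows `s l`, `l < i`, are consistent with the assignment `v`. -/
def Part (i : ℕ) (s : ℕ → ℕ) (v : ℕ → ℕ) : Prop :=
  ∀ l < i, (1 ≤ s l ∧ s l ≤ T.len l) ∧ T.Alive l (s l) ∧ ∀ x ∈ T.vars l, T.val l (s l) x = v x

/-- From the bag `i` on, the rows `s` are the heads of their groups. -/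
def Greedy (i : ℕ) (s : ℕ → ℕ) (v : ℕ → ℕ) : Prop :=
  ∀ l, i ≤ l → l < T.m → s l = T.root l (T.key l v)

/-- The weight of the best solution that begins with the rows `s l`, `l < i`. -/
noncomputable def best (i : ℕ) (s : ℕ → ℕ) (v : ℕ → ℕ) : W :=
  (∏ l ∈ Finset.range i, T.w l (s l)) *
    ∏ c ∈ (Finset.Ico i T.m).filter (fun c => c = 0 ∨ T.par c < i), T.bw c (T.root c (T.key c v))

variable {T} (hT : T.Valid)

include hT

omit [CommSemiring W] hT in
theorem Part.mono {i i' : ℕ} {s v : ℕ → ℕ} (h : T.Part i s v) (hi : i' ≤ i) : T.Part i' s v :=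
  fun l hl => h l (by omega)

/-- The separator of `c` lies in the parent bag, which is among the first `i` bags, so the row
chosen there fixes the key. The first bag has an empty separator. -/
theorem Part.key_eq {i : ℕ} {s v s' v' : ℕ → ℕ} (h : T.Part i s v) (h' : T.Part i s' v')
    (he : ∀ l < i, s l = s' l) {c : ℕ} (hc : c < T.m) (hp : c = 0 ∨ T.par c < i) :
    T.key c v = T.key c v' := by
  rcases Nat.eq_zero_or_pos c with rfl | h0
  · simp [key, hT.sep_zero]
  · have hp : T.par c < i := by omega
    refine List.map_congr_left fun x hx => ?_
    have hx' := hT.sep_par c h0 hc x hx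
    rw [← (h _ hp).2.2 x hx', ← (h' _ hp).2.2 x hx', he _ hp]

theorem Part.key_val {i : ℕ} {s v : ℕ → ℕ} (h : T.Part i s v) {l : ℕ} (hl : l < i) (hm : l < T.m) :
    T.key l (T.val l (s l)) = T.key l v :=
  List.map_congr_left fun x hx => (h l hl).2.2 x (hT.sep_self l hm x hx)

theorem Part.inGrp {i : ℕ} {s v : ℕ → ℕ} (h : T.Part i s v) {l : ℕ} (hl : l < i) (hm : l < T.m) :
    s l ∈ T.grp l (T.key l v) (T.len l) :=
  T.mem_grp.2 ⟨(h l hl).1, (h l hl).2.1, h.key_val hT hl hm⟩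

omit [CommSemiring W] hT in
theorem mem_kids {i c : ℕ} : c ∈ kidsOf T.m T.par i ↔ c < T.m ∧ i < c ∧ T.par c = i := by
  simp [kidsOf]

/-- The next group of a partial solution is not empty. -/
theorem Part.root_ne_zero {i : ℕ} {s v : ℕ → ℕ} (h : T.Part i s v) (h0 : 0 < i) (hi : i < T.m) :
    T.root i (T.key i v) ≠ 0 := by
  have hp := hT.par_lt i h0 hi
  have := (h _ hp).2.1 i (mem_kids.2 ⟨hi, hp, rfl⟩)
  have e : T.key i (T.val (T.par i) (s (T.par i))) = T.key i v :=
    List.map_congr_left fun x hx => (h _ hp).2.2 x (hT.sep_par i h0 hi x hx)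
  rwa [e] at this

theorem root_inGrp {i : ℕ} (hi : i < T.m) {k : List ℕ} (h : T.root i k ≠ 0) :
    T.root i k ∈ T.grp i k (T.len i) := (hT.heap i hi k).root_mem h

theorem root_ne_zero_of_mem {i : ℕ} (hi : i < T.m) {k : List ℕ} {r : ℕ}
    (h : r ∈ T.grp i k (T.len i)) : T.root i k ≠ 0 :=
  (hT.heap i hi k).root_ne_zero_iff.2 (List.ne_nil_of_mem h)

/-- Extending a partial solution by a row of the next group. -/
theorem Part.extend {i : ℕ} {s v : ℕ → ℕ} (h : T.Part i s v) (hi : i < T.m) {r : ℕ}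
    (hr : r ∈ T.grp i (T.key i v) (T.len i)) :
    T.Part (i + 1) (Function.update s i r) (fun x => if x ∈ T.vars i then T.val i r x else v x) ∧
    ∀ l < i, ∀ x ∈ T.vars l, (if x ∈ T.vars i then T.val i r x else v x) = v x := by
  obtain ⟨hr1, hr2, hr3⟩ := T.mem_grp.1 hr
  have key : ∀ l < i, ∀ x ∈ T.vars l, (if x ∈ T.vars i then T.val i r x else v x) = v x := by
    intro l hl x hx
    split
    · rename_i hx'
      -- A variable shared with an earlier bag belongs to the separator, on which the new row agrees
      -- with `v`.
      exact List.map_inj_left.1 hr3 x (hT.sep_shared l i hl hi x hx hx')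
    · rfl
  refine ⟨?_, key⟩
  intro l hl
  rcases Nat.lt_succ_iff_lt_or_eq.1 hl with hl | rfl
  · rw [Function.update_of_ne (by omega)]
    refine ⟨(h l hl).1, (h l hl).2.1, fun x hx => ?_⟩
    simp only [key l hl x hx]; exact (h l hl).2.2 x hx
  · rw [Function.update_self]
    exact ⟨hr1, hr2, fun x hx => by simp [hx]⟩

/-- A consistent choice of rows consists of rows which have matching rows below them. -/
theorem part_of_rows {s v : ℕ → ℕ} (h : ∀ l < T.m, (1 ≤ s l ∧ s l ≤ T.len l) ∧
    ∀ x ∈ T.vars l, T.val l (s l) x = v x) : T.Part T.m s v := by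
  -- Downward induction on the bag, as being alive depends on bags with larger numbers.
  suffices H : ∀ d l, T.m ≤ l + d → l < T.m → T.Alive l (s l) from
    fun l hl => ⟨(h l hl).1, H T.m l (by omega) hl, (h l hl).2⟩
  intro d
  induction d with
  | zero => intro l h1 h2; omega
  | succ d ih =>
    intro l h1 h2 c hc
    obtain ⟨hcm, hlc, hpc⟩ := mem_kids.1 hc
    have ec : T.key c (T.val l (s l)) = T.key c (T.val c (s c)) := by
      refine List.map_congr_left fun x hx => ?_
      rw [(h c hcm).2 x (hT.sep_self c hcm x hx), (h l h2).2]
      have := hT.sep_par c (by omega) hcm x hx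
      rwa [hpc] at this
    refine root_ne_zero_of_mem hT hcm (r := s c) ?_
    exact T.mem_grp.2 ⟨(h c hcm).1, ih c (by omega) hcm, ec.symm⟩

/-- A head is determined by its key, and the key by the earlier rows. -/
theorem Part.eq_of_greedy {s v s' v' : ℕ → ℕ} (h : T.Part T.m s v) (h' : T.Part T.m s' v') {i : ℕ}
    (he : ∀ l < i, s l = s' l) (hg : T.Greedy i s v) (hg' : T.Greedy i s' v') :
    ∀ l < T.m, s l = s' l := by
  intro l
  induction l using Nat.strong_induction_on with
  | _ l ih =>
    intro hl
    by_cases hli : l < i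
    · exact he l hli
    · rw [hg l (by omega) hl, hg' l (by omega) hl]
      congr 1
      refine (h.mono hl.le).key_eq hT (h'.mono hl.le) (fun l' hl' => ih l' hl' (by omega)) hl ?_
      rcases Nat.eq_zero_or_pos l with h0 | h0
      · exact .inl h0
      · exact .inr (hT.par_lt l h0 hl)

/-- Bag `i` is always one of the open bags, because its parent comes earlier. Its factor is
isolated, since it is the one that changes when a row of bag `i` is chosen. -/
theorem best_eq {i : ℕ} (hi : i < T.m) (s v : ℕ → ℕ) :
    T.best i s v = (∏ l ∈ Finset.range i, T.w l (s l)) * (T.bw i (T.root i (T.key i v)) *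
      ∏ c ∈ (Finset.Ioo i T.m).filter (fun c => T.par c < i), T.bw c (T.root c (T.key c v))) := by
  unfold best
  congr 1
  have : (Finset.Ico i T.m).filter (fun c => c = 0 ∨ T.par c < i) =
      insert i ((Finset.Ioo i T.m).filter (fun c => T.par c < i)) := by
    ext c
    have := hT.par_lt i
    simp only [Finset.mem_filter, Finset.mem_Ico, Finset.mem_insert, Finset.mem_Ioo]
    constructor
    · rintro ⟨⟨h1, h2⟩, h3⟩
      rcases h1.eq_or_lt with h | h
      · exact .inl h.symm
      · exact .inr ⟨⟨h, h2⟩, by omega⟩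
    · rintro (rfl | ⟨⟨h1, h2⟩, h3⟩)
      · refine ⟨⟨le_rfl, hi⟩, ?_⟩
        rcases Nat.eq_zero_or_pos c with h | h
        · exact .inl h
        · exact .inr (this h hi)
      · exact ⟨⟨h1.le, h2⟩, .inr h3⟩
  rw [this, Finset.prod_insert (by simp)]

/-- Choosing a row opens the children of bag `i`; the recursion `bw_eq` gathers their best weights
and the weight of the row in a single factor. Compared with `best_eq`, the head is merely replaced
by the chosen row. -/
theorem best_succ_eq {i : ℕ} (hi : i < T.m) {s v : ℕ → ℕ} (h : T.Part (i + 1) s v) :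
    T.best (i + 1) s v = (∏ l ∈ Finset.range i, T.w l (s l)) * (T.bw i (s i) *
      ∏ c ∈ (Finset.Ioo i T.m).filter (fun c => T.par c < i), T.bw c (T.root c (T.key c v))) := by
  unfold best
  have hb := hT.bw_eq i hi (s i) (h i (by omega)).1.1 (h i (by omega)).1.2
  have hk : ((kidsOf T.m T.par i).map fun c => T.bw c (T.root c (T.key c (T.val i (s i))))).prod =
      ∏ c ∈ (Finset.Ioo i T.m).filter (fun c => T.par c = i), T.bw c (T.root c (T.key c v)) := by
    have e : (Finset.Ioo i T.m).filter (fun c => T.par c = i) = (kidsOf T.m T.par i).toFinset := by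
      ext c
      simp only [Finset.mem_filter, Finset.mem_Ioo, List.mem_toFinset, mem_kids]
      tauto
    rw [e, List.prod_toFinset _ (show (kidsOf T.m T.par i).Nodup from List.nodup_range.filter _)]
    congr 1
    refine List.map_congr_left fun c hc => ?_
    obtain ⟨hcm, hic, hpc⟩ := mem_kids.1 hc
    congr 2
    refine List.map_congr_left fun x hx => (h i (by omega)).2.2 x ?_
    have := hT.sep_par c (by omega) hcm x hx
    rwa [hpc] at this
  have hs : (Finset.Ico (i + 1) T.m).filter (fun c => c = 0 ∨ T.par c < i + 1) =
      (Finset.Ioo i T.m).filter (fun c => T.par c = i) ∪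
        (Finset.Ioo i T.m).filter (fun c => T.par c < i) := by
    ext c
    simp only [Finset.mem_filter, Finset.mem_Ico, Finset.mem_union, Finset.mem_Ioo]
    omega
  rw [hs, Finset.prod_union, Finset.prod_range_succ, hb, hk]
  · simp only [mul_assoc]
  · rw [Finset.disjoint_filter]; intro c _ h1; omega

/-- As long as heads are chosen, `best_eq` and `best_succ_eq` are the same expression. -/
theorem best_greedy {i : ℕ} {s v : ℕ → ℕ} (h : T.Part T.m s v) (hg : T.Greedy i s v) :
    ∀ j, i ≤ j → j ≤ T.m → T.best j s v = T.best T.m s v := by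
  intro j hij hj
  induction hd : T.m - j generalizing j with
  | zero =>
    have : j = T.m := by omega
    rw [this]
  | succ d ih =>
    have hjm : j < T.m := by omega
    rw [← ih (j + 1) (by omega) (by omega) (by omega), best_succ_eq hT hjm (h.mono hjm),
      best_eq hT hjm, hg j hij hjm]

omit hT in
theorem best_m (s v : ℕ → ℕ) : T.best T.m s v = ∏ l ∈ Finset.range T.m, T.w l (s l) := by
  simp [best]

/-- Moving down in a heap of the bag `j` does not decrease the weight of the best completion. -/
theorem best_mono {j : ℕ} (hj : j < T.m) {s v s' v' : ℕ → ℕ} (h : T.Part T.m s v)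
    (h' : T.Part T.m s' v') (he : ∀ l < j, s l = s' l)
    (hle : wle (T.bw j (s j)) (T.bw j (s' j))) :
    wle (T.best (j + 1) s v) (T.best (j + 1) s' v') := by
  rw [best_succ_eq hT hj (h.mono hj), best_succ_eq hT hj (h'.mono hj)]
  have e1 : ∏ l ∈ Finset.range j, T.w l (s l) = ∏ l ∈ Finset.range j, T.w l (s' l) :=
    Finset.prod_congr rfl fun l hl => by rw [he l (Finset.mem_range.1 hl)]
  have e2 : ∏ c ∈ (Finset.Ioo j T.m).filter (fun c => T.par c < j), T.bw c (T.root c (T.key c v)) =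
      ∏ c ∈ (Finset.Ioo j T.m).filter (fun c => T.par c < j), T.bw c (T.root c (T.key c v')) := by
    refine Finset.prod_congr rfl fun c hc => ?_
    simp only [Finset.mem_filter, Finset.mem_Ioo] at hc
    rw [(h.mono hj.le).key_eq hT (h'.mono hj.le) he hc.1.2 (.inr hc.2)]
  rw [e1, e2, mul_comm (T.bw j (s j)), mul_comm (T.bw j (s' j))]
  exact wle_mul (wle_mul hle _) _

end Tree
end IndexedTree
end RankedEnum

namespace RankedEnum

universe u

/-! ### The search forest of solutions and the invariants of best-first search. -/

section Enumeration

variable {W : Type u} [CommSemiring W]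

namespace Tree

variable (T : Tree W)

/-- The weight of a choice of rows. -/
noncomputable def wt (s : ℕ → ℕ) : W := ∏ l ∈ Finset.range T.m, T.w l (s l)

/-- `s` is a solution whose rows after the bag `d` are the heads of their groups. -/
def IsCand (s : ℕ → ℕ) (d : ℕ) : Prop :=
  ∃ v, T.Part T.m s v ∧ T.Greedy (d + 1) s v ∧ ∀ l, T.m ≤ l → s l = 0

/-- `s'` arises from `s` by moving down in the heap of bag `j` and completing greedily. -/
def IsChild (s : ℕ → ℕ) (j : ℕ) (side : Bool) (s' : ℕ → ℕ) : Prop :=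
  (∀ l < j, s' l = s l) ∧ s' j = child (T.left j) (T.right j) side (s j) ∧ s' j ≠ 0 ∧
    T.IsCand s' j

variable {T} (hT : T.Valid)

include hT

/-- The bag of the move is the last one at which `s'` does not use the head of its group. Given this
bag, the earlier rows are those of `s'`, the row at the bag is the unique heap parent, and the later
rows are heads; so the parent is determined. -/
theorem IsChild.inj {s₁ s₂ s' : ℕ → ℕ} {d₁ d₂ j₁ j₂ : ℕ} {c₁ c₂ : Bool} (h₁ : T.IsCand s₁ d₁)
    (h₂ : T.IsCand s₂ d₂) (hj₁ : d₁ ≤ j₁) (hj₂ : d₂ ≤ j₂) (hm₁ : j₁ < T.m) (hm₂ : j₂ < T.m)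
    (hc₁ : T.IsChild s₁ j₁ c₁ s') (hc₂ : T.IsChild s₂ j₂ c₂ s') :
    s₁ = s₂ ∧ j₁ = j₂ ∧ c₁ = c₂ := by
  -- If `j₁ < j₂`, then the row of `s'` at bag `j₂` is a head by greedy completion and at the same
  -- time a heap child, which is impossible.
  have not_lt : ∀ {s₁ s₂ : ℕ → ℕ} {d₂ j₁ j₂ : ℕ} {c₁ c₂ : Bool}, T.IsCand s₂ d₂ →
      j₂ < T.m → T.IsChild s₁ j₁ c₁ s' → T.IsChild s₂ j₂ c₂ s' → ¬ j₁ < j₂ := by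
    intro s₁ s₂ d₂ j₁ j₂ c₁ c₂ h₂ hm₂ hc₁ hc₂ hlt
    obtain ⟨v₂, p₂, -, -⟩ := h₂
    obtain ⟨-, -, -, v', p', g', -⟩ := hc₁
    obtain ⟨e1, e2, e3, -⟩ := hc₂
    have hk : T.key j₂ v₂ = T.key j₂ v' := by
      refine (p₂.mono hm₂.le).key_eq hT (p'.mono hm₂.le) (fun l hl => (e1 l hl).symm) hm₂ ?_
      exact .inr (hT.par_lt _ (by omega) hm₂)
    have hr := g' j₂ (by omega) hm₂
    have hmem := p₂.inGrp hT hm₂ hm₂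
    have := (hT.heap j₂ hm₂ (T.key j₂ v₂)).child_ne_root (T.grp_nodup _ _ _) hmem (e2 ▸ e3)
    rw [← e2, hk] at this
    exact this hr
  have hj : j₁ = j₂ := by
    have := not_lt h₂ hm₂ hc₁ hc₂
    have := not_lt h₁ hm₁ hc₂ hc₁
    omega
  subst hj
  obtain ⟨v₁, p₁, g₁, z₁⟩ := h₁
  obtain ⟨v₂, p₂, g₂, z₂⟩ := h₂
  obtain ⟨e1, e2, e3, -⟩ := hc₁
  obtain ⟨f1, f2, f3, -⟩ := hc₂
  have he : ∀ l < j₁, s₁ l = s₂ l := fun l hl => by rw [← e1 l hl, ← f1 l hl]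
  have hk : T.key j₁ v₁ = T.key j₁ v₂ := by
    refine (p₁.mono hm₁.le).key_eq hT (p₂.mono hm₁.le) he hm₁ ?_
    rcases Nat.eq_zero_or_pos j₁ with h | h
    · exact .inl h
    · exact .inr (hT.par_lt _ h hm₁)
  have hi := (hT.heap j₁ hm₁ (T.key j₁ v₁)).child_inj (T.grp_nodup _ _ _)
    (p₁.inGrp hT hm₁ hm₁) (hk ▸ p₂.inGrp hT hm₁ hm₁) (e2 ▸ e3) (e2.symm.trans f2)
  refine ⟨?_, rfl, hi.2⟩
  have := p₁.eq_of_greedy hT p₂ (i := j₁ + 1) (fun l hl => ?_)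
    (fun l hl => g₁ l (by omega)) (fun l hl => g₂ l (by omega))
  · funext l
    by_cases hl : l < T.m
    · exact this l hl
    · rw [z₁ l (by omega), z₂ l (by omega)]
  · rcases Nat.lt_succ_iff_lt_or_eq.1 hl with hl | rfl
    · exact he l hl
    · exact hi.1

/-- Both solutions are greedy after bag `j`, so their weights are those of the best completions
after this bag, to which `best_mono` applies. -/
theorem IsChild.wt_le {s s' : ℕ → ℕ} {d j : ℕ} {c : Bool} (h : T.IsCand s d) (hj : d ≤ j)
    (hm : j < T.m) (hc : T.IsChild s j c s') : wle (T.wt s) (T.wt s') := by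
  obtain ⟨v, p, g, -⟩ := h
  obtain ⟨e1, e2, e3, v', p', g', -⟩ := hc
  have hle := ((hT.heap j hm _).child_mem (p.inGrp hT hm hm) (e2 ▸ e3)).2
  rw [← e2] at hle
  have := best_mono hT hm p p' (fun l hl => (e1 l hl).symm) hle
  rw [best_greedy hT p g _ (by omega) hm, best_greedy hT p' g' _ le_rfl hm] at this
  simpa only [best_m, wt] using this

/-- A child of a candidate does not consist of heads only. -/
theorem IsChild.not_greedy {s s' v : ℕ → ℕ} {d j : ℕ} {c : Bool} (h : T.IsCand s d)
    (hm : j < T.m) (hc : T.IsChild s j c s') (hp : T.Part T.m s' v) : ¬ T.Greedy 0 s' v := by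
  intro hg
  obtain ⟨v₁, p, g, -⟩ := h
  obtain ⟨e1, e2, e3, -⟩ := hc
  have hk : T.key j v₁ = T.key j v := by
    refine (p.mono hm.le).key_eq hT (hp.mono hm.le) (fun l hl => (e1 l hl).symm) hm ?_
    rcases Nat.eq_zero_or_pos j with h | h
    · exact .inl h
    · exact .inr (hT.par_lt _ h hm)
  have := (hT.heap j hm (T.key j v₁)).child_ne_root (T.grp_nodup _ _ _)
    (p.inGrp hT hm hm) (e2 ▸ e3)
  rw [← e2, hk] at this
  exact this (hg j (by omega) hm)

end Tree

/-- The state of the enumeration: the candidates `1, ..., N`, the set of those that have been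
extracted, and the pairs of a bag and a side for which the child has been generated. -/
structure EnumState where
  N : ℕ
  tree : ℕ → ℕ
  dev : ℕ → ℕ
  rows : ℕ → ℕ → ℕ
  popped : Finset ℕ
  done : ℕ → ℕ → Bool → Prop

namespace EnumState

/-- Adding a candidate. -/
def add (E : EnumState) (τ d : ℕ) (s : ℕ → ℕ) : EnumState where
  N := E.N + 1
  tree := Function.update E.tree (E.N + 1) τ
  dev := Function.update E.dev (E.N + 1) d
  rows := Function.update E.rows (E.N + 1) s
  popped := E.popped
  done := E.done

def mark (E : EnumState) (p j : ℕ) (side : Bool) : EnumState :=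
  { E with done := fun p' j' side' => E.done p' j' side' ∨ (p' = p ∧ j' = j ∧ side' = side) }

def pop (E : EnumState) (p : ℕ) : EnumState := { E with popped := insert p E.popped }

noncomputable def wt (E : EnumState) (T : ℕ → Tree W) (id : ℕ) : W :=
  (T (E.tree id)).wt (E.rows id)

def Mem (E : EnumState) (id : ℕ) : Prop := 1 ≤ id ∧ id ≤ E.N

/-- The child of the candidate `p` at the bag `j` is among the candidates, if there is one. -/
def HasChild (E : EnumState) (T : ℕ → Tree W) (p j : ℕ) (side : Bool) : Prop :=
  child ((T (E.tree p)).left j) ((T (E.tree p)).right j) side (E.rows p j) ≠ 0 →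
    ∃ id, E.Mem id ∧ E.tree id = E.tree p ∧ E.dev id = j ∧
      (T (E.tree p)).IsChild (E.rows p) j side (E.rows id)

/-- Separated from `Inv` because the generation of a child passes through a state in which the child
is marked as done but not yet present. -/
structure BaseInv (E : EnumState) (T : ℕ → Tree W) (nt : ℕ) : Prop where
  cand : ∀ id, E.Mem id → E.tree id < nt ∧ (T (E.tree id)).IsCand (E.rows id) (E.dev id)
  inj : ∀ id id', E.Mem id → E.Mem id' → E.tree id = E.tree id' → E.rows id = E.rows id' → id = id'
  origin : ∀ id, E.Mem id →
    (∃ v, (T (E.tree id)).Part (T (E.tree id)).m (E.rows id) v ∧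
      (T (E.tree id)).Greedy 0 (E.rows id) v) ∨
    ∃ p j side, E.done p j side ∧ E.tree p = E.tree id ∧
      (T (E.tree id)).IsChild (E.rows p) j side (E.rows id)
  done_mem : ∀ p j side, E.done p j side → p ∈ E.popped ∧ E.dev p ≤ j ∧ j < (T (E.tree p)).m
  popped_mem : ∀ p ∈ E.popped, E.Mem p
  order : ∀ p ∈ E.popped, ∀ id, E.Mem id → id ∉ E.popped → wle (E.wt T p) (E.wt T id)

structure Inv (E : EnumState) (T : ℕ → Tree W) (nt : ℕ) : Prop extends E.BaseInv T nt where
  closed : ∀ p j side, E.done p j side → E.HasChild T p j side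

/-- The best solution of tree `τ` is among the candidates, if there is any solution. -/
def HasRoot (E : EnumState) (T : ℕ → Tree W) (τ : ℕ) : Prop :=
  ((T τ).m = 0 ∨ (T τ).root 0 [] ≠ 0) → ∃ id, E.Mem id ∧ E.tree id = τ ∧ E.dev id = 0 ∧
    ∃ v, (T τ).Part (T τ).m (E.rows id) v ∧ (T τ).Greedy 0 (E.rows id) v

variable {E : EnumState} {T : ℕ → Tree W} {nt : ℕ}

theorem mem_add {τ d : ℕ} {s : ℕ → ℕ} {id : ℕ} :
    (E.add τ d s).Mem id ↔ E.Mem id ∨ id = E.N + 1 := by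
  simp only [Mem, add]; omega

theorem Mem.ne {id : ℕ} (h : E.Mem id) : id ≠ E.N + 1 := by
  have := h.2; omega

theorem add_tree_of_mem {τ d : ℕ} {s : ℕ → ℕ} {id : ℕ} (h : E.Mem id) :
    (E.add τ d s).tree id = E.tree id ∧ (E.add τ d s).dev id = E.dev id ∧
      (E.add τ d s).rows id = E.rows id := by
  simp [add, h.ne]

theorem add_tree_new {τ d : ℕ} {s : ℕ → ℕ} :
    (E.add τ d s).tree (E.N + 1) = τ ∧ (E.add τ d s).dev (E.N + 1) = d ∧
      (E.add τ d s).rows (E.N + 1) = s := by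
  simp [add]

omit [CommSemiring W] in
theorem HasChild.add {p j τ d : ℕ} {side : Bool} {s : ℕ → ℕ} (h : E.HasChild T p j side)
    (hp : E.Mem p) : (E.add τ d s).HasChild T p j side := by
  intro h0
  obtain ⟨f1, f2, f3⟩ := add_tree_of_mem (τ := τ) (d := d) (s := s) hp
  rw [f1, f3] at h0 ⊢
  obtain ⟨id, hid, h1, h2, h3⟩ := h h0
  obtain ⟨e1, e2, e3⟩ := add_tree_of_mem (τ := τ) (d := d) (s := s) hid
  exact ⟨id, mem_add.2 (.inl hid), by rw [e1, h1], by rw [e2, h2], by rw [e3]; exact h3⟩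

omit [CommSemiring W] in
theorem HasRoot.add {τ' τ d : ℕ} {s : ℕ → ℕ} (h : E.HasRoot T τ') :
    (E.add τ d s).HasRoot T τ' := by
  intro h0
  obtain ⟨id, hm, ht, hd, hv⟩ := h h0
  obtain ⟨e1, e2, e3⟩ := add_tree_of_mem (τ := τ) (d := d) (s := s) hm
  exact ⟨id, mem_add.2 (.inl hm), by rw [e1, ht], by rw [e2, hd], by rw [e3]; exact hv⟩

/-- Adding a candidate that was not there before. -/
theorem BaseInv.add (h : E.BaseInv T nt) {τ d : ℕ} {s : ℕ → ℕ} (hτ : τ < nt)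
    (hc : (T τ).IsCand s d) (hnew : ∀ id, E.Mem id → E.tree id = τ → E.rows id ≠ s)
    (hor : (∃ v, (T τ).Part (T τ).m s v ∧ (T τ).Greedy 0 s v) ∨
      ∃ p j side, E.done p j side ∧ E.tree p = τ ∧ (T τ).IsChild (E.rows p) j side s)
    (hord : ∀ p ∈ E.popped, wle (E.wt T p) ((T τ).wt s)) : (E.add τ d s).BaseInv T nt := by
  obtain ⟨n1, n2, n3⟩ := add_tree_new (E := E) (τ := τ) (d := d) (s := s)
  have ho := fun id (h : E.Mem id) => add_tree_of_mem (τ := τ) (d := d) (s := s) h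
  have hp := fun p j side (hd : E.done p j side) => h.popped_mem p (h.done_mem p j side hd).1
  refine ⟨?_, ?_, ?_, ?_, ?_, ?_⟩
  · intro id hid
    rcases mem_add.1 hid with hid | rfl
    · obtain ⟨e1, e2, e3⟩ := ho id hid
      rw [e1, e2, e3]; exact h.cand id hid
    · rw [n1, n2, n3]; exact ⟨hτ, hc⟩
  · intro id id' hid hid' ht hr
    rcases mem_add.1 hid with hid | rfl <;> rcases mem_add.1 hid' with hid' | rfl
    · rw [(ho _ hid).1, (ho _ hid').1] at ht
      rw [(ho _ hid).2.2, (ho _ hid').2.2] at hr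
      exact h.inj _ _ hid hid' ht hr
    · rw [(ho _ hid).1, n1] at ht
      rw [(ho _ hid).2.2, n3] at hr
      exact absurd hr (hnew _ hid ht)
    · rw [(ho _ hid').1, n1] at ht
      rw [(ho _ hid').2.2, n3] at hr
      exact absurd hr.symm (hnew _ hid' ht.symm)
    · rfl
  · intro id hid
    rcases mem_add.1 hid with hid | rfl
    · obtain ⟨e1, e2, e3⟩ := ho id hid
      rw [e1, e3]
      rcases h.origin id hid with h' | ⟨p, j, side, hd, h1, h2⟩
      · exact .inl h'
      · obtain ⟨f1, f2, f3⟩ := ho p (hp _ _ _ hd)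
        exact .inr ⟨p, j, side, hd, by rw [f1, h1], by rw [f3]; exact h2⟩
    · rw [n1, n3]
      rcases hor with h' | ⟨p, j, side, hd, h1, h2⟩
      · exact .inl h'
      · obtain ⟨f1, f2, f3⟩ := ho p (hp _ _ _ hd)
        exact .inr ⟨p, j, side, hd, by rw [f1, h1], by rw [f3]; exact h2⟩
  · intro p j side hd
    obtain ⟨f1, f2, f3⟩ := ho p (hp _ _ _ hd)
    rw [f1, f2]; exact h.done_mem p j side hd
  · intro p hpp
    exact mem_add.2 (.inl (h.popped_mem p hpp))
  · intro p hpp id hid hn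
    have e : (E.add τ d s).wt T p = E.wt T p := by
      obtain ⟨f1, f2, f3⟩ := ho p (h.popped_mem p hpp)
      rw [wt, wt, f1, f3]
    rw [e]
    rcases mem_add.1 hid with hid | rfl
    · obtain ⟨e1, e2, e3⟩ := ho id hid
      rw [wt, wt, e1, e3]; exact h.order p hpp id hid hn
    · rw [wt, wt, n1, n3]; exact hord p hpp

theorem Inv.addRoot (h : E.Inv T nt) {τ : ℕ} {s v : ℕ → ℕ} (hτ : τ < nt)
    (hp : (T τ).Part (T τ).m s v) (hg : (T τ).Greedy 0 s v) (hz : ∀ l, (T τ).m ≤ l → s l = 0)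
    (hnew : ∀ id, E.Mem id → E.tree id ≠ τ) (hpop : E.popped = ∅) :
    (E.add τ 0 s).Inv T nt ∧ (E.add τ 0 s).HasRoot T τ := by
  refine ⟨⟨h.toBaseInv.add hτ ⟨v, hp, fun l hl => hg l (by omega), hz⟩
    (fun id hid e => absurd e (hnew id hid)) (.inl ⟨v, hp, hg⟩) (by simp [hpop]), ?_⟩, ?_⟩
  · intro p j side hd
    exact (h.closed p j side hd).add (h.popped_mem p (h.done_mem p j side hd).1)
  intro _
  obtain ⟨n1, n2, n3⟩ := add_tree_new (E := E) (τ := τ) (d := 0) (s := s)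
  exact ⟨E.N + 1, mem_add.2 (.inr rfl), n1, n2, v, by rw [n3]; exact hp, by rw [n3]; exact hg⟩

theorem BaseInv.mark (h : E.BaseInv T nt) {p j : ℕ} {side : Bool} (hp : p ∈ E.popped)
    (hd : E.dev p ≤ j) (hj : j < (T (E.tree p)).m) : (E.mark p j side).BaseInv T nt := by
  refine ⟨h.cand, h.inj, ?_, ?_, h.popped_mem, h.order⟩
  · intro id hid
    rcases h.origin id hid with h' | ⟨q, j', s', h1, h2⟩
    · exact .inl h'
    · exact .inr ⟨q, j', s', .inl h1, h2⟩
  · rintro q j' s' (h1 | ⟨rfl, rfl, rfl⟩)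
    · exact h.done_mem q j' s' h1
    · exact ⟨hp, hd, hj⟩

theorem Inv.mark (h : E.Inv T nt) {p j : ℕ} {side : Bool} (hp : p ∈ E.popped) (hd : E.dev p ≤ j)
    (hj : j < (T (E.tree p)).m)
    (hc : child ((T (E.tree p)).left j) ((T (E.tree p)).right j) side (E.rows p j) = 0) :
    (E.mark p j side).Inv T nt := by
  refine ⟨h.toBaseInv.mark hp hd hj, ?_⟩
  rintro q j' s' (h1 | ⟨rfl, rfl, rfl⟩)
  · exact h.closed q j' s' h1
  · exact fun h0 => absurd hc h0

/-- Generating the child of an extracted candidate. -/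
theorem Inv.addChild (h : E.Inv T nt) (hT : ∀ τ < nt, (T τ).Valid) {p j : ℕ} {side : Bool}
    {s : ℕ → ℕ} (hp : p ∈ E.popped) (hd : E.dev p ≤ j) (hj : j < (T (E.tree p)).m)
    (hc : (T (E.tree p)).IsChild (E.rows p) j side s) (hn : ¬ E.done p j side)
    (hord : ∀ q ∈ E.popped, wle (E.wt T q) (E.wt T p)) :
    ((E.add (E.tree p) j s).mark p j side).Inv T nt := by
  have hpm := h.popped_mem p hp
  obtain ⟨hpt, hpc⟩ := h.cand p hpm
  have hv := hT _ hpt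
  -- An earlier copy of the child would be either the all-heads solution or the child of a candidate
  -- at a marked place. By uniqueness of parents this place is `p`, `j`, `side`, which is not
  -- marked.
  have hnew : ∀ id, E.Mem id → E.tree id = E.tree p → E.rows id ≠ s := by
    intro id hid ht hr
    have hor := h.origin id hid
    rw [ht, hr] at hor
    rcases hor with ⟨v, h1, h2⟩ | ⟨q, j', s', h1, h2, h3⟩
    · exact hc.not_greedy hv hpc hj h1 h2
    · obtain ⟨q1, q2, q3⟩ := h.done_mem q j' s' h1
      have hqm := h.popped_mem q q1
      have hqc := (h.cand q hqm).2
      rw [h2] at hqc q3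
      obtain ⟨e1, e2, e3⟩ := Tree.IsChild.inj hv hpc hqc hd q2 hj q3 hc h3
      have : p = q := h.inj p q hpm hqm h2.symm e1
      subst this; subst e2; subst e3
      exact hn h1
  refine ⟨(h.toBaseInv.mark (side := side) hp hd hj).add hpt hc.2.2.2 hnew
    (.inr ⟨p, j, side, .inr ⟨rfl, rfl, rfl⟩, rfl, hc⟩)
    fun q hq => wle_trans (hord q hq) (hc.wt_le hv hpc hd hj), ?_⟩
  rintro q j' s' (h1 | ⟨rfl, rfl, rfl⟩)
  · exact (h.closed q j' s' h1).add (h.popped_mem q (h.done_mem q j' s' h1).1)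
  · intro _
    obtain ⟨n1, n2, n3⟩ := add_tree_new (E := E) (τ := E.tree q) (d := j') (s := s)
    obtain ⟨f1, f2, f3⟩ := add_tree_of_mem (τ := E.tree q) (d := j') (s := s) hpm
    refine ⟨E.N + 1, (mem_add (E := E) (τ := E.tree q) (d := j') (s := s)).2 (.inr rfl),
      n1.trans f1.symm, n2, ?_⟩
    show (T ((E.add (E.tree q) j' s).tree q)).IsChild ((E.add (E.tree q) j' s).rows q) j' s'
      ((E.add (E.tree q) j' s).rows (E.N + 1))
    rw [f1, f3, n3]
    exact hc

/-- Extracting a candidate of least weight. -/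
theorem Inv.pop (h : E.Inv T nt) {p : ℕ} (hp : E.Mem p)
    (hmin : ∀ id, E.Mem id → id ∉ E.popped → wle (E.wt T p) (E.wt T id)) :
    (E.pop p).Inv T nt := by
  refine ⟨⟨h.cand, h.inj, h.origin, ?_, ?_, ?_⟩, h.closed⟩
  · intro q j s hd
    obtain ⟨h1, h2⟩ := h.done_mem q j s hd
    exact ⟨Finset.mem_insert_of_mem h1, h2⟩
  · intro q hq
    rcases Finset.mem_insert.1 hq with rfl | hq
    · exact hp
    · exact h.popped_mem q hq
  · intro q hq id hid hn
    have hn' : id ∉ E.popped := fun h => hn (Finset.mem_insert_of_mem h)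
    rcases Finset.mem_insert.1 hq with rfl | hq
    · exact hmin id hid hn'
    · exact h.order q hq id hid hn'

/-- When all candidates have been extracted and expanded, all solutions are among them. -/
theorem Inv.complete (h : E.Inv T nt) (hT : ∀ τ < nt, (T τ).Valid)
    (hpop : ∀ id, E.Mem id → id ∈ E.popped)
    (hsat : ∀ p ∈ E.popped, ∀ j side, E.dev p ≤ j → j < (T (E.tree p)).m → E.done p j side)
    {τ : ℕ} (hτ : τ < nt) (hroot : E.HasRoot T τ) {s v : ℕ → ℕ} (hs : (T τ).Part (T τ).m s v) :
    ∃ id, E.Mem id ∧ E.tree id = τ ∧ ∀ l < (T τ).m, E.rows id l = s l := by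
  have hv := hT τ hτ
  -- The solution is approached bag by bag: some candidate agrees with it before bag `i` and is
  -- greedy from there on. The bound on `dev` guarantees that its children at bag `i` have been
  -- generated.
  suffices H : ∀ i ≤ (T τ).m, ∃ id, E.Mem id ∧ E.tree id = τ ∧ E.dev id ≤ i ∧
      (∀ l < i, E.rows id l = s l) ∧
      ∃ u, (T τ).Part (T τ).m (E.rows id) u ∧ (T τ).Greedy i (E.rows id) u by
    obtain ⟨id, h1, h2, -, h3, -⟩ := H _ le_rfl
    exact ⟨id, h1, h2, h3⟩
  intro i
  induction i with
  | zero =>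
    intro _
    obtain ⟨id, h1, h2, h3, u, h4, h5⟩ := hroot (by
      by_cases h0 : (T τ).m = 0
      · exact .inl h0
      · right
        have := hs.inGrp hv (l := 0) (by omega) (by omega)
        have := Tree.root_ne_zero_of_mem hv (by omega) this
        simpa [Tree.key, hv.sep_zero] using this)
    exact ⟨id, h1, h2, by omega, by simp, u, h4, h5⟩
  | succ i ih =>
    intro hi
    have him : i < (T τ).m := by omega
    obtain ⟨id, h1, h2, h3, h4, u, h5, h6⟩ := ih him.le
    have hk : (T τ).key i u = (T τ).key i v := by
      refine (h5.mono him.le).key_eq hv (hs.mono him.le) h4 him ?_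
      rcases Nat.eq_zero_or_pos i with h | h
      · exact .inl h
      · exact .inr (hv.par_lt _ h him)
    -- Within one bag the heap is walked down from the head to the desired row; every step of the
    -- walk is a generated child.
    have key := (hv.heap i him ((T τ).key i v)).reach (P := fun y => ∃ id, E.Mem id ∧
      E.tree id = τ ∧ E.dev id ≤ i ∧ (∀ l < i, E.rows id l = s l) ∧ E.rows id i = y ∧
      ∃ u, (T τ).Part (T τ).m (E.rows id) u ∧ (T τ).Greedy (i + 1) (E.rows id) u)
      ⟨id, h1, h2, h3, h4, by rw [h6 i le_rfl him, hk], u, h5, fun l hl => h6 l (by omega)⟩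
      (by
        rintro y hy ⟨id, h1, h2, h3, h4, h5, h6⟩ side hc
        have hd := hsat id (hpop id h1) i side h3 (by rw [h2]; exact him)
        rw [← h5] at hc ⊢
        obtain ⟨id', g1, g2, g3, e1, e2, e3, u', e4, e5, -⟩ :=
          h.closed id i side hd (by rw [h2]; exact hc)
        rw [h2] at e2 e4 e5 g2
        exact ⟨id', g1, g2, g3.le, fun l hl => by rw [e1 l hl, h4 l hl], e2, u', e4, e5⟩)
    obtain ⟨id, h1, h2, h3, h4, h5, h6⟩ := key (s i) (hs.inGrp hv him him)
    refine ⟨id, h1, h2, by omega, ?_, h6⟩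
    intro l hl
    rcases Nat.lt_succ_iff_lt_or_eq.1 hl with hl | rfl
    · exact h4 l hl
    · exact h5

end EnumState
end Enumeration
end RankedEnum

namespace RankedEnum

universe u

/-! ### The programs that build the index, and the effect of their loop-free parts. -/

section IndexPrograms

/-- The static description of a join tree: number of bags, their numbers in the schema, variables,
separators, parents, and the atoms (relation and arguments) whose weights are charged to a bag. -/
structure Plan where
  m : ℕ
  id : ℕ → ℕ
  vars : ℕ → List ℕ
  sep : ℕ → List ℕ
  par : ℕ → ℕ
  atoms : ℕ → List (ℕ × List ℕ)

structure Plan.Valid (P : Plan) : Prop where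
  par_lt : ∀ c, 0 < c → c < P.m → P.par c < c
  sep_zero : P.sep 0 = []
  sep_par : ∀ c, 0 < c → c < P.m → ∀ x ∈ P.sep c, x ∈ P.vars (P.par c)
  sep_self : ∀ c < P.m, ∀ x ∈ P.sep c, x ∈ P.vars c
  sep_shared : ∀ i c, i < c → c < P.m → ∀ x ∈ P.vars i, x ∈ P.vars c → x ∈ P.sep c
  atoms_sub : ∀ i < P.m, ∀ a ∈ P.atoms i, ∀ x ∈ a.2, x ∈ P.vars i

/-- The registers that hold the values of the variables `l`. -/
def regs (l : List ℕ) : List Operand := l.map fun x => .reg (40 + x)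

/-- Loads the variables `l` from the row whose number (from `0`) is in register 7. -/
def loadVars (τ b : ℕ) (l : List ℕ) : Program :=
  seqs (l.map fun x => .load (40 + x)
    [.const 5, .const 1, .const τ, .const b, .reg 7, .const x])

/-- The weights come from a dictionary addressed by values, because a row of a bag shows the tuple
of an atom but not its position in the input. -/
def mulAtoms (l : List (ℕ × List ℕ)) : Program :=
  seqs (l.map fun a => .seq (.wload 1 (.const 2 :: .const a.1 :: regs a.2)) (.wmul 0 0 1))

/-- Rows are numbered from `1`, so `0` in register 5 signals that there is no match; it clears the
flag in register 18. The factor multiplied in that case is irrelevant, since such a row is not put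
into any heap. -/
def mulKids (τ : ℕ) (sep : ℕ → List ℕ) (l : List ℕ) : Program :=
  seqs (l.map fun c => seqs [
    .load 5 (.const 2 :: .const τ :: .const c :: regs (sep c)),
    .ite (.eq (.reg 5) (.const 0)) (.set 18 (.const 0)) skip,
    .wload 1 [.const 4, .const τ, .const c, .reg 5],
    .wmul 0 0 1])

/-- Computes the weight of the next row and the best weight below it. -/
def rowHead (P : Plan) (τ i : ℕ) : Program := seqs [
  .set 7 (.reg 16),
  .add 16 (.reg 16) (.const 1),
  loadVars τ (P.id i) (P.vars i),
  .wone 0,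
  mulAtoms (P.atoms i),
  .wstore [.const 3, .const τ, .const i, .reg 16] 0,
  .set 18 (.const 1),
  mulKids τ P.sep (kidsOf P.m P.par i),
  .wstore [.const 4, .const τ, .const i, .reg 16] 0]

/-- Register 19 is the lowest node of the spine, register 20 the tree of nodes taken off. The flag
in register 21 is needed because a loop condition cannot load from memory. -/
def popBody (τ i : ℕ) : Program :=
  .ite (.eq (.reg 19) (.const 0)) (.set 21 (.const 0))
    (.seq (.wload 1 [.const 4, .const τ, .const i, .reg 19])
      (.ite (.wle 1 0) (.set 21 (.const 0))
        (.seq (.set 20 (.reg 19)) (.load 19 [.const 11, .const τ, .const i, .reg 19]))))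

/-- The number cells with prefix 2 hold the heads of the groups, 3 and 4 the left and right
children, 11 the upward links of the spines, and 12 the last row of each group, where its spine
ends. -/
def insertStart (τ i : ℕ) (sep : List ℕ) : Program := seqs [
  .load 19 (.const 12 :: .const τ :: .const i :: regs sep),
  .set 20 (.const 0),
  .set 21 (.const 1)]

def insertEnd (τ i : ℕ) (sep : List ℕ) : Program := seqs [
  .store [.const 3, .const τ, .const i, .reg 16] (.reg 20),
  .store [.const 11, .const τ, .const i, .reg 16] (.reg 19),
  .ite (.eq (.reg 19) (.const 0))
    (.store (.const 2 :: .const τ :: .const i :: regs sep) (.reg 16))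
    (.store [.const 4, .const τ, .const i, .reg 19] (.reg 16)),
  .store (.const 12 :: .const τ :: .const i :: regs sep) (.reg 16)]

/-- Inserts the current row into the heap of its group. -/
def insertRow (τ i : ℕ) (sep : List ℕ) : Program :=
  .seq (insertStart τ i sep)
    (.seq (.while (.lt (.const 0) (.reg 21)) (popBody τ i)) (insertEnd τ i sep))

def indexRow (P : Plan) (τ i : ℕ) : Program :=
  .seq (rowHead P τ i) (.ite (.eq (.reg 18) (.const 1)) (insertRow τ i (P.sep i)) skip)

/-- Builds the heaps of all groups of a bag. -/
def indexBag (P : Plan) (τ i : ℕ) : Program :=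
  .seq (.seq (.load 17 [.const 5, .const 1, .const τ, .const (P.id i)]) (.set 16 (.const 0)))
    (.while (.lt (.reg 16) (.reg 17)) (indexRow P τ i))

variable {W : Type u} [CommSemiring W]

omit [CommSemiring W] in
theorem regs_val (σ : St W) (l : List ℕ) : (regs l).map σ.val = l.map fun x => σ.reg (40 + x) := by
  simp [regs, Function.comp_def]

theorem eval_loadVars (τ b : ℕ) (l : List ℕ) (σ : St W) :
    eval (loadVars τ b l) σ = { σ with reg := fun r => if 40 ≤ r ∧ r - 40 ∈ l then
      (σ.rd [5, 1, τ, b, σ.reg 7, r - 40]) else σ.reg r } := by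
  refine eval_seqs_map (fun x => Program.load (40 + x) _) (fun l σ' => σ' = { σ with
    reg := fun r => if 40 ≤ r ∧ r - 40 ∈ l then
      (σ.rd [5, 1, τ, b, σ.reg 7, r - 40]) else σ.reg r }) l σ (by simp) ?_
  rintro done a rest - σ' rfl
  simp only [eval, List.map_cons, List.map_nil, St.val, St.rd]
  congr 1
  funext r
  by_cases h : r = 40 + a
  · subst h; simp
  · rw [Function.update_of_ne h]
    by_cases h40 : 40 ≤ r
    · have : r - 40 ≠ a := by omega
      simp [h40, this]
    · simp [h40]

theorem loopFree_loadVars (τ b : ℕ) (l : List ℕ) : LoopFree (loadVars τ b l) := by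
  simp [loadVars, loopFree_seqs, LoopFree]

theorem eval_mulAtoms (l : List (ℕ × List ℕ)) (σ : St W) :
    (eval (mulAtoms l) σ).reg = σ.reg ∧ (eval (mulAtoms l) σ).mem = σ.mem ∧
    (eval (mulAtoms l) σ).wmem = σ.wmem ∧ (eval (mulAtoms l) σ).out = σ.out ∧
    (eval (mulAtoms l) σ).wreg 0 = σ.wreg 0 *
      (l.map fun a => σ.wrd (2 :: a.1 :: a.2.map fun x => σ.reg (40 + x))).prod := by
  refine eval_seqs_map (fun a : ℕ × List ℕ => Program.seq _ _) (fun l σ' => σ'.reg = σ.reg ∧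
    σ'.mem = σ.mem ∧ σ'.wmem = σ.wmem ∧ σ'.out = σ.out ∧ σ'.wreg 0 = σ.wreg 0 *
      (l.map fun a => σ.wrd (2 :: a.1 :: a.2.map fun x => σ.reg (40 + x))).prod) l σ (by simp) ?_
  rintro done a rest - σ' ⟨h1, h2, h3, h4, h5⟩
  simp [eval, h1, h2, h3, h4, h5, regs_val, St.wrd, mul_assoc]

theorem loopFree_mulAtoms (l : List (ℕ × List ℕ)) : LoopFree (mulAtoms l) := by
  rw [mulAtoms, loopFree_seqs]
  simp only [List.mem_map]
  rintro p ⟨a, -, rfl⟩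
  exact ⟨trivial, trivial⟩

open Classical in
theorem eval_mulKids (τ : ℕ) (sep : ℕ → List ℕ) (l : List ℕ) (σ : St W) :
    (∀ r, r ≠ 5 → r ≠ 18 → (eval (mulKids τ sep l) σ).reg r = σ.reg r) ∧
    (eval (mulKids τ sep l) σ).mem = σ.mem ∧
    (eval (mulKids τ sep l) σ).wmem = σ.wmem ∧ (eval (mulKids τ sep l) σ).out = σ.out ∧
    (eval (mulKids τ sep l) σ).wreg 0 = σ.wreg 0 * (l.map fun c => σ.wrd [4, τ, c,
      σ.rd (2 :: τ :: c :: (sep c).map fun x => σ.reg (40 + x))]).prod ∧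
    (eval (mulKids τ sep l) σ).reg 18 =
      if ∀ c ∈ l, σ.rd (2 :: τ :: c :: (sep c).map fun x => σ.reg (40 + x)) ≠ 0
      then σ.reg 18 else 0 := by
  refine eval_seqs_map (fun c : ℕ => seqs _)
    (fun l σ' => (∀ r, r ≠ 5 → r ≠ 18 → σ'.reg r = σ.reg r) ∧
      σ'.mem = σ.mem ∧ σ'.wmem = σ.wmem ∧ σ'.out = σ.out ∧
      σ'.wreg 0 = σ.wreg 0 * (l.map fun c => σ.wrd [4, τ, c,
        σ.rd (2 :: τ :: c :: (sep c).map fun x => σ.reg (40 + x))]).prod ∧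
      σ'.reg 18 = if ∀ c ∈ l, σ.rd (2 :: τ :: c :: (sep c).map fun x => σ.reg (40 + x)) ≠ 0
        then σ.reg 18 else 0) l σ (by simp) ?_
  rintro done a rest - σ' ⟨h1, h2, h3, h4, h5, h6⟩
  have hk : ((sep a).map fun x => σ'.reg (40 + x)) = (sep a).map fun x => σ.reg (40 + x) :=
    List.map_congr_left fun x _ => h1 _ (by omega) (by omega)
  by_cases h0 : σ.rd (2 :: τ :: a :: (sep a).map fun x => σ.reg (40 + x)) = 0
  · have h0' : (σ.mem (2 :: τ :: a :: (sep a).map fun x => σ.reg (40 + x))).getD 0 = 0 := h0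
    simp [eval, St.rd, St.wrd, regs_val, hk, h2, h3, h4, h5, St.holds, h0', mul_assoc]
    intro r hr hr'
    simp [hr, hr', h1]
  · have h0' : ¬ (σ.mem (2 :: τ :: a :: (sep a).map fun x => σ.reg (40 + x))).getD 0 = 0 := h0
    simp [eval, St.rd, St.wrd, regs_val, hk, h2, h3, h4, h5, St.holds, h0', h6, mul_assoc]
    refine ⟨?_, ?_⟩
    · intro r hr hr'
      simp [hr, hr', h1]
    · refine if_congr ?_ rfl rfl
      constructor
      · rintro h c (hc | rfl)
        · exact h c hc
        · exact h0'
      · intro h c hc; exact h c (.inl hc)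

theorem loopFree_mulKids (τ : ℕ) (sep : ℕ → List ℕ) (l : List ℕ) :
    LoopFree (mulKids τ sep l) := by
  simp [mulKids, loopFree_seqs, LoopFree, skip]

/-- The join tree and its index as stored in memory. -/
def mkTree (P : Plan) (τ : ℕ) (mem : List ℕ → Option ℕ) (wmem : List ℕ → Option W) : Tree W where
  m := P.m
  vars := P.vars
  sep := P.sep
  par := P.par
  len i := (mem [5, 1, τ, P.id i]).getD 0
  val i r x := (mem [5, 1, τ, P.id i, r - 1, x]).getD 0
  root i k := (mem (2 :: τ :: i :: k)).getD 0
  left i r := (mem [3, τ, i, r]).getD 0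
  right i r := (mem [4, τ, i, r]).getD 0
  w i r := (wmem [3, τ, i, r]).getD 1
  bw i r := (wmem [4, τ, i, r]).getD 1

/-- The weight of the row `r` of bag `i`, computed from the dictionary of input weights. -/
def rowW (P : Plan) (T : Tree W) (wmem : List ℕ → Option W) (i r : ℕ) : W :=
  ((P.atoms i).map fun a => (wmem (2 :: a.1 :: a.2.map (T.val i r))).getD 1).prod

/-- The best weight of a solution of the subtree below row `r` of bag `i`, computed from the
index of the child bags. -/
def bestW (P : Plan) (T : Tree W) (wmem : List ℕ → Option W) (i r : ℕ) : W :=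
  rowW P T wmem i r *
    ((kidsOf P.m P.par i).map fun c => T.bw c (T.root c (T.key c (T.val i r)))).prod

theorem loopFree_rowHead (P : Plan) (τ i : ℕ) : LoopFree (rowHead P τ i) := by
  simp [rowHead, loopFree_seqs, LoopFree, loopFree_loadVars, loopFree_mulAtoms, loopFree_mulKids]

open Classical in
theorem eval_rowHead {P : Plan} (hP : P.Valid) (τ i : ℕ) (hi : i < P.m) (σ : St W) (T : Tree W)
    (hT : T = mkTree P τ σ.mem σ.wmem) :
    let σ' := eval (rowHead P τ i) σ
    let r := σ.reg 16 + 1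
    σ'.mem = σ.mem ∧ σ'.out = σ.out ∧
    σ'.wmem = Function.update (Function.update σ.wmem [3, τ, i, r] (some (rowW P T σ.wmem i r)))
      [4, τ, i, r] (some (bestW P T σ.wmem i r)) ∧
    σ'.reg 16 = r ∧ σ'.reg 17 = σ.reg 17 ∧
    (∀ x ∈ P.vars i, σ'.reg (40 + x) = T.val i r x) ∧
    σ'.wreg 0 = bestW P T σ.wmem i r ∧
    (σ'.reg 18 = 1 ↔ T.Alive i r) := by
  intro σ' r
  have hσ' : σ' = eval (rowHead P τ i) σ := rfl
  simp only [rowHead, eval_seqs_cons, eval_seqs_nil] at hσ'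
  generalize h1 : eval (.add 16 (.reg 16) (.const 1)) (eval (.set 7 (.reg 16)) σ) = σ1 at hσ'
  generalize h2 : eval (loadVars τ (P.id i) (P.vars i)) σ1 = σ2 at hσ'
  generalize h3 : eval (.wone 0) σ2 = σ3 at hσ'
  generalize h4 : eval (mulAtoms (P.atoms i)) σ3 = σ4 at hσ'
  generalize h5 : eval (.set 18 (.const 1))
    (eval (.wstore [.const 3, .const τ, .const i, .reg 16] 0) σ4) = σ5 at hσ'
  generalize h6 : eval (mulKids τ P.sep (kidsOf P.m P.par i)) σ5 = σ6 at hσ'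
  have a1 : σ1.mem = σ.mem ∧ σ1.wmem = σ.wmem ∧ σ1.out = σ.out ∧ σ1.reg 7 = σ.reg 16 ∧
      σ1.reg 16 = r ∧ σ1.reg 17 = σ.reg 17 := by
    subst h1; simp [eval, r]
  rw [eval_loadVars] at h2
  have a2 : σ2.mem = σ.mem ∧ σ2.wmem = σ.wmem ∧ σ2.out = σ.out ∧ σ2.reg 16 = r ∧
      σ2.reg 17 = σ.reg 17 ∧ ∀ x ∈ P.vars i, σ2.reg (40 + x) = T.val i r x := by
    subst h2 hT
    refine ⟨a1.1, a1.2.1, a1.2.2.1, ?_, ?_, ?_⟩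
    · simp [a1.2.2.2.2.1]
    · simp [a1.2.2.2.2.2]
    · intro x hx; simp [hx, St.rd, a1.1, a1.2.2.2.1, mkTree, r]
  have a3 : σ3.mem = σ.mem ∧ σ3.wmem = σ.wmem ∧ σ3.out = σ.out ∧ σ3.reg 16 = r ∧
      σ3.reg 17 = σ.reg 17 ∧ (∀ x ∈ P.vars i, σ3.reg (40 + x) = T.val i r x) ∧
      σ3.wreg 0 = 1 := by
    subst h3; simp only [eval, Function.update_self]; exact ⟨a2.1, a2.2.1, a2.2.2.1, a2.2.2.2.1,
      a2.2.2.2.2.1, a2.2.2.2.2.2, trivial⟩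
  obtain ⟨b1, b2, b3, b4, b5⟩ := eval_mulAtoms (P.atoms i) σ3
  rw [h4] at b1 b2 b3 b4 b5
  have a4 : σ4.wreg 0 = rowW P T σ.wmem i r := by
    rw [b5, a3.2.2.2.2.2.2, one_mul, rowW]
    congr 1
    refine List.map_congr_left fun a ha => ?_
    rw [St.wrd, a3.2.1]
    congr 3
    congr 1
    exact List.map_congr_left fun x hx => a3.2.2.2.2.2.1 x (hP.atoms_sub i hi a ha x hx)
  have a5 : σ5.mem = σ.mem ∧ σ5.wmem = Function.update σ.wmem [3, τ, i, r]
      (some (rowW P T σ.wmem i r)) ∧ σ5.out = σ.out ∧ σ5.reg 16 = r ∧ σ5.reg 17 = σ.reg 17 ∧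
      (∀ x ∈ P.vars i, σ5.reg (40 + x) = T.val i r x) ∧ σ5.wreg 0 = rowW P T σ.wmem i r ∧
      σ5.reg 18 = 1 := by
    subst h5
    simp only [eval, List.map_cons, List.map_nil, St.val, b1, b2, b3, b4, a3, a4]
    simp only [Function.update_self, and_true, true_and]
    refine ⟨?_, ?_, ?_⟩
    · simp [a3.2.2.2.1]
    · simp [a3.2.2.2.2.1]
    · intro x hx
      rw [Function.update_of_ne (by omega)]
      exact a3.2.2.2.2.2.1 x hx
  obtain ⟨c1, c2, c3, c4, c5, c6⟩ := eval_mulKids τ P.sep (kidsOf P.m P.par i) σ5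
  rw [h6] at c1 c2 c3 c4 c5 c6
  obtain ⟨d1, d2, d3, d4, d5, d6, d7, d8⟩ := a5
  have hkey : ∀ c ∈ kidsOf P.m P.par i,
      ((P.sep c).map fun x => σ5.reg (40 + x)) = T.key c (T.val i r) := by
    intro c hc
    have hc' : c < P.m ∧ i < c ∧ P.par c = i := by simpa [kidsOf] using hc
    rw [hT]
    refine List.map_congr_left fun x hx => ?_
    rw [← hT]
    refine d6 x ?_
    have := hP.sep_par c (by omega) hc'.1 x hx
    rwa [hc'.2.2] at this
  have hroot : ∀ c ∈ kidsOf P.m P.par i, σ5.rd (2 :: τ :: c :: (P.sep c).map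
      fun x => σ5.reg (40 + x)) = T.root c (T.key c (T.val i r)) := by
    intro c hc
    rw [hkey c hc, St.rd, d1, hT]
    rfl
  have hw0 : σ6.wreg 0 = bestW P T σ.wmem i r := by
    rw [c5, d7, bestW]
    congr 2
    refine List.map_congr_left fun c hc => ?_
    rw [hroot c hc, St.wrd, d2, Function.update_of_ne (by simp), hT]
    rfl
  rw [hσ']
  simp only [eval, List.map_cons, List.map_nil, St.val, c2, c3, c4, d1, d2, d3, hw0, true_and]
  rw [c1 16 (by omega) (by omega), c1 17 (by omega) (by omega), d4, d5, c6, d8]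
  refine ⟨rfl, rfl, rfl, ?_, ?_⟩
  · intro x hx
    rw [c1 _ (by omega) (by omega)]; exact d6 x hx
  · have : (∀ c ∈ kidsOf P.m P.par i, σ5.rd (2 :: τ :: c :: (P.sep c).map
        fun x => σ5.reg (40 + x)) ≠ 0) ↔ T.Alive i r := by
      have hk : kidsOf T.m T.par i = kidsOf P.m P.par i := by rw [hT]; rfl
      rw [Tree.Alive, hk]
      exact forall₂_congr fun c hc => by rw [hroot c hc]
    simp only [this]
    by_cases hA : T.Alive i r <;> simp [hA]

end IndexPrograms
end RankedEnum

namespace RankedEnum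

universe u

/-! ### Correctness and amortised linear time of the indexing of one bag. -/

section IndexCorrect

variable {W : Type u} [CommSemiring W]

/-- Comparison of rows by weight. -/
def leBy (b : ℕ → W) (x y : ℕ) : Prop := wle (b x) (b y)

theorem leBy_trans (b : ℕ → W) : ∀ x y z, leBy b x y → leBy b y z → leBy b x z :=
  fun _ _ _ => wle_trans

theorem loopFree_popBody (τ i : ℕ) : LoopFree (popBody τ i) := by
  simp [popBody, LoopFree]

/-- Every iteration but the last moves a member of `O` from the spine to the nodes taken off. So all
but a constant part of the time is paid for by the growth of `O ∩ lp`. The number `n` only serves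
for the induction. -/
theorem spec_popLoop (hW : Selective W) (τ i : ℕ) {L R U : ℕ → ℕ} {b : ℕ → W} {O : Finset ℕ}
    {root x : ℕ} (n : ℕ) : ∀ (σ : St W) (cur prev : ℕ) (lc lp : List ℕ), lc.length ≤ n →
    σ.reg 19 = cur → σ.reg 20 = prev → σ.reg 21 = 1 → σ.wreg 0 = b x →
    (∀ y ∈ lc, σ.wrd [4, τ, i, y] = b y) → (∀ y ∈ lc, σ.rd [11, τ, i, y] = U y) →
    (lc ++ lp).Nodup → Popping L R U (leBy b) O root x cur prev lc lp →
    ∃ cur' prev' lc' lp' t, lc' ++ lp' = lc ++ lp ∧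
      Popping L R U (leBy b) O root x cur' prev' lc' lp' ∧ (cur' ≠ 0 → leBy b cur' x) ∧
      t + (cost (popBody τ i) + 1) * (O ∩ lp.toFinset).card ≤
        (cost (popBody τ i) + 1) * (O ∩ lp'.toFinset).card + cost (popBody τ i) + 2 ∧
      Spec (.while (.lt (.const 0) (.reg 21)) (popBody τ i)) t σ fun σ' =>
        σ'.mem = σ.mem ∧ σ'.wmem = σ.wmem ∧ σ'.out = σ.out ∧ σ'.reg 19 = cur' ∧
        σ'.reg 20 = prev' ∧ ∀ r, r ≠ 19 → r ≠ 20 → r ≠ 21 → σ'.reg r = σ.reg r := by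
  induction n with
  | zero =>
    intro σ cur prev lc lp hn h19 h20 h21 hw hb hU hnd hp
    have hlc : lc = [] := List.length_eq_zero_iff.1 (by omega)
    subst hlc
    have hc : cur = 0 := by
      by_contra h0
      exact absurd (hp.spine.top_mem h0) (by simp)
    refine ⟨cur, prev, [], lp, cost (popBody τ i) + 1 + 1, rfl, hp, fun h => absurd hc h, by omega,
      ?_⟩
    refine Spec.while_true (by simp [St.holds, h21]) ?_
    refine Spec.of_eval (loopFree_popBody τ i) ?_
    have he : eval (popBody τ i) σ = { σ with reg := Function.update σ.reg 21 0 } := by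
      simp [popBody, eval, St.holds, h19, hc]
    rw [he]
    refine Spec.while_false (by simp [St.holds]) ?_
    simp only [true_and]
    refine ⟨by simp [h19], by simp [h20], fun r _ _ h => by simp [h]⟩
  | succ n ih =>
    intro σ cur prev lc lp hn h19 h20 h21 hw hb hU hnd hp
    by_cases hend : cur = 0 ∨ leBy b cur x
    · have hle : cur ≠ 0 → leBy b cur x := fun h => hend.resolve_left h
      refine ⟨cur, prev, lc, lp, cost (popBody τ i) + 1 + 1, rfl, hp, hle, by omega, ?_⟩
      refine Spec.while_true (by simp [St.holds, h21]) ?_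
      refine Spec.of_eval (loopFree_popBody τ i) ?_
      have he : (eval (popBody τ i) σ).mem = σ.mem ∧ (eval (popBody τ i) σ).wmem = σ.wmem ∧
          (eval (popBody τ i) σ).out = σ.out ∧
          (eval (popBody τ i) σ).reg = Function.update σ.reg 21 0 := by
        by_cases hc : cur = 0
        · simp [popBody, eval, St.holds, h19, hc]
        · have h1 := hb cur (hp.spine.top_mem hc)
          have h2 : wle (σ.wrd [4, τ, i, cur]) (b x) := h1 ▸ hle hc
          simp [popBody, eval, St.holds, h19, hc, hw, h2]
      refine Spec.while_false (by simp [St.holds, he.2.2.2]) ?_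
      refine ⟨he.1, he.2.1, he.2.2.1, by simp [he.2.2.2, h19], by simp [he.2.2.2, h20],
        fun r _ _ h => by simp [he.2.2.2, h]⟩
    · push Not at hend
      obtain ⟨hc, hle⟩ := hend
      have hxc : leBy b x cur := (wle_total hW (b x) (b cur)).resolve_right hle
      obtain ⟨lc', ll, e, hcO, hp'⟩ := hp.pop (leBy_trans b) hc hxc
      have hcl := hp.spine.top_mem hc
      have h1 := hb cur hcl
      have h2 : ¬ wle (σ.wrd [4, τ, i, cur]) (b x) := h1 ▸ hle
      have he : (eval (popBody τ i) σ).mem = σ.mem ∧ (eval (popBody τ i) σ).wmem = σ.wmem ∧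
          (eval (popBody τ i) σ).out = σ.out ∧ (eval (popBody τ i) σ).wreg 0 = σ.wreg 0 ∧
          (eval (popBody τ i) σ).reg =
            Function.update (Function.update σ.reg 20 cur) 19 (σ.rd [11, τ, i, cur]) := by
        simp [popBody, eval, St.holds, h19, hc, hw, h2, St.rd]
      obtain ⟨e1, e2, e3, e4, e5⟩ := he
      have hU' := hU cur hcl
      have hnd' : (lc' ++ (ll ++ cur :: lp)).Nodup := by simpa [e] using hnd
      obtain ⟨cur', prev', lc2, lp2, t, f1, f2, f3, f4, f5⟩ :=
        ih (eval (popBody τ i) σ) (U cur) cur lc' (ll ++ cur :: lp)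
          (by have := congrArg List.length e; simp at this; omega)
          (by simp [e5, hU']) (by simp [e5]) (by simp [e5, h21]) (by rw [e4, hw])
          (fun y hy => by rw [St.wrd, e2]; exact hb y (by simp [e, hy]))
          (fun y hy => by rw [St.rd, e1]; exact hU y (by simp [e, hy])) hnd' hp'
      refine ⟨cur', prev', lc2, lp2, cost (popBody τ i) + t + 1, by rw [f1, e]; simp, f2, f3, ?_, ?_⟩
      -- The popped node is in `O` and, as the list has no repetitions, had not been taken off
      -- before.
      · have hcard : (O ∩ lp.toFinset).card + 1 ≤ (O ∩ (ll ++ cur :: lp).toFinset).card := by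
          rw [← Finset.card_insert_of_notMem (a := cur)]
          · apply Finset.card_le_card
            intro y hy
            simp only [Finset.mem_insert, Finset.mem_inter, List.mem_toFinset, List.mem_append,
              List.mem_cons] at hy ⊢
            rcases hy with rfl | ⟨h, h'⟩
            · exact ⟨hcO, .inr (.inl rfl)⟩
            · exact ⟨h, .inr (.inr h')⟩
          · have : cur ∉ lp := by
              have h3 := (List.nodup_append.1 hnd').2.1
              have h4 := (List.nodup_append.1 h3).2.1
              exact (List.nodup_cons.1 h4).1
            simp [this]
        have := Nat.mul_le_mul_left (cost (popBody τ i) + 1) hcard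
        rw [Nat.mul_add] at this
        omega
      · refine Spec.while_true (by simp [St.holds, h21]) ?_
        refine Spec.of_eval (loopFree_popBody τ i) (f5.mono le_rfl ?_)
        rintro σ' ⟨g1, g2, g3, g4, g5, g6⟩
        refine ⟨g1.trans e1, g2.trans e2, g3.trans e3, g4, g5, ?_⟩
        intro r h h' h''
        rw [g6 r h h' h'', e5]; simp [h, h']

/-- The addresses of number cells that belong to the index of a bag. -/
def Own (τ i : ℕ) (a : List ℕ) : Prop :=
  ∃ hd k, (hd = 2 ∨ hd = 3 ∨ hd = 4 ∨ hd = 11 ∨ hd = 12) ∧ a = hd :: τ :: i :: k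

/-- The addresses of weight cells that belong to the index of a bag. -/
def WOwn (τ i : ℕ) (a : List ℕ) : Prop := ∃ hd k, (hd = 3 ∨ hd = 4) ∧ a = hd :: τ :: i :: k

/-- The memory `mem', wmem'` agrees with `mem, wmem` on the data and on the index of the bags of
tree `τ` that come after `i`. -/
structure Agree (τ i : ℕ) (mem mem' : List ℕ → Option ℕ) (wmem wmem' : List ℕ → Option W) :
    Prop where
  data : ∀ l, mem' (5 :: l) = mem (5 :: l)
  dict : ∀ l, wmem' (2 :: l) = wmem (2 :: l)
  root : ∀ c k, i < c → mem' (2 :: τ :: c :: k) = mem (2 :: τ :: c :: k)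
  bw : ∀ c k, i < c → wmem' (4 :: τ :: c :: k) = wmem (4 :: τ :: c :: k)

omit [CommSemiring W] in
theorem agree_of_own {τ i : ℕ} {mem mem' : List ℕ → Option ℕ} {wmem wmem' : List ℕ → Option W}
    (h : ∀ a, ¬ Own τ i a → mem' a = mem a) (hw : ∀ a, ¬ WOwn τ i a → wmem' a = wmem a) :
    Agree τ i mem mem' wmem wmem' := by
  refine ⟨fun l => h _ ?_, fun l => hw _ ?_, fun c k hc => h _ ?_, fun c k hc => hw _ ?_⟩ <;>
  · rintro ⟨hd, k, hh, e⟩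
    simp only [List.cons.injEq] at e
    omega

/-- Groups and weights of bag `i` depend only on the data, the dictionary, and bags with larger
numbers. Indexing bag `i` changes none of these, so they may be computed from the memory before it.
-/
theorem Agree.congr {P : Plan} {τ i : ℕ} {mem mem' : List ℕ → Option ℕ}
    {wmem wmem' : List ℕ → Option W} (h : Agree τ i mem mem' wmem wmem') :
    (mkTree P τ mem' wmem').len = (mkTree P τ mem wmem).len ∧
    (mkTree P τ mem' wmem').val = (mkTree P τ mem wmem).val ∧
    (∀ r, (mkTree P τ mem' wmem').Alive i r ↔ (mkTree P τ mem wmem).Alive i r) ∧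
    (∀ k n, (mkTree P τ mem' wmem').grp i k n = (mkTree P τ mem wmem).grp i k n) ∧
    rowW P (mkTree P τ mem' wmem') wmem' i = rowW P (mkTree P τ mem wmem) wmem i ∧
    bestW P (mkTree P τ mem' wmem') wmem' i = bestW P (mkTree P τ mem wmem) wmem i := by
  have hval : (mkTree P τ mem' wmem').val = (mkTree P τ mem wmem).val := by
    funext i r x; simp only [mkTree, h.data]
  have hA : ∀ r, (mkTree P τ mem' wmem').Alive i r ↔ (mkTree P τ mem wmem).Alive i r := by
    intro r
    refine forall₂_congr fun c hc => ?_
    rw [hval]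
    have : (mkTree P τ mem' wmem').root c = (mkTree P τ mem wmem).root c := by
      funext k; simp only [mkTree, h.root c _ (Tree.mem_kids.1 hc).2.1]
    rw [this]; rfl
  have hrow : rowW P (mkTree P τ mem' wmem') wmem' i = rowW P (mkTree P τ mem wmem) wmem i := by
    funext r; simp only [rowW, hval, h.dict]
  refine ⟨?_, hval, hA, ?_, hrow, ?_⟩
  · funext i; simp only [mkTree, h.data]
  · intro k n
    refine List.filter_congr fun r _ => ?_
    have e : (mkTree P τ mem' wmem').InGrp i k r ↔ (mkTree P τ mem wmem).InGrp i k r := by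
      rw [Tree.InGrp, Tree.InGrp, hA, hval]; rfl
    exact decide_eq_decide.2 e
  · funext r
    simp only [bestW, hrow]
    congr 2
    refine List.map_congr_left fun c hc => ?_
    have hc' : c < P.m ∧ i < c ∧ P.par c = i := by simpa [kidsOf] using hc
    rw [hval]
    simp only [mkTree, Tree.key, h.root c _ hc'.2.1, h.bw c _ hc'.2.1]

/-- The state while the rows of a bag are being indexed: `j` rows are done. -/
structure BagInv (P : Plan) (τ i : ℕ) (T : Tree W) (σ₀ : St W) (j : ℕ) (O : Finset ℕ) (σ : St W) :
    Prop where
  mem : ∀ a, ¬ Own τ i a → σ.mem a = σ₀.mem a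
  wmem : ∀ a, ¬ WOwn τ i a → σ.wmem a = σ₀.wmem a
  out : σ.out = σ₀.out
  counter : σ.reg 16 = j
  len : σ.reg 17 = T.len i
  spine : ∀ k, Spine (fun y => σ.rd [3, τ, i, y]) (fun y => σ.rd [4, τ, i, y])
    (fun y => σ.rd [11, τ, i, y]) (leBy (bestW P T σ₀.wmem i)) O (σ.rd (2 :: τ :: i :: k))
    (σ.rd (12 :: τ :: i :: k)) (T.grp i k j)
  tail : ∀ k, σ.rd (12 :: τ :: i :: k) ≠ 0 → σ.rd [4, τ, i, σ.rd (12 :: τ :: i :: k)] = 0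
  empty : ∀ k, σ.rd (12 :: τ :: i :: k) = 0 → σ.rd (2 :: τ :: i :: k) = 0
  fresh : ∀ y, j < y → σ.rd [4, τ, i, y] = 0
  row : ∀ r, 1 ≤ r → r ≤ j → σ.wrd [3, τ, i, r] = rowW P T σ₀.wmem i r
  best : ∀ r, 1 ≤ r → r ≤ j → σ.wrd [4, τ, i, r] = bestW P T σ₀.wmem i r

omit [CommSemiring W] in
theorem grp_succ_of_not (T : Tree W) {i j : ℕ} {k : List ℕ} (h : ¬ T.InGrp i k (j + 1)) :
    T.grp i k (j + 1) = T.grp i k j := by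
  rw [Tree.grp, List.range'_concat, List.filter_append]
  simp [Tree.grp, add_comm 1 j, h]

omit [CommSemiring W] in
theorem grp_succ_of (T : Tree W) {i j : ℕ} {k : List ℕ} (h : T.InGrp i k (j + 1)) :
    T.grp i k (j + 1) = T.grp i k j ++ [j + 1] := by
  rw [Tree.grp, List.range'_concat, List.filter_append]
  simp [Tree.grp, add_comm 1 j, h]

theorem loopFree_insertStart (τ i : ℕ) (sep : List ℕ) : LoopFree (insertStart τ i sep) := by
  simp [insertStart, loopFree_seqs, LoopFree]

theorem loopFree_insertEnd (τ i : ℕ) (sep : List ℕ) : LoopFree (insertEnd τ i sep) := by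
  simp [insertEnd, loopFree_seqs, LoopFree]

theorem eval_insertEnd (τ i : ℕ) (sep : List ℕ) (σ : St W) {x cur prev : ℕ} {k : List ℕ}
    (hx : σ.reg 16 = x) (hc : σ.reg 19 = cur) (hp : σ.reg 20 = prev)
    (hk : (sep.map fun y => σ.reg (40 + y)) = k) :
    let σ' := eval (insertEnd τ i sep) σ
    (∀ a, ¬ Own τ i a → σ'.mem a = σ.mem a) ∧ σ'.wmem = σ.wmem ∧ σ'.out = σ.out ∧
    σ'.reg = σ.reg ∧
    (fun y => σ'.rd [3, τ, i, y]) = Function.update (fun y => σ.rd [3, τ, i, y]) x prev ∧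
    (fun y => σ'.rd [11, τ, i, y]) = Function.update (fun y => σ.rd [11, τ, i, y]) x cur ∧
    (fun y => σ'.rd [4, τ, i, y]) =
      (if cur = 0 then fun y => σ.rd [4, τ, i, y]
        else Function.update (fun y => σ.rd [4, τ, i, y]) cur x) ∧
    (∀ k', σ'.rd (2 :: τ :: i :: k') = if k' = k ∧ cur = 0 then x else σ.rd (2 :: τ :: i :: k')) ∧
    (∀ k', σ'.rd (12 :: τ :: i :: k') = if k' = k then x else σ.rd (12 :: τ :: i :: k')) := by
  have hown : ∀ a, ¬ Own τ i a → ∀ hd k, (hd = 2 ∨ hd = 3 ∨ hd = 4 ∨ hd = 11 ∨ hd = 12) →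
      a ≠ hd :: τ :: i :: k := fun a ha hd k hh e => ha ⟨hd, k, hh, e⟩
  by_cases h0 : cur = 0
  · simp only [insertEnd, eval_seqs_cons, eval_seqs_nil, eval, St.holds, List.map_cons,
      List.map_nil, St.val, regs_val, hx, hc, hp, hk, h0, if_true, St.rd]
    refine ⟨?_, trivial, trivial, trivial, ?_, ?_, ?_, ?_, ?_⟩
    · intro a ha
      have := hown a ha
      rw [Function.update_of_ne (this _ _ (by simp)), Function.update_of_ne (this _ _ (by simp)),
        Function.update_of_ne (this _ _ (by simp)), Function.update_of_ne (this _ _ (by simp))]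
    · funext y; by_cases hy : y = x <;> simp [hy]
    · funext y; by_cases hy : y = x <;> simp [hy]
    · funext y; simp
    · intro k'; by_cases hy : k' = k <;> simp [hy]
    · intro k'; by_cases hy : k' = k <;> simp [hy]
  · simp only [insertEnd, eval_seqs_cons, eval_seqs_nil, eval, St.holds, List.map_cons,
      List.map_nil, St.val, regs_val, hx, hc, hp, hk, h0, if_false, St.rd]
    refine ⟨?_, trivial, trivial, trivial, ?_, ?_, ?_, ?_, ?_⟩
    · intro a ha
      have := hown a ha
      rw [Function.update_of_ne (this _ _ (by simp)), Function.update_of_ne (this _ _ (by simp)),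
        Function.update_of_ne (this _ _ (by simp)), Function.update_of_ne (this _ _ (by simp))]
    · funext y; by_cases hy : y = x <;> simp [hy]
    · funext y; by_cases hy : y = x <;> simp [hy]
    · funext y; by_cases hy : y = cur <;> simp [hy]
    · intro k'; simp
    · intro k'; by_cases hy : k' = k <;> simp [hy]

/-- One more row is indexed; the time is paid for by the decrease of `O`. -/
theorem spec_indexRow (hW : Selective W) {P : Plan} (hP : P.Valid) {τ i : ℕ} (hi : i < P.m)
    {σ₀ : St W} {T : Tree W} (hT : T = mkTree P τ σ₀.mem σ₀.wmem) {j : ℕ} {O : Finset ℕ} {σ : St W}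
    (h : BagInv P τ i T σ₀ j O σ) :
    ∃ (O' : Finset ℕ) (t : ℕ), t + (cost (popBody τ i) + 1) * O'.card ≤
      (cost (popBody τ i) + 1) * O.card + (cost (rowHead P τ i) + 2 * cost (popBody τ i) +
        cost (insertStart τ i (P.sep i)) + cost (insertEnd τ i (P.sep i)) + 10) ∧
      Spec (indexRow P τ i) t σ (BagInv P τ i T σ₀ (j + 1) O') := by
  have hag := (agree_of_own h.mem h.wmem).congr (P := P)
  rw [← hT] at hag
  obtain ⟨q1, q2, q3, q4, q5, q6⟩ := hag
  obtain ⟨e1, e2, e3, e4, e5, e6, e7, e8⟩ := eval_rowHead hP τ i hi σ _ rfl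
  rw [h.counter] at e3 e4 e6 e7 e8
  rw [q5, q6] at e3
  rw [q6] at e7
  rw [q3] at e8
  simp only [q2] at e6
  rw [h.len] at e5
  set σ1 := eval (rowHead P τ i) σ with hσ1
  have hfr : ∀ a, ¬ WOwn τ i a → σ1.wmem a = σ₀.wmem a := by
    intro a ha
    rw [e3, Function.update_of_ne, Function.update_of_ne, h.wmem a ha]
    · rintro rfl; exact ha ⟨3, _, by simp, rfl⟩
    · rintro rfl; exact ha ⟨4, _, by simp, rfl⟩
  have hrow : ∀ r, 1 ≤ r → r ≤ j + 1 → σ1.wrd [3, τ, i, r] = rowW P T σ₀.wmem i r := by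
    intro r h1 h2
    rw [St.wrd, e3]
    rcases Nat.le_succ_iff.1 h2 with h2 | rfl
    · have : r ≠ j + 1 := by omega
      simpa [Function.update_apply, this, St.wrd] using h.row r h1 h2
    · simp
  have hbest : ∀ r, 1 ≤ r → r ≤ j + 1 → σ1.wrd [4, τ, i, r] = bestW P T σ₀.wmem i r := by
    intro r h1 h2
    rw [St.wrd, e3]
    rcases Nat.le_succ_iff.1 h2 with h2 | rfl
    · have : r ≠ j + 1 := by omega
      simpa [Function.update_apply, this, St.wrd] using h.best r h1 h2
    · simp
  have hrd : ∀ a, σ1.rd a = σ.rd a := fun a => by rw [St.rd, e1]; rfl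
  by_cases hA : T.Alive i (j + 1)
  swap
  · refine ⟨O, cost (rowHead P τ i) + (1 + 1) + 1, by omega, ?_⟩
    refine Spec.seq (Spec.of_eval (loopFree_rowHead P τ i) ?_)
    refine Spec.ite (fun h18 => absurd (e8.1 h18) hA) fun _ => spec_skip ?_
    have hg : ∀ k, T.grp i k (j + 1) = T.grp i k j :=
      fun k => grp_succ_of_not T fun hc => hA hc.1
    show BagInv P τ i T σ₀ (j + 1) O σ1
    refine ⟨fun a ha => by rw [e1]; exact h.mem a ha, hfr, e2.trans h.out, e4, e5, ?_, ?_, ?_, ?_,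
      hrow, hbest⟩
    · intro k; simp only [hrd, hg]; exact h.spine k
    · intro k; simp only [hrd]; exact h.tail k
    · intro k; simp only [hrd]; exact h.empty k
    · intro y hy; simp only [hrd]; exact h.fresh y (by omega)
  -- the row is inserted
  set x := j + 1 with hx
  set k := T.key i (T.val i x) with hk
  have hin : T.InGrp i k x := ⟨hA, rfl⟩
  set σ2 := eval (insertStart τ i (P.sep i)) σ1 with hσ2
  have hkey : ∀ σ' : St W, (∀ r, 40 ≤ r → σ'.reg r = σ1.reg r) →
      ((P.sep i).map fun y => σ'.reg (40 + y)) = k := by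
    intro σ' hσ'
    rw [hk, hT]
    refine List.map_congr_left fun y hy => ?_
    rw [hσ' _ (by omega), e6 y (hP.sep_self i hi y hy), ← hT]
  have s2 : σ2.mem = σ1.mem ∧ σ2.wmem = σ1.wmem ∧ σ2.out = σ1.out ∧ σ2.wreg = σ1.wreg ∧
      σ2.reg 19 = σ.rd (12 :: τ :: i :: k) ∧ σ2.reg 20 = 0 ∧ σ2.reg 21 = 1 ∧
      ∀ r, r ≠ 19 → r ≠ 20 → r ≠ 21 → σ2.reg r = σ1.reg r := by
    have := hkey σ1 fun _ _ => rfl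
    rw [hσ2]
    simp only [insertStart, eval_seqs_cons, eval_seqs_nil, eval, List.map_cons, St.val, regs_val,
      this, hrd]
    refine ⟨trivial, trivial, trivial, trivial, by simp, by simp, by simp, ?_⟩
    intro r h1 h2 h3
    simp [h1, h2, h3]
  obtain ⟨g1, g2, g3, g4, g5, g6, g7, g8⟩ := s2
  have hmemle : ∀ k', ∀ y ∈ T.grp i k' j, 1 ≤ y ∧ y ≤ j := fun k' y hy => (T.mem_grp.1 hy).1
  -- Initially no node has been taken off: the whole group lies on or beside its spine, and the
  -- lowest node has no right child.
  have hpop0 : Popping (fun y => σ.rd [3, τ, i, y]) (fun y => σ.rd [4, τ, i, y])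
      (fun y => σ.rd [11, τ, i, y]) (leBy (bestW P T σ₀.wmem i)) O (σ.rd (2 :: τ :: i :: k)) x
      (σ.rd (12 :: τ :: i :: k)) 0 (T.grp i k j) [] :=
    ⟨h.spine k, .nil, fun h0 => ⟨h.tail k h0, by simp⟩, h.empty k, by simp⟩
  have hrd2 : ∀ a, σ2.rd a = σ.rd a := fun a => by rw [St.rd, g1]; exact hrd a
  obtain ⟨cur, prev, lc, lp, t, f1, f2, f3, f4, f5⟩ := spec_popLoop hW τ i _ σ2 _ _ _ _ le_rfl
    g5 g6 g7 (by rw [g4, e7])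
    (fun y hy => by
      rw [St.wrd, g2]
      exact hbest y (hmemle k y hy).1 (by have := (hmemle k y hy).2; omega))
    (fun y _ => by rw [hrd2]) (by simpa using T.grp_nodup i k j) hpop0
  rw [List.append_nil] at f1
  have hxl : x ∉ lc ++ lp := by
    rw [f1]; intro hm; have := (hmemle k x hm).2; omega
  have hlcg : ∀ y ∈ lc, y ∈ T.grp i k j := fun y hy => f1 ▸ List.mem_append_left _ hy
  have hlpg : ∀ y ∈ lp, y ∈ T.grp i k j := fun y hy => f1 ▸ List.mem_append_right _ hy
  have hnd : (lc ++ lp).Nodup := f1 ▸ T.grp_nodup i k j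
  -- The nodes taken off leave the open set for good, and only `x` enters. The cardinality of the
  -- open set is the potential.
  set O' : Finset ℕ := insert x (O \ lp.toFinset) with hO'
  have hcard : O'.card + (O ∩ lp.toFinset).card ≤ O.card + 1 := by
    have h1 := Finset.card_insert_le x (O \ lp.toFinset)
    have h2 := Finset.card_sdiff_add_card_inter O lp.toFinset
    rw [hO']; omega
  refine ⟨O', cost (rowHead P τ i) + ((cost (insertStart τ i (P.sep i)) +
    (t + cost (insertEnd τ i (P.sep i)) + 1) + 1) + 1) + 1, ?_, ?_⟩
  · have h1 := Nat.mul_le_mul_left (cost (popBody τ i) + 1) hcard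
    rw [Nat.mul_add, Nat.mul_add] at h1
    simp only [List.toFinset_nil, Finset.inter_empty, Finset.card_empty, mul_zero] at f4
    omega
  refine Spec.seq (Spec.of_eval (loopFree_rowHead P τ i) ?_)
  refine Spec.ite (fun _ => ?_) fun h18 => absurd (e8.2 hA) h18
  refine Spec.seq (Spec.of_eval (loopFree_insertStart τ i _) ?_)
  refine Spec.seq (f5.mono le_rfl ?_)
  rintro σ3 ⟨i1, i2, i3, i4, i5, i6⟩
  refine Spec.of_eval (loopFree_insertEnd τ i _) ?_
  have h16 : σ3.reg 16 = x := by
    rw [i6 16 (by omega) (by omega) (by omega), g8 16 (by omega) (by omega) (by omega), e4]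
  have h17 : σ3.reg 17 = T.len i := by
    rw [i6 17 (by omega) (by omega) (by omega), g8 17 (by omega) (by omega) (by omega), e5]
  obtain ⟨r1, r2, r3, r4, r5, r6, r7, r8, r9⟩ := eval_insertEnd τ i (P.sep i) σ3 h16 i4 i5
    (hkey σ3 fun r hr => by
      rw [i6 r (by omega) (by omega) (by omega), g8 r (by omega) (by omega) (by omega)])
  have hrd3 : ∀ a, σ3.rd a = σ.rd a := fun a => by rw [St.rd, i1]; exact hrd2 a
  simp only [hrd3] at r5 r6 r7 r8 r9
  set σ4 := eval (insertEnd τ i (P.sep i)) σ3 with hσ4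
  have hcx : cur ≠ x := by
    intro e
    have : x ∈ lc := e ▸ f2.spine.top_mem (by omega)
    exact hxl (List.mem_append_left _ this)
  have hwm : σ4.wmem = σ1.wmem := by rw [r2, i2, g2]
  have hR : ∀ y, y ≠ cur → σ4.rd [4, τ, i, y] = σ.rd [4, τ, i, y] := by
    intro y hy
    refine (congrFun r7 y).trans ?_
    split
    · rfl
    · simp [hy]
  refine ⟨?_, ?_, ?_, ?_, ?_, ?_, ?_, ?_, ?_, ?_, ?_⟩
  · intro a ha
    rw [r1 a ha, i1, g1, e1, h.mem a ha]
  · rw [hwm]; exact hfr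
  · rw [r3, i3, g3, e2, h.out]
  · rw [r4, h16]
  · rw [r4, h17]
  · intro k'
    rw [r5, r6, r7, r8, r9]
    by_cases hkk : k' = k
    · subst hkk
      rw [if_pos rfl, grp_succ_of T hin, ← f1]
      simp only [true_and]
      refine f2.push hnd (by omega) hxl f3 ?_ (by simp [hO'])
      intro y hy hyO
      have : y ∉ lp := fun hy' => (List.nodup_append.1 hnd).2.2 y hy y hy' rfl
      simp only [hO', Finset.coe_insert, Finset.coe_sdiff, Set.mem_insert_iff, Set.mem_sdiff,
        Finset.mem_coe, List.mem_toFinset]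
      exact .inr ⟨hyO, this⟩
    · rw [if_neg hkk, if_neg (show ¬ (k' = k ∧ cur = 0) from fun hh => hkk hh.1),
        grp_succ_of_not T fun hc => hkk hc.2.symm]
      -- Groups with different keys are disjoint, so the spines of the other groups are not touched.
      have hne : ∀ y ∈ T.grp i k' j, y ∉ T.grp i k j := by
        intro y hy hy'
        exact hkk ((T.mem_grp.1 hy).2.2.symm.trans (T.mem_grp.1 hy').2.2)
      have hyx : ∀ y ∈ T.grp i k' j, y ≠ x := fun y hy => by
        have := (hmemle k' y hy).2; omega
      refine (h.spine k').congr (T.grp_nodup i k' j) ?_ ?_ ?_ ?_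
      · intro y hy; simp [hyx y hy]
      · intro y hy; simp [hyx y hy]
      · intro y hy _
        split
        · rfl
        · rename_i h0
          have : y ≠ cur := fun e => hne y hy (hlcg y (e ▸ f2.spine.top_mem h0))
          simp [this]
      · intro y hy hyO
        have : y ∉ lp := fun hy' => hne y hy (hlpg y hy')
        simp only [hO', Finset.coe_insert, Finset.coe_sdiff, Set.mem_insert_iff, Set.mem_sdiff,
          Finset.mem_coe, List.mem_toFinset]
        exact .inr ⟨hyO, this⟩
  · intro k'
    rw [r9]
    by_cases hkk : k' = k
    · rw [if_pos hkk, hR x hcx.symm]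
      intro _; exact h.fresh x (by omega)
    · rw [if_neg hkk]
      intro h0
      have hl := (h.spine k').top_mem h0
      rw [hR]
      · exact h.tail k' h0
      · intro e
        have hc0 : cur ≠ 0 := e ▸ h0
        have := hlcg cur (f2.spine.top_mem hc0)
        rw [← e] at this
        exact hkk ((T.mem_grp.1 hl).2.2.symm.trans (T.mem_grp.1 this).2.2)
  · intro k'
    rw [r8, r9]
    by_cases hkk : k' = k
    · rw [if_pos hkk]; intro h0; omega
    · rw [if_neg hkk, if_neg (fun hh => hkk hh.1)]; exact h.empty k'
  · intro y hy
    rw [hR]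
    · exact h.fresh y (by omega)
    · intro e
      by_cases h0 : cur = 0
      · omega
      · have := (hmemle k cur (hlcg cur (f2.spine.top_mem h0))).2
        omega
  · intro r; rw [St.wrd, hwm]; exact hrow r
  · intro r; rw [St.wrd, hwm]; exact hbest r

/-- The index of the bag `i` is complete. -/
def BagDone (P : Plan) (τ : ℕ) (mem : List ℕ → Option ℕ) (wmem : List ℕ → Option W) (i : ℕ) :
    Prop :=
  let T := mkTree P τ mem wmem
  (∀ k, HeapTree (T.left i) (T.right i) (leBy (T.bw i)) (T.root i k) (T.grp i k (T.len i))) ∧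
  ∀ r, 1 ≤ r → r ≤ T.len i → T.w i r = rowW P T wmem i r ∧ T.bw i r = bestW P T wmem i r

/-- The loop invariant compares computed best weights and the index compares stored ones. They are
known to agree on actual rows only, so the order may be exchanged on the traversal only. -/
theorem HeapTree.congr_le {L R : ℕ → ℕ} {le le' : ℕ → ℕ → Prop} {x : ℕ} {l : List ℕ}
    (h : HeapTree L R le x l) (hle : ∀ y ∈ l, ∀ z ∈ l, le y z → le' y z) :
    HeapTree L R le' x l := by
  induction h with
  | nil => exact .nil
  | node x l r hx hl hr h1 h2 ihl ihr =>
    refine .node x l r hx (ihl fun y hy z hz => hle y (by simp [hy]) z (by simp [hz]))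
      (ihr fun y hy z hz => hle y (by simp [hy]) z (by simp [hz])) ?_ ?_
    · intro y hy; exact hle x (by simp) y (by simp [hy]) (h1 y hy)
    · intro y hy; exact hle x (by simp) y (by simp [hy]) (h2 y hy)

theorem BagInv.done {P : Plan} {τ i : ℕ} {σ₀ σ : St W} {O : Finset ℕ}
    (h : BagInv P τ i (mkTree P τ σ₀.mem σ₀.wmem) σ₀ ((mkTree P τ σ₀.mem σ₀.wmem).len i) O σ) :
    BagDone P τ σ.mem σ.wmem i := by
  obtain ⟨q1, q2, q3, q4, q5, q6⟩ := (agree_of_own h.mem h.wmem).congr (P := P)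
  refine ⟨fun k => ?_, fun r h1 h2 => ?_⟩
  · rw [q1, q4]
    -- After the last row, each spine is closed with the empty tree, the null right pointer of its
    -- lowest node.
    have := (h.spine k).heapTree (leBy_trans _) 0 [] .nil (h.tail k) (h.empty k) (by simp)
    rw [List.append_nil] at this
    refine HeapTree.congr_le this ?_
    intro y hy z hz hyz
    have hy' := (Tree.mem_grp _).1 hy
    have hz' := (Tree.mem_grp _).1 hz
    unfold leBy at hyz
    rw [← h.best y hy'.1.1 hy'.1.2, ← h.best z hz'.1.1 hz'.1.2] at hyz
    exact hyz
  · rw [q1] at h2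
    rw [q5, q6]
    exact ⟨h.row r h1 h2, h.best r h1 h2⟩

/-- Indexing a bag takes linear time. -/
theorem spec_indexBag {P : Plan} (hP : P.Valid) (τ i : ℕ) (hi : i < P.m) :
    ∃ C, ∀ {W : Type u} [CommSemiring W], Selective W → ∀ (σ : St W),
      (∀ a, Own τ i a → σ.mem a = none) →
      Spec (indexBag P τ i) (C * (σ.rd [5, 1, τ, P.id i] + 1)) σ fun σ' =>
        (∀ a, ¬ Own τ i a → σ'.mem a = σ.mem a) ∧ (∀ a, ¬ WOwn τ i a → σ'.wmem a = σ.wmem a) ∧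
        σ'.out = σ.out ∧ BagDone P τ σ'.mem σ'.wmem i := by
  set K := cost (popBody τ i) + 1 with hK
  set C₁ := (cost (rowHead P τ i) + 2 * cost (popBody τ i) +
        cost (insertStart τ i (P.sep i)) + cost (insertEnd τ i (P.sep i)) + 10) + 1 with hC₁
  refine ⟨C₁ + 6, fun {W} _ hW σ hσ => ?_⟩
  set T := mkTree P τ σ.mem σ.wmem with hT
  -- The summand `K * O.card` is the potential from which the pops are paid; it is zero at the
  -- start.
  have loop : ∀ n j O σ', n + j = T.len i → BagInv P τ i T σ j O σ' →
      Spec (.while (.lt (.reg 16) (.reg 17)) (indexRow P τ i)) (C₁ * n + K * O.card + 1) σ'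
        fun σ'' => ∃ O, BagInv P τ i T σ (T.len i) O σ'' := by
    intro n
    induction n with
    | zero =>
      intro j O σ' hn h
      refine (Spec.while_false ?_ ⟨O, ?_⟩).mono (by omega) fun _ h => h
      · simp [St.holds, h.counter, h.len]; omega
      · rw [← hn, zero_add]; exact h
    | succ n ih =>
      intro j O σ' hn h
      obtain ⟨O', t, ht, hs⟩ := spec_indexRow hW hP hi hT h
      rw [← hK] at ht
      have := Spec.while_true (b := .lt (.reg 16) (.reg 17)) (σ := σ') (p := indexRow P τ i)
        (by simp [St.holds, h.counter, h.len]; omega)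
        (hs.mono le_rfl fun σ'' h'' => ih (j + 1) O' σ'' (by omega) h'')
      refine this.mono ?_ fun _ h => h
      rw [Nat.mul_add, mul_one]
      omega
  have hinit : BagInv P τ i T σ 0 ∅ (eval (.seq (.load 17 [.const 5, .const 1, .const τ,
      .const (P.id i)]) (.set 16 (.const 0))) σ) := by
    have hz : ∀ a, Own τ i a → σ.rd a = 0 := fun a ha => by rw [St.rd, hσ a ha]; rfl
    simp only [eval, List.map_cons, List.map_nil, St.val]
    refine ⟨fun _ _ => rfl, fun _ _ => rfl, rfl, by simp, by simp [St.rd, hT, mkTree], ?_, ?_, ?_,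
      ?_, ?_, ?_⟩
    · intro k
      have e : T.grp i k 0 = [] := rfl
      rw [e]
      have : σ.rd (12 :: τ :: i :: k) = 0 := hz _ ⟨12, k, by simp, rfl⟩
      simp only [St.rd] at this ⊢
      rw [this]
      exact .nil
    · intro k h0
      exact absurd (hz _ ⟨12, k, by simp, rfl⟩) h0
    · intro k _
      exact hz _ ⟨2, k, by simp, rfl⟩
    · intro y _
      exact hz _ ⟨4, [y], by simp, rfl⟩
    · intro r h1 h2; omega
    · intro r h1 h2; omega
  have := Spec.seq (Spec.of_eval (by simp [LoopFree]) (loop (T.len i) 0 ∅ _ (by omega) hinit))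
  refine this.mono ?_ ?_
  · have e : σ.rd [5, 1, τ, P.id i] = T.len i := rfl
    rw [e]
    simp only [cost, Finset.card_empty, mul_zero]
    ring_nf
    omega
  · rintro σ' ⟨O, h⟩
    exact ⟨h.mem, h.wmem, h.out, h.done⟩

end IndexCorrect
end RankedEnum

namespace RankedEnum

universe u

/-! ### The index of all bags of all trees. -/

section IndexAll

/-- Every bag, tree and relation has its own piece of program with its own constant. There are
finitely many pieces, fixed by query and schema, so one constant serves them all independently of
the data. -/
theorem exists_uniform_bound {p : ℕ → ℕ → Prop} (n : ℕ)
    (hmono : ∀ i C C', C ≤ C' → p i C → p i C') (h : ∀ i < n, ∃ C, p i C) :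
    ∃ C, ∀ i < n, p i C := by
  induction n with
  | zero => exact ⟨0, by simp⟩
  | succ n ih =>
    obtain ⟨C, hC⟩ := ih fun i hi => h i (by omega)
    obtain ⟨C', hC'⟩ := h n (by omega)
    refine ⟨max C C', fun i hi => ?_⟩
    rcases Nat.lt_succ_iff_lt_or_eq.1 hi with hi | rfl
    · exact hmono _ _ _ (le_max_left _ _) (hC i hi)
    · exact hmono _ _ _ (le_max_right _ _) hC'

/-- The last bag comes first, because the best weight of a row is computed from the index of the
child bags, and these have larger numbers. -/
def indexTree (P : Plan) (τ : ℕ) : Program :=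
  seqs ((List.range P.m).map fun d => indexBag P τ (P.m - 1 - d))

/-- Builds the index of all bags of all trees. -/
def indexAll (plan : ℕ → Plan) (nt : ℕ) : Program :=
  seqs ((List.range nt).map fun τ => indexTree (plan τ) τ)

/-- Number cells of the index. -/
def IndexAddr (a : List ℕ) : Prop :=
  ∃ hd l, (hd = 2 ∨ hd = 3 ∨ hd = 4 ∨ hd = 11 ∨ hd = 12) ∧ a = hd :: l

/-- Weight cells of the index. -/
def WIndexAddr (a : List ℕ) : Prop := ∃ hd l, (hd = 3 ∨ hd = 4) ∧ a = hd :: l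

theorem Own.indexAddr {τ i : ℕ} {a : List ℕ} (h : Own τ i a) : IndexAddr a := by
  obtain ⟨hd, k, h, rfl⟩ := h
  exact ⟨hd, _, h, rfl⟩

theorem WOwn.wIndexAddr {τ i : ℕ} {a : List ℕ} (h : WOwn τ i a) : WIndexAddr a := by
  obtain ⟨hd, k, h, rfl⟩ := h
  exact ⟨hd, _, h, rfl⟩

theorem not_own_of_ne {τ i τ' i' : ℕ} (hne : τ ≠ τ' ∨ i ≠ i') {a : List ℕ} (h : Own τ' i' a) :
    ¬ Own τ i a := by
  rintro ⟨hd, k, -, rfl⟩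
  obtain ⟨hd', k', -, e⟩ := h
  simp only [List.cons.injEq] at e
  omega

variable {W : Type u} [CommSemiring W]

/-- The index of a bag refers only to the same tree and to bags with the same or larger numbers, so
indexing an earlier bag, or one of another tree, does not disturb it. -/
theorem BagDone.congr {P : Plan} {τ i τ' i' : ℕ} {mem mem' : List ℕ → Option ℕ}
    {wmem wmem' : List ℕ → Option W} (h : BagDone P τ' mem wmem i')
    (hm : ∀ a, ¬ Own τ i a → mem' a = mem a) (hw : ∀ a, ¬ WOwn τ i a → wmem' a = wmem a)
    (hne : τ ≠ τ' ∨ i < i') : BagDone P τ' mem' wmem' i' := by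
  have m1 : ∀ hd c k, i' ≤ c → mem' (hd :: τ' :: c :: k) = mem (hd :: τ' :: c :: k) := by
    intro hd c k hc
    refine hm _ ?_
    rintro ⟨hd, k, -, e⟩
    simp only [List.cons.injEq] at e
    omega
  have m2 : ∀ hd c k, i' ≤ c → wmem' (hd :: τ' :: c :: k) = wmem (hd :: τ' :: c :: k) := by
    intro hd c k hc
    refine hw _ ?_
    rintro ⟨hd, k, -, e⟩
    simp only [List.cons.injEq] at e
    omega
  have hag : Agree τ' i' mem mem' wmem wmem' := by
    refine ⟨fun l => hm _ ?_, fun l => hw _ ?_, fun c k hc => m1 _ c k hc.le,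
      fun c k hc => m2 _ c k hc.le⟩ <;>
    · rintro ⟨hd, k, hh, e⟩
      simp only [List.cons.injEq] at e
      omega
  obtain ⟨q1, q2, q3, q4, q5, q6⟩ := hag.congr (P := P)
  have hbw : (mkTree P τ' mem' wmem').bw i' = (mkTree P τ' mem wmem).bw i' := by
    funext r; simp only [mkTree, m2 4 i' _ le_rfl]
  have hwt : (mkTree P τ' mem' wmem').w i' = (mkTree P τ' mem wmem).w i' := by
    funext r; simp only [mkTree, m2 3 i' _ le_rfl]
  have hl : (mkTree P τ' mem' wmem').left i' = (mkTree P τ' mem wmem).left i' := by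
    funext r; simp only [mkTree, m1 3 i' _ le_rfl]
  have hr : (mkTree P τ' mem' wmem').right i' = (mkTree P τ' mem wmem).right i' := by
    funext r; simp only [mkTree, m1 4 i' _ le_rfl]
  have hroot : (mkTree P τ' mem' wmem').root i' = (mkTree P τ' mem wmem).root i' := by
    funext r; simp only [mkTree, m1 2 i' _ le_rfl]
  unfold BagDone
  simp only [q1, q4, q5, q6, hbw, hwt, hl, hr, hroot]
  exact h

/-- The state in the course of the indexing: the bags in `Done` have been indexed. -/
structure IndexInv (plan : ℕ → Plan) (σ₀ : St W) (Done : ℕ → ℕ → Prop) (σ : St W) : Prop where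
  mem : ∀ a, ¬ IndexAddr a → σ.mem a = σ₀.mem a
  wmem : ∀ a, ¬ WIndexAddr a → σ.wmem a = σ₀.wmem a
  out : σ.out = σ₀.out
  done : ∀ τ i, Done τ i → BagDone (plan τ) τ σ.mem σ.wmem i
  fresh : ∀ τ i, ¬ Done τ i → ∀ a, Own τ i a → σ.mem a = none

theorem spec_indexTree {plan : ℕ → Plan} (hP : ∀ τ, (plan τ).Valid) (τ : ℕ) :
    ∃ C, ∀ {W : Type u} [CommSemiring W], Selective W → ∀ (σ₀ σ : St W) (B : ℕ),
      (∀ i < (plan τ).m, σ₀.rd [5, 1, τ, (plan τ).id i] ≤ B) →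
      IndexInv plan σ₀ (fun τ' i => τ' < τ ∧ i < (plan τ').m) σ →
      Spec (indexTree (plan τ) τ) (C * (B + 1)) σ
        (IndexInv plan σ₀ (fun τ' i => τ' < τ + 1 ∧ i < (plan τ').m)) := by
  obtain ⟨C, hC⟩ := exists_uniform_bound (p := fun i C => ∀ {W : Type u} [CommSemiring W],
    Selective W → ∀ (σ : St W), (∀ a, Own τ i a → σ.mem a = none) →
      Spec (indexBag (plan τ) τ i) (C * (σ.rd [5, 1, τ, (plan τ).id i] + 1)) σ fun σ' =>
        (∀ a, ¬ Own τ i a → σ'.mem a = σ.mem a) ∧ (∀ a, ¬ WOwn τ i a → σ'.wmem a = σ.wmem a) ∧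
        σ'.out = σ.out ∧ BagDone (plan τ) τ σ'.mem σ'.wmem i) (plan τ).m
    (fun i C C' hC h W _ hW σ hσ => (h hW σ hσ).mono (Nat.mul_le_mul_right _ hC) fun _ h => h)
    (fun i hi => spec_indexBag (hP τ) τ i hi)
  set m := (plan τ).m with hm
  refine ⟨m * (C + 1) + 1, fun {W} _ hW σ₀ σ B hB h => ?_⟩
  have := spec_seqs_range (fun d => indexBag (plan τ) τ (m - 1 - d))
    (fun d => IndexInv plan σ₀ (fun τ' i => (τ' < τ ∧ i < (plan τ').m) ∨
      (τ' = τ ∧ m - d ≤ i ∧ i < m))) m (C * (B + 1)) σ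
    (by
      refine ⟨h.mem, h.wmem, h.out, ?_, ?_⟩
      · rintro τ' i (h' | ⟨-, h1, h2⟩)
        · exact h.done τ' i h'
        · omega
      · intro τ' i hn
        exact h.fresh τ' i fun h' => hn (.inl h'))
    (by
      intro d hd σ h
      have hlen : σ.rd [5, 1, τ, (plan τ).id (m - 1 - d)] ≤ B := by
        rw [St.rd, h.mem]
        · exact hB _ (by omega)
        · rintro ⟨hd, l, hh, e⟩
          simp only [List.cons.injEq] at e
          omega
      have hs := hC (m - 1 - d) (by omega) hW σ (h.fresh τ _ (by
        rintro (⟨h1, -⟩ | ⟨-, h1, -⟩) <;> omega))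
      refine hs.mono (Nat.mul_le_mul_left _ (by omega)) ?_
      rintro σ' ⟨g1, g2, g3, g4⟩
      refine ⟨?_, ?_, g3.trans h.out, ?_, ?_⟩
      · intro a ha
        rw [g1 a fun h' => ha h'.indexAddr, h.mem a ha]
      · intro a ha
        rw [g2 a fun h' => ha h'.wIndexAddr, h.wmem a ha]
      · intro τ' i hd'
        by_cases hi : τ' = τ ∧ i = m - 1 - d
        · obtain ⟨rfl, rfl⟩ := hi; exact g4
        · have hd2 : (τ' < τ ∧ i < (plan τ').m) ∨ (τ' = τ ∧ m - d ≤ i ∧ i < m) := by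
            rcases hd' with h1 | ⟨h1, h2, h3⟩
            · exact .inl h1
            · exact .inr ⟨h1, by omega, h3⟩
          refine (h.done τ' i hd2).congr g1 g2 ?_
          omega
      · intro τ' i hn a ha
        have : τ ≠ τ' ∨ m - 1 - d ≠ i := by
          by_contra hcon
          push Not at hcon
          exact hn (.inr ⟨hcon.1.symm, by omega, by omega⟩)
        rw [g1 a (not_own_of_ne this ha)]
        refine h.fresh τ' i (fun h' => hn ?_) a ha
        rcases h' with h1 | ⟨h1, h2, h3⟩
        · exact .inl h1
        · exact .inr ⟨h1, by omega, h3⟩)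
  refine this.mono ?_ ?_
  · have : m * (C * (B + 1) + 1) ≤ m * ((C + 1) * (B + 1)) := by
      apply Nat.mul_le_mul_left; ring_nf; omega
    calc m * (C * (B + 1) + 1) + 1 ≤ m * ((C + 1) * (B + 1)) + (B + 1) := by omega
      _ = _ := by ring
  · intro σ' h'
    refine ⟨h'.mem, h'.wmem, h'.out, ?_, ?_⟩
    · intro τ' i hd
      refine h'.done τ' i ?_
      rcases Nat.lt_succ_iff_lt_or_eq.1 hd.1 with h1 | rfl
      · exact .inl ⟨h1, hd.2⟩
      · exact .inr ⟨rfl, by omega, hd.2⟩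
    · intro τ' i hn
      refine h'.fresh τ' i fun h1 => hn ?_
      rcases h1 with ⟨h1, h2⟩ | ⟨rfl, -, h2⟩
      · exact ⟨by omega, h2⟩
      · exact ⟨by omega, h2⟩

theorem spec_indexAll {plan : ℕ → Plan} (hP : ∀ τ, (plan τ).Valid) (nt : ℕ) :
    ∃ C, ∀ {W : Type u} [CommSemiring W], Selective W → ∀ (σ : St W) (B : ℕ),
      (∀ τ < nt, ∀ i < (plan τ).m, σ.rd [5, 1, τ, (plan τ).id i] ≤ B) →
      (∀ a, IndexAddr a → σ.mem a = none) →
      Spec (indexAll plan nt) (C * (B + 1)) σ fun σ' =>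
        (∀ a, ¬ IndexAddr a → σ'.mem a = σ.mem a) ∧
        (∀ a, ¬ WIndexAddr a → σ'.wmem a = σ.wmem a) ∧ σ'.out = σ.out ∧
        ∀ τ < nt, ∀ i < (plan τ).m, BagDone (plan τ) τ σ'.mem σ'.wmem i := by
  obtain ⟨C, hC⟩ := exists_uniform_bound (p := fun τ C => ∀ {W : Type u} [CommSemiring W],
    Selective W → ∀ (σ₀ σ : St W) (B : ℕ),
      (∀ i < (plan τ).m, σ₀.rd [5, 1, τ, (plan τ).id i] ≤ B) →
      IndexInv plan σ₀ (fun τ' i => τ' < τ ∧ i < (plan τ').m) σ →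
      Spec (indexTree (plan τ) τ) (C * (B + 1)) σ
        (IndexInv plan σ₀ (fun τ' i => τ' < τ + 1 ∧ i < (plan τ').m))) nt
    (fun τ C C' hC h W _ hW σ₀ σ B hB hσ =>
      (h hW σ₀ σ B hB hσ).mono (Nat.mul_le_mul_right _ hC) fun _ h => h)
    (fun τ _ => spec_indexTree hP τ)
  refine ⟨nt * (C + 1) + 1, fun {W} _ hW σ B hB hσ => ?_⟩
  have := spec_seqs_range (fun τ => indexTree (plan τ) τ)
    (fun τ => IndexInv plan σ (fun τ' i => τ' < τ ∧ i < (plan τ').m)) nt (C * (B + 1)) σ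
    ⟨fun _ _ => rfl, fun _ _ => rfl, rfl, fun _ _ h => by omega,
      fun _ _ _ a ha => hσ a ha.indexAddr⟩
    (fun τ hτ σ' h => hC τ hτ hW σ σ' B (hB τ hτ) h)
  refine this.mono ?_ fun σ' h => ⟨h.mem, h.wmem, h.out, fun τ hτ i hi => h.done τ i ⟨hτ, hi⟩⟩
  have : nt * (C * (B + 1) + 1) ≤ nt * ((C + 1) * (B + 1)) := by
    apply Nat.mul_le_mul_left; ring_nf; omega
  calc nt * (C * (B + 1) + 1) + 1 ≤ nt * ((C + 1) * (B + 1)) + (B + 1) := by omega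
    _ = _ := by ring

/-- A completely indexed tree with distinct rows is valid. -/
theorem valid_mkTree {P : Plan} (hP : P.Valid) {τ : ℕ} {mem : List ℕ → Option ℕ}
    {wmem : List ℕ → Option W} (h : ∀ i < P.m, BagDone P τ mem wmem i)
    (hd : ∀ i < P.m, ∀ r r', 1 ≤ r → r ≤ (mkTree P τ mem wmem).len i → 1 ≤ r' →
      r' ≤ (mkTree P τ mem wmem).len i → (∀ x ∈ P.vars i,
        (mkTree P τ mem wmem).val i r x = (mkTree P τ mem wmem).val i r' x) → r = r') :
    (mkTree P τ mem wmem).Valid where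
  par_lt := hP.par_lt
  sep_zero := hP.sep_zero
  sep_par := hP.sep_par
  sep_self := hP.sep_self
  sep_shared := hP.sep_shared
  distinct := hd
  heap i hi k := (h i hi).1 k
  bw_eq i hi r h1 h2 := by
    obtain ⟨e1, e2⟩ := (h i hi).2 r h1 h2
    rw [e1, e2]; rfl

end IndexAll
end RankedEnum

namespace RankedEnum

universe u

section PriorityQueue

/-! ### A tournament tree as priority queue

The cell `[8, l, i]` holds the number of a lightest candidate among the leaves `[8, 0, j]` with
`j / 2 ^ l = i`, or `0` if there is none. The weight of the candidate `j` is in the weight cell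
`[6, j]`. Register 0 holds the height. -/

/-- The null candidate is dealt with before any comparison, since the weight loaded for it has no
meaning. -/
def fixBody : Program := seqs [
  .half 9 (.reg 9),
  .add 24 (.reg 9) (.reg 9),
  .add 25 (.reg 24) (.const 1),
  .load 10 [.const 8, .reg 8, .reg 24],
  .load 11 [.const 8, .reg 8, .reg 25],
  .add 8 (.reg 8) (.const 1),
  .wload 1 [.const 6, .reg 10],
  .wload 2 [.const 6, .reg 11],
  .ite (.eq (.reg 11) (.const 0)) (.store [.const 8, .reg 8, .reg 9] (.reg 10))
    (.ite (.eq (.reg 10) (.const 0)) (.store [.const 8, .reg 8, .reg 9] (.reg 11))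
      (.ite (.wle 1 2) (.store [.const 8, .reg 8, .reg 9] (.reg 10))
        (.store [.const 8, .reg 8, .reg 9] (.reg 11))))]

/-- Recomputes the path from a leaf to the root. -/
def fixLoop : Program := .while (.lt (.reg 8) (.reg 0)) fixBody

variable {W : Type u} [CommSemiring W]

open Classical in
/-- The lighter one of two candidates; `0` stands for none. -/
noncomputable def pick (wt : ℕ → W) (a b : ℕ) : ℕ :=
  if b = 0 then a else if a = 0 then b else if wle (wt a) (wt b) then a else b

theorem pick_eq (wt : ℕ → W) (a b : ℕ) : pick wt a b = a ∨ pick wt a b = b := by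
  unfold pick; split_ifs <;> simp

theorem pick_left (hW : Selective W) {wt : ℕ → W} {a : ℕ} (b : ℕ) (ha : a ≠ 0) :
    pick wt a b ≠ 0 ∧ wle (wt (pick wt a b)) (wt a) := by
  unfold pick
  split_ifs with h1 h3
  · exact ⟨ha, wle_refl hW _⟩
  · exact ⟨ha, wle_refl hW _⟩
  · exact ⟨h1, (wle_total hW _ _).resolve_right h3⟩

theorem pick_right (hW : Selective W) {wt : ℕ → W} (a : ℕ) {b : ℕ} (hb : b ≠ 0) :
    pick wt a b ≠ 0 ∧ wle (wt (pick wt a b)) (wt b) := by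
  unfold pick
  split_ifs with h1 h2 h3
  · exact absurd h1 hb
  · exact ⟨hb, wle_refl hW _⟩
  · exact ⟨h2, h3⟩
  · exact ⟨hb, wle_refl hW _⟩

/-- In a consistent tournament tree, the node `(l, i)` is a lightest leaf below it. -/
theorem tournament_min (hW : Selective W) {wt : ℕ → W} {q : ℕ → ℕ → ℕ} {h : ℕ}
    (hq : ∀ l < h, ∀ i, q (l + 1) i = pick wt (q l (2 * i)) (q l (2 * i + 1)))
    (hleaf : ∀ j, q 0 j = 0 ∨ q 0 j = j) : ∀ l ≤ h, ∀ i,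
    (∀ j, j / 2 ^ l = i → q 0 j ≠ 0 → q l i ≠ 0 ∧ wle (wt (q l i)) (wt j)) ∧
    (q l i ≠ 0 → q 0 (q l i) = q l i) := by
  intro l
  induction l with
  | zero =>
    intro _ i
    refine ⟨?_, ?_⟩
    · intro j hj h0
      rw [pow_zero, Nat.div_one] at hj
      subst hj
      have := (hleaf j).resolve_left h0
      rw [this]
      exact ⟨fun e => h0 (this.trans e), wle_refl hW _⟩
    · intro h0
      rw [(hleaf i).resolve_left h0]
      exact (hleaf i).resolve_left h0
  | succ l ih =>
    intro hl i
    rw [hq l (by omega) i]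
    obtain ⟨a1, a2⟩ := ih (by omega) (2 * i)
    obtain ⟨b1, b2⟩ := ih (by omega) (2 * i + 1)
    refine ⟨?_, ?_⟩
    · intro j hj h0
      rw [pow_succ, ← Nat.div_div_eq_div_mul] at hj
      have : j / 2 ^ l = 2 * i ∨ j / 2 ^ l = 2 * i + 1 := by omega
      rcases this with h1 | h1
      · obtain ⟨c1, c2⟩ := a1 j h1 h0
        obtain ⟨d1, d2⟩ := pick_left hW (wt := wt) (q l (2 * i + 1)) c1
        exact ⟨d1, wle_trans d2 c2⟩
      · obtain ⟨c1, c2⟩ := b1 j h1 h0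
        obtain ⟨d1, d2⟩ := pick_right hW (wt := wt) (q l (2 * i)) c1
        exact ⟨d1, wle_trans d2 c2⟩
    · rcases pick_eq wt (q l (2 * i)) (q l (2 * i + 1)) with e | e <;> rw [e]
      · exact a2
      · exact b2

theorem loopFree_fixBody : LoopFree fixBody := by
  simp [fixBody, loopFree_seqs, LoopFree]

theorem eval_fixBody (σ : St W) {l i : ℕ} (hl : σ.reg 8 = l) (hi : σ.reg 9 / 2 = i) :
    let σ' := eval fixBody σ
    σ'.mem = Function.update σ.mem [8, l + 1, i]
      (some (pick (fun j => σ.wrd [6, j]) (σ.rd [8, l, 2 * i]) (σ.rd [8, l, 2 * i + 1]))) ∧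
    σ'.wmem = σ.wmem ∧ σ'.out = σ.out ∧ σ'.reg 8 = l + 1 ∧ σ'.reg 9 = i ∧
    ∀ r, r ≠ 8 → r ≠ 9 → r ≠ 10 → r ≠ 11 → r ≠ 24 → r ≠ 25 → σ'.reg r = σ.reg r := by
  intro σ'
  have e : i + i = 2 * i := by ring
  have hσ' : σ' = eval fixBody σ := rfl
  simp only [fixBody, eval_seqs_cons, eval_seqs_nil, eval, List.map_cons, List.map_nil, St.val,
    hl, hi, e, Function.update_self, ne_eq, not_false_eq_true, St.holds,
    Function.update_of_ne, Nat.reduceEqDiff, St.rd, St.wrd] at hσ'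
  rw [hσ']
  unfold pick
  by_cases hb : (σ.mem [8, l, 2 * i + 1]).getD 0 = 0
  · simp [hb, St.rd]
    intro r h1 h2 h3 h4 h5 h6
    simp [h1, h2, h3, h4, h5, h6]
  by_cases ha : (σ.mem [8, l, 2 * i]).getD 0 = 0
  · simp [hb, ha, St.rd]
    intro r h1 h2 h3 h4 h5 h6
    simp [h1, h2, h3, h4, h5, h6]
  by_cases hc : wle ((σ.wmem [6, (σ.mem [8, l, 2 * i]).getD 0]).getD 1)
      ((σ.wmem [6, (σ.mem [8, l, 2 * i + 1]).getD 0]).getD 1)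
  · simp [hb, ha, hc, St.rd, St.wrd]
    intro r h1 h2 h3 h4 h5 h6
    simp [h1, h2, h3, h4, h5, h6]
  · simp [hb, ha, hc, St.rd, St.wrd]
    intro r h1 h2 h3 h4 h5 h6
    simp [h1, h2, h3, h4, h5, h6]

/-- The node `(l + 1, i)` is the lighter one of its children. -/
def NodeOk (σ : St W) (l i : ℕ) : Prop :=
  σ.rd [8, l + 1, i] =
    pick (fun j => σ.wrd [6, j]) (σ.rd [8, l, 2 * i]) (σ.rd [8, l, 2 * i + 1])

/-- The cells of a tournament tree of height `h`. -/
def QueueAddr (h : ℕ) (a : List ℕ) : Prop := ∃ l i, a = [8, l, i] ∧ l ≤ h ∧ i < 2 ^ (h - l)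

/-- When level `l` has been reached, only nodes of higher levels on the path from leaf `j` to the
root may be inconsistent. The condition on written cells confines the queue to a tree of height `h`,
as the space bound requires. -/
theorem spec_fixLoop {h j : ℕ} (hj : j < 2 ^ h) (d : ℕ) : ∀ (σ : St W) (l : ℕ), l + d = h →
    σ.reg 0 = h → σ.reg 8 = l → σ.reg 9 = j / 2 ^ l →
    (∀ l' < h, ∀ i, (l' < l ∨ i ≠ j / 2 ^ (l' + 1)) → NodeOk σ l' i) →
    (∀ a, σ.mem (8 :: a) ≠ none → QueueAddr h (8 :: a)) →
    Spec fixLoop ((cost fixBody + 1) * d + 1) σ fun σ' =>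
      (∀ l' < h, ∀ i, NodeOk σ' l' i) ∧ (∀ a, (∀ l i, a ≠ [8, l + 1, i]) → σ'.mem a = σ.mem a) ∧
      (∀ a, σ'.mem (8 :: a) ≠ none → QueueAddr h (8 :: a)) ∧
      σ'.wmem = σ.wmem ∧ σ'.out = σ.out ∧
      ∀ r, r ≠ 8 → r ≠ 9 → r ≠ 10 → r ≠ 11 → r ≠ 24 → r ≠ 25 → σ'.reg r = σ.reg r := by
  induction d with
  | zero =>
    intro σ l hl h0 h8 h9 hok hsup
    have : l = h := by omega
    subst this
    refine Spec.while_false (by simp [St.holds, h0, h8]) ⟨?_, fun _ _ => rfl, hsup, rfl, rfl,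
      fun _ _ _ _ _ _ _ => rfl⟩
    intro l' hl' i
    exact hok l' hl' i (.inl hl')
  | succ d ih =>
    intro σ l hl h0 h8 h9 hok hsup
    have hdiv : σ.reg 9 / 2 = j / 2 ^ (l + 1) := by
      rw [h9, Nat.div_div_eq_div_mul, ← pow_succ]
    obtain ⟨e1, e2, e3, e4, e5, e6⟩ := eval_fixBody σ h8 hdiv
    set σ1 := eval fixBody σ with hσ1
    have hrd : ∀ a, a ≠ [8, l + 1, j / 2 ^ (l + 1)] → σ1.rd a = σ.rd a := by
      intro a ha; rw [St.rd, e1, Function.update_of_ne ha]; rfl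
    have hwrd : ∀ a, σ1.wrd a = σ.wrd a := fun a => by rw [St.wrd, e2]; rfl
    have hs := ih σ1 (l + 1) (by omega)
      (by rw [e6 0 (by omega) (by omega) (by omega) (by omega) (by omega) (by omega), h0]) e4 e5
      (by
        intro l' hl' i hc
        unfold NodeOk
        simp only [hwrd]
        by_cases hll : l' = l
        · subst hll
          by_cases hi : i = j / 2 ^ (l' + 1)
          · subst hi
            rw [hrd [8, l', _] (by simp), hrd [8, l', _] (by simp), St.rd, e1,
              Function.update_self]
            rfl
          · rw [hrd _ (by simp [hi]), hrd [8, l', _] (by simp), hrd [8, l', _] (by simp)]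
            exact hok l' hl' i (.inr hi)
        · have hne : ∀ k, k ≠ j / 2 ^ (l + 1) ∨ l' < l + 1 →
              σ1.rd [8, l', k] = σ.rd [8, l', k] := by
            intro k hk
            refine hrd _ ?_
            simp only [ne_eq, List.cons.injEq, and_true, true_and, not_and]
            intro h1
            rcases hk with hk | hk
            · exact hk
            · omega
          have hpar : i ≠ j / 2 ^ (l' + 1) ∨ l' < l := by omega
          rw [hrd [8, l' + 1, i] (by simp [hll])]
          -- The cell just rewritten is a child of the next node on the path only, and that node is
          -- still exempt.
          by_cases h1 : l' = l + 1
          · subst h1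
            have hi : i ≠ j / 2 ^ (l + 1 + 1) := by omega
            have hx : j / 2 ^ (l + 1 + 1) = j / 2 ^ (l + 1) / 2 := by
              rw [Nat.div_div_eq_div_mul, ← pow_succ]
            rw [hne _ (.inl (by omega)), hne _ (.inl (by omega))]
            exact hok (l + 1) hl' i (.inr hi)
          · rw [hrd [8, l', _] (by simp [h1]), hrd [8, l', _] (by simp [h1])]
            refine hok l' hl' i ?_
            omega)
      (by
        intro a ha
        by_cases hx : 8 :: a = [8, l + 1, j / 2 ^ (l + 1)]
        · refine ⟨l + 1, j / 2 ^ (l + 1), hx, by omega, ?_⟩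
          apply Nat.div_lt_of_lt_mul
          rwa [← pow_add, show l + 1 + (h - (l + 1)) = h by omega]
        · rw [e1, Function.update_of_ne hx] at ha
          exact hsup a ha)
    have := Spec.while_true (b := .lt (.reg 8) (.reg 0)) (σ := σ) (p := fixBody)
      (by simp [St.holds, h0, h8]; omega) (Spec.of_eval loopFree_fixBody hs)
    refine this.mono (by ring_nf; omega) ?_
    rintro σ' ⟨g1, g2, g3, g4, g5, g6⟩
    refine ⟨g1, ?_, g3, g4.trans e2, g5.trans e3, ?_⟩
    · intro a ha
      rw [g2 a ha, e1, Function.update_of_ne (ha _ _)]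
    · intro r h1 h2 h3 h4 h5 h6
      rw [g6 r h1 h2 h3 h4 h5 h6, e6 r h1 h2 h3 h4 h5 h6]

end PriorityQueue
end RankedEnum

namespace RankedEnum

universe u

/-! ### Construction of a candidate from a parent candidate and a row. -/

section Build

/-- Determines the row of bag `i` in the new candidate: copied from the parent candidate before
the bag `j`, given in register 5 at the bag `j`, and the head of its group after it. -/
def chooseRow (P : Plan) (τ j i : ℕ) : Program :=
  if i < j then .load 6 [.const 6, .reg 3, .const i]
  else if i = j then .set 6 (.reg 5)
  else .load 6 (.const 2 :: .const τ :: .const i :: regs (P.sep i))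

/-- Loading the variables of the chosen row extends the assignment held in the registers, so the key
of every later bag is at hand. The data number rows from `0`, hence the subtraction. -/
def buildStep (P : Plan) (τ j i : ℕ) : Program := seqs [
  chooseRow P τ j i,
  .store [.const 6, .reg 1, .const i] (.reg 6),
  .sub 7 (.reg 6) (.const 1),
  loadVars τ (P.id i) (P.vars i),
  .wload 1 [.const 3, .const τ, .const i, .reg 6],
  .wmul 0 0 1]

def buildRows (P : Plan) (τ j : ℕ) : Program :=
  .seq (.seq (.add 1 (.reg 1) (.const 1)) (.wone 0))
    (seqs ((List.range P.m).map (buildStep P τ j)))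

/-- The number of a candidate is also the number of its leaf. When it equals the capacity in
register 2, the queue gets one more level instead of being rebuilt: the old tree is the left half of
the new one. -/
def buildEnd (τ j : ℕ) : Program := seqs [
  .store [.const 7, .reg 1, .const 0] (.const τ),
  .store [.const 7, .reg 1, .const 1] (.const j),
  .wstore [.const 6, .reg 1] 0,
  .store [.const 8, .const 0, .reg 1] (.reg 1),
  .ite (.eq (.reg 1) (.reg 2))
    (.seq (.add 2 (.reg 2) (.reg 2)) (.add 0 (.reg 0) (.const 1))) skip,
  .set 8 (.const 0),
  .set 9 (.reg 1)]

/-- Creates a candidate and inserts it into the priority queue. -/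
def build (P : Plan) (τ j : ℕ) : Program := .seq (buildRows P τ j) (.seq (buildEnd τ j) fixLoop)

variable {W : Type u} [CommSemiring W]

theorem loopFree_chooseRow (P : Plan) (τ j i : ℕ) : LoopFree (chooseRow P τ j i) := by
  unfold chooseRow; split_ifs <;> trivial

theorem loopFree_buildRows (P : Plan) (τ j : ℕ) : LoopFree (buildRows P τ j) := by
  refine ⟨⟨trivial, trivial⟩, loopFree_seqs.2 ?_⟩
  simp only [List.mem_map]
  rintro p ⟨i, -, rfl⟩
  simp [buildStep, loopFree_seqs, loopFree_chooseRow, loopFree_loadVars, LoopFree]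

theorem loopFree_buildEnd (τ j : ℕ) : LoopFree (buildEnd τ j) := by
  simp [buildEnd, loopFree_seqs, LoopFree, skip]

theorem eval_chooseRow (P : Plan) (τ j i : ℕ) (σ : St W) :
    eval (chooseRow P τ j i) σ = { σ with
      reg := (Function.update σ.reg 6 (if i < j then σ.rd [6, σ.reg 3, i] else
        (if i = j then σ.reg 5 else
          σ.rd (2 :: τ :: i :: (P.sep i).map fun x => σ.reg (40 + x))))) } := by
  unfold chooseRow
  split_ifs <;> simp [eval, regs_val]

theorem eval_buildStep (P : Plan) (τ j i : ℕ) (σ : St W) {r : ℕ}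
    (hr : r = if i < j then σ.rd [6, σ.reg 3, i] else if i = j then σ.reg 5
        else σ.rd (2 :: τ :: i :: (P.sep i).map fun x => σ.reg (40 + x))) :
    let σ' := eval (buildStep P τ j i) σ
    σ'.mem = Function.update σ.mem [6, σ.reg 1, i] (some r) ∧ σ'.wmem = σ.wmem ∧
    σ'.out = σ.out ∧ σ'.wreg 0 = σ.wreg 0 * σ.wrd [3, τ, i, r] ∧
    (∀ x, σ'.reg (40 + x) = if x ∈ P.vars i then σ.rd [5, 1, τ, P.id i, r - 1, x]
      else σ.reg (40 + x)) ∧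
    ∀ q, q < 40 → q ≠ 6 → q ≠ 7 → σ'.reg q = σ.reg q := by
  intro σ'
  have hσ' : σ' = eval (buildStep P τ j i) σ := rfl
  simp only [buildStep, eval_seqs_cons, eval_seqs_nil, eval_chooseRow, ← hr, eval_loadVars] at hσ'
  simp only [eval, List.map_cons, List.map_nil, St.val] at hσ'
  rw [hσ']
  refine ⟨by simp, rfl, rfl, by simp [St.wrd], ?_, ?_⟩
  · intro x
    have h7 : 40 + x ≠ 7 := by omega
    have h6 : 40 + x ≠ 6 := by omega
    by_cases hx : x ∈ P.vars i <;> simp [hx, St.rd, h6, h7]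
  · intro q h40 h6 h7
    have : ¬ 40 ≤ q := by omega
    simp [this, h6, h7]

/-- The rows of a new candidate. -/
theorem eval_buildRows {P : Plan} {τ j : ℕ} {T : Tree W} (hTv : T.Valid)
    {mem₀ : List ℕ → Option ℕ} {wmem₀ : List ℕ → Option W} (hT : T = mkTree P τ mem₀ wmem₀)
    (σ : St W) {N : ℕ} {old : ℕ → ℕ} (hN : σ.reg 1 = N)
    (hcur : σ.reg 3 ≠ N + 1) (hold : ∀ l < j, σ.rd [6, σ.reg 3, l] = old l)
    (h5 : ∀ l, σ.mem (5 :: l) = mem₀ (5 :: l)) (h2 : ∀ l, σ.mem (2 :: l) = mem₀ (2 :: l))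
    (hw : ∀ l, σ.wmem (3 :: l) = wmem₀ (3 :: l)) (hfresh : ∀ l, σ.mem [6, N + 1, l] = none)
    (hc : ∀ i < j, i < T.m → ∀ s v, T.Part i s v → (∀ l < i, s l = old l) →
      old i ∈ T.grp i (T.key i v) (T.len i))
    (hc' : j < T.m → ∀ s v, T.Part j s v → (∀ l < j, s l = old l) →
      σ.reg 5 ∈ T.grp j (T.key j v) (T.len j)) :
    let σ' := eval (buildRows P τ j) σ
    ∃ s v, T.Part T.m s v ∧ (∀ l < j, l < T.m → s l = old l) ∧ (j < T.m → s j = σ.reg 5) ∧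
      T.Greedy (j + 1) s v ∧ (∀ l, T.m ≤ l → s l = 0) ∧ (∀ l, σ'.rd [6, N + 1, l] = s l) ∧
      (∀ l, σ'.mem [6, N + 1, l] ≠ none → l < T.m) ∧
      σ'.wreg 0 = T.wt s ∧ (∀ a, (∀ l, a ≠ [6, N + 1, l]) → σ'.mem a = σ.mem a) ∧
      σ'.wmem = σ.wmem ∧ σ'.out = σ.out ∧ σ'.reg 1 = N + 1 ∧
      ∀ q, q < 40 → q ≠ 1 → q ≠ 6 → q ≠ 7 → σ'.reg q = σ.reg q := by
  intro σ'
  have hm : P.m = T.m := by rw [hT]; rfl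
  have key := eval_seqs_range (buildStep P τ j) (fun i (σ1 : St W) =>
    T.Part i (fun l => σ1.rd [6, N + 1, l]) (fun x => σ1.reg (40 + x)) ∧
    (∀ l < i, l < j → σ1.rd [6, N + 1, l] = old l) ∧ (j < i → σ1.rd [6, N + 1, j] = σ.reg 5) ∧
    (∀ l < i, j < l → σ1.rd [6, N + 1, l] = T.root l (T.key l fun x => σ1.reg (40 + x))) ∧
    (∀ l, i ≤ l → σ1.mem [6, N + 1, l] = none) ∧
    σ1.wreg 0 = ∏ l ∈ Finset.range i, T.w l (σ1.rd [6, N + 1, l]) ∧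
    (∀ a, (∀ l, a ≠ [6, N + 1, l]) → σ1.mem a = σ.mem a) ∧
    σ1.wmem = σ.wmem ∧ σ1.out = σ.out ∧ σ1.reg 1 = N + 1 ∧
    ∀ q, q < 40 → q ≠ 1 → q ≠ 6 → q ≠ 7 → σ1.reg q = σ.reg q) P.m
    (eval (.seq (.add 1 (.reg 1) (.const 1)) (.wone 0)) σ) ?_ ?_
  · rw [hm] at key
    obtain ⟨k1, k2, k3, k4, k5, k6, k7, k8, k9, k10, k11⟩ := key
    have e : σ' = eval (seqs ((List.range T.m).map (buildStep P τ j)))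
      (eval (.seq (.add 1 (.reg 1) (.const 1)) (.wone 0)) σ) := by rw [← hm]; rfl
    rw [← e] at k1 k2 k3 k4 k5 k6 k7 k8 k9 k10 k11
    refine ⟨_, _, k1, fun l h h' => k2 l h' h, k3, fun l h h' => k4 l h' (by omega), ?_,
      fun _ => rfl, ?_, k6, k7, k8, k9, k10, k11⟩
    · intro l hl; rw [St.rd, k5 l hl]; rfl
    · intro l hl; by_contra hcon; exact hl (k5 l (by omega))
  · simp only [eval, St.val, hN]
    refine ⟨fun l hl => absurd hl (by omega), fun l hl => absurd hl (by omega),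
      fun hl => absurd hl (by omega), fun l hl => absurd hl (by omega), fun l _ => hfresh l,
      by simp, fun _ _ => trivial, trivial, trivial, by simp, ?_⟩
    intro q _ h1 _ _
    simp [h1]
  · rintro i hi σ1 ⟨k1, k2, k3, k4, k5, k6, k7, k8, k9, k10, k11⟩
    have him : i < T.m := hm ▸ hi
    set v : ℕ → ℕ := fun x => σ1.reg (40 + x) with hv
    set s : ℕ → ℕ := fun l => σ1.rd [6, N + 1, l] with hs
    have hsep : (P.sep i).map (fun x => σ1.reg (40 + x)) = T.key i v := by rw [hT]; rfl
    have h3 : σ1.reg 3 = σ.reg 3 := k11 3 (by omega) (by omega) (by omega) (by omega)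
    have h5' : σ1.reg 5 = σ.reg 5 := k11 5 (by omega) (by omega) (by omega) (by omega)
    have hroot : ∀ k, σ1.rd (2 :: τ :: i :: k) = T.root i k := by
      intro k
      rw [St.rd, k7 _ (by simp), h2, hT]; rfl
    obtain ⟨e1, e2, e3, e4, e5, e6⟩ := eval_buildStep P τ j i σ1 rfl
    set r := if i < j then σ1.rd [6, σ1.reg 3, i] else if i = j then σ1.reg 5
        else σ1.rd (2 :: τ :: i :: (P.sep i).map fun x => σ1.reg (40 + x)) with hr
    have hold' : i < j → r = old i := by
      intro h
      rw [hr, if_pos h, h3, St.rd, k7 _ (by simp [hcur])]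
      exact hold i h
    have hreq : i = j → r = σ.reg 5 := by
      intro h
      rw [hr, if_neg (by omega), if_pos h, h5']
    have hrgt : j < i → r = T.root i (T.key i v) := by
      intro h
      rw [hr, if_neg (by omega), if_neg (by omega), hsep, hroot]
    -- Whatever its origin, the row belongs to the group prescribed by the rows before it. After bag
    -- `j` this group is not empty, because the row in the parent bag is alive.
    have hgrp : r ∈ T.grp i (T.key i v) (T.len i) := by
      rcases lt_trichotomy i j with h | h | h
      · rw [hold' h]
        exact hc i h him s v k1 fun l hl => k2 l hl (by omega)
      · rw [hreq h]
        subst h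
        exact hc' him s v k1 fun l hl => k2 l hl hl
      · rw [hrgt h]
        exact Tree.root_inGrp hTv him (k1.root_ne_zero hTv (by omega) him)
    obtain ⟨p1, p2⟩ := k1.extend hTv him hgrp
    set σ2 := eval (buildStep P τ j i) σ1 with hσ2
    have hs2 : (fun l => σ2.rd [6, N + 1, l]) = Function.update s i r := by
      funext l
      by_cases hl : l = i
      · subst hl; simp [St.rd, e1, k10]
      · simp [St.rd, e1, k10, hl, hs]
    have hv2 : (fun x => σ2.reg (40 + x)) = fun x => if x ∈ T.vars i then T.val i r x else v x := by
      funext x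
      rw [e5, St.rd, k7 _ (by simp), h5, hT]
      rfl
    have hkey : ∀ l ≤ i, T.key l (fun x => σ2.reg (40 + x)) = T.key l v := by
      intro l hl
      rw [hv2]
      rcases Nat.eq_zero_or_pos l with rfl | h0
      · simp [Tree.key, hTv.sep_zero]
      · refine List.map_congr_left fun x hx => ?_
        have := hTv.par_lt l h0 (by omega)
        exact p2 (T.par l) (by omega) x (hTv.sep_par l h0 (by omega) x hx)
    have hs2' : ∀ l, σ2.rd [6, N + 1, l] = Function.update s i r l := fun l => congrFun hs2 l
    refine ⟨?_, ?_, ?_, ?_, ?_, ?_, ?_, e2.trans k8, e3.trans k9, ?_, ?_⟩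
    · rw [hs2, hv2]; exact p1
    · intro l hl hlj
      rw [hs2']
      rcases Nat.lt_succ_iff_lt_or_eq.1 hl with hl | rfl
      · rw [Function.update_of_ne (by omega)]; exact k2 l hl hlj
      · rw [Function.update_self]; exact hold' hlj
    · intro hji
      rw [hs2']
      rcases Nat.lt_succ_iff_lt_or_eq.1 hji with hl | rfl
      · rw [Function.update_of_ne (by omega)]; exact k3 hl
      · rw [Function.update_self]; exact hreq rfl
    · intro l hl hjl
      rw [hs2', hkey l (by omega)]
      rcases Nat.lt_succ_iff_lt_or_eq.1 hl with hl | rfl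
      · rw [Function.update_of_ne (by omega)]; exact k4 l hl hjl
      · rw [Function.update_self]; exact hrgt hjl
    · intro l hl
      rw [e1, k10, Function.update_of_ne (by simp; omega)]
      exact k5 l (by omega)
    · rw [e4, k6, Finset.prod_range_succ, hs2' i, Function.update_self]
      congr 1
      · refine Finset.prod_congr rfl fun l hl => ?_
        rw [hs2', Function.update_of_ne (by have := Finset.mem_range.1 hl; omega)]
      · rw [St.wrd, k8, hw, hT]; rfl
    · intro a ha
      rw [e1, k10, Function.update_of_ne (ha i)]
      exact k7 a ha
    · rw [e6 1 (by omega) (by omega) (by omega), k10]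
    · intro q h40 h1 h6 h7
      rw [e6 q h40 h6 h7, k11 q h40 h1 h6 h7]

end Build
end RankedEnum

namespace RankedEnum

universe u

/-! ### How the state of the enumeration is laid out in memory. -/

section Representation

/-- The data on which the enumeration works: the memory after the indexing, and the weights `ω` of
the results. -/
structure Env (W : Type u) where
  plan : ℕ → Plan
  nt : ℕ
  n : ℕ
  mm : ℕ
  mem : List ℕ → Option ℕ
  wmem : List ℕ → Option W
  ω : List ℕ → W

variable {W : Type u}

/-- The number cells which the enumeration uses. -/
def EnumAddr (a : List ℕ) : Prop := ∃ hd l, 6 ≤ hd ∧ hd ≤ 10 ∧ a = hd :: l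

theorem not_enumAddr {hd : ℕ} {l : List ℕ} (h : hd < 6) : ¬ EnumAddr (hd :: l) := by
  rintro ⟨hd', l', h1, -, e⟩
  simp only [List.cons.injEq] at e
  omega

theorem enumAddr {hd : ℕ} {l : List ℕ} (h : 6 ≤ hd) (h' : hd ≤ 10) : EnumAddr (hd :: l) :=
  ⟨hd, l, h, h', rfl⟩

variable [CommSemiring W]

def Env.T (e : Env W) (τ : ℕ) : Tree W := mkTree (e.plan τ) τ e.mem e.wmem

/-- A result may be a solution of several trees, by different rows. The field `weight` makes its
weight a function of the assignment alone, so that the order of candidates across trees is an order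
of results. -/
structure Env.Ok (e : Env W) : Prop where
  valid : ∀ τ < e.nt, (e.T τ).Valid
  m_le : ∀ τ < e.nt, (e.plan τ).m ≤ e.mm
  vars_lt : ∀ τ < e.nt, ∀ l < (e.plan τ).m, ∀ x ∈ (e.plan τ).vars l, x < e.n
  covered : ∀ τ < e.nt, ∀ x < e.n, ∃ l < (e.plan τ).m, x ∈ (e.plan τ).vars l
  weight : ∀ τ < e.nt, ∀ s v, (e.T τ).Part (e.T τ).m s v →
    (e.T τ).wt s = e.ω ((List.range e.n).map v)
  fresh : ∀ a, EnumAddr a → e.mem a = none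
  wfresh : ∀ l, e.wmem (6 :: l) = none

/-- The memory holds the candidates. -/
structure CandRep (e : Env W) (E : EnumState) (σ : St W) : Prop where
  base : ∀ a, ¬ EnumAddr a → σ.mem a = e.mem a
  wbase : ∀ a, (∀ l, a ≠ 6 :: l) → σ.wmem a = e.wmem a
  num : σ.reg 1 = E.N
  rows : ∀ id, E.Mem id → ∀ l, σ.rd [6, id, l] = E.rows id l
  tree : ∀ id, E.Mem id → σ.rd [7, id, 0] = E.tree id
  dev : ∀ id, E.Mem id → σ.rd [7, id, 1] = E.dev id
  wt : ∀ id, E.Mem id → σ.wrd [6, id] = E.wt e.T id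
  rows_supp : ∀ a, σ.mem (6 :: a) ≠ none → ∃ id l, a = [id, l] ∧ id ≤ E.N ∧ l < e.mm
  tree_supp : ∀ a, σ.mem (7 :: a) ≠ none → ∃ id b, a = [id, b] ∧ id ≤ E.N ∧ b < 2
  wt_supp : ∀ a, σ.wmem (6 :: a) ≠ none → ∃ id, a = [id] ∧ id ≤ E.N

open Classical in
/-- The memory holds a priority queue of the candidates that have not been extracted. -/
structure QueueRep (E : EnumState) (σ : St W) : Prop where
  cap : σ.reg 2 = 2 ^ σ.reg 0
  lt_cap : E.N < 2 ^ σ.reg 0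
  cap_le : 2 ^ σ.reg 0 ≤ 2 * E.N + 1
  leaf : ∀ id, σ.rd [8, 0, id] = if E.Mem id ∧ id ∉ E.popped then id else 0
  node : ∀ l < σ.reg 0, ∀ i, NodeOk σ l i
  supp : ∀ a, σ.mem (8 :: a) ≠ none → QueueAddr (σ.reg 0) (8 :: a)

/-- The memory holds the results found so far. -/
structure OutRep (n : ℕ) (L : List (List ℕ)) (σ : St W) : Prop where
  length : ∀ u ∈ L, u.length = n
  seen : ∀ u, u.length = n → (σ.rd (9 :: u) ≠ 0 ↔ u ∈ L)
  queue : ∀ q (hq : q < L.length), (List.range n).map (fun x => σ.rd [10, q, x]) = L[q]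
  qt : σ.reg 14 = L.length
  seen_supp : ∀ u, σ.mem (9 :: u) ≠ none → u ∈ L
  queue_supp : ∀ a, σ.mem (10 :: a) ≠ none → ∃ q x, a = [q, x] ∧ q < L.length ∧ x < n

omit [CommSemiring W] in
theorem OutRep.congr {n : ℕ} {L : List (List ℕ)} {σ σ' : St W} (h : OutRep n L σ)
    (h9 : ∀ a, σ'.mem (9 :: a) = σ.mem (9 :: a)) (h10 : ∀ a, σ'.mem (10 :: a) = σ.mem (10 :: a))
    (hr : σ'.reg 14 = σ.reg 14) : OutRep n L σ' where
  length := h.length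
  seen u hu := by rw [St.rd, h9]; exact h.seen u hu
  queue q hq := by simp only [St.rd, h10]; exact h.queue q hq
  qt := hr.trans h.qt
  seen_supp u hu := h.seen_supp u (by rwa [h9] at hu)
  queue_supp a ha := h.queue_supp a (by rwa [h10] at ha)

theorem CandRep.congr {e : Env W} {E E' : EnumState} {σ σ' : St W} (h : CandRep e E σ)
    (hm : ∀ a, ¬ EnumAddr a → σ'.mem a = σ.mem a)
    (h6 : ∀ a, σ'.mem (6 :: a) = σ.mem (6 :: a)) (h7 : ∀ a, σ'.mem (7 :: a) = σ.mem (7 :: a))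
    (hw : σ'.wmem = σ.wmem) (hr : σ'.reg 1 = σ.reg 1) (hN : E'.N = E.N) (ht : E'.tree = E.tree)
    (hd : E'.dev = E.dev) (hrow : E'.rows = E.rows) : CandRep e E' σ' where
  base a ha := (hm a ha).trans (h.base a ha)
  wbase a ha := by rw [hw]; exact h.wbase a ha
  num := by rw [hr, h.num, hN]
  rows id hid l := by
    rw [St.rd, h6, hrow]; exact h.rows id (by rwa [EnumState.Mem, hN] at hid) l
  tree id hid := by
    rw [St.rd, h7, ht]; exact h.tree id (by rwa [EnumState.Mem, hN] at hid)
  dev id hid := by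
    rw [St.rd, h7, hd]; exact h.dev id (by rwa [EnumState.Mem, hN] at hid)
  wt id hid := by
    rw [St.wrd, hw, EnumState.wt, ht, hrow]; exact h.wt id (by rwa [EnumState.Mem, hN] at hid)
  rows_supp a ha := by rw [hN]; exact h.rows_supp a (by rwa [h6] at ha)
  tree_supp a ha := by rw [hN]; exact h.tree_supp a (by rwa [h7] at ha)
  wt_supp a ha := by rw [hN]; exact h.wt_supp a (by rwa [hw] at ha)

theorem QueueRep.congr {E E' : EnumState} {σ σ' : St W} (h : QueueRep E σ)
    (h8 : ∀ a, σ'.mem (8 :: a) = σ.mem (8 :: a)) (hw : σ'.wmem = σ.wmem)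
    (h0 : σ'.reg 0 = σ.reg 0) (h2 : σ'.reg 2 = σ.reg 2) (hN : E'.N = E.N)
    (hp : E'.popped = E.popped) : QueueRep E' σ' where
  cap := by rw [h0, h2, h.cap]
  lt_cap := by rw [h0, hN]; exact h.lt_cap
  cap_le := by rw [h0, hN]; exact h.cap_le
  leaf id := by rw [St.rd, h8, hp, EnumState.Mem, hN]; exact h.leaf id
  node l hl i := by
    unfold NodeOk
    simp only [St.rd, St.wrd, h8, hw]
    exact h.node l (by rwa [h0] at hl) i
  supp a ha := by rw [h0]; exact h.supp a (by rwa [h8] at ha)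

/-- The weight of the null candidate is never consulted. Hence storing the weight of a new candidate
does not disturb nodes that do not mention it. -/
theorem pick_congr {wt wt' : ℕ → W} {a b : ℕ} (ha : a ≠ 0 → wt a = wt' a)
    (hb : b ≠ 0 → wt b = wt' b) : pick wt a b = pick wt' a b := by
  unfold pick
  split_ifs with h1 h2 h3 h4 h4 <;> try rfl
  · rw [ha h2, hb h1] at h3; exact absurd h3 h4
  · rw [ha h2, hb h1] at h3; exact absurd h4 h3

/-- The nodes of the queue hold candidates that have not been extracted. -/
theorem QueueRep.mem_of_node (hW : Selective W) {E : EnumState} {σ : St W} (h : QueueRep E σ)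
    {l i : ℕ} (hl : l ≤ σ.reg 0) (h0 : σ.rd [8, l, i] ≠ 0) :
    E.Mem (σ.rd [8, l, i]) ∧ σ.rd [8, l, i] ∉ E.popped := by
  have := (tournament_min hW (q := fun l i => σ.rd [8, l, i]) (h := σ.reg 0)
    (wt := fun j => σ.wrd [6, j]) (fun l hl i => h.node l hl i)
    (fun j => by simp only [h.leaf]; split_ifs <;> simp) l hl i).2 h0
  simp only [h.leaf] at this
  by_contra hc
  rw [if_neg hc] at this
  exact h0 this.symm

/-- The root of the queue is a lightest candidate. -/
theorem QueueRep.min (hW : Selective W) {e : Env W} {E : EnumState} {σ : St W} (h : QueueRep E σ)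
    (hc : CandRep e E σ) {id : ℕ} (hid : E.Mem id) (hp : id ∉ E.popped) :
    σ.rd [8, σ.reg 0, 0] ≠ 0 ∧ wle (E.wt e.T (σ.rd [8, σ.reg 0, 0])) (E.wt e.T id) := by
  have := (tournament_min hW (q := fun l i => σ.rd [8, l, i]) (h := σ.reg 0)
    (wt := fun j => σ.wrd [6, j]) (fun l hl i => h.node l hl i)
    (fun j => by simp only [h.leaf]; split_ifs <;> simp) (σ.reg 0) le_rfl 0).1 id
    (Nat.div_eq_of_lt (lt_of_le_of_lt hid.2 h.lt_cap))
    (by simp only [h.leaf, if_pos (And.intro hid hp)]; have := hid.1; omega)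
  refine ⟨this.1, ?_⟩
  rw [← hc.wt id hid, ← hc.wt _ (h.mem_of_node hW le_rfl this.1).1]
  exact this.2

end Representation
end RankedEnum

namespace RankedEnum

universe u

/-! ### Insertion of a candidate into the priority queue. -/

section BuildCorrect

variable {W : Type u} [CommSemiring W]

theorem Spec.seq_of_le {p q : Program} {σ : St W} {Post : St W → Prop} {t : ℕ} (t₁ t₂ : ℕ)
    (ht : t₁ + t₂ + 1 ≤ t) (h : Spec p t₁ σ fun σ' => Spec q t₂ σ' Post) :
    Spec (.seq p q) t σ Post :=
  (Spec.seq h).mono ht fun _ h => h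

theorem Spec.eval_seq {p q : Program} (hp : LoopFree p) {σ : St W} {Post : St W → Prop} {t : ℕ}
    (t' : ℕ) (ht : cost p + t' + 1 ≤ t) (h : Spec q t' (eval p σ) Post) :
    Spec (.seq p q) t σ Post :=
  Spec.seq_of_le _ _ ht (Spec.of_eval hp h)

theorem eval_buildEnd (τ j : ℕ) (σ : St W) {N : ℕ} (hN : σ.reg 1 = N) :
    let σ' := eval (buildEnd τ j) σ
    σ'.mem = Function.update (Function.update (Function.update σ.mem [7, N, 0] (some τ))
      [7, N, 1] (some j)) [8, 0, N] (some N) ∧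
    σ'.wmem = Function.update σ.wmem [6, N] (some (σ.wreg 0)) ∧ σ'.out = σ.out ∧
    σ'.reg 0 = (if N = σ.reg 2 then σ.reg 0 + 1 else σ.reg 0) ∧
    σ'.reg 2 = (if N = σ.reg 2 then σ.reg 2 + σ.reg 2 else σ.reg 2) ∧
    σ'.reg 8 = 0 ∧ σ'.reg 9 = N ∧
    ∀ q, q ≠ 0 → q ≠ 2 → q ≠ 8 → q ≠ 9 → σ'.reg q = σ.reg q := by
  intro σ'
  have hσ' : σ' = eval (buildEnd τ j) σ := rfl
  simp only [buildEnd, eval_seqs_cons, eval_seqs_nil, eval, List.map_cons, List.map_nil, St.val,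
    hN, St.holds, eval_skip] at hσ'
  by_cases h : N = σ.reg 2
  · rw [if_pos h] at hσ'
    rw [hσ']
    simp [← h]
    refine ⟨by simp [hN], ?_⟩
    intro q h0 h2 h8 h9
    simp [h0, h2, h8, h9]
  · rw [if_neg h] at hσ'
    rw [hσ']
    simp [h]
    refine ⟨by simp [hN], ?_⟩
    intro q h0 h2 h8 h9
    simp [h8, h9]

/-- The hypotheses `hc` and `hc'` ask that the copied rows and the row in register 5 fit the
assignment built so far. This covers both uses: children of a candidate and, with `j = 0`, the best
solution of a tree. The number `H` bounds the height after a possible doubling. -/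
theorem spec_build (hW : Selective W) {e : Env W} (he : e.Ok) {E : EnumState} {L : List (List ℕ)}
    {σ : St W} {τ j H : ℕ} {old : ℕ → ℕ} (hτ : τ < e.nt) (hC : CandRep e E σ) (hQ : QueueRep E σ)
    (hO : OutRep e.n L σ) (hpop : ∀ p ∈ E.popped, E.Mem p) (h3 : σ.reg 3 ≠ E.N + 1)
    (hold : ∀ l < j, σ.rd [6, σ.reg 3, l] = old l) (hH : 2 * E.N + 3 ≤ 2 ^ H)
    (hc : ∀ i < j, i < (e.T τ).m → ∀ s v, (e.T τ).Part i s v → (∀ l < i, s l = old l) →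
      old i ∈ (e.T τ).grp i ((e.T τ).key i v) ((e.T τ).len i))
    (hc' : j < (e.T τ).m → ∀ s v, (e.T τ).Part j s v → (∀ l < j, s l = old l) →
      σ.reg 5 ∈ (e.T τ).grp j ((e.T τ).key j v) ((e.T τ).len j)) :
    Spec (build (e.plan τ) τ j) (cost (buildRows (e.plan τ) τ j) + cost (buildEnd τ j) +
        (cost fixBody + 1) * H + 3) σ fun σ' =>
      ∃ s v, (e.T τ).Part (e.T τ).m s v ∧ (∀ l < j, l < (e.T τ).m → s l = old l) ∧
      (j < (e.T τ).m → s j = σ.reg 5) ∧ (e.T τ).Greedy (j + 1) s v ∧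
      (∀ l, (e.T τ).m ≤ l → s l = 0) ∧ CandRep e (E.add τ j s) σ' ∧
      QueueRep (E.add τ j s) σ' ∧ OutRep e.n L σ' ∧ σ'.out = σ.out ∧
      ∀ q, 12 ≤ q ∧ q < 24 ∨ q = 3 ∨ q = 4 → σ'.reg q = σ.reg q := by
  obtain ⟨N, hN⟩ : ∃ N, N = E.N := ⟨_, rfl⟩
  have hfresh : ∀ l, σ.mem [6, N + 1, l] = none := by
    intro l
    by_contra h
    obtain ⟨id, l', e1, e2, -⟩ := hC.rows_supp _ h
    simp only [List.cons.injEq] at e1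
    omega
  have hb := eval_buildRows (he.valid τ hτ) (τ := τ) (P := e.plan τ) (mem₀ := e.mem)
    (wmem₀ := e.wmem) rfl σ (hC.num.trans hN.symm) (by rw [hN]; exact h3) hold
    (fun l => hC.base _ (not_enumAddr (by omega))) (fun l => hC.base _ (not_enumAddr (by omega)))
    (fun l => hC.wbase _ (by simp)) hfresh hc hc'
  refine Spec.eval_seq (loopFree_buildRows (e.plan τ) τ j)
    (cost (buildEnd τ j) + (cost fixBody + 1) * H + 2) (by omega) ?_
  set σ1 := eval (buildRows (e.plan τ) τ j) σ
  obtain ⟨s, v, k1, k2, k3, k4, k5, k6, k7, k8, k9, k10, k11, k12, k13⟩ := hb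
  obtain ⟨b1, b2, b3, b4, b5, b6, b7, b8⟩ := eval_buildEnd τ j σ1 k12
  refine Spec.eval_seq (loopFree_buildEnd τ j) ((cost fixBody + 1) * H + 1) (by omega) ?_
  set σ2 := eval (buildEnd τ j) σ1
  have r0 : σ1.reg 0 = σ.reg 0 := k13 0 (by omega) (by omega) (by omega) (by omega)
  have r2 : σ1.reg 2 = σ.reg 2 := k13 2 (by omega) (by omega) (by omega) (by omega)
  obtain ⟨h, hh⟩ : ∃ h, h = σ2.reg 0 := ⟨_, rfl⟩
  -- Doubling takes place exactly when the new number equals the capacity, and it preserves both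
  -- bounds that tie the capacity to the number of candidates.
  have hle : σ.reg 0 ≤ h ∧ h ≤ σ.reg 0 + 1 ∧ σ2.reg 2 = 2 ^ h ∧ N + 1 < 2 ^ h ∧
      2 ^ h ≤ 2 * (N + 1) + 1 := by
    have c1 := hQ.cap
    have c2 := hQ.lt_cap
    have c3 := hQ.cap_le
    rw [hh, b4, b5, r0, r2]
    split_ifs with hx
    · rw [pow_succ]; omega
    · omega
  obtain ⟨hl1, hl2, hcap, hlt, hcle⟩ := hle
  have hhH : h ≤ H := by
    have : 2 ^ h ≤ 2 ^ H := by omega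
    exact (Nat.pow_le_pow_iff_right (by omega)).1 this
  -- memory of the intermediate state
  have m8 : ∀ a, 8 :: a ≠ [8, 0, N + 1] → σ2.mem (8 :: a) = σ.mem (8 :: a) := by
    intro a ha
    rw [b1, Function.update_of_ne ha, Function.update_of_ne (by simp),
      Function.update_of_ne (by simp), k9 _ (by simp)]
  have hw2 : ∀ j, j ≠ N + 1 → σ2.wrd [6, j] = σ.wrd [6, j] := by
    intro j hj
    rw [St.wrd, b2, Function.update_of_ne (by simpa using hj), k10]; rfl
  have rd8 : ∀ l i, (l = 0 → i ≠ N + 1) → σ2.rd [8, l, i] = σ.rd [8, l, i] := by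
    intro l i hli
    rw [St.rd, m8 _ (by simpa using hli)]; rfl
  have hnode : ∀ l' < h, ∀ i, (l' < 0 ∨ i ≠ (N + 1) / 2 ^ (l' + 1)) → NodeOk σ2 l' i := by
    intro l' hl' i hi
    have hi := hi.resolve_left (by omega)
    have hch : ∀ i', i' / 2 = i → l' = 0 → i' ≠ N + 1 := by
      rintro i' hi' rfl rfl
      simp only [zero_add, pow_one] at hi; omega
    unfold NodeOk
    rw [rd8 (l' + 1) i (by omega), rd8 l' (2 * i) (hch _ (by omega)),
      rd8 l' (2 * i + 1) (hch _ (by omega))]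
    by_cases hlt' : l' < σ.reg 0
    · rw [hQ.node l' hlt' i]
      refine pick_congr ?_ ?_ <;>
      · intro h0
        have := (hQ.mem_of_node hW hlt'.le h0).1.ne
        exact (hw2 _ (by rw [hN]; exact this)).symm
    -- Such a node exists only after a doubling. Number `0` of this level lies on the path; the
    -- others and their children read as `0`, and `0` is consistent with two zeros.
    · have hl0 : l' = σ.reg 0 := by omega
      have hi0 : i ≠ 0 := by
        intro h0
        apply hi
        rw [h0, Nat.div_eq_of_lt]
        rwa [hl0, show σ.reg 0 + 1 = h by omega]
      have z : ∀ l i, (σ.reg 0 < l ∨ (l = σ.reg 0 ∧ i ≠ 0)) → σ.rd [8, l, i] = 0 := by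
        intro l i hli
        rw [St.rd]
        by_contra hx
        have : σ.mem [8, l, i] ≠ none := by intro h; rw [h] at hx; exact hx rfl
        obtain ⟨l1, i1, q1, q2, q3⟩ := hQ.supp _ this
        simp only [List.cons.injEq, true_and, and_true] at q1
        obtain ⟨rfl, rfl⟩ := q1
        rcases hli with hli | ⟨rfl, hli⟩
        · omega
        · simp at q3; omega
      rw [z (l' + 1) i (by omega), z l' (2 * i) (by omega), z l' (2 * i + 1) (by omega)]
      simp [pick]
  have hsupp : ∀ a, σ2.mem (8 :: a) ≠ none → QueueAddr h (8 :: a) := by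
    intro a ha
    by_cases hx : 8 :: a = [8, 0, N + 1]
    · exact ⟨0, N + 1, hx, by omega, by simpa using hlt⟩
    · rw [m8 a hx] at ha
      obtain ⟨l1, i1, q1, q2, q3⟩ := hQ.supp _ ha
      refine ⟨l1, i1, q1, by omega, lt_of_lt_of_le q3 (Nat.pow_le_pow_right (by omega) (by omega))⟩
  have hf := spec_fixLoop hlt h σ2 0 (by omega) hh.symm b6 (by simpa using b7) hnode hsupp
  refine hf.mono (by gcongr) ?_
  rintro σ' ⟨g1, g2, g3, g4, g5, g6⟩
  have hmem : ∀ a, (∀ l, a ≠ [6, N + 1, l]) → (∀ l, a ≠ 8 :: l) → a ≠ [7, N + 1, 0] →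
      a ≠ [7, N + 1, 1] → σ'.mem a = σ.mem a := by
    intro a h1 h2 h3 h4
    rw [g2 a (fun l i => h2 _), b1, Function.update_of_ne (h2 _), Function.update_of_ne h4,
      Function.update_of_ne h3, k9 a h1]
  have hm6 : ∀ l, σ'.mem [6, N + 1, l] = σ1.mem [6, N + 1, l] := by
    intro l
    rw [g2 _ (by simp), b1, Function.update_of_ne (by simp), Function.update_of_ne (by simp),
      Function.update_of_ne (by simp)]
  have hm7 : σ'.rd [7, N + 1, 0] = τ ∧ σ'.rd [7, N + 1, 1] = j := by
    rw [St.rd, St.rd, g2 _ (by simp), g2 _ (by simp), b1]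
    simp
  obtain ⟨n1, n2, n3⟩ := EnumState.add_tree_new (E := E) (τ := τ) (d := j) (s := s)
  rw [← hN] at n1 n2 n3
  have ho := fun id (h : E.Mem id) => EnumState.add_tree_of_mem (τ := τ) (d := j) (s := s) h
  have hwm : σ'.wmem = Function.update σ.wmem [6, N + 1] (some ((e.T τ).wt s)) := by
    rw [g4, b2, k10, k8]
  have hne : ∀ id, E.Mem id → id ≠ N + 1 := fun id hid => by rw [hN]; exact hid.ne
  refine ⟨s, v, k1, k2, k3, k4, k5, ?_, ?_, ?_, ?_, ?_⟩
  · refine ⟨?_, ?_, ?_, ?_, ?_, ?_, ?_, ?_, ?_, ?_⟩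
    · intro a ha
      rw [hmem a, hC.base a ha]
      · rintro l rfl; exact ha (enumAddr (by omega) (by omega))
      · rintro l rfl; exact ha (enumAddr (by omega) (by omega))
      · rintro rfl; exact ha (enumAddr (by omega) (by omega))
      · rintro rfl; exact ha (enumAddr (by omega) (by omega))
    · intro a ha
      rw [hwm, Function.update_of_ne (ha _), hC.wbase a ha]
    · rw [g6 1 (by omega) (by omega) (by omega) (by omega) (by omega) (by omega),
        b8 1 (by omega) (by omega) (by omega) (by omega), k12, hN]; rfl
    · intro id hid l
      rcases EnumState.mem_add.1 hid with hid | rfl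
      · rw [(ho id hid).2.2, ← hC.rows id hid l, St.rd, hmem _ _ (by simp) (by simp) (by simp)]
        · rfl
        · simp [hne id hid]
      · rw [← hN, n3, St.rd, hm6, ← k6]; rfl
    · intro id hid
      rcases EnumState.mem_add.1 hid with hid | rfl
      · rw [(ho id hid).1, ← hC.tree id hid, St.rd, hmem _ (by simp) (by simp) _ (by simp)]
        · rfl
        · simp [hne id hid]
      · rw [← hN, n1]; exact hm7.1
    · intro id hid
      rcases EnumState.mem_add.1 hid with hid | rfl
      · rw [(ho id hid).2.1, ← hC.dev id hid, St.rd, hmem _ (by simp) (by simp) (by simp)]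
        · rfl
        · simp [hne id hid]
      · rw [← hN, n2]; exact hm7.2
    · intro id hid
      rcases EnumState.mem_add.1 hid with hid | rfl
      · rw [EnumState.wt, (ho id hid).1, (ho id hid).2.2, ← EnumState.wt, ← hC.wt id hid, St.wrd,
          hwm, Function.update_of_ne (by simp [hne id hid])]; rfl
      · rw [← hN, EnumState.wt, n1, n3, St.wrd, hwm]; simp
    · intro a ha
      by_cases hx : ∃ l, a = [N + 1, l]
      · obtain ⟨l, rfl⟩ := hx
        rw [hm6] at ha
        refine ⟨N + 1, l, rfl, by rw [hN]; exact le_rfl, lt_of_lt_of_le (k7 l ha) (he.m_le τ hτ)⟩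
      · rw [hmem _ _ (by simp) (by simp) (by simp)] at ha
        · obtain ⟨id, l, q1, q2, q3⟩ := hC.rows_supp a ha
          exact ⟨id, l, q1, by simp only [EnumState.add]; omega, q3⟩
        · intro l hl
          simp only [List.cons.injEq, true_and] at hl
          exact hx ⟨l, hl⟩
    · intro a ha
      by_cases h0 : a = [N + 1, 0]
      · exact ⟨N + 1, 0, h0, by rw [hN]; exact le_rfl, by omega⟩
      by_cases h1 : a = [N + 1, 1]
      · exact ⟨N + 1, 1, h1, by rw [hN]; exact le_rfl, by omega⟩
      rw [hmem _ (by simp) (by simp) (by simpa using h0) (by simpa using h1)] at ha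
      obtain ⟨id, l, q1, q2, q3⟩ := hC.tree_supp a ha
      exact ⟨id, l, q1, by simp only [EnumState.add]; omega, q3⟩
    · intro a ha
      by_cases h0 : a = [N + 1]
      · exact ⟨N + 1, h0, by rw [hN]; exact le_rfl⟩
      rw [hwm, Function.update_of_ne (by simpa using h0)] at ha
      obtain ⟨id, q1, q2⟩ := hC.wt_supp a ha
      exact ⟨id, q1, by simp only [EnumState.add]; omega⟩
  · have s0 : σ'.reg 0 = h := by
      rw [g6 0 (by omega) (by omega) (by omega) (by omega) (by omega) (by omega), hh]
    refine ⟨?_, ?_, ?_, ?_, ?_, ?_⟩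
    · rw [s0, g6 2 (by omega) (by omega) (by omega) (by omega) (by omega) (by omega), hcap]
    · rw [s0]; simp only [EnumState.add]; omega
    · rw [s0]; simp only [EnumState.add]; omega
    · intro id
      rw [St.rd, g2 _ (by simp)]
      by_cases hx : id = N + 1
      · subst hx
        rw [b1, Function.update_self, if_pos]
        · rfl
        · refine ⟨EnumState.mem_add.2 (.inr (by rw [hN])), fun hp => ?_⟩
          exact hne _ (hpop _ hp) rfl
      · have := hQ.leaf id
        rw [m8 _ (by simpa using hx), ← St.rd, this]
        have : E.Mem id ↔ (E.add τ j s).Mem id := by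
          rw [EnumState.mem_add, ← hN]; simp [hx]
        rw [this]; rfl
    · rw [s0]; exact g1
    · rw [s0]; exact g3
  · refine hO.congr ?_ ?_ ?_
    · intro a; exact hmem _ (by simp) (by simp) (by simp) (by simp)
    · intro a; exact hmem _ (by simp) (by simp) (by simp) (by simp)
    · rw [g6 14 (by omega) (by omega) (by omega) (by omega) (by omega) (by omega),
        b8 14 (by omega) (by omega) (by omega) (by omega),
        k13 14 (by omega) (by omega) (by omega) (by omega)]
  · rw [g5, b3, k11]
  · intro q hq
    rw [g6 q (by omega) (by omega) (by omega) (by omega) (by omega) (by omega),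
      b8 q (by omega) (by omega) (by omega) (by omega),
      k13 q (by omega) (by omega) (by omega) (by omega)]

end BuildCorrect
end RankedEnum

namespace RankedEnum

universe u

/-! ### Expansion of an extracted candidate. -/

section Expand

/-- Generates a child of the candidate in register 3. -/
def tryChild (P : Plan) (τ j : ℕ) (side : Bool) : Program :=
  .seq (.seq (.load 6 [.const 6, .reg 3, .const j])
      (.load 5 [.const (cond side 4 3), .const τ, .const j, .reg 6]))
    (.ite (.eq (.reg 5) (.const 0)) skip (build P τ j))

/-- Generates the children of the candidate in register 3 at the bag `j`. -/
def kidsAt (P : Plan) (τ j : ℕ) : Program :=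
  .ite (.lt (.reg 4) (.const (j + 1))) (.seq (tryChild P τ j false) (tryChild P τ j true)) skip

def expandKids (P : Plan) (τ : ℕ) : Program := seqs ((List.range P.m).map (kidsAt P τ))

/-- Loads the assignment that belongs to the candidate in register 3. -/
def loadCand (P : Plan) (τ : ℕ) : Program :=
  seqs ((List.range P.m).map fun i => seqs [
    .load 6 [.const 6, .reg 3, .const i],
    .sub 7 (.reg 6) (.const 1),
    loadVars τ (P.id i) (P.vars i)])

/-- Prefix 9 is a dictionary for the test of membership, prefix 10 the list of results in order of
discovery, and register 14 its length. -/
def append (n : ℕ) : Program := seqs [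
  .store (.const 9 :: regs (List.range n)) (.const 1),
  seqs ((List.range n).map fun x => .store [.const 10, .reg 14, .const x] (.reg (40 + x))),
  .add 14 (.reg 14) (.const 1)]

/-- Appends the current assignment to the list of results, unless it is there already. -/
def record (n : ℕ) : Program :=
  .seq (.load 23 (.const 9 :: regs (List.range n)))
    (.ite (.eq (.reg 23) (.const 0)) (append n) skip)

def expand (P : Plan) (n τ : ℕ) : Program :=
  .seq (.seq (loadCand P τ) (record n)) (expandKids P τ)

theorem loopFree_loadCand (P : Plan) (τ : ℕ) : LoopFree (loadCand P τ) := by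
  rw [loadCand, loopFree_seqs]
  simp only [List.mem_map]
  rintro p ⟨i, -, rfl⟩
  simp [loopFree_seqs, loopFree_loadVars, LoopFree]

theorem loopFree_append (n : ℕ) : LoopFree (append n) := by
  simp [append, loopFree_seqs, LoopFree]

theorem loopFree_record (n : ℕ) : LoopFree (record n) :=
  ⟨trivial, loopFree_append n, trivial⟩

variable {W : Type u} [CommSemiring W]

/-- `E'` arises from `E` by adding candidates and marking children. -/
structure EnumState.Ext (E E' : EnumState) : Prop where
  le : E.N ≤ E'.N
  tree : ∀ id, E.Mem id → E'.tree id = E.tree id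
  dev : ∀ id, E.Mem id → E'.dev id = E.dev id
  rows : ∀ id, E.Mem id → E'.rows id = E.rows id
  popped : E'.popped = E.popped

theorem EnumState.Ext.refl (E : EnumState) : E.Ext E :=
  ⟨le_rfl, fun _ _ => rfl, fun _ _ => rfl, fun _ _ => rfl, rfl⟩

theorem EnumState.Ext.mem {E E' : EnumState} (h : E.Ext E') {id : ℕ} (hid : E.Mem id) :
    E'.Mem id := ⟨hid.1, hid.2.trans h.le⟩

theorem EnumState.Ext.trans {E E' E'' : EnumState} (h : E.Ext E') (h' : E'.Ext E'') :
    E.Ext E'' where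
  le := h.le.trans h'.le
  tree id hid := (h'.tree id (h.mem hid)).trans (h.tree id hid)
  dev id hid := (h'.dev id (h.mem hid)).trans (h.dev id hid)
  rows id hid := (h'.rows id (h.mem hid)).trans (h.rows id hid)
  popped := h'.popped.trans h.popped

theorem EnumState.Ext.wt {E E' : EnumState} (h : E.Ext E') (T : ℕ → Tree W) {id : ℕ}
    (hid : E.Mem id) : E'.wt T id = E.wt T id := by
  rw [EnumState.wt, EnumState.wt, h.tree id hid, h.rows id hid]

theorem EnumState.ext_add (E : EnumState) (τ d : ℕ) (s : ℕ → ℕ) : E.Ext (E.add τ d s) :=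
  ⟨Nat.le_succ _, fun _ h => (add_tree_of_mem h).1, fun _ h => (add_tree_of_mem h).2.1,
    fun _ h => (add_tree_of_mem h).2.2, rfl⟩

theorem EnumState.ext_mark (E : EnumState) (p j : ℕ) (side : Bool) : E.Ext (E.mark p j side) :=
  ⟨le_rfl, fun _ _ => rfl, fun _ _ => rfl, fun _ _ => rfl, rfl⟩

/-- A bound for the running times of the parts of the enumeration program. -/
structure CostBound (plan : ℕ → Plan) (nt n K : ℕ) : Prop where
  build : ∀ τ < nt, ∀ j, j = 0 ∨ j < (plan τ).m →
    cost (buildRows (plan τ) τ j) + cost (buildEnd τ j) + 3 ≤ K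
  fix : cost fixBody + 1 ≤ K
  load : ∀ τ < nt, cost (loadCand (plan τ) τ) ≤ K
  record : cost (record n) ≤ K

theorem exists_costBound (plan : ℕ → Plan) (nt n : ℕ) : ∃ K, CostBound plan nt n K := by
  obtain ⟨K₁, h₁⟩ := exists_uniform_bound (p := fun τ K => ∀ j, j = 0 ∨ j < (plan τ).m →
    cost (buildRows (plan τ) τ j) + cost (buildEnd τ j) + 3 ≤ K) nt
    (fun τ C C' h h' j hj => (h' j hj).trans h) (fun τ _ => by
      obtain ⟨K, hK⟩ := exists_uniform_bound (p := fun j K =>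
        cost (buildRows (plan τ) τ j) + cost (buildEnd τ j) + 3 ≤ K) ((plan τ).m + 1)
        (fun _ _ _ h h' => h'.trans h) (fun j _ => ⟨_, le_rfl⟩)
      exact ⟨K, fun j hj => hK j (by omega)⟩)
  obtain ⟨K₂, h₂⟩ := exists_uniform_bound (p := fun τ K => cost (loadCand (plan τ) τ) ≤ K) nt
    (fun _ _ _ h h' => h'.trans h) (fun j _ => ⟨_, le_rfl⟩)
  exact ⟨K₁ + K₂ + (cost fixBody + 1) + cost (record n),
    fun τ hτ j hj => by have := h₁ τ hτ j hj; omega, by omega,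
    fun τ hτ => by have := h₂ τ hτ; omega, by omega⟩

/-- The memory holds the state of the enumeration. -/
structure EnumRep (e : Env W) (E : EnumState) (L : List (List ℕ)) (σ : St W) : Prop where
  cand : CandRep e E σ
  queue : QueueRep E σ
  out : OutRep e.n L σ
  inv : E.Inv e.T e.nt
  root : ∀ τ < e.nt, E.HasRoot e.T τ

/-- Without a heap child, marking alone preserves the invariant. Otherwise the rows of `p` before
bag `j` and the heap child at `j` belong to the right groups, because keys depend on earlier rows
only. -/
theorem spec_tryChild (hW : Selective W) {e : Env W} (he : e.Ok) {K : ℕ}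
    (hK : CostBound e.plan e.nt e.n K) {E : EnumState} {L : List (List ℕ)} {σ : St W}
    (hR : EnumRep e E L σ) {p j : ℕ} (side : Bool) {H : ℕ} (hp : p ∈ E.popped)
    (hd : E.dev p ≤ j) (hj : j < (e.T (E.tree p)).m) (hn : ¬ E.done p j side)
    (hord : ∀ q ∈ E.popped, wle (E.wt e.T q) (E.wt e.T p)) (h3 : σ.reg 3 = p)
    (hH : 2 * E.N + 3 ≤ 2 ^ H) :
    Spec (tryChild (e.plan (E.tree p)) (E.tree p) j side) (K * (H + 1) + 6) σ fun σ' =>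
      ∃ E', EnumRep e E' L σ' ∧ E.Ext E' ∧ E'.N ≤ E.N + 1 ∧
        (∀ p' j' side', E'.done p' j' side' ↔
          E.done p' j' side' ∨ (p' = p ∧ j' = j ∧ side' = side)) ∧
        σ'.out = σ.out ∧ ∀ q, 12 ≤ q ∧ q < 24 ∨ q = 3 ∨ q = 4 → σ'.reg q = σ.reg q := by
  have hpm := hR.inv.popped_mem p hp
  obtain ⟨hτ, hcand⟩ := hR.inv.cand p hpm
  set τ := E.tree p with hτdef
  set T := e.T τ with hT
  set c := child (T.left j) (T.right j) side (E.rows p j) with hc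
  have hTv : T.Valid := he.valid τ hτ
  refine Spec.eval_seq (p := .seq (.load 6 [.const 6, .reg 3, .const j])
      (.load 5 [.const (cond side 4 3), .const τ, .const j, .reg 6])) ⟨trivial, trivial⟩
    (K * (H + 1) + 2) (by simp only [cost]; omega) ?_
  set σ1 := eval (.seq (.load 6 [.const 6, .reg 3, .const j])
      (.load 5 [.const (cond side 4 3), .const τ, .const j, .reg 6])) σ with hσ1
  have hrow : σ.rd [6, p, j] = E.rows p j := hR.cand.rows p hpm j
  have e5 : σ1.reg 5 = c := by
    simp only [hσ1, eval, List.map_cons, List.map_nil, St.val, h3, hrow, Function.update_self]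
    rw [St.rd]
    simp only []
    rw [hR.cand.base _ (not_enumAddr (by cases side <;> simp))]
    cases side <;> rfl
  have eo : σ1.mem = σ.mem ∧ σ1.wmem = σ.wmem ∧ σ1.out = σ.out := ⟨rfl, rfl, rfl⟩
  have er : ∀ q, q ≠ 5 → q ≠ 6 → σ1.reg q = σ.reg q := by
    intro q h1 h2
    simp [hσ1, eval, h1, h2]
  have hC1 : CandRep e E σ1 := hR.cand.congr (fun _ _ => rfl) (fun _ => rfl) (fun _ => rfl) rfl
    (er 1 (by omega) (by omega)) rfl rfl rfl rfl
  have hQ1 : QueueRep E σ1 := hR.queue.congr (fun _ => rfl) rfl (er 0 (by omega) (by omega))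
    (er 2 (by omega) (by omega)) rfl rfl
  have hO1 : OutRep e.n L σ1 := hR.out.congr (fun _ => rfl) (fun _ => rfl)
    (er 14 (by omega) (by omega))
  have h31 : σ1.reg 3 = p := (er 3 (by omega) (by omega)).trans h3
  clear_value σ1
  refine (Spec.ite (t := K * (H + 1) + 1) (fun h0 => ?_) fun h0 => ?_).mono (by omega) fun _ h => h
  · have h0 : c = 0 := by simpa [St.holds, e5] using h0
    refine (spec_skip ⟨E.mark p j side, ⟨hC1.congr (fun _ _ => rfl) (fun _ => rfl) (fun _ => rfl) rfl
      rfl rfl rfl rfl rfl, hQ1.congr (fun _ => rfl) rfl rfl rfl rfl rfl, hO1,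
      hR.inv.mark hp hd hj h0, hR.root⟩, E.ext_mark p j side, by simp [EnumState.mark],
      fun _ _ _ => Iff.rfl, eo.2.2, fun q hq => er q (by omega) (by omega)⟩).mono (by omega)
      fun _ h => h
  · have h0 : c ≠ 0 := by simpa [St.holds, e5] using h0
    obtain ⟨v₀, p₀, g₀, z₀⟩ := hcand
    have hb := spec_build hW he (σ := σ1) (τ := τ) (j := j) (H := H) (old := E.rows p) hτ hC1 hQ1 hO1
      hR.inv.popped_mem (by rw [h31]; exact hpm.ne)
      (fun l _ => by rw [h31]; exact hC1.rows p hpm l) hH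
      (by
        intro i hij him s v hs hso
        have hk : T.key i v = T.key i v₀ := by
          refine hs.key_eq hTv (p₀.mono him.le) hso him ?_
          rcases Nat.eq_zero_or_pos i with h | h
          · exact .inl h
          · exact .inr (hTv.par_lt _ h him)
        rw [hk]
        exact p₀.inGrp hTv him him)
      (by
        intro _ s v hs hso
        have hk : T.key j v = T.key j v₀ := by
          refine hs.key_eq hTv (p₀.mono hj.le) hso hj ?_
          rcases Nat.eq_zero_or_pos j with h | h
          · exact .inl h
          · exact .inr (hTv.par_lt _ h hj)
        rw [hk, e5]
        exact ((hTv.heap j hj _).child_mem (p₀.inGrp hTv hj hj) h0).1)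
    refine hb.mono ?_ ?_
    · have k1 := hK.build τ hτ j (.inr hj)
      have k2 := Nat.mul_le_mul_right H hK.fix
      rw [Nat.mul_succ]
      omega
    · rintro σ' ⟨s, v, b1, b2, b3, b4, b5, b6, b7, b8, b9, b10⟩
      have hchild : T.IsChild (E.rows p) j side s := by
        refine ⟨fun l hl => b2 l hl (hl.trans hj), ?_, ?_, v, b1, b4, b5⟩
        · rw [b3 hj, e5]
        · rw [b3 hj, e5]; exact h0
      have hE := E.ext_add τ j s
      refine ⟨(E.add τ j s).mark p j side, ⟨b6.congr (fun _ _ => rfl) (fun _ => rfl) (fun _ => rfl)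
        rfl rfl rfl rfl rfl rfl, b7.congr (fun _ => rfl) rfl rfl rfl rfl rfl, b8,
        hR.inv.addChild he.valid hp hd hj hchild hn hord, ?_⟩,
        hE.trans (EnumState.ext_mark _ _ _ _), le_rfl, fun _ _ _ => Iff.rfl, b9.trans eo.2.2, ?_⟩
      · intro τ' hτ'
        exact (hR.root τ' hτ').add
      · intro q hq
        rw [b10 q hq, er q (by omega) (by omega)]

/-- At most two children arise per bag, a number independent of the data. The bound `H` refers to
the number of candidates at the end and so serves all insertions. -/
theorem spec_expandKids (hW : Selective W) {e : Env W} (he : e.Ok) {K : ℕ}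
    (hK : CostBound e.plan e.nt e.n K) {E : EnumState} {L : List (List ℕ)} {σ : St W}
    (hR : EnumRep e E L σ) {p : ℕ} {H : ℕ} (hp : p ∈ E.popped)
    (hn : ∀ j side, ¬ E.done p j side)
    (hord : ∀ q ∈ E.popped, wle (E.wt e.T q) (E.wt e.T p)) (h3 : σ.reg 3 = p)
    (h4 : σ.reg 4 = E.dev p) (hH : 2 * (E.N + 2 * e.mm) + 3 ≤ 2 ^ H) :
    Spec (expandKids (e.plan (E.tree p)) (E.tree p)) (e.mm * (2 * (K * (H + 1)) + 15) + 1) σ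
      fun σ' => ∃ E', EnumRep e E' L σ' ∧ E.Ext E' ∧ E'.N ≤ E.N + 2 * e.mm ∧
        (∀ p' j' side', E'.done p' j' side' ↔
          E.done p' j' side' ∨ (p' = p ∧ E.dev p ≤ j' ∧ j' < (e.T (E.tree p)).m)) ∧
        σ'.out = σ.out ∧ ∀ q, 12 ≤ q ∧ q < 24 ∨ q = 3 ∨ q = 4 → σ'.reg q = σ.reg q := by
  have hpm := hR.inv.popped_mem p hp
  have hτ := (hR.inv.cand p hpm).1
  have hm : (e.plan (E.tree p)).m ≤ e.mm := he.m_le _ hτ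
  have key := spec_seqs_range (kidsAt (e.plan (E.tree p)) (E.tree p)) (fun i (σ' : St W) =>
    ∃ E', EnumRep e E' L σ' ∧ E.Ext E' ∧ E'.N ≤ E.N + 2 * i ∧
        (∀ p' j' side', E'.done p' j' side' ↔
          E.done p' j' side' ∨ (p' = p ∧ E.dev p ≤ j' ∧ j' < i)) ∧
        σ'.out = σ.out ∧ ∀ q, 12 ≤ q ∧ q < 24 ∨ q = 3 ∨ q = 4 → σ'.reg q = σ.reg q)
    (e.plan (E.tree p)).m (2 * (K * (H + 1)) + 14) σ
    ⟨E, hR, .refl E, by omega, fun _ _ _ => ⟨.inl, fun h => h.elim id (by omega)⟩, rfl,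
      fun _ _ => rfl⟩ ?_
  · refine key.mono ?_ ?_
    · exact Nat.add_le_add_right (Nat.mul_le_mul_right (2 * (K * (H + 1)) + 15) hm) 1
    · rintro σ' ⟨E', a1, a2, a3, a4, a5, a6⟩
      exact ⟨E', a1, a2, by omega, a4, a5, a6⟩
  · rintro i hi σ1 ⟨E1, a1, a2, a3, a4, a5, a6⟩
    have r3 : σ1.reg 3 = p := (a6 3 (by omega)).trans h3
    have r4 : σ1.reg 4 = E.dev p := (a6 4 (by omega)).trans h4
    refine (Spec.ite (t := 2 * (K * (H + 1)) + 13) (fun h0 => ?_) fun h0 => ?_)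
    · have h0 : E.dev p ≤ i := by
        simp only [St.holds, St.val, r4] at h0; omega
      have ht1 := a2.tree p hpm
      have hw1 : ∀ q ∈ E1.popped, wle (E1.wt e.T q) (E1.wt e.T p) := by
        intro q hq
        rw [a2.popped] at hq
        rw [a2.wt _ hpm, a2.wt _ (hR.inv.popped_mem q hq)]
        exact hord q hq
      have s1 := spec_tryChild hW he hK a1 (p := p) (j := i) false (H := H)
        (by rw [a2.popped]; exact hp) (by rw [a2.dev p hpm]; exact h0) (by rw [ht1]; exact hi)
        (by
          rw [a4]
          rintro (h | h)
          · exact hn _ _ h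
          · omega) hw1 r3 (by omega)
      rw [ht1] at s1
      refine Spec.seq_of_le _ (K * (H + 1) + 6) (by omega) (s1.mono le_rfl ?_)
      rintro σ2 ⟨E2, b1, b2, b3, b4, b5, b6⟩
      have a2' := a2.trans b2
      have hw2 : ∀ q ∈ E2.popped, wle (E2.wt e.T q) (E2.wt e.T p) := by
        intro q hq
        rw [a2'.popped] at hq
        rw [a2'.wt _ hpm, a2'.wt _ (hR.inv.popped_mem q hq)]
        exact hord q hq
      have s2 := spec_tryChild hW he hK b1 (p := p) (j := i) true (H := H)
        (by rw [a2'.popped]; exact hp) (by rw [a2'.dev p hpm]; exact h0)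
        (by rw [a2'.tree p hpm]; exact hi)
        (by
          rw [b4, a4]
          rintro ((h | h) | h)
          · exact hn _ _ h
          · omega
          · simp at h) hw2 ((b6 3 (by omega)).trans r3) (by omega)
      rw [a2'.tree p hpm] at s2
      refine s2.mono le_rfl ?_
      rintro σ3 ⟨E3, c1, c2, c3, c4, c5, c6⟩
      refine ⟨E3, c1, a2'.trans c2, by omega, ?_, c5.trans (b5.trans a5),
        fun q hq => (c6 q hq).trans ((b6 q hq).trans (a6 q hq))⟩
      intro p' j' side'
      rw [c4, b4, a4]
      constructor
      · rintro (((h | ⟨h1, h2, h3⟩) | ⟨h1, h2, h3⟩) | ⟨h1, h2, h3⟩)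
        · exact .inl h
        all_goals exact .inr ⟨h1, by omega, by omega⟩
      · rintro (h | ⟨h1, h2, h3⟩)
        · exact .inl (.inl (.inl h))
        · rcases Nat.lt_succ_iff_lt_or_eq.1 h3 with h4 | h4
          · exact .inl (.inl (.inr ⟨h1, h2, h4⟩))
          · cases side'
            · exact .inl (.inr ⟨h1, h4, rfl⟩)
            · exact .inr ⟨h1, h4, rfl⟩
    · have h0 : i < E.dev p := by
        simp only [St.holds, St.val, r4] at h0; omega
      refine (spec_skip ⟨E1, a1, a2, by omega, ?_, a5, a6⟩).mono (by omega) fun _ h => h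
      intro p' j' side'
      rw [a4]
      constructor
      · rintro (h | h)
        · exact .inl h
        · exact .inr (by omega)
      · rintro (h | h)
        · exact .inl h
        · exact .inr (by omega)

end Expand
end RankedEnum

namespace RankedEnum

universe u

/-! ### Reading the assignment of a candidate and recording it as a result. -/

section Extract

variable {W : Type u} [CommSemiring W]

theorem eval_loadCand {P : Plan} {τ : ℕ} {T : Tree W} {mem₀ : List ℕ → Option ℕ}
    {wmem₀ : List ℕ → Option W} (hT : T = mkTree P τ mem₀ wmem₀) (σ : St W)
    (h5 : ∀ l, σ.mem (5 :: l) = mem₀ (5 :: l)) {s v : ℕ → ℕ}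
    (hs : ∀ l, σ.rd [6, σ.reg 3, l] = s l) (hp : T.Part T.m s v) :
    let σ' := eval (loadCand P τ) σ
    σ'.mem = σ.mem ∧ σ'.wmem = σ.wmem ∧ σ'.out = σ.out ∧
    (∀ l < T.m, ∀ x ∈ T.vars l, σ'.reg (40 + x) = v x) ∧
    ∀ q, q < 40 → q ≠ 6 → q ≠ 7 → σ'.reg q = σ.reg q := by
  have hm : P.m = T.m := by rw [hT]; rfl
  have hvars : P.vars = T.vars := by rw [hT]; rfl
  have := eval_seqs_range (fun i => seqs [
    .load 6 [.const 6, .reg 3, .const i],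
    .sub 7 (.reg 6) (.const 1),
    loadVars τ (P.id i) (P.vars i)]) (fun i (σ' : St W) =>
    σ'.mem = σ.mem ∧ σ'.wmem = σ.wmem ∧ σ'.out = σ.out ∧
    (∀ l < i, ∀ x ∈ T.vars l, σ'.reg (40 + x) = v x) ∧
    ∀ q, q < 40 → q ≠ 6 → q ≠ 7 → σ'.reg q = σ.reg q) P.m σ
    ⟨rfl, rfl, rfl, fun l hl => absurd hl (by omega), fun _ _ _ _ => rfl⟩ (by
      rintro i hi σ1 ⟨a1, a2, a3, a4, a5⟩
      have hrd : σ1.rd [6, σ1.reg 3, i] = s i := by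
        rw [a5 3 (by omega) (by omega) (by omega), St.rd, a1]; exact hs i
      simp only [eval_seqs_cons, eval_seqs_nil, eval_loadVars, eval, List.map_cons, List.map_nil,
        St.val, hrd, Function.update_self]
      refine ⟨a1, a2, a3, ?_, ?_⟩
      · intro l hl x hx
        by_cases hxi : x ∈ P.vars i
        · rw [if_pos ⟨by omega, by simpa using hxi⟩]
          rw [show 40 + x - 40 = x by omega, St.rd]
          simp only []
          rw [a1, h5]
          rw [hvars] at hxi
          rw [← (hp i (by omega)).2.2 x hxi, hT]
          rfl
        · rw [if_neg (by simpa using hxi), Function.update_of_ne (by omega),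
            Function.update_of_ne (by omega)]
          rcases Nat.lt_succ_iff_lt_or_eq.1 hl with hl | rfl
          · exact a4 l hl x hx
          · rw [hvars] at hxi; exact absurd hx hxi
      · intro q h1 h2 h3
        rw [if_neg (by omega), Function.update_of_ne h3, Function.update_of_ne h2]
        exact a5 q h1 h2 h3)
  rw [hm] at this
  intro σ'
  have e : σ' = eval (loadCand P τ) σ := rfl
  rw [loadCand, hm] at e
  rw [e]
  exact this

theorem eval_storeRow (q n : ℕ) (σ : St W) (hq : σ.reg 14 = q) :
    let σ' := eval (seqs ((List.range n).map fun x =>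
      .store [.const 10, .reg 14, .const x] (.reg (40 + x)))) σ
    σ'.reg = σ.reg ∧ σ'.wmem = σ.wmem ∧ σ'.out = σ.out ∧
    (∀ a, (∀ x < n, a ≠ [10, q, x]) → σ'.mem a = σ.mem a) ∧
    ∀ x < n, σ'.mem [10, q, x] = some (σ.reg (40 + x)) := by
  refine eval_seqs_range (fun x => Program.store [.const 10, .reg 14, .const x] (.reg (40 + x)))
    (fun n (σ' : St W) => σ'.reg = σ.reg ∧ σ'.wmem = σ.wmem ∧ σ'.out = σ.out ∧
    (∀ a, (∀ x < n, a ≠ [10, q, x]) → σ'.mem a = σ.mem a) ∧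
    ∀ x < n, σ'.mem [10, q, x] = some (σ.reg (40 + x))) n σ
    ⟨rfl, rfl, rfl, fun _ _ => rfl, fun _ h => absurd h (by omega)⟩ ?_
  rintro i - σ1 ⟨a1, a2, a3, a4, a5⟩
  simp only [eval, List.map_cons, List.map_nil, St.val, a1, hq, true_and]
  refine ⟨a2, a3, ?_, ?_⟩
  · intro a ha
    rw [Function.update_of_ne (ha i (by omega))]
    exact a4 a fun x hx => ha x (by omega)
  · intro x hx
    by_cases h : x = i
    · subst h; simp
    · rw [Function.update_of_ne (by simpa using h)]
      exact a5 x (by omega)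

open Classical in
/-- Appending an element unless it is there already. -/
noncomputable def addNew (L : List (List ℕ)) (u : List ℕ) : List (List ℕ) :=
  if u ∈ L then L else L ++ [u]

theorem eval_record {n : ℕ} {L : List (List ℕ)} {σ : St W} (h : OutRep n L σ) {u : List ℕ}
    (hu : u = (List.range n).map fun x => σ.reg (40 + x)) :
    let σ' := eval (record n) σ
    OutRep n (addNew L u) σ' ∧
    (∀ a, (∀ l, a ≠ 9 :: l) → (∀ l, a ≠ 10 :: l) → σ'.mem a = σ.mem a) ∧
    σ'.wmem = σ.wmem ∧ σ'.out = σ.out ∧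
    ∀ q, q ≠ 14 → q ≠ 23 → σ'.reg q = σ.reg q := by
  have hlen : u.length = n := by simp [hu]
  intro σ'
  set σ1 : St W := { σ with reg := Function.update σ.reg 23 (σ.rd (9 :: u)) } with hσ1
  have e0 : σ' = if σ1.reg 23 = 0 then eval (append n) σ1 else σ1 := by
    show eval (record n) σ = _
    simp only [record, eval, St.holds, St.val, List.map_cons, regs_val, ← hu, eval_skip, hσ1]
  have h23 : σ1.reg 23 = σ.rd (9 :: u) := by simp [hσ1]
  have r1 : ∀ q, q ≠ 23 → σ1.reg q = σ.reg q := fun q hq => by simp [hσ1, hq]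
  by_cases hL : u ∈ L
  · rw [if_neg (by rw [h23]; exact (h.seen u hlen).2 hL)] at e0
    rw [addNew, if_pos hL, e0]
    exact ⟨h.congr (fun _ => rfl) (fun _ => rfl) (r1 14 (by omega)), fun _ _ _ => rfl, rfl, rfl,
      fun q _ hq => r1 q hq⟩
  · have hz : σ.rd (9 :: u) = 0 := by
      by_contra hc; exact hL ((h.seen u hlen).1 hc)
    rw [if_pos (by rw [h23, hz])] at e0
    rw [addNew, if_neg hL]
    have hu1 : ((List.range n).map fun x => σ1.reg (40 + x)) = u := by
      rw [hu]; exact List.map_congr_left fun x _ => r1 _ (by omega)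
    set σ2 : St W := { σ1 with mem := Function.update σ1.mem (9 :: u) (some 1) } with hσ2
    obtain ⟨b1, b2, b3, b4, b5⟩ := eval_storeRow L.length n σ2
      (show σ1.reg 14 = _ by rw [r1 14 (by omega), h.qt])
    set σ3 := eval (seqs ((List.range n).map fun x =>
      .store [.const 10, .reg 14, .const x] (.reg (40 + x)))) σ2 with hσ3
    have e1 : σ' = { σ3 with reg := Function.update σ3.reg 14 (σ3.reg 14 + 1) } := by
      rw [e0]
      simp only [append, eval_seqs_cons, eval_seqs_nil]
      have : eval (.store (.const 9 :: regs (List.range n)) (.const 1)) σ1 = σ2 := by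
        simp only [eval, List.map_cons, regs_val, hu1, St.val, hσ2]
      rw [this, ← hσ3]
      simp only [eval, St.val]
    have hmem : σ'.mem = σ3.mem := by rw [e1]
    have r3 : ∀ q, q ≠ 23 → σ3.reg q = σ.reg q := by
      intro q hq; rw [b1]; exact r1 q hq
    have m9 : ∀ a, σ'.mem (9 :: a) = if a = u then some 1 else σ.mem (9 :: a) := by
      intro a
      rw [hmem, b4 _ (by simp)]
      by_cases ha : a = u <;> simp [hσ2, hσ1, ha]
    have m10 : ∀ a, (∀ x < n, a ≠ [L.length, x]) → σ'.mem (10 :: a) = σ.mem (10 :: a) := by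
      intro a ha
      rw [hmem, b4 _ (by simpa using ha)]
      simp [hσ2, hσ1]
    have m10' : ∀ x < n, σ'.mem [10, L.length, x] = some (σ.reg (40 + x)) := by
      intro x hx
      rw [hmem, b5 x hx]
      show some (σ1.reg (40 + x)) = _
      rw [r1 _ (by omega)]
    refine ⟨⟨?_, ?_, ?_, ?_, ?_, ?_⟩, ?_, ?_, ?_, ?_⟩
    · intro w hw
      rcases List.mem_append.1 hw with hw | hw
      · exact h.length w hw
      · rw [List.mem_singleton.1 hw, hlen]
    · intro w hw
      rw [St.rd, m9, List.mem_append, List.mem_singleton]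
      by_cases hwu : w = u
      · simp [hwu]
      · rw [if_neg hwu, ← St.rd, h.seen w hw]; simp [hwu]
    · intro q hq
      rcases lt_or_ge q L.length with hq' | hq'
      · rw [List.getElem_append_left hq', ← h.queue q hq']
        refine List.map_congr_left fun x _ => ?_
        rw [St.rd, m10 _ (by simp; omega)]; rfl
      · have : q = L.length := by simp at hq; omega
        subst this
        rw [List.getElem_concat_length rfl, hu]
        refine List.map_congr_left fun x hx => ?_
        rw [St.rd, m10' x (by simpa using hx)]; rfl
    · rw [e1]
      simp [r3 14, h.qt]
    · intro w hw
      rw [m9] at hw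
      by_cases hwu : w = u
      · simp [hwu]
      · rw [if_neg hwu] at hw
        exact List.mem_append_left _ (h.seen_supp w hw)
    · intro a ha
      by_cases hx : ∃ x < n, a = [L.length, x]
      · obtain ⟨x, hx, rfl⟩ := hx
        exact ⟨_, x, rfl, by simp, hx⟩
      · rw [m10 a (by push Not at hx; exact hx)] at ha
        obtain ⟨q, x, h1, h2, h3⟩ := h.queue_supp a ha
        exact ⟨q, x, h1, by simp; omega, h3⟩
    · intro a h1 h2
      rw [hmem, b4 _ (fun x _ => h2 _)]
      simp [hσ2, hσ1, h1]
    · rw [e1]; exact b2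
    · rw [e1]; exact b3
    · intro q h1 h2
      rw [e1]
      simp only [Function.update_of_ne h1]
      exact r3 q h2

end Extract
end RankedEnum

namespace RankedEnum

universe u

/-! ### Extraction of one candidate and the list of results found. -/

section ExtractStep

def extractHead : Program := seqs [
  .store [.const 8, .const 0, .reg 3] (.const 0),
  .set 8 (.const 0),
  .set 9 (.reg 3)]

/-- Expands the candidate in register 3, whose tree is in register 22. -/
def dispatch (plan : ℕ → Plan) (nt n : ℕ) : Program :=
  seqs ((List.range nt).map fun τ => .ite (.eq (.reg 22) (.const τ)) (expand (plan τ) n τ) skip)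

/-- Extracts a lightest candidate from the priority queue and expands it. -/
def popOne (plan : ℕ → Plan) (nt n : ℕ) : Program :=
  .seq (.load 3 [.const 8, .reg 0, .const 0])
    (.ite (.eq (.reg 3) (.const 0)) skip
      (.seq (.seq extractHead fixLoop)
        (.seq (.seq (.load 22 [.const 7, .reg 3, .const 0]) (.load 4 [.const 7, .reg 3, .const 1]))
          (dispatch plan nt n))))

variable {W : Type u} [CommSemiring W]

/-- Extraction clears the leaf and repairs its path to the root. The data of the candidate stay in
memory, since its children are built from its rows. -/
theorem spec_extract {e : Env W} {E : EnumState} {L : List (List ℕ)} {σ : St W}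
    {p H : ℕ} (hC : CandRep e E σ) (hQ : QueueRep E σ) (hO : OutRep e.n L σ) (h3 : σ.reg 3 = p)
    (hp : E.Mem p) (hH : 2 * E.N + 1 ≤ 2 ^ H) :
    Spec (.seq extractHead fixLoop) (cost extractHead + (cost fixBody + 1) * H + 2) σ fun σ' =>
      CandRep e (E.pop p) σ' ∧ QueueRep (E.pop p) σ' ∧ OutRep e.n L σ' ∧ σ'.out = σ.out ∧
      ∀ q, 12 ≤ q ∧ q < 24 ∨ q = 3 → σ'.reg q = σ.reg q := by
  refine Spec.eval_seq (by simp [extractHead, loopFree_seqs, LoopFree])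
    ((cost fixBody + 1) * H + 1) (by omega) ?_
  set σ1 := eval extractHead σ with hσ1
  have e1 : σ1.mem = Function.update σ.mem [8, 0, p] (some 0) ∧ σ1.wmem = σ.wmem ∧
      σ1.out = σ.out ∧ σ1.reg 8 = 0 ∧ σ1.reg 9 = p ∧
      ∀ q, q ≠ 8 → q ≠ 9 → σ1.reg q = σ.reg q := by
    simp only [hσ1, extractHead, eval_seqs_cons, eval_seqs_nil, eval, List.map_cons, List.map_nil,
      St.val, h3]
    refine ⟨trivial, trivial, trivial, by simp, by simp [h3], fun q h8 h9 => by simp [h8, h9]⟩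
  obtain ⟨b1, b2, b3, b4, b5, b6⟩ := e1
  clear_value σ1
  obtain ⟨h, hh⟩ : ∃ h, h = σ.reg 0 := ⟨_, rfl⟩
  have hhH : h ≤ H := by
    have := hQ.cap_le
    rw [← hh] at this
    exact (Nat.pow_le_pow_iff_right (a := 2) (by omega)).1 (by omega)
  have hlt : p < 2 ^ h := by rw [hh]; exact lt_of_le_of_lt hp.2 hQ.lt_cap
  have m8 : ∀ a, 8 :: a ≠ [8, 0, p] → σ1.mem (8 :: a) = σ.mem (8 :: a) := by
    intro a ha; rw [b1, Function.update_of_ne ha]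
  have rd8 : ∀ l i, (l = 0 → i ≠ p) → σ1.rd [8, l, i] = σ.rd [8, l, i] := by
    intro l i hli
    rw [St.rd, m8 _ (by simpa using hli)]; rfl
  have hf := spec_fixLoop hlt h σ1 0 (by omega) ((b6 0 (by omega) (by omega)).trans hh.symm) b4
    (by simpa using b5) (by
      intro l' hl' i hi
      have hi := hi.resolve_left (by omega)
      have hch : ∀ i', i' / 2 = i → l' = 0 → i' ≠ p := by
        rintro i' hi' rfl rfl
        simp only [zero_add, pow_one] at hi; omega
      unfold NodeOk
      rw [rd8 (l' + 1) i (by omega), rd8 l' (2 * i) (hch _ (by omega)),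
        rd8 l' (2 * i + 1) (hch _ (by omega))]
      simp only [St.wrd, b2]
      exact hQ.node l' (by omega) i) (by
      intro a ha
      by_cases hx : 8 :: a = [8, 0, p]
      · exact ⟨0, p, hx, by omega, by simpa using hlt⟩
      · rw [m8 a hx] at ha
        rw [hh]
        exact hQ.supp _ ha)
  refine hf.mono (by gcongr) ?_
  rintro σ' ⟨g1, g2, g3, g4, g5, g6⟩
  have hmem : ∀ a, (∀ l, a ≠ 8 :: l) → σ'.mem a = σ.mem a := by
    intro a ha
    rw [g2 a fun l i => ha _, b1, Function.update_of_ne (ha _)]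
  have hr : ∀ q, 12 ≤ q ∧ q < 24 ∨ q < 8 → σ'.reg q = σ.reg q := by
    intro q hq
    rw [g6 q (by omega) (by omega) (by omega) (by omega) (by omega) (by omega),
      b6 q (by omega) (by omega)]
  refine ⟨?_, ?_, ?_, g5.trans b3, fun q hq => hr q (by omega)⟩
  · refine hC.congr ?_ ?_ ?_ (g4.trans b2) (hr 1 (by omega)) rfl rfl rfl rfl
    · intro a ha
      refine hmem a ?_
      rintro l rfl
      exact ha (enumAddr (by omega) (by omega))
    · intro a; exact hmem _ (by simp)
    · intro a; exact hmem _ (by simp)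
  · have s0 : σ'.reg 0 = h := by rw [hr 0 (by omega), hh]
    refine ⟨?_, ?_, ?_, ?_, ?_, ?_⟩
    · rw [s0, hr 2 (by omega), hh, hQ.cap]
    · rw [s0, hh]; exact hQ.lt_cap
    · rw [s0, hh]; exact hQ.cap_le
    · intro id
      rw [St.rd, g2 _ (by simp)]
      by_cases hx : id = p
      · subst hx
        rw [b1, Function.update_self, if_neg]
        · rfl
        · rintro ⟨-, h⟩; exact h (Finset.mem_insert_self _ _)
      · have := hQ.leaf id
        rw [m8 _ (by simpa using hx), ← St.rd, this]
        have e2 : (E.Mem id ∧ id ∉ E.popped) ↔ ((E.pop p).Mem id ∧ id ∉ (E.pop p).popped) := by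
          simp only [EnumState.pop, Finset.mem_insert, EnumState.Mem, hx, false_or]
        by_cases hc : E.Mem id ∧ id ∉ E.popped
        · rw [if_pos hc, if_pos (e2.1 hc)]
        · rw [if_neg hc, if_neg fun h => hc (e2.2 h)]
    · rw [s0]; exact g1
    · rw [s0]; exact g3
  · refine hO.congr ?_ ?_ (hr 14 (by omega))
    · intro a; exact hmem _ (by simp)
    · intro a; exact hmem _ (by simp)

theorem spec_expand (hW : Selective W) {e : Env W} (he : e.Ok) {K : ℕ}
    (hK : CostBound e.plan e.nt e.n K) {E : EnumState} {L : List (List ℕ)} {σ : St W}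
    (hR : EnumRep e E L σ) {p : ℕ} {H : ℕ} (hp : p ∈ E.popped)
    (hn : ∀ j side, ¬ E.done p j side)
    (hord : ∀ q ∈ E.popped, wle (E.wt e.T q) (E.wt e.T p)) (h3 : σ.reg 3 = p)
    (h4 : σ.reg 4 = E.dev p) (hH : 2 * (E.N + 2 * e.mm) + 3 ≤ 2 ^ H) {v : ℕ → ℕ}
    (hv : (e.T (E.tree p)).Part (e.T (E.tree p)).m (E.rows p) v) :
    Spec (expand (e.plan (E.tree p)) e.n (E.tree p))
      (2 * K + e.mm * (2 * (K * (H + 1)) + 15) + 4) σ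
      fun σ' => ∃ E', EnumRep e E' (addNew L ((List.range e.n).map v)) σ' ∧ E.Ext E' ∧
        E'.N ≤ E.N + 2 * e.mm ∧
        (∀ p' j' side', E'.done p' j' side' ↔
          E.done p' j' side' ∨ (p' = p ∧ E.dev p ≤ j' ∧ j' < (e.T (E.tree p)).m)) ∧
        σ'.out = σ.out ∧ ∀ q, 12 ≤ q ∧ q < 14 ∨ 15 ≤ q ∧ q < 23 → σ'.reg q = σ.reg q := by
  have hpm := hR.inv.popped_mem p hp
  have hτ := (hR.inv.cand p hpm).1
  obtain ⟨a1, a2, a3, a4, a5⟩ := eval_loadCand (P := e.plan (E.tree p)) (τ := E.tree p)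
    (T := e.T (E.tree p)) (mem₀ := e.mem) (wmem₀ := e.wmem) rfl σ
    (fun l => hR.cand.base _ (not_enumAddr (by omega)))
    (fun l => by rw [h3]; exact hR.cand.rows p hpm l) hv
  have hlf : LoopFree (.seq (loadCand (e.plan (E.tree p)) (E.tree p)) (record e.n)) :=
    ⟨loopFree_loadCand _ _, loopFree_record _⟩
  refine Spec.eval_seq hlf (e.mm * (2 * (K * (H + 1)) + 15) + 1) ?_ ?_
  · have := hK.load _ hτ
    have := hK.record
    simp only [cost]; omega
  simp only [eval]
  set σ1 := eval (loadCand (e.plan (E.tree p)) (E.tree p)) σ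
  have hO1 : OutRep e.n L σ1 := hR.out.congr (fun _ => by rw [a1]) (fun _ => by rw [a1])
    (a5 14 (by omega) (by omega) (by omega))
  obtain ⟨b1, b2, b3, b4, b5⟩ := eval_record hO1 (u := (List.range e.n).map v) (by
    refine List.map_congr_left fun x hx => ?_
    obtain ⟨l, hl, hx'⟩ := he.covered _ hτ x (by simpa using hx)
    exact (a4 l hl x hx').symm)
  set σ2 := eval (record e.n) σ1
  have hr : ∀ q, q < 14 ∨ 15 ≤ q ∧ q < 23 → q ≠ 6 → q ≠ 7 → σ2.reg q = σ.reg q := by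
    intro q hq h6 h7
    rw [b5 q (by omega) (by omega), a5 q (by omega) h6 h7]
  have hm : ∀ a, (∀ l, a ≠ 9 :: l) → (∀ l, a ≠ 10 :: l) → σ2.mem a = σ.mem a := by
    intro a h h'; rw [b2 a h h', a1]
  have hR2 : EnumRep e E (addNew L ((List.range e.n).map v)) σ2 := by
    refine ⟨hR.cand.congr ?_ ?_ ?_ (b3.trans a2) (hr 1 (by omega) (by omega) (by omega)) rfl rfl
      rfl rfl, hR.queue.congr ?_ (b3.trans a2) (hr 0 (by omega) (by omega) (by omega))
      (hr 2 (by omega) (by omega) (by omega)) rfl rfl, b1, hR.inv, hR.root⟩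
    · intro a ha
      refine hm a ?_ ?_
      · rintro l rfl; exact ha (enumAddr (by omega) (by omega))
      · rintro l rfl; exact ha (enumAddr (by omega) (by omega))
    · intro a; exact hm _ (by simp) (by simp)
    · intro a; exact hm _ (by simp) (by simp)
    · intro a; exact hm _ (by simp) (by simp)
  refine (spec_expandKids hW he hK hR2 hp hn hord ((hr 3 (by omega) (by omega) (by omega)).trans h3)
    ((hr 4 (by omega) (by omega) (by omega)).trans h4) hH).mono le_rfl ?_
  rintro σ' ⟨E', c1, c2, c3, c4, c5, c6⟩
  refine ⟨E', c1, c2, c3, c4, c5.trans (b4.trans a3), fun q hq => ?_⟩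
  rw [c6 q (by omega), hr q (by omega) (by omega) (by omega)]

/-- The list `L` consists of the results found by the extracted candidates, all of which have been
expanded. -/
structure Found (e : Env W) (E : EnumState) (L : List (List ℕ)) : Prop where
  sat : ∀ p ∈ E.popped, ∀ j side, E.dev p ≤ j → j < (e.T (E.tree p)).m → E.done p j side
  nodup : L.Nodup
  found : ∀ p ∈ E.popped, ∀ v, (e.T (E.tree p)).Part (e.T (E.tree p)).m (E.rows p) v →
    (List.range e.n).map v ∈ L
  source : ∀ u ∈ L, ∃ p ∈ E.popped, ∃ v,
    (e.T (E.tree p)).Part (e.T (E.tree p)).m (E.rows p) v ∧ u = (List.range e.n).map v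
  sorted : L.Pairwise fun u u' => wle (e.ω u) (e.ω u')

/-- Every variable occurs in some bag, so the rows determine the assignment. -/
theorem Env.Ok.result_eq {e : Env W} (he : e.Ok) {τ : ℕ} (hτ : τ < e.nt) {s v v' : ℕ → ℕ}
    (h : (e.T τ).Part (e.T τ).m s v) (h' : (e.T τ).Part (e.T τ).m s v') :
    (List.range e.n).map v = (List.range e.n).map v' := by
  refine List.map_congr_left fun x hx => ?_
  obtain ⟨l, hl, hxl⟩ := he.covered τ hτ x (by simpa using hx)
  rw [← (h l hl).2.2 x hxl, ← (h' l hl).2.2 x hxl]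

theorem mem_addNew {L : List (List ℕ)} {u w : List ℕ} : w ∈ addNew L u ↔ w ∈ L ∨ w = u := by
  unfold addNew
  split_ifs with h
  · constructor
    · exact .inl
    · rintro (h' | rfl)
      · exact h'
      · exact h
  · simp

theorem prefix_addNew (L : List (List ℕ)) (u : List ℕ) : L <+: addNew L u := by
  unfold addNew
  split_ifs
  · exact List.prefix_rfl
  · exact List.prefix_append _ _

/-- A new result is not lighter than the earlier ones, because each of these stems from a candidate
extracted before `p`. A duplicate leaves the list unchanged. -/
theorem Found.step {e : Env W} (he : e.Ok) {E E' : EnumState} {L : List (List ℕ)}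
    (hF : Found e E L) (hI : E.Inv e.T e.nt) {p : ℕ} (hp : E.Mem p) (hpn : p ∉ E.popped)
    {v : ℕ → ℕ} (hv : (e.T (E.tree p)).Part (e.T (E.tree p)).m (E.rows p) v)
    (hE : (E.pop p).Ext E') (hd : ∀ p' j' side', E'.done p' j' side' ↔
      E.done p' j' side' ∨ (p' = p ∧ E.dev p ≤ j' ∧ j' < (e.T (E.tree p)).m)) :
    Found e E' (addNew L ((List.range e.n).map v)) := by
  have hpop : ∀ q, q ∈ E'.popped ↔ q = p ∨ q ∈ E.popped := by
    intro q; rw [hE.popped]; exact Finset.mem_insert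
  have hmem : ∀ q, q ∈ E'.popped → E.Mem q := by
    intro q hq
    rcases (hpop q).1 hq with rfl | hq
    · exact hp
    · exact hI.popped_mem q hq
  have ht := fun q hq => hE.tree q (hmem q hq)
  have hdv := fun q hq => hE.dev q (hmem q hq)
  have hrw := fun q hq => hE.rows q (hmem q hq)
  simp only [EnumState.pop] at ht hdv hrw
  refine ⟨?_, ?_, ?_, ?_, ?_⟩
  · intro q hq j side h1 h2
    rw [hdv q hq] at h1
    rw [ht q hq] at h2
    rw [hd]
    rcases (hpop q).1 hq with rfl | hq'
    · exact .inr ⟨rfl, h1, h2⟩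
    · exact .inl (hF.sat q hq' j side h1 h2)
  · unfold addNew
    split_ifs with h
    · exact hF.nodup
    · exact List.nodup_append'.2 ⟨hF.nodup, List.nodup_singleton _, by simpa using h⟩
  · intro q hq v' hv'
    rw [ht q hq, hrw q hq] at hv'
    rw [mem_addNew]
    rcases (hpop q).1 hq with rfl | hq'
    · exact .inr (he.result_eq (hI.cand q hp).1 hv' hv)
    · exact .inl (hF.found q hq' v' hv')
  · intro w hw
    rcases mem_addNew.1 hw with hw | rfl
    · obtain ⟨q, hq, v', h1, h2⟩ := hF.source w hw
      have hq' := (hpop q).2 (.inr hq)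
      exact ⟨q, hq', v', by rw [ht q hq', hrw q hq']; exact h1, h2⟩
    · have hq' := (hpop p).2 (.inl rfl)
      exact ⟨p, hq', v, by rw [ht p hq', hrw p hq']; exact hv, rfl⟩
  · unfold addNew
    split_ifs with h
    · exact hF.sorted
    · rw [List.pairwise_append]
      refine ⟨hF.sorted, List.pairwise_singleton _ _, ?_⟩
      intro w hw w' hw'
      rw [List.mem_singleton.1 hw']
      obtain ⟨q, hq, v', h1, rfl⟩ := hF.source w hw
      have hqm := hI.popped_mem q hq
      rw [← he.weight _ (hI.cand q hqm).1 _ _ h1, ← he.weight _ (hI.cand p hp).1 _ _ hv]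
      exact hI.order q hq p hp hpn

/-- All candidates have been extracted. -/
def EnumState.AllPopped (E : EnumState) : Prop := ∀ id, E.Mem id → id ∈ E.popped

/-- The time for the extraction of one candidate. -/
def popTime (K nt mm H : ℕ) : ℕ :=
  K * H + cost extractHead + nt * (2 * K + mm * (2 * (K * (H + 1)) + 15) + 6) + 12

theorem spec_popOne (hW : Selective W) {e : Env W} (he : e.Ok) {K : ℕ}
    (hK : CostBound e.plan e.nt e.n K) {E : EnumState} {L : List (List ℕ)} {σ : St W} {H : ℕ}
    (hR : EnumRep e E L σ) (hF : Found e E L) (hH : 2 * (E.N + 2 * e.mm) + 3 ≤ 2 ^ H) :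
    Spec (popOne e.plan e.nt e.n) (popTime K e.nt e.mm H) σ fun σ' =>
      ∃ E' L', EnumRep e E' L' σ' ∧ Found e E' L' ∧ L <+: L' ∧ E'.N ≤ E.N + 2 * e.mm ∧
        ((E.AllPopped ∧ E' = E ∧ L' = L) ∨
          (¬ E.AllPopped ∧ E'.popped.card = E.popped.card + 1)) ∧
        σ'.out = σ.out ∧ σ'.reg 13 = σ.reg 13 ∧ σ'.reg 15 = σ.reg 15 := by
  unfold popTime
  set B := 2 * K + e.mm * (2 * (K * (H + 1)) + 15) with hB
  set B' := e.nt * (B + 6) with hB'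
  refine Spec.eval_seq (p := .load 3 [.const 8, .reg 0, .const 0]) trivial
    (K * H + cost extractHead + B' + 10)
    (by simp only [cost]; omega) ?_
  set σ1 := eval (.load 3 [.const 8, .reg 0, .const 0]) σ with hσ1
  have e3 : σ1.reg 3 = σ.rd [8, σ.reg 0, 0] := by simp [hσ1, eval]
  have er : ∀ q, q ≠ 3 → σ1.reg q = σ.reg q := fun q hq => by simp [hσ1, eval, hq]
  have eo : σ1.mem = σ.mem ∧ σ1.wmem = σ.wmem ∧ σ1.out = σ.out := ⟨rfl, rfl, rfl⟩
  have hR1 : EnumRep e E L σ1 := ⟨hR.cand.congr (fun _ _ => rfl) (fun _ => rfl) (fun _ => rfl) rfl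
    (er 1 (by omega)) rfl rfl rfl rfl, hR.queue.congr (fun _ => rfl) rfl (er 0 (by omega))
    (er 2 (by omega)) rfl rfl, hR.out.congr (fun _ => rfl) (fun _ => rfl) (er 14 (by omega)),
    hR.inv, hR.root⟩
  clear_value σ1
  set p := σ.rd [8, σ.reg 0, 0] with hp
  refine (Spec.ite (t := K * H + cost extractHead + B' + 9) (fun h0 => ?_)
    fun h0 => ?_).mono (by omega) fun _ h => h
  · have h0 : p = 0 := by simpa [St.holds, e3] using h0
    refine (spec_skip ⟨E, L, hR1, hF, List.prefix_rfl, by omega, .inl ⟨?_, rfl, rfl⟩, eo.2.2,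
      er 13 (by omega), er 15 (by omega)⟩).mono (by omega) fun _ h => h
    intro id hid
    by_contra hc
    exact (hR.queue.min hW hR.cand hid hc).1 h0
  · have h0 : p ≠ 0 := by simpa [St.holds, e3] using h0
    obtain ⟨hpm, hpn⟩ := hR.queue.mem_of_node hW le_rfl h0
    rw [← hp] at hpm hpn
    have hmin := fun id hid hn => (hR.queue.min hW hR.cand (id := id) hid hn).2
    rw [← hp] at hmin
    have hx := spec_extract (p := p) (H := H) hR1.cand hR1.queue hR1.out e3 hpm (by omega)
    have k1 := Nat.mul_le_mul_right H hK.fix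
    refine Spec.seq_of_le (K * H + cost extractHead + 2) (B' + 6) (by omega)
      (hx.mono (by omega) ?_)
    rintro σ2 ⟨a1, a2, a3, a4, a5⟩
    have hpm' : (E.pop p).Mem p := hpm
    refine Spec.eval_seq (p := .seq (.load 22 [.const 7, .reg 3, .const 0])
      (.load 4 [.const 7, .reg 3, .const 1])) ⟨trivial, trivial⟩ (B' + 1)
      (by simp only [cost]; omega) ?_
    set σ3 := eval (.seq (.load 22 [.const 7, .reg 3, .const 0])
      (.load 4 [.const 7, .reg 3, .const 1])) σ2 with hσ3
    have r3 : σ2.reg 3 = p := (a5 3 (by omega)).trans e3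
    have s22 : σ3.reg 22 = E.tree p := by
      simp only [hσ3, eval, List.map_cons, List.map_nil, St.val, r3]
      simp [a1.tree p hpm', EnumState.pop]
    have s4 : σ3.reg 4 = E.dev p := by
      simp only [hσ3, eval, List.map_cons, List.map_nil, St.val, r3]
      have := a1.dev p hpm'
      simp only [EnumState.pop] at this
      rw [Function.update_self, ← this]
      simp [St.rd, r3]
    have sr : ∀ q, q ≠ 22 → q ≠ 4 → σ3.reg q = σ2.reg q := by
      intro q h1 h2; simp [hσ3, eval, h1, h2]
    have so : σ3.out = σ2.out := rfl
    have hR3 : EnumRep e (E.pop p) L σ3 := ⟨a1.congr (fun _ _ => rfl) (fun _ => rfl) (fun _ => rfl)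
      rfl (sr 1 (by omega) (by omega)) rfl rfl rfl rfl, a2.congr (fun _ => rfl) rfl
      (sr 0 (by omega) (by omega)) (sr 2 (by omega) (by omega)) rfl rfl,
      a3.congr (fun _ => rfl) (fun _ => rfl) (sr 14 (by omega) (by omega)), hR.inv.pop hpm hmin,
      hR.root⟩
    clear_value σ3
    obtain ⟨hτ, v, hv, -⟩ := hR.inv.cand p hpm
    have hexp := spec_expand hW he hK hR3 (p := p) (H := H) (Finset.mem_insert_self _ _)
      (by
        intro j side hd
        exact hpn (hR.inv.done_mem p j side hd).1)
      (by
        intro q hq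
        rcases Finset.mem_insert.1 hq with rfl | hq
        · exact wle_refl hW _
        · exact hR.inv.order q hq p hpm hpn)
      ((sr 3 (by omega) (by omega)).trans r3) s4 hH hv
    simp only [EnumState.pop] at hexp
    -- Only the iteration for `E.tree p` acts. The later ones are passed over because the expansion
    -- preserves register 22.
    have hd := spec_seqs_range (fun τ => Program.ite (.eq (.reg 22) (.const τ))
        (expand (e.plan τ) e.n τ) skip)
      (fun i (σ' : St W) => (i ≤ E.tree p → σ' = σ3) ∧ (E.tree p < i →
        ∃ E', EnumRep e E' (addNew L ((List.range e.n).map v)) σ' ∧ (E.pop p).Ext E' ∧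
        E'.N ≤ E.N + 2 * e.mm ∧
        (∀ p' j' side', E'.done p' j' side' ↔
          E.done p' j' side' ∨ (p' = p ∧ E.dev p ≤ j' ∧ j' < (e.T (E.tree p)).m)) ∧
        σ'.out = σ3.out ∧ ∀ q, 12 ≤ q ∧ q < 14 ∨ 15 ≤ q ∧ q < 23 → σ'.reg q = σ3.reg q))
      e.nt (B + 5) σ3 ⟨fun _ => rfl, fun h => absurd h (by omega)⟩ ?_
    · refine hd.mono le_rfl ?_
      rintro σ' ⟨-, h⟩
      obtain ⟨E', c1, c2, c3, c4, c5, c6⟩ := h hτ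
      refine ⟨E', _, c1, hF.step he hR.inv hpm hpn hv c2 c4, prefix_addNew _ _, c3,
        .inr ⟨fun h => hpn (h p hpm), ?_⟩, ?_, ?_, ?_⟩
      · rw [c2.popped]; exact Finset.card_insert_of_notMem hpn
      · rw [c5, so, a4, eo.2.2]
      · rw [c6 13 (by omega), sr 13 (by omega) (by omega), a5 13 (by omega), er 13 (by omega)]
      · rw [c6 15 (by omega), sr 15 (by omega) (by omega), a5 15 (by omega), er 15 (by omega)]
    · rintro i hi σ4 ⟨d1, d2⟩
      refine Spec.ite (t := B + 4) (fun h => ?_) (fun h => ?_)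
      · have h22 : σ4.reg 22 = E.tree p := by
          rcases lt_or_ge (E.tree p) i with hlt | hge
          · obtain ⟨E', -, -, -, -, -, c6⟩ := d2 hlt
            rw [c6 22 (by omega), s22]
          · rw [d1 hge, s22]
        have hi' : i = E.tree p := by
          simp only [St.holds, St.val, h22] at h; exact h.symm
        subst hi'
        rw [d1 le_rfl]
        refine hexp.mono (by omega) ?_
        intro σ' h'
        exact ⟨fun h => absurd h (by omega), fun _ => h'⟩
      · have hi' : i ≠ E.tree p := by
          rintro rfl
          rw [d1 le_rfl] at h
          exact h (by simp [St.holds, s22])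
        refine (spec_skip ?_).mono (by omega) fun _ h => h
        exact ⟨fun h => d1 (by omega), fun h => d2 (by omega)⟩

end ExtractStep
end RankedEnum

namespace RankedEnum

universe u

/-! ### Initialisation and one round of the main loop. -/

section EnumLoop

/-- Inserts the best solution of the tree `τ`. -/
def addRoot (P : Plan) (τ : ℕ) : Program :=
  .seq (if P.m = 0 then .set 5 (.const 1) else .load 5 [.const 2, .const τ, .const 0])
    (.ite (.eq (.reg 5) (.const 0)) skip (build P τ 0))

/-- The empty queue has height `0` and capacity `1`. Register 3 must not be the number of the
candidate about to be built, and `0` is the number of none. -/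
def initRegs : Program := seqs [
  .set 0 (.const 0), .set 1 (.const 0), .set 2 (.const 1), .set 3 (.const 0),
  .set 13 (.const 0), .set 14 (.const 0), .set 15 (.const 1)]

def initEnum (plan : ℕ → Plan) (nt : ℕ) : Program :=
  .seq initRegs (seqs ((List.range nt).map fun τ => addRoot (plan τ) τ))

def emitRow (n : ℕ) : Program :=
  .seq (seqs ((List.range n).map fun x => .load (40 + x) [.const 10, .reg 13, .const x]))
    (.seq (.output (regs (List.range n))) (.add 13 (.reg 13) (.const 1)))

/-- Outputs the next result, or ends the main loop if there is none. -/
def emit (n : ℕ) : Program :=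
  .ite (.lt (.reg 13) (.reg 14)) (emitRow n) (.set 15 (.const 0))

def enumRound (plan : ℕ → Plan) (nt n : ℕ) : Program :=
  .seq (seqs ((List.range nt).map fun _ => popOne plan nt n)) (emit n)

def enumLoop (plan : ℕ → Plan) (nt n : ℕ) : Program :=
  .while (.lt (.const 0) (.reg 15)) (enumRound plan nt n)

variable {W : Type u} [CommSemiring W]

def EnumState.empty : EnumState := ⟨0, fun _ => 0, fun _ => 0, fun _ _ => 0, ∅, fun _ _ _ => False⟩

theorem EnumState.not_mem_empty (id : ℕ) : ¬ EnumState.empty.Mem id := by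
  simp only [Mem, empty]; omega

theorem EnumState.inv_empty (T : ℕ → Tree W) (nt : ℕ) : EnumState.empty.Inv T nt where
  cand id h := absurd h (not_mem_empty id)
  inj id _ h := absurd h (not_mem_empty id)
  origin id h := absurd h (not_mem_empty id)
  done_mem _ _ _ h := h.elim
  popped_mem p h := by simp [empty] at h
  order p h := by simp [empty] at h
  closed _ _ _ h := h.elim

/-- The all-heads solution of every solvable tree becomes a candidate. A tree without bags has the
empty solution, whence the case distinction in `addRoot`. -/
theorem spec_initEnum (hW : Selective W) {e : Env W} (he : e.Ok) {K : ℕ}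
    (hK : CostBound e.plan e.nt e.n K) {σ : St W} (hm : σ.mem = e.mem) (hw : σ.wmem = e.wmem)
    {H : ℕ} (hH : 2 * e.nt + 3 ≤ 2 ^ H) :
    Spec (initEnum e.plan e.nt) (cost initRegs + e.nt * (K * (H + 1) + 6) + 2) σ fun σ' =>
      ∃ E, EnumRep e E [] σ' ∧ E.popped = ∅ ∧ E.N ≤ e.nt ∧ σ'.out = σ.out ∧ σ'.reg 13 = 0 ∧
        σ'.reg 15 = 1 := by
  refine Spec.eval_seq (by simp [initRegs, loopFree_seqs, LoopFree])
    (e.nt * (K * (H + 1) + 6) + 1) (by omega) ?_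
  set σ1 := eval initRegs σ with hσ1
  have a1 : σ1.mem = e.mem ∧ σ1.wmem = e.wmem ∧ σ1.out = σ.out ∧ σ1.reg 0 = 0 ∧ σ1.reg 1 = 0 ∧
      σ1.reg 2 = 1 ∧ σ1.reg 3 = 0 ∧ σ1.reg 13 = 0 ∧ σ1.reg 14 = 0 ∧ σ1.reg 15 = 1 := by
    simp only [hσ1, initRegs, eval_seqs_cons, eval_seqs_nil, eval, St.val]
    refine ⟨hm, hw, trivial, ?_⟩
    simp
  clear_value σ1
  obtain ⟨m1, w1, o1, q0, q1, q2, q3, q13, q14, q15⟩ := a1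
  have hz : ∀ a, EnumAddr a → σ1.mem a = none := fun a ha => by rw [m1]; exact he.fresh a ha
  have hz' : ∀ a, EnumAddr a → σ1.rd a = 0 := fun a ha => by rw [St.rd, hz a ha]; rfl
  have hC : CandRep e .empty σ1 := by
    refine ⟨fun a _ => by rw [m1], fun a _ => by rw [w1], q1, ?_, ?_, ?_, ?_, ?_, ?_, ?_⟩
    · intro id h; exact absurd h (EnumState.not_mem_empty id)
    · intro id h; exact absurd h (EnumState.not_mem_empty id)
    · intro id h; exact absurd h (EnumState.not_mem_empty id)
    · intro id h; exact absurd h (EnumState.not_mem_empty id)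
    · intro a ha; exact absurd (hz _ (enumAddr (by omega) (by omega))) ha
    · intro a ha; exact absurd (hz _ (enumAddr (by omega) (by omega))) ha
    · intro a ha; rw [w1] at ha; exact absurd (he.wfresh a) ha
  have hQ : QueueRep .empty σ1 := by
    refine ⟨by rw [q0, q2]; rfl, by simp [EnumState.empty], by simp [q0, EnumState.empty], ?_,
      ?_, ?_⟩
    · intro id
      rw [hz' _ (enumAddr (by omega) (by omega)), if_neg]
      rintro ⟨h, -⟩; exact absurd h (EnumState.not_mem_empty id)
    · intro l hl; omega
    · intro a ha; exact absurd (hz _ (enumAddr (by omega) (by omega))) ha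
  have hO : OutRep e.n [] σ1 := by
    refine ⟨by simp, ?_, by simp, by simp [q14], ?_, ?_⟩
    · intro u _; simp [hz' (9 :: u) (enumAddr (by omega) (by omega))]
    · intro a ha; exact absurd (hz _ (enumAddr (by omega) (by omega))) ha
    · intro a ha; exact absurd (hz _ (enumAddr (by omega) (by omega))) ha
  have key := spec_seqs_range (fun τ => addRoot (e.plan τ) τ) (fun i (σ' : St W) =>
    ∃ E, CandRep e E σ' ∧ QueueRep E σ' ∧ OutRep e.n [] σ' ∧ E.Inv e.T e.nt ∧
      (∀ τ < i, E.HasRoot e.T τ) ∧ (∀ id, E.Mem id → E.tree id < i) ∧ E.popped = ∅ ∧ E.N ≤ i ∧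
      σ'.out = σ.out ∧ σ'.reg 3 = 0 ∧ σ'.reg 13 = 0 ∧ σ'.reg 15 = 1) e.nt (K * (H + 1) + 5) σ1
    ⟨.empty, hC, hQ, hO, EnumState.inv_empty _ _, fun τ h => absurd h (by omega),
      fun id h => absurd h (EnumState.not_mem_empty id), rfl, le_rfl, o1, q3, q13, q15⟩ ?_
  · refine key.mono le_rfl ?_
    rintro σ' ⟨E, b1, b2, b3, b4, b5, b6, b7, b8, b9, b10, b11, b12⟩
    exact ⟨E, ⟨b1, b2, b3, b4, b5⟩, b7, b8, b9, b11, b12⟩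
  · rintro τ hτ σ2 ⟨E, b1, b2, b3, b4, b5, b6, b7, b8, b9, b10, b11, b12⟩
    set T := e.T τ with hT
    have hTm : (e.plan τ).m = T.m := rfl
    have hTv : T.Valid := he.valid τ hτ
    set p₀ : Program := if (e.plan τ).m = 0 then .set 5 (.const 1)
      else .load 5 [.const 2, .const τ, .const 0] with hp₀
    have hlf : LoopFree p₀ ∧ cost p₀ = 1 := by
      rw [hp₀]; split_ifs <;> exact ⟨trivial, rfl⟩
    refine Spec.eval_seq hlf.1 (K * (H + 1) + 2) (by rw [hlf.2]; omega) ?_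
    set σ3 := eval p₀ σ2 with hσ3
    have c1 : σ3.mem = σ2.mem ∧ σ3.wmem = σ2.wmem ∧ σ3.out = σ2.out ∧
        (T.m = 0 → σ3.reg 5 = 1) ∧ (T.m ≠ 0 → σ3.reg 5 = T.root 0 []) ∧
        ∀ q, q ≠ 5 → σ3.reg q = σ2.reg q := by
      rw [hσ3, hp₀, hTm]
      split_ifs with h
      · simp only [eval, h, Function.update_self]
        refine ⟨trivial, trivial, trivial, fun _ => rfl, fun h => absurd rfl h, fun q hq => ?_⟩
        simp [hq]
      · simp only [eval, h, Function.update_self, List.map_cons, List.map_nil, St.val]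
        refine ⟨trivial, trivial, trivial, fun h => h.elim, fun _ => ?_, fun q hq => ?_⟩
        · rw [St.rd, b1.base _ (not_enumAddr (by omega))]; rfl
        · simp [hq]
    clear_value σ3
    obtain ⟨cm, cw, co, c0, c5, cr⟩ := c1
    have hC3 : CandRep e E σ3 := b1.congr (fun _ _ => by rw [cm]) (fun _ => by rw [cm])
      (fun _ => by rw [cm]) cw (cr 1 (by omega)) rfl rfl rfl rfl
    have hQ3 : QueueRep E σ3 := b2.congr (fun _ => by rw [cm]) cw (cr 0 (by omega))
      (cr 2 (by omega)) rfl rfl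
    have hO3 : OutRep e.n [] σ3 := b3.congr (fun _ => by rw [cm]) (fun _ => by rw [cm])
      (cr 14 (by omega))
    refine (Spec.ite (t := K * (H + 1) + 1) (fun h => ?_) fun h => ?_).mono (by omega) fun _ h => h
    · have h5 : σ3.reg 5 = 0 := by simpa [St.holds] using h
      refine (spec_skip ⟨E, hC3, hQ3, hO3, b4, ?_, fun id hid => (b6 id hid).trans (by omega), b7,
        by omega, co.trans b9, (cr 3 (by omega)).trans b10, (cr 13 (by omega)).trans b11,
        (cr 15 (by omega)).trans b12⟩).mono (by omega) fun _ h => h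
      intro τ' hτ'
      rcases Nat.lt_succ_iff_lt_or_eq.1 hτ' with h' | rfl
      · exact b5 τ' h'
      · rintro (h' | h')
        · rw [c0 h'] at h5; omega
        · have hm0 : T.m ≠ 0 := fun h0 => by rw [c0 h0] at h5; omega
          rw [c5 hm0] at h5
          exact absurd h5 h'
    · have h5 : σ3.reg 5 ≠ 0 := by simpa [St.holds] using h
      have hb := spec_build hW he (σ := σ3) (τ := τ) (j := 0) (H := H) (old := fun _ => 0) hτ
        hC3 hQ3 hO3 (by simp [b7]) (by rw [cr 3 (by omega), b10]; omega)
        (fun l hl => absurd hl (by omega)) (by omega) (fun i hi => absurd hi (by omega))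
        (by
          intro h0 s v _ _
          have hm0 : T.m ≠ 0 := Nat.pos_iff_ne_zero.1 h0
          have hk : T.key 0 v = [] := by simp [Tree.key, hTv.sep_zero]
          rw [c5 hm0] at h5 ⊢
          have := Tree.root_inGrp hTv h0 h5
          rw [← hT, hk]; exact this)
      refine hb.mono ?_ ?_
      · have k1 := hK.build τ hτ 0 (.inl rfl)
        have k2 := Nat.mul_le_mul_right H hK.fix
        rw [Nat.mul_succ]
        omega
      · rintro σ' ⟨s, v, d1, d2, d3, d4, d5, d6, d7, d8, d9, d10⟩
        have hg : T.Greedy 0 s v := by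
          intro l _ hl
          rcases Nat.eq_zero_or_pos l with rfl | h0
          · have hk : T.key 0 v = [] := by simp [Tree.key, hTv.sep_zero]
            rw [d3 hl, hk]; exact c5 (by omega)
          · exact d4 l (by omega) hl
        obtain ⟨f1, f2⟩ := b4.addRoot hτ d1 hg d5
          (fun id hid h => by have := b6 id hid; omega) b7
        refine ⟨E.add τ 0 s, d6, d7, d8, f1, ?_, ?_, b7, by simp only [EnumState.add]; omega,
          d9.trans (co.trans b9), ?_, ?_, ?_⟩
        · intro τ' hτ'
          rcases Nat.lt_succ_iff_lt_or_eq.1 hτ' with h' | rfl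
          · exact (b5 τ' h').add
          · exact f2
        · intro id hid
          rcases EnumState.mem_add.1 hid with hid | rfl
          · rw [(EnumState.add_tree_of_mem hid).1]; exact (b6 id hid).trans (by omega)
          · rw [EnumState.add_tree_new.1]; omega
        · rw [d10 3 (by omega), cr 3 (by omega), b10]
        · rw [d10 13 (by omega), cr 13 (by omega), b11]
        · rw [d10 15 (by omega), cr 15 (by omega), b12]

/-- The state of the machine at the beginning of a round, when `k` results have been output. -/
structure RoundInv (e : Env W) (k : ℕ) (E : EnumState) (L : List (List ℕ)) (σ : St W) : Prop where
  rep : EnumRep e E L σ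
  found : Found e E L
  qh : σ.reg 13 = k
  go : σ.reg 15 = 1
  le : k ≤ L.length
  out : σ.out = L.take k
  card : E.popped.card = e.nt * k ∨ E.AllPopped
  num : E.N ≤ e.nt + 2 * e.mm * (e.nt * k)

/-- The state of the machine at the end of the enumeration. -/
structure FinalInv (e : Env W) (E : EnumState) (L : List (List ℕ)) (σ : St W) : Prop where
  rep : EnumRep e E L σ
  found : Found e E L
  ended : σ.reg 15 = 0
  out : σ.out = L
  all : E.AllPopped

/-- The rows of a bag are distinct as tuples, so a candidate is determined by its tree and its
assignment. Hence each result accounts for at most one extraction per tree; this controls the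
overlap between the trees. -/
theorem Found.card_le {e : Env W} (he : e.Ok) {E : EnumState} {L : List (List ℕ)}
    (hF : Found e E L) (hI : E.Inv e.T e.nt) : E.popped.card ≤ e.nt * L.length := by
  have hv : ∀ p ∈ E.popped, ∃ v, (e.T (E.tree p)).Part (e.T (E.tree p)).m (E.rows p) v := by
    intro p hp
    obtain ⟨-, v, hv, -⟩ := hI.cand p (hI.popped_mem p hp)
    exact ⟨v, hv⟩
  choose! v hv using hv
  have := Finset.card_le_card_of_injOn (s := E.popped) (t := Finset.range e.nt ×ˢ L.toFinset)
    (fun p => (E.tree p, (List.range e.n).map (v p))) (by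
      intro p hp
      simp only [Finset.coe_product, Set.mem_prod, Finset.mem_coe, Finset.mem_range,
        List.mem_toFinset]
      exact ⟨(hI.cand p (hI.popped_mem p hp)).1, hF.found p hp _ (hv p hp)⟩) (by
      intro p hp q hq hpq
      simp only [Prod.mk.injEq] at hpq
      obtain ⟨h1, h2⟩ := hpq
      have hpm := hI.popped_mem p hp
      have hqm := hI.popped_mem q hq
      obtain ⟨hτ, -, -, -, hz⟩ := hI.cand p hpm
      obtain ⟨-, -, -, -, hz'⟩ := hI.cand q hqm
      refine hI.inj p q hpm hqm h1 (funext fun l => ?_)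
      have hvp := hv p hp
      have hvq := hv q hq
      rw [← h1] at hvq hz'
      by_cases hl : l < (e.T (E.tree p)).m
      · obtain ⟨a1, -, a3⟩ := hvp l hl
        obtain ⟨b1, -, b3⟩ := hvq l hl
        refine (he.valid _ hτ).distinct l hl _ _ a1.1 a1.2 b1.1 b1.2 fun x hx => ?_
        rw [a3 x hx, b3 x hx]
        exact List.map_inj_left.1 h2 x (List.mem_range.2 (he.vars_lt _ hτ l hl x hx))
      · rw [hz l (by omega), hz' l (by omega)])
  rwa [Finset.card_product, Finset.card_range, List.toFinset_card_of_nodup hF.nodup] at this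

/-- Every result can be traced to a candidate of its own. Needed for the space of the dictionary and
the list of results. -/
theorem Found.length_le {e : Env W} (he : e.Ok) {E : EnumState} {L : List (List ℕ)}
    (hF : Found e E L) (hI : E.Inv e.T e.nt) : L.length ≤ E.N := by
  choose! p hp v hv hu using hF.source
  rw [← List.toFinset_card_of_nodup hF.nodup]
  have := Finset.card_le_card_of_injOn (s := L.toFinset) (t := Finset.Icc 1 E.N) p (by
      intro u hu'
      have := hI.popped_mem _ (hp u (by simpa using hu'))
      exact Finset.mem_coe.2 (Finset.mem_Icc.2 this)) (by
      intro u hu' w hw' h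
      have hu'' : u ∈ L := by simpa using hu'
      have hw'' : w ∈ L := by simpa using hw'
      rw [hu u hu'', hu w hw'']
      have h1 := hv u hu''
      have h2 := hv w hw''
      rw [← h] at h2
      exact he.result_eq (hI.cand _ (hI.popped_mem _ (hp u hu''))).1 h1 h2)
  simpa using this

theorem loopFree_emitRow (n : ℕ) : LoopFree (emitRow n) := by
  simp [emitRow, loopFree_seqs, LoopFree]

theorem eval_emitRow (n : ℕ) (σ : St W) :
    let σ' := eval (emitRow n) σ
    σ'.mem = σ.mem ∧ σ'.wmem = σ.wmem ∧
    σ'.out = σ.out ++ [(List.range n).map fun x => σ.rd [10, σ.reg 13, x]] ∧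
    σ'.reg 13 = σ.reg 13 + 1 ∧ ∀ q, q < 40 → q ≠ 13 → σ'.reg q = σ.reg q := by
  have := eval_seqs_range (fun x => Program.load (40 + x) [.const 10, .reg 13, .const x])
    (fun i (σ' : St W) => σ'.mem = σ.mem ∧ σ'.wmem = σ.wmem ∧ σ'.out = σ.out ∧
      (∀ x < i, σ'.reg (40 + x) = σ.rd [10, σ.reg 13, x]) ∧ ∀ q, q < 40 → σ'.reg q = σ.reg q)
    n σ ⟨rfl, rfl, rfl, fun _ h => absurd h (by omega), fun _ _ => rfl⟩ (by
      rintro i - σ1 ⟨a1, a2, a3, a4, a5⟩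
      simp only [eval, List.map_cons, List.map_nil, St.val]
      refine ⟨a1, a2, a3, ?_, ?_⟩
      · intro x hx
        by_cases h : x = i
        · subst h; rw [Function.update_self, St.rd, a1, a5 13 (by omega)]; rfl
        · rw [Function.update_of_ne (by omega)]; exact a4 x (by omega)
      · intro q hq
        rw [Function.update_of_ne (by omega)]; exact a5 q hq)
  obtain ⟨a1, a2, a3, a4, a5⟩ := this
  simp only [emitRow, eval, regs_val, St.val]
  refine ⟨a1, a2, ?_, ?_, ?_⟩
  · rw [a3]
    congr 2
    exact List.map_congr_left fun x hx => a4 x (by simpa using hx)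
  · rw [Function.update_self, a5 13 (by omega)]
  · intro q h1 h2
    rw [Function.update_of_ne h2, a5 q h1]

/-- The time for one round. -/
def roundTime (K nt mm n H : ℕ) : ℕ := nt * (popTime K nt mm H + 1) + cost (emitRow n) + 5

/-- If `e.nt * (k + 1)` candidates have been extracted, `Found.card_le` guarantees a result that has
not been output. If nothing is left to output, then all candidates have been extracted and the
enumeration is complete. -/
theorem spec_round (hW : Selective W) {e : Env W} (he : e.Ok) {K : ℕ}
    (hK : CostBound e.plan e.nt e.n K) {k : ℕ} {E : EnumState} {L : List (List ℕ)} {σ : St W}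
    {H : ℕ} (hI : RoundInv e k E L σ)
    (hH : 2 * (e.nt + 2 * e.mm * (e.nt * (k + 1))) + 3 ≤ 2 ^ H) :
    Spec (enumRound e.plan e.nt e.n) (roundTime K e.nt e.mm e.n H) σ fun σ' =>
      ∃ E' L', L <+: L' ∧ E'.N ≤ e.nt + 2 * e.mm * (e.nt * (k + 1)) ∧
        (RoundInv e (k + 1) E' L' σ' ∨ FinalInv e E' L' σ' ∧ L'.length = k) := by
  unfold roundTime
  have hp := spec_seqs_range (fun _ => popOne e.plan e.nt e.n) (fun i (σ' : St W) =>
    ∃ E' L', EnumRep e E' L' σ' ∧ Found e E' L' ∧ L <+: L' ∧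
      E'.N ≤ e.nt + 2 * e.mm * (e.nt * k + i) ∧
      (E'.popped.card = e.nt * k + i ∨ E'.AllPopped) ∧
      σ'.out = σ.out ∧ σ'.reg 13 = σ.reg 13 ∧ σ'.reg 15 = σ.reg 15) e.nt (popTime K e.nt e.mm H) σ
    ⟨E, L, hI.rep, hI.found, List.prefix_rfl, hI.num, hI.card, rfl, rfl, rfl⟩ (by
      rintro i hi σ1 ⟨E1, L1, a1, a2, a3, a4, a5, a6, a7, a8⟩
      have hle : 2 * e.mm * (e.nt * k + i) + 2 * e.mm ≤ 2 * e.mm * (e.nt * (k + 1)) := by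
        calc _ = 2 * e.mm * (e.nt * k + i + 1) := by ring
          _ ≤ _ := by apply Nat.mul_le_mul_left; rw [Nat.mul_succ]; omega
      refine (spec_popOne hW he hK (H := H) a1 a2 (by omega)).mono le_rfl ?_
      rintro σ2 ⟨E2, L2, b1, b2, b3, b4, b5, b6, b7, b8⟩
      refine ⟨E2, L2, b1, b2, a3.trans b3, ?_, ?_, b6.trans a6, b7.trans a7, b8.trans a8⟩
      · calc E2.N ≤ _ := b4
          _ ≤ e.nt + 2 * e.mm * (e.nt * k + i) + 2 * e.mm := by omega
          _ = _ := by ring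
      · rcases b5 with ⟨h1, rfl, -⟩ | ⟨h1, h2⟩
        · exact .inr h1
        · exact .inl (by have := a5.resolve_right h1; omega))
  refine Spec.seq_of_le _ (cost (emitRow e.n) + 2) (by omega) (hp.mono le_rfl ?_)
  rintro σ1 ⟨E1, L1, a1, a2, a3, a4, a5, a6, a7, a8⟩
  have hnum : E1.N ≤ e.nt + 2 * e.mm * (e.nt * (k + 1)) := by rw [Nat.mul_succ e.nt]; exact a4
  have h14 := a1.out.qt
  have hk1 : k ≤ L1.length := hI.le.trans a3.length_le
  have h13 : σ1.reg 13 = k := a7.trans hI.qh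
  have hout : σ1.out = L1.take k := by
    obtain ⟨l, rfl⟩ := a3
    rw [a6, hI.out, List.take_append_of_le_length hI.le]
  have hcongr : ∀ σ2 : St W, σ2.mem = σ1.mem → σ2.wmem = σ1.wmem →
      (∀ q, q < 40 → q ≠ 13 → q ≠ 15 → σ2.reg q = σ1.reg q) → EnumRep e E1 L1 σ2 := by
    intro σ2 hm hw hr
    exact ⟨a1.cand.congr (fun _ _ => by rw [hm]) (fun _ => by rw [hm]) (fun _ => by rw [hm]) hw
      (hr 1 (by omega) (by omega) (by omega)) rfl rfl rfl rfl,
      a1.queue.congr (fun _ => by rw [hm]) hw (hr 0 (by omega) (by omega) (by omega))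
        (hr 2 (by omega) (by omega) (by omega)) rfl rfl,
      a1.out.congr (fun _ => by rw [hm]) (fun _ => by rw [hm])
        (hr 14 (by omega) (by omega) (by omega)), a1.inv, a1.root⟩
  refine (Spec.ite (t := cost (emitRow e.n) + 1) (fun h => ?_) fun h => ?_).mono (by omega)
    fun _ h => h
  · have hlt : k < L1.length := by simpa [St.holds, h13, h14] using h
    obtain ⟨b1, b2, b3, b4, b5⟩ := eval_emitRow e.n σ1
    refine (Spec.of_eval (loopFree_emitRow e.n) ?_).mono (Nat.le_succ _) fun _ h => h
    refine ⟨E1, L1, a3, hnum, .inl ⟨hcongr _ b1 b2 fun q h1 h2 _ => b5 q h1 h2, a2, ?_, ?_, hlt,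
      ?_, ?_, hnum⟩⟩
    · rw [b4, h13]
    · rw [b5 15 (by omega) (by omega), a8, hI.go]
    · rw [b3, hout, h13, a1.out.queue k hlt, List.take_concat_get' _ _ hlt]
    · rw [Nat.mul_succ]; exact a5
  · have hge : L1.length = k := by
      have : ¬ k < L1.length := by simpa [St.holds, h13, h14] using h
      omega
    refine (Spec.of_eval (p := .set 15 (.const 0)) trivial ?_).mono (by simp [cost]) fun _ h => h
    refine ⟨E1, L1, a3, hnum, .inr ⟨⟨hcongr _ rfl rfl ?_, a2, ?_, ?_, ?_⟩, hge⟩⟩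
    · intro q _ _ h15
      simp [eval, h15]
    · simp [eval]
    · show σ1.out = _
      rw [hout, ← hge, List.take_length]
    -- Without a new result, the number of extractions would exceed `e.nt * k`; the exception is
    -- that there are no trees, and then there is no candidate either.
    · rcases a5 with h1 | h1
      · intro id hid
        exfalso
        have hnt := (a1.inv.cand id hid).1
        have := a2.card_le he a1.inv
        rw [hge] at this
        omega
      · exact h1

end EnumLoop
end RankedEnum

namespace RankedEnum

universe u

/-! ### Space of the enumeration and the sequence of rounds. -/

section EnumRun

variable {W : Type u} [CommSemiring W]

/-- `u` is the list of values of a solution of one of the trees. -/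
def Env.IsRes (e : Env W) (u : List ℕ) : Prop :=
  ∃ τ < e.nt, ∃ s v, (e.T τ).Part (e.T τ).m s v ∧ u = (List.range e.n).map v

theorem Found.isRes {e : Env W} {E : EnumState} {L : List (List ℕ)} (hF : Found e E L)
    (hI : E.Inv e.T e.nt) {u : List ℕ} (hu : u ∈ L) : e.IsRes u := by
  obtain ⟨p, hp, v, hv, rfl⟩ := hF.source u hu
  exact ⟨_, (hI.cand p (hI.popped_mem p hp)).1, _, v, hv, rfl⟩

theorem FinalInv.mem_iff {e : Env W} (he : e.Ok) {E : EnumState} {L : List (List ℕ)} {σ : St W}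
    (h : FinalInv e E L σ) {u : List ℕ} : u ∈ L ↔ e.IsRes u := by
  refine ⟨h.found.isRes h.rep.inv, ?_⟩
  rintro ⟨τ, hτ, s, v, hp, rfl⟩
  obtain ⟨id, h1, rfl, h3⟩ := h.rep.inv.complete he.valid h.all h.found.sat hτ
    (h.rep.root τ hτ) hp
  refine h.found.found id (h.all id h1) v fun l hl => ?_
  rw [h3 l hl]
  exact hp l hl

theorem encard_le_of_subset_image {α β : Type*} [DecidableEq β] {s : Set β} (t : Finset α)
    (f : α → β) (h : s ⊆ f '' t) {n : ℕ} (hn : t.card ≤ n) : s.encard ≤ n := by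
  calc s.encard ≤ (f '' (t : Set α)).encard := Set.encard_le_encard h
    _ ≤ (t : Set α).encard := Set.encard_image_le _ _
    _ = t.card := Set.encard_coe_eq_coe_finsetCard _
    _ ≤ n := by exact_mod_cast hn

/-- The levels of a complete binary tree form a geometric sum. -/
theorem encard_queueAddr_le (h : ℕ) : {a | QueueAddr h a}.encard ≤ ((2 * 2 ^ h : ℕ) : ℕ∞) := by
  refine encard_le_of_subset_image ((Finset.range (h + 1)).sigma fun l => Finset.range (2 ^ (h - l)))
    (fun x => [8, x.1, x.2]) ?_ ?_
  · rintro a ⟨l, i, rfl, hl, hi⟩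
    exact ⟨⟨l, i⟩, by simp; omega, rfl⟩
  · rw [Finset.card_sigma]
    simp only [Finset.card_range]
    have := Finset.sum_range_reflect (fun l => 2 ^ l) (h + 1)
    simp only [Nat.add_sub_cancel] at this
    rw [this, Nat.geomSum_eq le_rfl, pow_succ]
    omega

/-- The space used by the enumeration. -/
theorem EnumRep.space_le {e : Env W} (he : e.Ok) {E : EnumState} {L : List (List ℕ)} {σ : St W}
    (hR : EnumRep e E L σ) (hF : Found e E L) :
    σ.space ≤ {a | e.mem a ≠ none}.encard + {a | e.wmem a ≠ none}.encard +
      (((E.N + 1) * (e.mm + e.n + 8) : ℕ) : ℕ∞) := by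
  have hL := hF.length_le he hR.inv
  set N := E.N
  have h6 : {a | ∃ b, a = 6 :: b ∧ σ.mem a ≠ none}.encard ≤ (((N + 1) * e.mm : ℕ) : ℕ∞) := by
    refine encard_le_of_subset_image (Finset.range (N + 1) ×ˢ Finset.range e.mm)
      (fun x => [6, x.1, x.2]) ?_ (by simp)
    rintro a ⟨b, rfl, hb⟩
    obtain ⟨id, l, rfl, h1, h2⟩ := hR.cand.rows_supp b hb
    exact ⟨(id, l), by simp; omega, rfl⟩
  have h7 : {a | ∃ b, a = 7 :: b ∧ σ.mem a ≠ none}.encard ≤ (((N + 1) * 2 : ℕ) : ℕ∞) := by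
    refine encard_le_of_subset_image (Finset.range (N + 1) ×ˢ Finset.range 2)
      (fun x => [7, x.1, x.2]) ?_ (by simp)
    rintro a ⟨b, rfl, hb⟩
    obtain ⟨id, l, rfl, h1, h2⟩ := hR.cand.tree_supp b hb
    exact ⟨(id, l), by simp; omega, rfl⟩
  have h8 : {a | ∃ b, a = 8 :: b ∧ σ.mem a ≠ none}.encard ≤ (((N + 1) * 4 : ℕ) : ℕ∞) := by
    refine (Set.encard_le_encard ?_).trans ((encard_queueAddr_le (σ.reg 0)).trans ?_)
    · rintro a ⟨b, rfl, hb⟩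
      exact hR.queue.supp b hb
    · have := hR.queue.cap_le
      norm_cast
      omega
  have h9 : {a | ∃ b, a = 9 :: b ∧ σ.mem a ≠ none}.encard ≤ ((N : ℕ) : ℕ∞) := by
    refine encard_le_of_subset_image L.toFinset (fun x => 9 :: x) ?_
      ((List.toFinset_card_le L).trans hL)
    rintro a ⟨b, rfl, hb⟩
    exact ⟨b, by simpa using hR.out.seen_supp b hb, rfl⟩
  have h10 : {a | ∃ b, a = 10 :: b ∧ σ.mem a ≠ none}.encard ≤ ((N * e.n : ℕ) : ℕ∞) := by
    refine encard_le_of_subset_image (Finset.range N ×ˢ Finset.range e.n)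
      (fun x => [10, x.1, x.2]) ?_ (by simp)
    rintro a ⟨b, rfl, hb⟩
    obtain ⟨id, l, rfl, h1, h2⟩ := hR.out.queue_supp b hb
    exact ⟨(id, l), by simp; omega, rfl⟩
  have hw : {a | ∃ b, a = 6 :: b ∧ σ.wmem a ≠ none}.encard ≤ ((N + 1 : ℕ) : ℕ∞) := by
    refine encard_le_of_subset_image (Finset.range (N + 1)) (fun x => [6, x]) ?_ (by simp)
    rintro a ⟨b, rfl, hb⟩
    obtain ⟨id, rfl, h1⟩ := hR.cand.wt_supp b hb
    exact ⟨id, by simp; omega, rfl⟩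
  have hmem : {a | σ.mem a ≠ none} ⊆ {a | e.mem a ≠ none} ∪
      ({a | ∃ b, a = 6 :: b ∧ σ.mem a ≠ none} ∪ ({a | ∃ b, a = 7 :: b ∧ σ.mem a ≠ none} ∪
      ({a | ∃ b, a = 8 :: b ∧ σ.mem a ≠ none} ∪ ({a | ∃ b, a = 9 :: b ∧ σ.mem a ≠ none} ∪
      {a | ∃ b, a = 10 :: b ∧ σ.mem a ≠ none})))) := by
    intro a ha
    by_cases hx : EnumAddr a
    · right
      obtain ⟨hd, l, h1, h2, rfl⟩ := hx
      have : hd = 6 ∨ hd = 7 ∨ hd = 8 ∨ hd = 9 ∨ hd = 10 := by omega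
      rcases this with rfl | rfl | rfl | rfl | rfl
      · exact .inl ⟨l, rfl, ha⟩
      · exact .inr (.inl ⟨l, rfl, ha⟩)
      · exact .inr (.inr (.inl ⟨l, rfl, ha⟩))
      · exact .inr (.inr (.inr (.inl ⟨l, rfl, ha⟩)))
      · exact .inr (.inr (.inr (.inr ⟨l, rfl, ha⟩)))
    · left
      show e.mem a ≠ none
      rw [← hR.cand.base a hx]; exact ha
  have hwmem : {a | σ.wmem a ≠ none} ⊆ {a | e.wmem a ≠ none} ∪
      {a | ∃ b, a = 6 :: b ∧ σ.wmem a ≠ none} := by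
    intro a ha
    by_cases hx : ∃ l, a = 6 :: l
    · obtain ⟨l, rfl⟩ := hx
      exact .inr ⟨l, rfl, ha⟩
    · left
      show e.wmem a ≠ none
      rw [← hR.cand.wbase a fun l h => hx ⟨l, h⟩]; exact ha
  have b1 := (Set.encard_le_encard hmem).trans ((Set.encard_union_le _ _).trans (add_le_add le_rfl
    ((Set.encard_union_le _ _).trans (add_le_add h6 ((Set.encard_union_le _ _).trans
      (add_le_add h7 ((Set.encard_union_le _ _).trans (add_le_add h8
        ((Set.encard_union_le _ _).trans (add_le_add h9 h10))))))))))
  have b2 := (Set.encard_le_encard hwmem).trans ((Set.encard_union_le _ _).trans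
    (add_le_add le_rfl hw))
  refine (add_le_add b1 b2).trans ?_
  rw [add_add_add_comm]
  refine add_le_add le_rfl ?_
  norm_cast
  have : N * e.n ≤ (N + 1) * e.n := Nat.mul_le_mul_right _ (Nat.le_succ N)
  calc _ ≤ (N + 1) * e.mm + ((N + 1) * 2 + ((N + 1) * 4 + (N + 1 + (N + 1) * e.n))) + (N + 1) := by
        omega
    _ = _ := by ring

/-- A process that makes steps until it is finished. -/
theorem exists_chain {claim fin : ℕ → ℕ → Prop} {R : ℕ → ℕ} {B t₀ : ℕ} (h0 : claim 0 t₀)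
    (step : ∀ k t, claim k t → (∃ t' ≤ t + R k, claim (k + 1) t') ∨ fin k t)
    (bound : ∀ k t, claim k t → k ≤ B) :
    ∃ M, ∃ t : ℕ → ℕ, t 0 = t₀ ∧ (∀ k ≤ M, claim k (t k)) ∧ (∀ k < M, t (k + 1) ≤ t k + R k) ∧
      fin M (t M) := by
  -- If no stage were final, the chain could be prolonged beyond `B`.
  by_contra hcon
  have H : ∀ M, ∃ t : ℕ → ℕ, t 0 = t₀ ∧ (∀ k ≤ M, claim k (t k)) ∧
      ∀ k < M, t (k + 1) ≤ t k + R k := by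
    intro M
    induction M with
    | zero =>
      refine ⟨fun _ => t₀, rfl, fun k hk => ?_, fun k hk => absurd hk (by omega)⟩
      rwa [Nat.le_zero.1 hk]
    | succ M ih =>
      obtain ⟨t, h1, h2, h3⟩ := ih
      rcases step M (t M) (h2 M le_rfl) with ⟨t', h4, h5⟩ | h4
      · refine ⟨Function.update t (M + 1) t', ?_, ?_, ?_⟩
        · rw [Function.update_of_ne (by omega), h1]
        · intro k hk
          rcases Nat.le_succ_iff.1 hk with hk | rfl
          · rw [Function.update_of_ne (by omega)]; exact h2 k hk
          · rw [Function.update_self]; exact h5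
        · intro k hk
          rw [Function.update_of_ne (a' := M + 1) (a := k) (by omega)]
          rcases Nat.lt_succ_iff_lt_or_eq.1 hk with hk | rfl
          · rw [Function.update_of_ne (by omega)]; exact h3 k hk
          · rw [Function.update_self]; exact h4
      · exact absurd ⟨M, t, h1, h2, h3, h4⟩ hcon
  obtain ⟨t, -, h2, -⟩ := H (B + 1)
  have := bound _ _ (h2 (B + 1) le_rfl)
  omega

variable {Q : CQ} {P : Program} {D : Database Q W}

/-- The enumeration phase of a run. -/
theorem enum_run (hW : Selective W) {e : Env W} (he : e.Ok) {K : ℕ}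
    (hK : CostBound e.plan e.nt e.n K) {t₀ B : ℕ} {σ₀ : St W} {E₀ : EnumState}
    (hrun : run P D t₀ = σ₀.cfg [enumLoop e.plan e.nt e.n]) (h0 : RoundInv e 0 E₀ [] σ₀)
    (hB : ∀ L : List (List ℕ), L.Nodup → (∀ u ∈ L, e.IsRes u) → L.length ≤ B)
    {H : ℕ → ℕ} (hH : ∀ k, 2 * (e.nt + 2 * e.mm * (e.nt * (k + 1))) + 3 ≤ 2 ^ H k) :
    ∃ (L : List (List ℕ)) (t : ℕ → ℕ) (tf : ℕ), t 0 = t₀ ∧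
      (∀ k ≤ L.length, ¬ (run P D (t k)).halted ∧ (run P D (t k)).out.length = k ∧
        (run P D (t k)).space ≤ {a | e.mem a ≠ none}.encard + {a | e.wmem a ≠ none}.encard +
          (((e.nt + 2 * e.mm * (e.nt * k) + 1) * (e.mm + e.n + 8) : ℕ) : ℕ∞)) ∧
      (∀ k < L.length, t (k + 1) ≤ t k + (roundTime K e.nt e.mm e.n (H k) + 1)) ∧
      tf ≤ t L.length + (roundTime K e.nt e.mm e.n (H L.length) + 2) ∧
      (run P D tf).halted ∧ (run P D tf).out = L ∧
      (run P D tf).space ≤ {a | e.mem a ≠ none}.encard + {a | e.wmem a ≠ none}.encard +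
          (((e.nt + 2 * e.mm * (e.nt * (L.length + 1)) + 1) * (e.mm + e.n + 8) : ℕ) : ℕ∞) ∧
      L.Nodup ∧ L.Pairwise (fun u u' => wle (e.ω u) (e.ω u')) ∧ ∀ u, u ∈ L ↔ e.IsRes u := by
  have sp : ∀ {E : EnumState} {L : List (List ℕ)} {σ : St W} {n : ℕ}, EnumRep e E L σ →
      Found e E L → E.N ≤ n → σ.space ≤ {a | e.mem a ≠ none}.encard +
        {a | e.wmem a ≠ none}.encard + (((n + 1) * (e.mm + e.n + 8) : ℕ) : ℕ∞) := by
    intro E L σ n h1 h2 h3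
    refine (h1.space_le he h2).trans (add_le_add le_rfl ?_)
    exact_mod_cast Nat.mul_le_mul_right _ (by omega)
  -- A stage is a moment at the head of the main loop when exactly `k` results are out. The finite
  -- number of results bounds the number of stages, so the machine halts.
  obtain ⟨M, t, h1, h2, h3, h4⟩ := exists_chain (t₀ := t₀) (B := B)
    (R := fun k => roundTime K e.nt e.mm e.n (H k) + 1)
    (claim := fun k t => ∃ E L σ, run P D t = σ.cfg [enumLoop e.plan e.nt e.n] ∧
      RoundInv e k E L σ)
    (fin := fun k t => ∃ E L σ, ∃ tf ≤ t + (roundTime K e.nt e.mm e.n (H k) + 2),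
      run P D tf = σ.cfg [] ∧ FinalInv e E L σ ∧ L.length = k ∧
      E.N ≤ e.nt + 2 * e.mm * (e.nt * (k + 1))) ⟨_, _, _, hrun, h0⟩
    (by
      rintro k t ⟨E, L, σ, hr, hI⟩
      obtain ⟨σ', s, hs, hrn, E', L', -, hN, hp⟩ := spec_round hW he hK hI (hH k)
      have hr' : run P D (t + (s + 1)) = σ'.cfg [enumLoop e.plan e.nt e.n] := by
        rw [run_add, hr, Function.iterate_succ_apply, enumLoop, step_while,
          if_pos (by simp [St.holds, hI.go]), hrn]
      rcases hp with hp | ⟨hp, hl⟩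
      · exact .inl ⟨_, by omega, E', L', σ', hr', hp⟩
      · refine .inr ⟨E', L', σ', t + (s + 1) + 1, by omega, ?_, hp, hl, hN⟩
        rw [run_succ, hr', enumLoop, step_while, if_neg (by simp [St.holds, hp.ended])])
    (by
      rintro k t ⟨E, L, σ, -, hI⟩
      exact hI.le.trans (hB L hI.found.nodup fun u hu => hI.found.isRes hI.rep.inv hu))
  obtain ⟨E, L, σ, tf, hle, hr, hF, rfl, hN⟩ := h4
  refine ⟨L, t, tf, h1, ?_, h3, hle, ?_, ?_, ?_, hF.found.nodup, hF.found.sorted,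
    fun u => hF.mem_iff he⟩
  · intro k hk
    obtain ⟨E', L', σ', hr', hI⟩ := h2 k hk
    rw [hr']
    refine ⟨by simp [Config.halted, St.cfg], ?_, sp hI.rep hI.found hI.num⟩
    show σ'.out.length = k
    rw [hI.out, List.length_take, min_eq_left hI.le]
  · rw [hr]; rfl
  · rw [hr]; exact hF.out
  · rw [hr]; exact sp hF.rep hF.found hN

end EnumRun
end RankedEnum

namespace RankedEnum

universe u

/-! ### Copying the input into the arena. -/

section CopyInput

/-- Copies the tuple whose number is in register 16 to the arena, and enters its weight in the
dictionary of weights. -/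
def copyRow (r a : ℕ) : Program := seqs [
  seqs ((List.range a).map fun c => .load (40 + c) [.const 0, .const r, .reg 16, .const c]),
  seqs ((List.range a).map fun c =>
    .store [.const 5, .const 0, .const r, .reg 16, .const c] (.reg (40 + c))),
  .wload 1 [.const 0, .const r, .reg 16],
  .wstore [.const 5, .const 0, .const r, .reg 16] 1,
  .wstore (.const 2 :: .const r :: regs (List.range a)) 1,
  .add 16 (.reg 16) (.const 1)]

def copyHead (r : ℕ) : Program := seqs [
  .load 17 [.const 0, .const r], .store [.const 5, .const 0, .const r] (.reg 17),
  .set 16 (.const 0)]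

def copyRel (r a : ℕ) : Program :=
  .seq (copyHead r) (.while (.lt (.reg 16) (.reg 17)) (copyRow r a))

/-- The arity of the `r`-th relation. -/
def CQ.ar (Q : CQ) (r : ℕ) : ℕ := if h : r < Q.numRels then Q.arity ⟨r, h⟩ else 0

/-- Copies the input to the arena. -/
def copyAll (Q : CQ) : Program := seqs ((List.range Q.numRels).map fun r => copyRel r (Q.ar r))

theorem loopFree_copyRow (r a : ℕ) : LoopFree (copyRow r a) := by
  simp [copyRow, loopFree_seqs, LoopFree]

variable {W : Type u} [CommSemiring W]

theorem eval_copyRow (r a : ℕ) (σ : St W) {j : ℕ} (hj : σ.reg 16 = j) {row : List ℕ}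
    (hrow : row = (List.range a).map fun c => σ.rd [0, r, j, c]) :
    let σ' := eval (copyRow r a) σ
    (∀ x, (∀ c < a, x ≠ [5, 0, r, j, c]) → σ'.mem x = σ.mem x) ∧
    (∀ c < a, σ'.mem [5, 0, r, j, c] = some (σ.rd [0, r, j, c])) ∧
    σ'.wmem = Function.update (Function.update σ.wmem [5, 0, r, j] (some (σ.wrd [0, r, j])))
      (2 :: r :: row) (some (σ.wrd [0, r, j])) ∧
    σ'.out = σ.out ∧ σ'.reg 16 = j + 1 ∧
    (∀ q, q < 40 ∨ 40 + a ≤ q → q ≠ 16 → σ'.reg q = σ.reg q) ∧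
    ∀ q, q ≠ 1 → σ'.wreg q = σ.wreg q := by
  obtain ⟨a1, a2, a3, a4, a5, a6⟩ := eval_seqs_range
    (fun c => Program.load (40 + c) [.const 0, .const r, .reg 16, .const c])
    (fun i (σ' : St W) => σ'.mem = σ.mem ∧ σ'.wmem = σ.wmem ∧ σ'.out = σ.out ∧
      (∀ c < i, σ'.reg (40 + c) = σ.rd [0, r, j, c]) ∧
      (∀ q, q < 40 ∨ 40 + i ≤ q → σ'.reg q = σ.reg q) ∧ σ'.wreg = σ.wreg)
    a σ ⟨rfl, rfl, rfl, fun _ h => absurd h (by omega), fun _ _ => rfl, rfl⟩ (by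
      rintro i - σ1 ⟨a1, a2, a3, a4, a5, a6⟩
      simp only [eval, List.map_cons, List.map_nil, St.val]
      refine ⟨a1, a2, a3, ?_, ?_, a6⟩
      · intro x hx
        by_cases h : x = i
        · subst h; rw [Function.update_self, St.rd, a1, a5 16 (by omega), hj]; rfl
        · rw [Function.update_of_ne (by omega)]; exact a4 x (by omega)
      · intro q hq
        rw [Function.update_of_ne (by omega)]; exact a5 q (by omega))
  set σ1 := eval (seqs ((List.range a).map fun c =>
    .load (40 + c) [.const 0, .const r, .reg 16, .const c])) σ with hσ1
  obtain ⟨b1, b2, b3, b4, b5, b6⟩ := eval_seqs_range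
    (fun c => Program.store [.const 5, .const 0, .const r, .reg 16, .const c] (.reg (40 + c)))
    (fun n (σ' : St W) => σ'.reg = σ1.reg ∧ σ'.wmem = σ1.wmem ∧ σ'.out = σ1.out ∧
    (∀ x, (∀ c < n, x ≠ [5, 0, r, j, c]) → σ'.mem x = σ1.mem x) ∧
    (∀ c < n, σ'.mem [5, 0, r, j, c] = some (σ1.reg (40 + c))) ∧ σ'.wreg = σ1.wreg) a σ1
    ⟨rfl, rfl, rfl, fun _ _ => rfl, fun _ h => absurd h (by omega), rfl⟩ (by
      rintro i - σ2 ⟨a1, a2, a3, a4, a5', a6⟩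
      simp only [eval, List.map_cons, List.map_nil, St.val, a1, true_and]
      rw [a5 16 (by omega), hj]
      refine ⟨a2, a3, ?_, ?_, a6⟩
      · intro x hx
        rw [Function.update_of_ne (hx i (by omega))]
        exact a4 x fun c hc => hx c (by omega)
      · intro x hx
        by_cases h : x = i
        · subst h; simp
        · rw [Function.update_of_ne (by simpa using h)]
          exact a5' x (by omega))
  set σ2 := eval (seqs ((List.range a).map fun c =>
    .store [.const 5, .const 0, .const r, .reg 16, .const c] (.reg (40 + c)))) σ1 with hσ2
  have hrow' : row = (List.range a).map fun c => σ2.reg (40 + c) := by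
    rw [hrow]
    refine List.map_congr_left fun c hc => ?_
    rw [b1, a4 c (by simpa using hc)]
  have h16 : σ2.reg 16 = j := by rw [b1, a5 16 (by omega), hj]
  intro σ'
  have e : σ' = eval (copyRow r a) σ := rfl
  simp only [copyRow, eval_seqs_cons, eval_seqs_nil, ← hσ1, ← hσ2] at e
  simp only [eval, List.map_cons, List.map_nil, St.val, h16, regs_val, ← hrow',
    Function.update_self] at e
  rw [e]
  have hwr : σ2.wrd [0, r, j] = σ.wrd [0, r, j] := by rw [St.wrd, b2, a2]; rfl
  refine ⟨?_, ?_, ?_, b3.trans a3, by simp, ?_, ?_⟩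
  · intro x hx
    show σ2.mem x = _
    rw [b4 x hx, a1]
  · intro c hc
    show σ2.mem _ = _
    rw [b5 c hc, a4 c hc]
  · simp only [hwr, b2, a2]
  · intro q hq h
    simp only [Function.update_of_ne h]
    rw [b1, a5 q hq]
  · intro q h
    simp only [Function.update_of_ne h]
    rw [b6, a6]

variable {Q : CQ}

omit [CommSemiring W] in
theorem inputMem_head (D : Database Q W) (r : Fin Q.numRels) :
    inputMem D [0, r] = some (D.rows r).length := by
  simp [inputMem]

omit [CommSemiring W] in
theorem inputMem_row (D : Database Q W) (r : Fin Q.numRels) {j : ℕ} (hj : j < (D.rows r).length)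
    {c : ℕ} (hc : c < Q.arity r) : inputMem D [0, r, j, c] = some ((D.rows r)[j] ⟨c, hc⟩) := by
  simp [inputMem, hj, hc]

omit [CommSemiring W] in
theorem inputWMem_row (D : Database Q W) (r : Fin Q.numRels) {j : ℕ}
    (hj : j < (D.rows r).length) :
    inputWMem D [0, r, j] = some (D.weight r (D.rows r)[j]) := by
  simp [inputWMem, hj]

/-- In the course of the copying, each cell of the arena is empty or correct. -/
structure CopyInv (D : Database Q W) (s : ℕ) (σ : St W) : Prop where
  base : ∀ a, (∀ l, a ≠ 5 :: l) → σ.mem a = inputMem D a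
  wbase : ∀ a, (∀ l, a ≠ 5 :: l) → (∀ l, a ≠ 2 :: l) → σ.wmem a = inputWMem D a
  sub : ∀ a, σ.mem (5 :: a) = none ∨ σ.mem (5 :: a) = inputMem D a
  wsub : ∀ a, σ.wmem (5 :: a) = none ∨ σ.wmem (5 :: a) = inputWMem D a
  out : σ.out = []
  reg : ∀ q, s ≤ q → σ.reg q = 0
  wreg : ∀ q, 2 ≤ q → σ.wreg q = 1

structure RowDone (D : Database Q W) (σ : St W) (r : Fin Q.numRels) (j : ℕ) : Prop where
  mem : ∀ c < Q.arity r, σ.mem [5, 0, r, j, c] = inputMem D [0, r, j, c]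
  wmem : σ.wmem [5, 0, r, j] = inputWMem D [0, r, j]
  dict : ∀ hj : j < (D.rows r).length, σ.wmem (2 :: r :: List.ofFn (D.rows r)[j]) =
    some (D.weight r (D.rows r)[j])

structure RelDone (D : Database Q W) (σ : St W) (r : Fin Q.numRels) : Prop where
  head : σ.mem [5, 0, r] = inputMem D [0, r]
  row : ∀ j < (D.rows r).length, RowDone D σ r j

/-- `Done` carries along the relations that have been copied before, since their cells have to
survive. -/
theorem spec_copyLoop (D : Database Q W) (s : ℕ) (r : Fin Q.numRels) (hs : 40 + Q.arity r ≤ s)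
    (Done : Fin Q.numRels → Prop) (d : ℕ) : ∀ (σ : St W) (j : ℕ),
    j + d = (D.rows r).length → σ.reg 16 = j → σ.reg 17 = (D.rows r).length → CopyInv D s σ →
    (∀ r', Done r' → RelDone D σ r') → σ.mem [5, 0, r] = inputMem D [0, r] →
    (∀ j' < j, RowDone D σ r j') →
    Spec (.while (.lt (.reg 16) (.reg 17)) (copyRow r (Q.arity r)))
      (d * (cost (copyRow r (Q.arity r)) + 1) + 1) σ fun σ' =>
      CopyInv D s σ' ∧ RelDone D σ' r ∧ ∀ r', Done r' → RelDone D σ' r' := by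
  induction d with
  | zero =>
    intro σ j hd h16 h17 hI hD hh hr
    refine (Spec.while_false (by simp [St.holds, h16, h17]; omega) ?_).mono (by omega) fun _ h => h
    exact ⟨hI, ⟨hh, fun j' hj' => hr j' (by omega)⟩, hD⟩
  | succ d ih =>
    intro σ j hd h16 h17 hI hD hh hr
    have hj : j < (D.rows r).length := by omega
    have hrd : ∀ c (hc : c < Q.arity r), σ.rd [0, r, j, c] = (D.rows r)[j] ⟨c, hc⟩ := by
      intro c hc
      rw [St.rd, hI.base _ (by simp), inputMem_row D r hj hc]; rfl
    have hw : σ.wrd [0, r, j] = D.weight r (D.rows r)[j] := by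
      rw [St.wrd, hI.wbase _ (by simp) (by simp), inputWMem_row D r hj]; rfl
    obtain ⟨a1, a2, a3, a4, a5, a6, a7⟩ := eval_copyRow r (Q.arity r) σ h16
      (row := List.ofFn (D.rows r)[j]) (by
        refine List.ext_getElem (by simp) fun c h1 h2 => ?_
        simp only [List.getElem_ofFn, List.getElem_map, List.getElem_range]
        rw [hrd c (by simpa using h1)])
    rw [hw] at a3
    set σ1 := eval (copyRow r (Q.arity r)) σ with hσ1
    have mmem : ∀ a, σ.mem (5 :: a) = inputMem D a → σ1.mem (5 :: a) = inputMem D a := by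
      intro a ha
      by_cases hx : ∃ c < Q.arity r, 5 :: a = [5, 0, (r : ℕ), j, c]
      · obtain ⟨c, hc, hx⟩ := hx
        rw [hx, a2 c hc]
        simp only [List.cons.injEq, true_and] at hx
        rw [hx, inputMem_row D r hj hc, hrd c hc]
      · push Not at hx
        rw [a1 _ hx, ha]
    have mw : ∀ a, σ.wmem (5 :: a) = inputWMem D a → σ1.wmem (5 :: a) = inputWMem D a := by
      intro a ha
      rw [a3, Function.update_of_ne (by simp)]
      by_cases hx : a = [0, (r : ℕ), j]
      · rw [hx, Function.update_self, inputWMem_row D r hj]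
      · rw [Function.update_of_ne (by simpa using hx), ha]
    -- The address determines relation and tuple, so an entry can be overwritten only by the same
    -- weight.
    have mdict : ∀ (r' : Fin Q.numRels) (row : Fin (Q.arity r') → ℕ),
        σ.wmem (2 :: r' :: List.ofFn row) = some (D.weight r' row) →
        σ1.wmem (2 :: r' :: List.ofFn row) = some (D.weight r' row) := by
      intro r' row ha
      rw [a3]
      by_cases hx : (2 :: (r' : ℕ) :: List.ofFn row) = 2 :: (r : ℕ) :: List.ofFn (D.rows r)[j]
      · rw [hx, Function.update_self]
        simp only [List.cons.injEq, true_and] at hx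
        obtain ⟨h1, h2⟩ := hx
        have h1 : r' = r := Fin.ext h1
        subst h1
        rw [List.ofFn_injective h2]
      · rw [Function.update_of_ne hx, Function.update_of_ne (by simp), ha]
    have mrow : ∀ r' j', RowDone D σ r' j' → RowDone D σ1 r' j' := fun r' j' h =>
      ⟨fun c hc => mmem _ (h.mem c hc), mw _ h.wmem, fun hj => mdict _ _ (h.dict hj)⟩
    have hspec := ih σ1 (j + 1) (by omega) a5 (by rw [a6 17 (by omega) (by omega), h17])
      (by
        refine ⟨?_, ?_, ?_, ?_, a4.trans hI.out, ?_, ?_⟩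
        · intro a ha
          rw [a1 a fun c _ => ha _, hI.base a ha]
        · intro a ha ha'
          rw [a3, Function.update_of_ne (ha' _), Function.update_of_ne (ha _), hI.wbase a ha ha']
        · intro a
          by_cases hx : ∃ c < Q.arity r, 5 :: a = [5, 0, (r : ℕ), j, c]
          · right
            obtain ⟨c, hc, hx⟩ := hx
            rw [hx, a2 c hc]
            simp only [List.cons.injEq, true_and] at hx
            rw [hx, inputMem_row D r hj hc, hrd c hc]
          · push Not at hx
            rw [a1 _ hx]; exact hI.sub a
        · intro a
          rw [a3, Function.update_of_ne (by simp)]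
          by_cases hx : a = [0, (r : ℕ), j]
          · rw [hx, Function.update_self, inputWMem_row D r hj]; exact .inr rfl
          · rw [Function.update_of_ne (by simpa using hx)]; exact hI.wsub a
        · intro q hq
          rw [a6 q (by omega) (by omega), hI.reg q hq]
        · intro q hq
          rw [a7 q (by omega), hI.wreg q hq])
      (fun r' h => ⟨mmem _ (hD r' h).head, fun j' hj' => mrow _ _ ((hD r' h).row j' hj')⟩)
      (mmem _ hh)
      (by
        intro j' hj'
        rcases Nat.lt_succ_iff_lt_or_eq.1 hj' with h | rfl
        · exact mrow _ _ (hr j' h)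
        · refine ⟨?_, ?_, ?_⟩
          · intro c hc
            rw [a2 c hc, inputMem_row D r hj hc, hrd c hc]
          · rw [a3, Function.update_of_ne (by simp), Function.update_self, inputWMem_row D r hj]
          · intro _
            rw [a3, Function.update_self])
    refine (Spec.while_true (by simp [St.holds, h16, h17]; omega)
      (Spec.of_eval (loopFree_copyRow _ _) hspec)).mono ?_ fun _ h => h
    rw [Nat.succ_mul]; omega

theorem spec_copyRel (D : Database Q W) (s : ℕ) (r : Fin Q.numRels) (hs : 40 + Q.arity r ≤ s)
    (Done : Fin Q.numRels → Prop) (σ : St W) (hI : CopyInv D s σ)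
    (hD : ∀ r', Done r' → RelDone D σ r') :
    Spec (copyRel r (Q.arity r))
      ((D.rows r).length * (cost (copyRow r (Q.arity r)) + 1) + 9) σ fun σ' =>
      CopyInv D s σ' ∧ RelDone D σ' r ∧ ∀ r', Done r' → RelDone D σ' r' := by
  refine Spec.eval_seq (by simp [copyHead, loopFree_seqs, LoopFree])
    ((D.rows r).length * (cost (copyRow r (Q.arity r)) + 1) + 1)
    (by simp only [copyHead, seqs, skip, cost]; omega) ?_
  set σ1 := eval (copyHead r) σ with hσ1
  have hrd : σ.rd [0, r] = (D.rows r).length := by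
    rw [St.rd, hI.base _ (by simp), inputMem_head]; rfl
  have a : σ1.mem = Function.update σ.mem [5, 0, r] (some (D.rows r).length) ∧
      σ1.wmem = σ.wmem ∧ σ1.out = σ.out ∧ σ1.wreg = σ.wreg ∧ σ1.reg 16 = 0 ∧
      σ1.reg 17 = (D.rows r).length ∧ ∀ q, q ≠ 16 → q ≠ 17 → σ1.reg q = σ.reg q := by
    simp only [hσ1, copyHead, eval_seqs_cons, eval_seqs_nil, eval, List.map_cons, List.map_nil,
      St.val, hrd]
    refine ⟨by simp, trivial, trivial, trivial, by simp, by simp, fun q h1 h2 => by simp [h1, h2]⟩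
  clear_value σ1
  obtain ⟨a1, a2, a3, a4, a5, a6, a7⟩ := a
  have mmem : ∀ a, σ.mem (5 :: a) = inputMem D a → σ1.mem (5 :: a) = inputMem D a := by
    intro a ha
    rw [a1]
    by_cases hx : a = [0, (r : ℕ)]
    · rw [hx, Function.update_self, inputMem_head]
    · rw [Function.update_of_ne (by simpa using hx), ha]
  refine spec_copyLoop D s r hs Done (D.rows r).length σ1 0 (by omega) a5 a6 ?_ ?_ ?_ ?_
  · refine ⟨?_, ?_, ?_, ?_, a3.trans hI.out, ?_, ?_⟩
    · intro a ha
      rw [a1, Function.update_of_ne (ha _), hI.base a ha]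
    · intro a ha ha'
      rw [a2, hI.wbase a ha ha']
    · intro a
      rw [a1]
      by_cases hx : a = [0, (r : ℕ)]
      · rw [hx, Function.update_self, inputMem_head]; exact .inr rfl
      · rw [Function.update_of_ne (by simpa using hx)]; exact hI.sub a
    · intro a
      rw [a2]; exact hI.wsub a
    · intro q hq
      rw [a7 q (by omega) (by omega), hI.reg q hq]
    · intro q hq
      rw [a4, hI.wreg q hq]
  · intro r' h
    refine ⟨mmem _ (hD r' h).head, fun j' hj' => ?_⟩
    have := (hD r' h).row j' hj'
    exact ⟨fun c hc => mmem _ (this.mem c hc), by rw [a2]; exact this.wmem,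
      fun hj => by rw [a2]; exact this.dict hj⟩
  · rw [a1, Function.update_self, inputMem_head]
  · intro j' hj'; omega

/-- The state after the input has been copied. -/
theorem spec_copyAll (Q : CQ) : ∃ C, ∀ {W : Type u} [CommSemiring W] (D : Database Q W) (s : ℕ)
    (σ : St W), (∀ r, 40 + Q.arity r ≤ s) → CopyInv D s σ →
    Spec (copyAll Q) (C * (D.maxCard + 1)) σ fun σ' => CopyInv D s σ' ∧ ∀ r, RelDone D σ' r := by
  obtain ⟨C, hC⟩ := exists_uniform_bound (p := fun r C => cost (copyRow r (Q.ar r)) + 1 ≤ C)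
    Q.numRels (fun _ _ _ h h' => h'.trans h) (fun r _ => ⟨_, le_rfl⟩)
  refine ⟨Q.numRels * (C + 10) + 1, fun {W} _ D s σ hs hI => ?_⟩
  have := spec_seqs_range (fun r => copyRel r (Q.ar r)) (fun i (σ' : St W) =>
    CopyInv D s σ' ∧ ∀ r : Fin Q.numRels, (r : ℕ) < i → RelDone D σ' r) Q.numRels
    (C * D.maxCard + 9) σ ⟨hI, fun r h => absurd h (by omega)⟩ (by
      rintro i hi σ1 ⟨h1, h2⟩
      have har : Q.ar i = Q.arity ⟨i, hi⟩ := by simp [CQ.ar, hi]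
      have hlen : (D.rows ⟨i, hi⟩).length ≤ D.maxCard :=
        Finset.le_sup (f := fun r => (D.rows r).length) (Finset.mem_univ (⟨i, hi⟩ : Fin Q.numRels))
      have hsp := spec_copyRel D s ⟨i, hi⟩ (hs _) (fun r => (r : ℕ) < i) σ1 h1 h2
      have hCi := hC i hi
      rw [har] at hCi
      simp only [har]
      refine hsp.mono ?_ ?_
      · have := Nat.mul_le_mul hlen hCi
        rw [mul_comm C]
        simp only at this ⊢
        omega
      · rintro σ2 ⟨b1, b2, b3⟩
        refine ⟨b1, fun r hr => ?_⟩
        rcases Nat.lt_succ_iff_lt_or_eq.1 hr with h | h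
        · exact b3 r h
        · have : r = ⟨i, hi⟩ := Fin.ext h
          rw [this]; exact b2)
  refine this.mono ?_ fun σ' h => ⟨h.1, fun r => h.2 r r.2⟩
  calc Q.numRels * (C * D.maxCard + 9 + 1) + 1
      ≤ Q.numRels * ((C + 10) * (D.maxCard + 1)) + (D.maxCard + 1) := by
        gcongr
        · nlinarith [Nat.zero_le (C * 1)]
        · omega
    _ = _ := by ring

/-- Every cell of the input has been copied, so an empty cell of the arena is empty in the input
too. Equality everywhere is required, as the embedded algorithm could notice any deviation. -/
theorem CopyInv.arena {D : Database Q W} {s : ℕ} {σ : St W} (h : CopyInv D s σ)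
    (hr : ∀ r, RelDone D σ r) : (∀ a, σ.mem (5 :: a) = inputMem D a) ∧
      ∀ a, σ.wmem (5 :: a) = inputWMem D a := by
  constructor
  · intro a
    rcases h.sub a with h1 | h1
    · rw [h1]
      unfold inputMem
      split
      · rename_i r
        split_ifs with hr'
        · have := (hr ⟨r, hr'⟩).head
          rw [inputMem_head] at this
          rw [this] at h1
          exact absurd h1 (by simp)
        · rfl
      · rename_i r j c
        split_ifs with hr' hj hc
        · have := ((hr ⟨r, hr'⟩).row j hj).mem c hc
          rw [inputMem_row D ⟨r, hr'⟩ hj hc] at this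
          rw [this] at h1
          exact absurd h1 (by simp)
        · rfl
        · rfl
        · rfl
      · rfl
    · exact h1
  · intro a
    rcases h.wsub a with h1 | h1
    · rw [h1]
      unfold inputWMem
      split
      · rename_i r j
        split_ifs with hr' hj
        · have := ((hr ⟨r, hr'⟩).row j hj).wmem
          rw [inputWMem_row D ⟨r, hr'⟩ hj] at this
          rw [this] at h1
          exact absurd h1 (by simp)
        · rfl
        · rfl
      · rfl
    · exact h1

end CopyInput
end RankedEnum

namespace RankedEnum

universe u

/-! ### Join trees from GYO reductions, and the distribution of the atoms over the bags. -/

section Planning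

/-- The order in which the GYO reduction removes the ears, read backwards: the vertices which an
edge shares with the edges before it lie in one of these. -/
theorem exists_gyo_order {V ι : Type*} [DecidableEq ι] (bag : ι → Finset V)
    {H : Multiset (Finset V)} (hH : AlphaAcyclic H) : ∀ s : Multiset ι, s.map bag = H →
    ∃ l : List ι, (l : Multiset ι) = s ∧ ∀ i < l.length, 0 < i → ∃ p < i,
      ∀ x ∈ (l.map bag).getD i ∅, (∃ q < i, x ∈ (l.map bag).getD q ∅) →
        x ∈ (l.map bag).getD p ∅ := by
  induction hH with
  | empty =>
    intro s hs
    refine ⟨[], ?_, fun i hi => absurd hi (by simp)⟩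
    rw [Multiset.map_eq_zero] at hs
    rw [hs]; rfl
  | ear e H he _ ih =>
    intro s hs
    -- The ear removed first is placed last, so the edges it is compared with are exactly those
    -- before it.
    obtain ⟨a, ha, hae, hH⟩ := (Multiset.map_eq_cons bag s H e).2 hs
    obtain ⟨l, hl, hgood⟩ := ih _ hH
    have hlen : ∀ i < l.length, ((l ++ [a]).map bag).getD i ∅ = (l.map bag).getD i ∅ := by
      intro i hi
      rw [List.map_append, List.getD_append _ _ _ _ (by simpa using hi)]
    have hlast : ((l ++ [a]).map bag).getD l.length ∅ = e := by
      rw [List.map_append, List.getD_append_right _ _ _ _ (by simp)]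
      simp [hae]
    have hmem : ∀ f, f ∈ H ↔ ∃ q < l.length, (l.map bag).getD q ∅ = f := by
      intro f
      rw [← hH, ← hl, Multiset.map_coe, Multiset.mem_coe, List.mem_iff_getElem]
      constructor
      · rintro ⟨q, hq, rfl⟩
        exact ⟨q, by simpa using hq, by rw [List.getD_eq_getElem _ _ hq]⟩
      · rintro ⟨q, hq, rfl⟩
        exact ⟨q, by simpa using hq, by rw [List.getD_eq_getElem]⟩
    refine ⟨l ++ [a], ?_, ?_⟩
    · rw [← Multiset.coe_add, hl, Multiset.coe_singleton, add_comm, Multiset.singleton_add,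
        Multiset.cons_erase ha]
    · intro i hi h0
      rcases Nat.lt_succ_iff_lt_or_eq.1 (show i < l.length + 1 by simpa using hi) with h | rfl
      · obtain ⟨p, hp, hx⟩ := hgood i h h0
        refine ⟨p, hp, fun x hx1 hx2 => ?_⟩
        rw [hlen p (by omega)]
        rw [hlen i h] at hx1
        refine hx x hx1 ?_
        obtain ⟨q, hq, hq'⟩ := hx2
        rw [hlen q (by omega)] at hq'
        exact ⟨q, hq, hq'⟩
      · rw [hlast]
        rcases he with he | ⟨f, hf, he⟩
        -- An ear that shares no vertex may be attached anywhere; the first edge serves.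
        · refine ⟨0, h0, ?_⟩
          rintro x hx ⟨q, hq, hq'⟩
          rw [hlen q hq] at hq'
          exact absurd hq' (he x hx _ ((hmem _).2 ⟨q, hq, rfl⟩))
        · obtain ⟨p, hp, rfl⟩ := (hmem f).1 hf
          refine ⟨p, hp, ?_⟩
          rintro x hx ⟨q, hq, hq'⟩
          rw [hlen q hq] at hq'
          rw [hlen p hp]
          exact he x hx ⟨_, (hmem _).2 ⟨q, hq, rfl⟩, hq'⟩

variable {Q : CQ} (Δ : Schema Q)

namespace Schema

/-- The bags of the tree `τ`, ordered from the root on. -/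
noncomputable def ord (τ : Fin Δ.numTrees) : List (Fin (Δ.numBags τ)) :=
  (exists_gyo_order (Δ.bag τ) (Δ.acyclic τ) Finset.univ.val rfl).choose

theorem ord_spec (τ : Fin Δ.numTrees) : (Δ.ord τ : Multiset (Fin (Δ.numBags τ))) = Finset.univ.val ∧
    ∀ i < (Δ.ord τ).length, 0 < i → ∃ p < i,
      ∀ x ∈ ((Δ.ord τ).map (Δ.bag τ)).getD i ∅,
        (∃ q < i, x ∈ ((Δ.ord τ).map (Δ.bag τ)).getD q ∅) →
        x ∈ ((Δ.ord τ).map (Δ.bag τ)).getD p ∅ :=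
  (exists_gyo_order (Δ.bag τ) (Δ.acyclic τ) Finset.univ.val rfl).choose_spec

theorem mem_ord (τ : Fin Δ.numTrees) (b : Fin (Δ.numBags τ)) : b ∈ Δ.ord τ := by
  have : b ∈ (Δ.ord τ : Multiset (Fin (Δ.numBags τ))) := by rw [(Δ.ord_spec τ).1]; simp
  simpa using this

/-- The `i`-th bag of the tree `τ`. -/
noncomputable def bagAt (τ : Fin Δ.numTrees) (i : ℕ) : Finset (Fin Q.numVars) :=
  ((Δ.ord τ).map (Δ.bag τ)).getD i ∅

noncomputable def varsAt (τ : Fin Δ.numTrees) (i : ℕ) : List ℕ :=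
  ((List.finRange Q.numVars).filter (· ∈ Δ.bagAt τ i)).map Fin.val

theorem mem_varsAt {τ : Fin Δ.numTrees} {i x : ℕ} :
    x ∈ Δ.varsAt τ i ↔ ∃ h : x < Q.numVars, (⟨x, h⟩ : Fin Q.numVars) ∈ Δ.bagAt τ i := by
  simp only [varsAt, List.mem_map, List.mem_filter, List.mem_finRange, true_and, decide_eq_true_eq]
  constructor
  · rintro ⟨a, ha, rfl⟩
    exact ⟨a.2, ha⟩
  · rintro ⟨h, hx⟩
    exact ⟨_, hx, rfl⟩

open Classical in
noncomputable def sepAt (τ : Fin Δ.numTrees) (i : ℕ) : List ℕ :=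
  (Δ.varsAt τ i).filter fun x => ∃ l < i, x ∈ Δ.varsAt τ l

open Classical in
noncomputable def parAt (τ : Fin Δ.numTrees) (i : ℕ) : ℕ :=
  if h : ∃ p < i, ∀ x ∈ Δ.sepAt τ i, x ∈ Δ.varsAt τ p then h.choose else 0

theorem parAt_spec (τ : Fin Δ.numTrees) {i : ℕ} (hi : i < (Δ.ord τ).length) (h0 : 0 < i) :
    Δ.parAt τ i < i ∧ ∀ x ∈ Δ.sepAt τ i, x ∈ Δ.varsAt τ (Δ.parAt τ i) := by
  have h : ∃ p < i, ∀ x ∈ Δ.sepAt τ i, x ∈ Δ.varsAt τ p := by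
    obtain ⟨p, hp, hx⟩ := (Δ.ord_spec τ).2 i hi h0
    refine ⟨p, hp, fun x hxs => ?_⟩
    simp only [sepAt, List.mem_filter, decide_eq_true_eq] at hxs
    obtain ⟨h1, l, hl, h2⟩ := hxs
    obtain ⟨hxn, h1⟩ := Δ.mem_varsAt.1 h1
    obtain ⟨_, h2⟩ := Δ.mem_varsAt.1 h2
    exact Δ.mem_varsAt.2 ⟨hxn, hx _ h1 ⟨l, hl, h2⟩⟩
  rw [parAt, dif_pos h]
  exact h.choose_spec

/-- The position of the bag to which the weight of an atom is charged. -/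
noncomputable def posOf (τ : Fin Δ.numTrees) (a : Fin Q.numAtoms) : ℕ :=
  (Δ.ord τ).idxOf (Δ.covers τ a).choose

/-- An atom as a relation symbol with a list of variables. -/
def _root_.RankedEnum.CQ.atom (Q : CQ) (a : Fin Q.numAtoms) : ℕ × List ℕ :=
  (Q.rel a, List.ofFn fun c => (Q.args a c : ℕ))

noncomputable def atomsAt (τ : Fin Δ.numTrees) (i : ℕ) : List (ℕ × List ℕ) :=
  ((List.finRange Q.numAtoms).filter fun a => Δ.posOf τ a = i).map Q.atom

theorem posOf_lt (τ : Fin Δ.numTrees) (a : Fin Q.numAtoms) : Δ.posOf τ a < (Δ.ord τ).length :=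
  List.idxOf_lt_length_iff.2 (Δ.mem_ord τ _)

theorem bagAt_of_lt {τ : Fin Δ.numTrees} {i : ℕ} (hi : i < (Δ.ord τ).length) :
    Δ.bagAt τ i = Δ.bag τ (Δ.ord τ)[i] := by
  rw [bagAt, List.getD_eq_getElem _ _ (by simpa using hi), List.getElem_map]

theorem atomVars_subset (τ : Fin Δ.numTrees) (a : Fin Q.numAtoms) :
    Q.atomVars a ⊆ Δ.bagAt τ (Δ.posOf τ a) := by
  rw [Δ.bagAt_of_lt (Δ.posOf_lt τ a)]
  have : (Δ.ord τ)[Δ.posOf τ a]'(Δ.posOf_lt τ a) = (Δ.covers τ a).choose :=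
    List.getElem_idxOf _
  rw [this]
  exact (Δ.covers τ a).choose_spec

/-- The description of the tree `τ` on which the algorithm is based. -/
noncomputable def planOf (τ : Fin Δ.numTrees) : Plan where
  m := (Δ.ord τ).length
  id i := ((Δ.ord τ).map Fin.val).getD i 0
  vars := Δ.varsAt τ
  sep := Δ.sepAt τ
  par := Δ.parAt τ
  atoms := Δ.atomsAt τ

theorem valid_planOf (τ : Fin Δ.numTrees) : (Δ.planOf τ).Valid where
  par_lt c h0 hc := (Δ.parAt_spec τ hc h0).1
  sep_zero := by
    show Δ.sepAt τ 0 = []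
    simp [sepAt]
  sep_par c h0 hc := (Δ.parAt_spec τ hc h0).2
  sep_self c _ x hx := by
    have : x ∈ Δ.sepAt τ c := hx
    simp only [sepAt, List.mem_filter] at this
    exact this.1
  sep_shared i c hic _ x hx hx' := by
    show x ∈ Δ.sepAt τ c
    simp only [sepAt, List.mem_filter, decide_eq_true_eq]
    exact ⟨hx', i, hic, hx⟩
  atoms_sub i _ a ha x hx := by
    have ha : a ∈ Δ.atomsAt τ i := ha
    simp only [atomsAt, List.mem_map, List.mem_filter, decide_eq_true_eq] at ha
    obtain ⟨b, ⟨-, rfl⟩, rfl⟩ := ha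
    simp only [CQ.atom, List.mem_ofFn] at hx
    obtain ⟨c, rfl⟩ := hx
    refine Δ.mem_varsAt.2 ⟨(Q.args b c).2, Δ.atomVars_subset τ b ?_⟩
    exact Finset.mem_image_of_mem _ (Finset.mem_univ _)

/-- The plans of all trees. -/
noncomputable def plan (τ : ℕ) : Plan :=
  if h : τ < Δ.numTrees then Δ.planOf ⟨τ, h⟩
  else ⟨0, fun _ => 0, fun _ => [], fun _ => [], fun _ => 0, fun _ => []⟩

theorem plan_eq (τ : Fin Δ.numTrees) : Δ.plan τ = Δ.planOf τ := by simp [plan]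

theorem valid_plan (τ : ℕ) : (Δ.plan τ).Valid := by
  unfold plan
  split_ifs with h
  · exact Δ.valid_planOf _
  · exact ⟨by simp, rfl, by simp, by simp, by simp, by simp⟩

theorem vars_lt (τ : Fin Δ.numTrees) (i : ℕ) {x : ℕ} (hx : x ∈ (Δ.planOf τ).vars i) :
    x < Q.numVars := (Δ.mem_varsAt.1 hx).1

theorem covered (τ : Fin Δ.numTrees) {x : ℕ} (hx : x < Q.numVars) :
    ∃ l < (Δ.planOf τ).m, x ∈ (Δ.planOf τ).vars l := by
  obtain ⟨a, c, h⟩ := Q.var_occurs ⟨x, hx⟩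
  refine ⟨Δ.posOf τ a, Δ.posOf_lt τ a, Δ.mem_varsAt.2 ⟨hx, Δ.atomVars_subset τ a ?_⟩⟩
  rw [← h]
  exact Finset.mem_image_of_mem _ (Finset.mem_univ _)

/-- The bag at a position. -/
theorem bag_of_pos (τ : Fin Δ.numTrees) {i : ℕ} (hi : i < (Δ.planOf τ).m) :
    ∃ b : Fin (Δ.numBags τ), (Δ.planOf τ).id i = b ∧
      ∀ x, x ∈ (Δ.planOf τ).vars i ↔ ∃ h : x < Q.numVars, (⟨x, h⟩ : Fin _) ∈ Δ.bag τ b := by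
  have hi' : i < (Δ.ord τ).length := hi
  refine ⟨(Δ.ord τ)[i], ?_, fun x => ?_⟩
  · show ((Δ.ord τ).map Fin.val).getD i 0 = _
    rw [List.getD_eq_getElem _ _ (by simpa using hi'), List.getElem_map]
  · rw [← Δ.bagAt_of_lt hi']
    exact Δ.mem_varsAt

/-- The position of a bag. -/
theorem pos_of_bag (τ : Fin Δ.numTrees) (b : Fin (Δ.numBags τ)) :
    ∃ i < (Δ.planOf τ).m, (Δ.planOf τ).id i = b ∧
      ∀ x, x ∈ (Δ.planOf τ).vars i ↔ ∃ h : x < Q.numVars, (⟨x, h⟩ : Fin _) ∈ Δ.bag τ b := by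
  have hi : (Δ.ord τ).idxOf b < (Δ.ord τ).length := List.idxOf_lt_length_iff.2 (Δ.mem_ord τ _)
  have e : (Δ.ord τ)[(Δ.ord τ).idxOf b]'hi = b := List.getElem_idxOf _
  refine ⟨_, hi, ?_, fun x => ?_⟩
  · show ((Δ.ord τ).map Fin.val).getD _ 0 = _
    rw [List.getD_eq_getElem _ _ (by simpa using hi), List.getElem_map, e]
  · have := Δ.bagAt_of_lt hi
    rw [e] at this
    rw [← this]
    exact Δ.mem_varsAt

/-- Every atom is charged to exactly one bag. -/
theorem prod_atoms {W : Type u} [CommMonoid W] (τ : Fin Δ.numTrees) (g : ℕ × List ℕ → W) :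
    ∏ i ∈ Finset.range (Δ.planOf τ).m, (((Δ.planOf τ).atoms i).map g).prod =
      (List.ofFn fun a => g (Q.atom a)).prod := by
  rw [List.prod_ofFn]
  rw [← Finset.prod_fiberwise_of_maps_to (s := Finset.univ) (t := Finset.range (Δ.planOf τ).m)
    (g := Δ.posOf τ) (fun a _ => Finset.mem_range.2 (Δ.posOf_lt τ a))]
  refine Finset.prod_congr rfl fun i _ => ?_
  show ((Δ.atomsAt τ i).map g).prod = _
  rw [atomsAt, List.map_map, ← List.prod_toFinset _ ((List.nodup_finRange _).filter _)]
  refine Finset.prod_congr ?_ fun _ _ => rfl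
  ext a
  simp

end Schema
end Planning
end RankedEnum

namespace RankedEnum

universe u

/-! ### The solutions of the indexed trees are the results of the query, with their weights. -/

section Environment

variable {Q : CQ} {W : Type u}

/-- The memory `mem`, `wmem` holds the bags `R`, their index, and the dictionary of weights. -/
structure Indexed [CommSemiring W] (Δ : Schema Q) (D : Database Q W)
    (R : (τ : Fin Δ.numTrees) → (b : Fin (Δ.numBags τ)) → List (Δ.bag τ b → ℕ))
    (mem : List ℕ → Option ℕ) (wmem : List ℕ → Option W) : Prop where
  nodup : ∀ (τ : Fin Δ.numTrees) (b : Fin (Δ.numBags τ)), (R τ b).Nodup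
  len : ∀ (τ : Fin Δ.numTrees) (b : Fin (Δ.numBags τ)),
    mem [5, 1, (τ : ℕ), (b : ℕ)] = some (R τ b).length
  val : ∀ (τ : Fin Δ.numTrees) (b : Fin (Δ.numBags τ)) (j : Fin (R τ b).length) (x : Δ.bag τ b),
    mem [5, 1, (τ : ℕ), (b : ℕ), (j : ℕ), ((x : Fin Q.numVars) : ℕ)] = some ((R τ b)[j] x)
  done : ∀ τ < Δ.numTrees, ∀ i < (Δ.plan τ).m, BagDone (Δ.plan τ) τ mem wmem i
  dict : ∀ r, ∀ row ∈ D.rows r, wmem (2 :: r :: List.ofFn row) = some (D.weight r row)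
  fresh : ∀ a, EnumAddr a → mem a = none
  wfresh : ∀ l, wmem (6 :: l) = none

/-- A bound for the number of bags of a tree. -/
def Schema.maxBags (Δ : Schema Q) : ℕ := ∑ τ, Δ.numBags τ

theorem Schema.length_ord (Δ : Schema Q) (τ : Fin Δ.numTrees) :
    (Δ.ord τ).length = Δ.numBags τ := by
  rw [← Multiset.coe_card, (Δ.ord_spec τ).1]; simp

variable [CommSemiring W]

noncomputable def envOf (Δ : Schema Q) (D : Database Q W) (mem : List ℕ → Option ℕ)
    (wmem : List ℕ → Option W) : Env W where
  plan := Δ.plan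
  nt := Δ.numTrees
  n := Q.numVars
  mm := Δ.maxBags
  mem := mem
  wmem := wmem
  ω u := D.resultWeight fun i => u.getD i 0

theorem map_range_eq_ofFn (n : ℕ) (v : ℕ → ℕ) :
    (List.range n).map v = List.ofFn fun i : Fin n => v i := by
  refine List.ext_getElem (by simp) fun i h1 h2 => by simp

theorem getD_ofFn {n : ℕ} (v : Fin n → ℕ) : (fun i : Fin n => (List.ofFn v).getD i 0) = v := by
  funext i
  rw [List.getD_eq_getElem _ _ (by simp), List.getElem_ofFn]

variable {Δ : Schema Q} {D : Database Q W}
  {R : (τ : Fin Δ.numTrees) → (b : Fin (Δ.numBags τ)) → List (Δ.bag τ b → ℕ)}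
  {mem : List ℕ → Option ℕ} {wmem : List ℕ → Option W}

namespace Indexed

variable (h : Indexed Δ D R mem wmem)

include h

/-- The rows of a bag as they are seen by the index. -/
theorem rows (τ : Fin Δ.numTrees) {i : ℕ} (hi : i < (Δ.planOf τ).m) :
    ∃ b, (∀ x, x ∈ (Δ.planOf τ).vars i ↔ ∃ h : x < Q.numVars, (⟨x, h⟩ : Fin _) ∈ Δ.bag τ b) ∧
      (mkTree (Δ.planOf τ) τ mem wmem).len i = (R τ b).length ∧
      ∀ j (hj : j < (R τ b).length) (x : Δ.bag τ b),
        (mkTree (Δ.planOf τ) τ mem wmem).val i (j + 1) ((x : Fin Q.numVars) : ℕ) =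
          (R τ b)[j] x := by
  obtain ⟨b, hb, hx⟩ := Δ.bag_of_pos τ hi
  refine ⟨b, hx, ?_, ?_⟩
  · simp only [mkTree, hb, h.len τ b]; rfl
  · intro j hj x
    simp only [mkTree, hb, Nat.add_sub_cancel]
    rw [h.val τ b ⟨j, hj⟩ x]; rfl

theorem valid (τ : Fin Δ.numTrees) : (mkTree (Δ.planOf τ) τ mem wmem).Valid := by
  refine valid_mkTree (Δ.valid_planOf τ) ?_ ?_
  · intro i hi
    have := h.done τ τ.2 i
    rw [Δ.plan_eq] at this
    exact this hi
  · intro i hi r r' h1 h2 h3 h4 hx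
    obtain ⟨b, hb, hl, hv⟩ := h.rows τ hi
    rw [hl] at h2 h4
    obtain ⟨r, rfl⟩ : ∃ j, r = j + 1 := ⟨r - 1, by omega⟩
    obtain ⟨r', rfl⟩ : ∃ j, r' = j + 1 := ⟨r' - 1, by omega⟩
    have : (R τ b)[r]'(by omega) = (R τ b)[r']'(by omega) := by
      funext x
      rw [← hv r (by omega) x, ← hv r' (by omega) x]
      exact hx _ ((hb _).2 ⟨(x : Fin Q.numVars).2, x.2⟩)
    have := (List.Nodup.getElem_inj_iff (h.nodup τ b)).1 this
    omega

/-- The solutions of a tree are the assignments which agree on each bag with a tuple of it. -/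
theorem part_iff (τ : Fin Δ.numTrees) (v : ℕ → ℕ) :
    (∃ s, (mkTree (Δ.planOf τ) τ mem wmem).Part (mkTree (Δ.planOf τ) τ mem wmem).m s v) ↔
      ∀ b, (fun x : Δ.bag τ b => v (x : Fin Q.numVars)) ∈ R τ b := by
  set T := mkTree (Δ.planOf τ) τ mem wmem with hT
  constructor
  · rintro ⟨s, hs⟩ b
    obtain ⟨i, hi, hid, -⟩ := Δ.pos_of_bag τ b
    obtain ⟨b', hb', hx⟩ := Δ.bag_of_pos τ hi
    have : b' = b := Fin.ext (hb'.symm.trans hid)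
    subst this
    obtain ⟨⟨h1, h2⟩, -, h3⟩ := hs i hi
    have hl : T.len i = (R τ b').length := by
      simp only [hT, mkTree, hid, h.len τ b']; rfl
    rw [hl] at h2
    have : (fun x : Δ.bag τ b' => v (x : Fin Q.numVars)) = (R τ b')[s i - 1]'(by omega) := by
      funext x
      have hv := h3 _ ((hx ((x : Fin Q.numVars) : ℕ)).2 ⟨(x : Fin Q.numVars).2, x.2⟩)
      rw [← hv]
      simp only [hT, mkTree, hid]
      rw [h.val τ b' ⟨s i - 1, by omega⟩ x]; rfl
    rw [this]
    exact List.getElem_mem _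
  · intro hv
    have hex : ∀ i < T.m, ∃ r, (1 ≤ r ∧ r ≤ T.len i) ∧ ∀ x ∈ T.vars i, T.val i r x = v x := by
      intro i hi
      obtain ⟨b, hb, hl, hval⟩ := h.rows τ hi
      obtain ⟨j, hj, he⟩ := List.getElem_of_mem (hv b)
      refine ⟨j + 1, ⟨by omega, by rw [hl]; omega⟩, fun x hx => ?_⟩
      obtain ⟨hxn, hxb⟩ := (hb x).1 hx
      rw [show T.val i (j + 1) x = (R τ b)[j] ⟨⟨x, hxn⟩, hxb⟩ from hval j hj ⟨⟨x, hxn⟩, hxb⟩, he]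
    choose! s hs using hex
    exact ⟨s, Tree.part_of_rows (h.valid τ) hs⟩

omit h in
theorem env_T (τ : Fin Δ.numTrees) :
    (envOf Δ D mem wmem).T τ = mkTree (Δ.planOf τ) τ mem wmem := by
  simp only [Env.T, envOf, Δ.plan_eq]

variable (hR : ∀ v : Fin Q.numVars → ℕ, D.IsResult v ↔
  ∃ τ, ∀ b, (fun x : Δ.bag τ b => v x) ∈ R τ b)

include hR

theorem isRes_iff (u : List ℕ) :
    (envOf Δ D mem wmem).IsRes u ↔ ∃ v, D.IsResult v ∧ u = List.ofFn v := by
  constructor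
  · rintro ⟨τ, hτ, s, v, hp, rfl⟩
    rw [show τ = ((⟨τ, hτ⟩ : Fin Δ.numTrees) : ℕ) from rfl, env_T] at hp
    refine ⟨fun i => v i, (hR _).2 ⟨⟨τ, hτ⟩, (h.part_iff ⟨τ, hτ⟩ v).1 ⟨s, hp⟩⟩, ?_⟩
    exact map_range_eq_ofFn _ v
  · rintro ⟨v, hv, rfl⟩
    obtain ⟨τ, hb⟩ := (hR v).1 hv
    set v' : ℕ → ℕ := fun x => if hx : x < Q.numVars then v ⟨x, hx⟩ else 0 with hv'
    have hvv : ∀ x : Fin Q.numVars, v' x = v x := fun x => by simp [hv']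
    obtain ⟨s, hs⟩ := (h.part_iff τ v').2 (by simpa only [hvv] using hb)
    refine ⟨τ, τ.2, s, v', ?_, ?_⟩
    · rw [env_T]; exact hs
    · rw [map_range_eq_ofFn]
      exact congrArg List.ofFn (funext fun x => (hvv x).symm)

theorem ok : (envOf Δ D mem wmem).Ok where
  valid τ hτ := by
    have := h.valid ⟨τ, hτ⟩
    rwa [← env_T] at this
  m_le τ hτ := by
    show (Δ.plan τ).m ≤ Δ.maxBags
    rw [show Δ.plan τ = _ from Δ.plan_eq ⟨τ, hτ⟩]
    show (Δ.ord ⟨τ, hτ⟩).length ≤ _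
    rw [Δ.length_ord]
    exact Finset.single_le_sum (f := Δ.numBags) (fun _ _ => Nat.zero_le _) (Finset.mem_univ _)
  vars_lt τ hτ l _ x hx := by
    have hx : x ∈ (Δ.plan τ).vars l := hx
    rw [show Δ.plan τ = _ from Δ.plan_eq ⟨τ, hτ⟩] at hx
    exact Δ.vars_lt _ l hx
  covered τ hτ x hx := by
    show ∃ l < (Δ.plan τ).m, x ∈ (Δ.plan τ).vars l
    rw [show Δ.plan τ = _ from Δ.plan_eq ⟨τ, hτ⟩]
    exact Δ.covered _ hx
  fresh := h.fresh
  wfresh := h.wfresh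
  weight τ hτ s v hp := by
    obtain ⟨τ, rfl⟩ : ∃ τ' : Fin Δ.numTrees, τ = τ' := ⟨⟨τ, hτ⟩, rfl⟩
    rw [env_T] at hp ⊢
    set T := mkTree (Δ.planOf τ) τ mem wmem with hT
    have hres : D.IsResult fun i => v i := (hR _).2 ⟨τ, (h.part_iff τ v).1 ⟨s, hp⟩⟩
    have hw : ∀ l < (Δ.planOf τ).m, T.w l (s l) = (((Δ.planOf τ).atoms l).map fun a =>
        (wmem (2 :: a.1 :: a.2.map v)).getD 1).prod := by
      intro l hl
      obtain ⟨h1, -, h3⟩ := hp l hl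
      have hd := h.done τ τ.2 l
      rw [Δ.plan_eq] at hd
      rw [hT, ((hd hl).2 (s l) h1.1 h1.2).1, rowW]
      refine congrArg _ (List.map_congr_left fun a ha => ?_)
      rw [List.map_congr_left fun x hx =>
        h3 x ((Δ.valid_planOf τ).atoms_sub l hl a ha x hx)]
    show ∏ l ∈ Finset.range (Δ.planOf τ).m, T.w l (s l) = D.resultWeight _
    rw [Finset.prod_congr rfl fun l hl => hw l (Finset.mem_range.1 hl),
      Δ.prod_atoms τ fun a => (wmem (2 :: a.1 :: a.2.map v)).getD 1, map_range_eq_ofFn]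
    show _ = D.resultWeight fun i : Fin Q.numVars =>
      (List.ofFn fun i : Fin Q.numVars => v i).getD i 0
    rw [getD_ofFn, Database.resultWeight]
    congr 2
    funext a
    -- The solution is a result, so the tuple of the atom is in its relation and has an entry in the
    -- dictionary. For rows that occur in no result a lookup may return the default weight, which
    -- does no harm.
    have hm := hres a
    have e : (Q.atom a).2.map v = List.ofFn ((fun i : Fin Q.numVars => v i) ∘ Q.args a) := by
      simp only [CQ.atom, List.map_ofFn]; rfl
    show (wmem (2 :: ((Q.rel a : Fin _) : ℕ) :: (Q.atom a).2.map v)).getD 1 = _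
    rw [e, h.dict _ _ hm]
    rfl

end Indexed

-- Every variable ranges over a column of some relation. Finiteness is what makes the main loop
-- terminate.
omit [CommSemiring W] in
theorem finite_results (D : Database Q W) : {v | D.IsResult v}.Finite := by
  choose a c hac using Q.var_occurs
  refine (Set.Finite.pi' (ι := Fin Q.numVars) (κ := fun _ => ℕ)
    (t := fun x => {y | ∃ row ∈ D.rows (Q.rel (a x)), row (c x) = y}) fun x => ?_).subset ?_
  · have : {y | ∃ row ∈ D.rows (Q.rel (a x)), row (c x) = y} =
        (fun row => row (c x)) '' {row | row ∈ D.rows (Q.rel (a x))} := by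
      ext y; simp
    rw [this]
    exact (List.finite_toSet _).image _
  · intro v hv x
    exact ⟨_, hv (a x), by simp [hac]⟩

end Environment
end RankedEnum

namespace RankedEnum

universe u

/-! ### Time and space before the first round. -/

section Preprocessing

variable {Q : CQ} {W : Type u}

theorem le_of_encard_le {X : Type*} {s : Set X} {N k : ℕ} (hs : s.encard ≤ N) (f : Fin k → X)
    (hf : Function.Injective f) (hm : ∀ j, f j ∈ s) : k ≤ N := by
  have h1 : (Set.range f).encard ≤ N :=
    (Set.encard_le_encard (Set.range_subset_iff.2 hm)).trans hs
  rw [← Set.image_univ, hf.injOn.encard_image, Set.encard_univ] at h1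
  simpa using h1

section Cells

variable [CommSemiring W] {Δ : Schema Q} {D : Database Q W}
  {R : (τ : Fin Δ.numTrees) → (b : Fin (Δ.numBags τ)) → List (Δ.bag τ b → ℕ)}

omit [CommSemiring W] in
theorem inputMem_cons (D : Database Q W) {hd : ℕ} (l : List ℕ) (h : hd ≠ 0) :
    inputMem D (hd :: l) = none := by
  unfold inputMem
  split <;> simp_all

omit [CommSemiring W] in
theorem inputWMem_cons (D : Database Q W) {hd : ℕ} (l : List ℕ) (h : hd ≠ 0) :
    inputWMem D (hd :: l) = none := by
  unfold inputWMem
  split <;> simp_all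

-- Each tuple of a bag with a variable occupies a cell of its own outside the input. A bag without
-- variables has at most one tuple, whence the `+ 1`.
omit [CommSemiring W] in
theorem length_bag_le {c : Config W} (hc : StoresBags Δ c R) {N : ℕ}
    (hN : {a | c.mem a ≠ none ∧ inputMem D a = none}.encard ≤ N) (τ : Fin Δ.numTrees)
    (b : Fin (Δ.numBags τ)) : (R τ b).length ≤ N + 1 := by
  obtain ⟨h1, -, h3⟩ := hc τ b
  rcases isEmpty_or_nonempty (Δ.bag τ b) with he | ⟨⟨x⟩⟩
  · by_contra hlt
    have := (List.Nodup.getElem_inj_iff h1 (i := 0) (j := 1) (hi := by omega)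
      (hj := by omega)).1 (Subsingleton.elim _ _)
    omega
  · refine (le_of_encard_le hN (fun j : Fin (R τ b).length =>
      [1, (τ : ℕ), (b : ℕ), (j : ℕ), ((x : Fin Q.numVars) : ℕ)]) ?_ ?_).trans (Nat.le_succ _)
    · intro j j' h
      simpa [Fin.ext_iff] using h
    · intro j
      refine ⟨?_, inputMem_cons D _ one_ne_zero⟩
      rw [h3 j x]
      simp

/-- Weight cells are counted, one per tuple: the tuples of a nullary relation have no number cells.
-/
theorem maxCard_le_of_space (A : Program) {N : ℕ} (hN : (start A D).space ≤ N) :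
    D.maxCard ≤ N := by
  refine Finset.sup_le fun r _ => ?_
  refine le_of_encard_le (le_trans le_add_self hN) (fun j => [0, (r : ℕ), (j : ℕ)]) ?_ ?_
  · intro j j' h
    simpa [Fin.ext_iff] using h
  · intro j
    show inputWMem D [0, (r : ℕ), (j : ℕ)] ≠ none
    rw [inputWMem_row D r j.2]
    simp

omit [CommSemiring W] in
theorem over_mem_of_ne (s : ℕ) (σ : St W) (c : Config W) {a : List ℕ} (ha : ∀ l, a ≠ 5 :: l) :
    (σ.over s c).mem a = σ.mem a := by
  unfold St.over
  dsimp only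
  split
  · exact absurd rfl (ha _)
  · rfl

omit [CommSemiring W] in
theorem over_wmem_of_ne (s : ℕ) (σ : St W) (c : Config W) {a : List ℕ} (ha : ∀ l, a ≠ 5 :: l) :
    (σ.over s c).wmem a = σ.wmem a := by
  unfold St.over
  dsimp only
  split
  · exact absurd rfl (ha _)
  · rfl

theorem encard_arena_le {X : Type*} {f g h : List ℕ → Option X}
    (h1 : ∀ a, (∀ l, a ≠ 5 :: l) → h a = f a) (h2 : ∀ a, h (5 :: a) = g a) :
    {a | h a ≠ none}.encard ≤ {a | f a ≠ none}.encard + {a | g a ≠ none}.encard := by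
  refine (Set.encard_le_encard (t := {a | f a ≠ none} ∪ (5 :: ·) '' {a | g a ≠ none})
    fun a ha => ?_).trans ((Set.encard_union_le _ _).trans
      (add_le_add le_rfl (Set.encard_image_le _ _)))
  by_cases hl : ∃ l, a = 5 :: l
  · obtain ⟨l, rfl⟩ := hl
    exact Or.inr ⟨l, fun e => ha (by rw [h2, e]), rfl⟩
  · exact Or.inl fun e => ha (by rw [h1 a fun l e => hl ⟨l, e⟩, e])

omit [CommSemiring W] in
theorem space_over_le (s : ℕ) (σ : St W) (c : Config W) :
    (σ.over s c).space ≤ σ.space + c.space := by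
  have h1 := encard_arena_le (f := σ.mem) (g := c.mem) (h := (σ.over s c).mem)
    (fun a ha => over_mem_of_ne s σ c ha) (fun _ => rfl)
  have h2 := encard_arena_le (f := σ.wmem) (g := c.wmem) (h := (σ.over s c).wmem)
    (fun a ha => over_wmem_of_ne s σ c ha) (fun _ => rfl)
  refine (add_le_add h1 h2).trans (le_of_eq ?_)
  simp only [St.space, Config.space]
  ring

/-- The data of the initial configuration. -/
def initSt (D : Database Q W) : St W where
  reg := fun _ => 0
  wreg := fun _ => 1
  mem := inputMem D
  wmem := inputWMem D
  out := []

theorem copyInv_initSt (D : Database Q W) (s : ℕ) : CopyInv D s (initSt D) where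
  base _ _ := rfl
  wbase _ _ _ := rfl
  sub a := Or.inl (inputMem_cons (hd := 5) D a (by simp))
  wsub a := Or.inl (inputWMem_cons (hd := 5) D a (by simp))
  out := rfl
  reg _ _ := rfl
  wreg _ _ := rfl

end Cells

/-- The first register of the subprogram. -/
def CQ.shift (Q : CQ) : ℕ := 40 + ∑ r, Q.arity r

/-- Copies the input for the decomposition algorithm `A` and runs it. -/
def decompose (Q : CQ) (A : Program) : Program := .seq (copyAll Q) (A.embed Q.shift)

/-- After the decomposition: the final memory of the decomposition algorithm is found under the
prefix `5`, the weights of the input tuples in a dictionary under the prefix `2`. -/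
structure Decomposed [CommSemiring W] (D : Database Q W) (c : Config W) (σ : St W) : Prop where
  arena : ∀ a, σ.mem (5 :: a) = c.mem a
  base : ∀ a, (∀ l, a ≠ 5 :: l) → σ.mem a = inputMem D a
  wbase : ∀ a, (∀ l, a ≠ 5 :: l) → (∀ l, a ≠ 2 :: l) → σ.wmem a = inputWMem D a
  dict : ∀ r, ∀ row ∈ D.rows r, σ.wmem (2 :: r :: List.ofFn row) = some (D.weight r row)
  out : σ.out = []

/-- Three kinds of cells add up: the original input, the cells written while copying, at most one
per step, and the final memory of the embedded algorithm. -/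
theorem spec_decompose (Q : CQ) : ∃ C, ∀ {W : Type u} [CommSemiring W] (D : Database Q W)
    (A : Program) (t : ℕ), (run A D t).halted →
    Spec (decompose Q A) (C * (D.maxCard + 1) + t + 1) (initSt D) fun σ' =>
      Decomposed D (run A D t) σ' ∧
      σ'.space ≤ (start A D).space + ((C * (D.maxCard + 1) : ℕ) : ℕ∞) + (run A D t).space := by
  obtain ⟨C, hC⟩ := spec_copyAll.{u} Q
  refine ⟨C, fun {W} _ D A t ht => ?_⟩
  have hs : ∀ r, 40 + Q.arity r ≤ Q.shift := fun r => by
    have := Finset.single_le_sum (f := Q.arity) (fun _ _ => Nat.zero_le _) (Finset.mem_univ r)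
    unfold CQ.shift
    omega
  obtain ⟨σ, t₁, ht₁, hr₁, hI, hrel⟩ := hC D Q.shift (initSt D) hs (copyInv_initSt D _)
  obtain ⟨ha, hwa⟩ := hI.arena hrel
  -- Seen from inside the arena, the copied state is the initial configuration, registers included:
  -- the shift exceeds every register used for copying.
  have hov : σ.over Q.shift (start A D) = σ := by
    have e1 : (σ.over Q.shift (start A D)).reg = σ.reg := by
      funext r
      simp only [St.over]
      split_ifs with h
      · rfl
      · exact (hI.reg r (by omega)).symm
    have e2 : (σ.over Q.shift (start A D)).wreg = σ.wreg := by
      funext r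
      simp only [St.over]
      split_ifs with h
      · rfl
      · exact (hI.wreg r (by unfold CQ.shift at h; omega)).symm
    have e3 : (σ.over Q.shift (start A D)).mem = σ.mem := by
      funext a
      by_cases h : ∃ l, a = 5 :: l
      · obtain ⟨l, rfl⟩ := h
        exact (ha l).symm
      · exact over_mem_of_ne _ _ _ fun l e => h ⟨l, e⟩
    have e4 : (σ.over Q.shift (start A D)).wmem = σ.wmem := by
      funext a
      by_cases h : ∃ l, a = 5 :: l
      · obtain ⟨l, rfl⟩ := h
        exact (hwa l).symm
      · exact over_wmem_of_ne _ _ _ fun l e => h ⟨l, e⟩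
    have e5 : (σ.over Q.shift (start A D)).out = σ.out := rfl
    revert e1 e2 e3 e4 e5
    generalize σ.over Q.shift (start A D) = ρ
    intro e1 e2 e3 e4 e5
    cases ρ; cases σ
    simp_all
  obtain ⟨t₂, ht₂, hr₂⟩ := runs_embed Q.shift σ A D t ht hov
  refine ⟨_, _, by omega, hr₁.seq hr₂, ⟨fun a => rfl, fun a h => ?_, fun a h h' => ?_,
    fun r row hrow => ?_, hI.out⟩, ?_⟩
  · rw [over_mem_of_ne _ _ _ h]; exact hI.base a h
  · rw [over_wmem_of_ne _ _ _ h]; exact hI.wbase a h h'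
  · rw [over_wmem_of_ne _ _ _ (by simp)]
    obtain ⟨j, hj, rfl⟩ := List.getElem_of_mem hrow
    exact ((hrel r).row j hj).dict hj
  · refine (space_over_le _ _ _).trans (add_le_add (hr₁.space_le.trans ?_) le_rfl)
    exact add_le_add le_rfl (by exact_mod_cast ht₁)

/-- Everything that precedes the enumeration. -/
noncomputable def prepare (Δ : Schema Q) (A : Program) : Program :=
  .seq (decompose Q A) (.seq (indexAll Δ.plan Δ.numTrees) (initEnum Δ.plan Δ.numTrees))

theorem roundInv_zero [CommSemiring W] {e : Env W} {E : EnumState} {σ : St W}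
    (h : EnumRep e E [] σ) (hp : E.popped = ∅) (hN : E.N ≤ e.nt) (ho : σ.out = [])
    (h13 : σ.reg 13 = 0) (h15 : σ.reg 15 = 1) : RoundInv e 0 E [] σ where
  rep := h
  found := ⟨by simp [hp], by simp, by simp [hp], by simp, by simp⟩
  qh := h13
  go := h15
  le := le_rfl
  out := by simpa using ho
  card := Or.inl (by simp [hp])
  num := by simpa using hN

/-- Indexing is linear in the sizes of the bags, which are bounded both by the time and by the space
of the decomposition. The first bound gives the time; the second gives the space, which a bound by
time alone would not. -/
theorem spec_prepare (Δ : Schema Q) : ∃ C, ∀ {W : Type u} [CommSemiring W], Selective W →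
    ∀ (D : Database Q W) (A : Program) (t S : ℕ)
      (R : (τ : Fin Δ.numTrees) → (b : Fin (Δ.numBags τ)) → List (Δ.bag τ b → ℕ)),
    (∀ s, (run A D s).space ≤ S) → (run A D t).halted → StoresBags Δ (run A D t) R →
    (∀ v : Fin Q.numVars → ℕ, D.IsResult v ↔ ∃ τ, ∀ b, (fun x : Δ.bag τ b => v x) ∈ R τ b) →
    Spec (prepare Δ A) (C * (D.maxCard + t + 1)) (initSt D) fun σ' =>
      ∃ mem wmem E, Indexed Δ D R mem wmem ∧ RoundInv (envOf Δ D mem wmem) 0 E [] σ' ∧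
        {a | mem a ≠ none}.encard + {a | wmem a ≠ none}.encard ≤
          ((C * (S + 1) : ℕ) : ℕ∞) := by
  obtain ⟨C₁, h₁⟩ := spec_decompose.{u} Q
  obtain ⟨C₂, h₂⟩ := spec_indexAll.{u} Δ.valid_plan Δ.numTrees
  obtain ⟨K, hK⟩ := exists_costBound Δ.plan Δ.numTrees Q.numVars
  -- Before the enumeration there is at most one candidate per tree, so a height independent of the
  -- data suffices; the crude choice works because `x < 2 ^ x`.
  set H := 2 * Δ.numTrees + 3 with hH
  set C₃ := cost initRegs + Δ.numTrees * (K * (H + 1) + 6) + 2 with hC₃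
  refine ⟨C₁ + 2 * C₂ + C₃ + 3, fun {W} _ hW D A t S R hS ht hst hR => ?_⟩
  set c := run A D t with hc
  -- The cells outside the input are limited by the number of steps as well as by the total space.
  have hU : {a | c.mem a ≠ none ∧ inputMem D a = none}.encard ≤ ((min t S : ℕ) : ℕ∞) := by
    rcases min_choice t S with h | h <;> rw [h]
    · exact encard_new_le (start A D) t
    · refine (Set.encard_le_encard fun a ha => ha.1).trans (le_trans le_self_add (hS t))
  have hmS : D.maxCard ≤ S := maxCard_le_of_space A (hS 0)
  obtain ⟨σ₁, t₁, ht₁, hr₁, hd, hsp₁⟩ := h₁ D A t ht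
  have hB : ∀ τ < Δ.numTrees, ∀ i < (Δ.plan τ).m,
      σ₁.rd [5, 1, τ, (Δ.plan τ).id i] ≤ min t S + 1 := by
    intro τ hτ i hi
    rw [show Δ.plan τ = _ from Δ.plan_eq ⟨τ, hτ⟩] at hi ⊢
    obtain ⟨b, hb, -⟩ := Δ.bag_of_pos ⟨τ, hτ⟩ hi
    have := (hst ⟨τ, hτ⟩ b).2.1
    rw [hb, St.rd, hd.arena, this]
    exact length_bag_le hst hU ⟨τ, hτ⟩ b
  obtain ⟨σ₂, t₂, ht₂, hr₂, hm, hwm, ho, hdone⟩ := h₂ hW σ₁ (min t S + 1) hB (by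
    rintro a ⟨hd', l, h, rfl⟩
    rw [hd.base _ (by rintro l' e; simp only [List.cons.injEq] at e; omega)]
    exact inputMem_cons D l (by omega))
  have hidx : Indexed Δ D R σ₂.mem σ₂.wmem := by
    have h5 : ∀ l, ¬ IndexAddr (5 :: l) := by
      rintro l ⟨hd', l', h, e⟩
      simp only [List.cons.injEq] at e
      omega
    refine ⟨fun τ b => (hst τ b).1, fun τ b => ?_, fun τ b j x => ?_, hdone, ?_, ?_, ?_⟩
    · rw [hm _ (h5 _), hd.arena]; exact (hst τ b).2.1
    · rw [hm _ (h5 _), hd.arena]; exact (hst τ b).2.2 j x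
    · intro r row hrow
      rw [hwm _ (by rintro ⟨hd', l', h, e⟩; simp only [List.cons.injEq] at e; omega)]
      exact hd.dict r row hrow
    · rintro a ⟨hd', l, h6, h10, rfl⟩
      rw [hm _ (by rintro ⟨hd', l', h, e⟩; simp only [List.cons.injEq] at e; omega),
        hd.base _ (by rintro l' e; simp only [List.cons.injEq] at e; omega)]
      exact inputMem_cons D l (by omega)
    · intro l
      rw [hwm _ (by rintro ⟨hd', l', h, e⟩; simp only [List.cons.injEq] at e; omega),
        hd.wbase _ (by simp) (by simp)]
      exact inputWMem_cons D l (by simp)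
  obtain ⟨σ₃, t₃, ht₃, hr₃, E, hE, hp, hN, ho', h13, h15⟩ :=
    spec_initEnum hW (e := envOf Δ D σ₂.mem σ₂.wmem) (hidx.ok hR) (K := K) hK (σ := σ₂) rfl rfl
      (H := H) Nat.lt_two_pow_self.le
  have ht₃ : t₃ ≤ C₃ := ht₃
  refine ⟨σ₃, _, ?_, hr₁.seq (hr₂.seq hr₃), σ₂.mem, σ₂.wmem, E, hidx,
    roundInv_zero hE hp hN (by rw [ho', ho, hd.out]) h13 h15, ?_⟩
  · have h1 : C₂ * (min t S + 1 + 1) ≤ C₂ * (t + 2) :=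
      Nat.mul_le_mul_left _ (by have := min_le_left t S; omega)
    have h2 : C₂ * (t + 2) ≤ 2 * C₂ * (D.maxCard + t + 1) := by
      rw [mul_comm 2 C₂, mul_assoc]; exact Nat.mul_le_mul_left _ (by omega)
    have h3 : C₁ * (D.maxCard + 1) ≤ C₁ * (D.maxCard + t + 1) :=
      Nat.mul_le_mul_left _ (by omega)
    have h4 : C₃ * 1 ≤ C₃ * (D.maxCard + t + 1) := Nat.mul_le_mul_left _ (by omega)
    have h5 : (C₁ + 2 * C₂ + C₃ + 3) * (D.maxCard + t + 1) = C₁ * (D.maxCard + t + 1) +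
      2 * C₂ * (D.maxCard + t + 1) + C₃ * (D.maxCard + t + 1) + 3 * (D.maxCard + t + 1) := by ring
    omega
  · have h1 : σ₂.space ≤ (((S + C₁ * (D.maxCard + 1) + S) + C₂ * (min t S + 1 + 1) : ℕ) : ℕ∞) := by
      push_cast
      refine hr₂.space_le.trans (add_le_add (hsp₁.trans ?_) ?_)
      · exact_mod_cast add_le_add (add_le_add (hS 0) le_rfl) (hS t)
      · exact_mod_cast ht₂
    refine h1.trans ?_
    have h2 : C₂ * (min t S + 1 + 1) ≤ C₂ * (2 * (S + 1)) :=
      Nat.mul_le_mul_left _ (by have := min_le_right t S; omega)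
    have h3 : C₁ * (D.maxCard + 1) ≤ C₁ * (S + 1) := Nat.mul_le_mul_left _ (by omega)
    have h5 : (C₁ + 2 * C₂ + C₃ + 3) * (S + 1) = C₁ * (S + 1) +
      C₂ * (2 * (S + 1)) + C₃ * (S + 1) + 3 * (S + 1) := by ring
    exact_mod_cast (by omega : _ ≤ (C₁ + 2 * C₂ + C₃ + 3) * (S + 1))

end Preprocessing
end RankedEnum

namespace RankedEnum

universe u

/-! ### From rounds to delays. -/

section Main

variable {Q : CQ} {W : Type u} [CommSemiring W]

/-- The times of the outputs of a run which emits its `k`-th result before time `t k`, where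
`t (k + 1) ≤ t k + r k`, and halts at time `tf`. -/
theorem exists_timeTo {P : Program} {D : Database Q W} {M tf : ℕ} {t r : ℕ → ℕ}
    (ht : ∀ k ≤ M, ¬ (run P D (t k)).halted ∧ (run P D (t k)).out.length = k)
    (hs : ∀ k < M, t (k + 1) ≤ t k + r k) (hf : tf ≤ t M + r M) (hh : (run P D tf).halted)
    (ho : (run P D tf).out.length = M) :
    ∃ TT : ℕ → ℕ, (∀ k, IsTimeTo P D k (TT k)) ∧ TT 1 ≤ t 0 + r 0 ∧
      (∀ k, 2 ≤ k → TT k ≤ TT (k - 1) + (r (k - 2) + r (k - 1))) ∧ (∀ k ≤ M, TT k ≤ t k) ∧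
      ∀ k, TT k ≤ tf := by
  classical
  have hex : ∀ k, ∃ s, k ≤ (run P D s).out.length ∨ (run P D s).halted := fun k =>
    ⟨tf, Or.inr hh⟩
  set TT : ℕ → ℕ := fun k => Nat.find (hex k) with hTT
  have hTf : ∀ k, TT k ≤ tf := fun k => Nat.find_min' (hex k) (Or.inr hh)
  have hTt : ∀ k ≤ M, TT k ≤ t k := fun k hk =>
    Nat.find_min' (hex k) (Or.inl (ht k hk).2.ge)
  have hstep : ∀ k ≤ M, TT (k + 1) ≤ t k + r k := by
    intro k hk
    rcases hk.lt_or_eq with h | rfl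
    · exact (hTt _ h).trans (hs k h)
    · exact (hTf _).trans hf
  have hout : ∀ s, (run P D s).out.length ≤ M := by
    intro s
    rw [← ho, ← run_of_halted hh (le_max_right s tf)]
    exact out_length_mono (le_max_left _ _)
  refine ⟨TT, fun k => ⟨Nat.find_spec (hex k), fun s h => Nat.find_min' (hex k) h⟩,
    hstep 0 (Nat.zero_le _), fun k hk => ?_, hTt, hTf⟩
  obtain ⟨k, rfl⟩ : ∃ j, k = j + 2 := ⟨k - 2, by omega⟩
  simp only [Nat.add_sub_cancel, show k + 2 - 1 = k + 1 by omega]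
  by_cases hhalt : (run P D (TT (k + 1))).halted
  · exact (Nat.find_min' (hex (k + 2)) (Or.inr hhalt)).trans (Nat.le_add_right _ _)
  · have h1 : k + 1 ≤ (run P D (TT (k + 1))).out.length :=
      (Nat.find_spec (hex (k + 1))).resolve_right hhalt
    have hkM : k + 1 ≤ M := h1.trans (hout _)
    -- At the start of round `k` only `k` results are out, so the next one comes later. The moment
    -- of output within a round is not tracked; hence the delay is bounded by two rounds.
    have h2 : t k < TT (k + 1) := by
      by_contra hle
      have := out_length_mono (P := P) (D := D) (not_lt.1 hle)
      rw [(ht k (by omega)).2] at this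
      omega
    have h3 := hstep (k + 1) hkM
    have h4 := hs k (by omega)
    have h5 : TT (k + 2) ≤ t (k + 1) + r (k + 1) := h3
    omega

/-- The number of candidates is linear in `k`, so a height of `log k` plus a constant suffices, and
the time of a round is an affine function of the height. -/
theorem exists_roundTime_le (K nt mm n : ℕ) :
    ∃ C, ∀ k, ∃ H, 2 * (nt + 2 * mm * (nt * (k + 1))) + 3 ≤ 2 ^ H ∧
      roundTime K nt mm n H + 2 ≤ C * (Nat.log 2 (k + 1) + 1) := by
  set X := 2 * nt + 4 * mm * nt + 3 with hX
  set b := nt * (K + nt * mm * 2 * K) with hb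
  refine ⟨roundTime K nt mm n 0 + 2 + b * (X + 1), fun k => ⟨X + (Nat.log 2 (k + 1) + 1), ?_, ?_⟩⟩
  · calc 2 * (nt + 2 * mm * (nt * (k + 1))) + 3 ≤ X * (k + 1) := by
          rw [hX]; nlinarith [Nat.zero_le (nt * k)]
      _ ≤ 2 ^ X * 2 ^ (Nat.log 2 (k + 1) + 1) :=
          Nat.mul_le_mul Nat.lt_two_pow_self.le (Nat.lt_pow_succ_log_self (by simp) _).le
      _ = _ := (pow_add _ _ _).symm
  · set l := Nat.log 2 (k + 1)
    have e : roundTime K nt mm n (X + (l + 1)) = roundTime K nt mm n 0 + b * (X + (l + 1)) := by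
      simp only [roundTime, popTime, hb]; ring
    rw [e]
    have h1 : roundTime K nt mm n 0 + 2 ≤ (roundTime K nt mm n 0 + 2) * (l + 1) :=
      Nat.le_mul_of_pos_right _ (by omega)
    have h2 : b * (X + (l + 1)) ≤ b * ((X + 1) * (l + 1)) :=
      Nat.mul_le_mul_left _ (by nlinarith [Nat.zero_le (X * l)])
    have h3 : (roundTime K nt mm n 0 + 2 + b * (X + 1)) * (l + 1) =
      (roundTime K nt mm n 0 + 2) * (l + 1) + b * ((X + 1) * (l + 1)) := by ring
    omega

/-- The ranked enumeration of the results of `Q` on top of the decomposition algorithm `A`. -/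
noncomputable def rankedEnum (Δ : Schema Q) (A : Program) : Program :=
  .seq (prepare Δ A) (enumLoop Δ.plan Δ.numTrees Q.numVars)

theorem run_rankedEnum {Δ : Schema Q} {A : Program} {D : Database Q W} {σ : St W} {t : ℕ}
    (h : Runs (prepare Δ A) (initSt D) σ t) :
    run (rankedEnum Δ A) D (t + 1) = σ.cfg [enumLoop Δ.plan Δ.numTrees Q.numVars] := by
  rw [run, Function.iterate_succ_apply]
  exact h _

/-- A list of encoded results decodes. -/
theorem ranksResults_of_list {P : Program} {D : Database Q W} {t : ℕ} {L : List (List ℕ)}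
    (hh : (run P D t).halted) (ho : (run P D t).out = L) (hn : L.Nodup)
    (hs : L.Pairwise fun u u' => wle (D.resultWeight fun i => u.getD i 0)
      (D.resultWeight fun i => u'.getD i 0))
    (hm : ∀ u, u ∈ L ↔ ∃ v, D.IsResult v ∧ u = List.ofFn v) : RanksResults P D := by
  set dec : List ℕ → Fin Q.numVars → ℕ := fun u i => u.getD i 0 with hdec
  have hde : ∀ v, dec (List.ofFn v) = v := getD_ofFn
  have hed : ∀ u ∈ L, List.ofFn (dec u) = u := by
    intro u hu
    obtain ⟨v, -, rfl⟩ := (hm u).1 hu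
    rw [hde]
  refine ⟨t, hh, L.map dec, ?_, ?_, fun v => ?_, ?_⟩
  · rw [ho, List.map_map]
    conv_lhs => rw [← List.map_id L]
    exact List.map_congr_left fun u hu => (hed u hu).symm
  · refine hn.map_on fun u hu u' hu' h => ?_
    rw [← hed u hu, ← hed u' hu', h]
  · rw [List.mem_map]
    constructor
    · rintro ⟨u, hu, rfl⟩
      obtain ⟨v, hv, rfl⟩ := (hm u).1 hu
      rwa [hde]
    · intro hv
      exact ⟨_, (hm _).2 ⟨v, hv, rfl⟩, hde v⟩
  · exact List.pairwise_map.2 hs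

end Main
end RankedEnum

theorem mainTheorem1 (Q : CQ) (Δ : Schema Q) :
    ∃ C : ℕ, ∀ A : Program, ∃ P : Program,
      ∀ (W : Type*) [CommSemiring W], Selective W →
      ∀ T S : Database Q W → ℕ, (∀ D, D.maxCard ≤ T D) →
        IsDecompositionAlgorithm Δ A T S →
      ∀ D : Database Q W,
        RanksResults P D ∧
        ∃ TT : ℕ → ℕ, (∀ k, IsTimeTo P D k (TT k)) ∧
          TT 1 ≤ C * T D ∧
          (∀ k, 2 ≤ k → TT k ≤ TT (k - 1) + C * (Nat.log 2 k + 1)) ∧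
          (∀ k, 1 ≤ k → (run P D (TT k)).space ≤ ((C * (S D + k) : ℕ) : ℕ∞)) := by
  obtain ⟨C₁, h₁⟩ := spec_prepare Δ
  obtain ⟨K, hK⟩ := exists_costBound Δ.plan Δ.numTrees Q.numVars
  obtain ⟨C₂, h₂⟩ := exists_roundTime_le K Δ.numTrees Δ.maxBags Q.numVars
  choose H hH hround using h₂
  set Y := Δ.maxBags + Q.numVars + 8 with hY
  -- A result accounts for a constant number of candidates, and a candidate for at most `Y` cells,
  -- so `Z * k` covers the memory of the enumeration for `k` results.
  set Z := (Δ.numTrees + 2 * Δ.maxBags * Δ.numTrees + 1) * Y with hZ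
  refine ⟨3 * C₁ + 2 * C₂ + 1 + Z, fun A => ⟨rankedEnum Δ A, ?_⟩⟩
  intro W _ hW T S hT hA D
  obtain ⟨hS, t, htT, hhalt, R, hst, hR⟩ := hA D
  -- The initial configuration is not halted, so the running time is positive and absorbs additive
  -- constants.
  have ht1 : 1 ≤ t := by
    rcases Nat.eq_zero_or_pos t with rfl | h
    · exact absurd hhalt (List.cons_ne_nil _ _)
    · exact h
  obtain ⟨σ, tp, htp, hrp, mem, wmem, E, hidx, hinv, hsp⟩ := h₁ hW D A t (S D) R hS hhalt hst hR
  set e := envOf Δ D mem wmem with he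
  have hres := hidx.isRes_iff hR
  obtain ⟨L, tm, tf, h0, hk, hstep, hf, hh, ho, hspf, hnd, hsorted, hmem⟩ :=
    enum_run hW (hidx.ok hR) (K := K) hK (B := (finite_results D).toFinset.card)
      (run_rankedEnum hrp) hinv (fun L hL hmem => by
        rw [← List.toFinset_card_of_nodup hL,
          ← Finset.card_image_of_injective _ List.ofFn_injective]
        refine Finset.card_le_card fun u hu => ?_
        obtain ⟨v, hv, rfl⟩ := (hres u).1 (hmem u (by simpa using hu))
        exact Finset.mem_image_of_mem _ (by simpa using hv)) (H := H) hH
  obtain ⟨TT, hTT, hT1, hTk, hTt, hTf⟩ := exists_timeTo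
    (r := fun k => C₂ * (Nat.log 2 (k + 1) + 1)) (fun k h => ⟨(hk k h).1, (hk k h).2.1⟩)
    (fun k h => (hstep k h).trans (Nat.add_le_add_left ((Nat.le_succ _).trans (hround k)) _))
    (hf.trans (Nat.add_le_add_left (hround _) _)) hh (by rw [ho])
  refine ⟨ranksResults_of_list hh ho hnd hsorted fun u => (hmem u).trans (hres u),
    TT, hTT, ?_, fun k hk2 => ?_, fun k hk1 => ?_⟩
  · have hmT := hT D
    rw [h0] at hT1
    have h3 : C₁ * (D.maxCard + t + 1) ≤ C₁ * (3 * T D) := Nat.mul_le_mul_left _ (by omega)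
    have h4 : C₂ * 1 ≤ C₂ * (2 * T D) := Nat.mul_le_mul_left _ (by omega)
    have h5 : (3 * C₁ + 2 * C₂ + 1 + Z) * T D =
      C₁ * (3 * T D) + C₂ * (2 * T D) + T D + Z * T D := by ring
    simp only [zero_add, Nat.log_one_right] at hT1
    omega
  · refine (hTk k hk2).trans (Nat.add_le_add_left ?_ _)
    have h3 : C₂ * (Nat.log 2 (k - 2 + 1) + 1) ≤ C₂ * (Nat.log 2 k + 1) :=
      Nat.mul_le_mul_left _ (Nat.succ_le_succ (Nat.log_mono_right (by omega)))
    have h4 : k - 1 + 1 = k := by omega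
    have h5 : (3 * C₁ + 2 * C₂ + 1 + Z) * (Nat.log 2 k + 1) = 2 * (C₂ * (Nat.log 2 k + 1)) +
      (3 * C₁ + 1 + Z) * (Nat.log 2 k + 1) := by ring
    simp only [h4]
    omega
  · have key : ∀ j ≤ k, {a | e.mem a ≠ none}.encard + {a | e.wmem a ≠ none}.encard +
        (((e.nt + 2 * e.mm * (e.nt * j) + 1) * (e.mm + e.n + 8) : ℕ) : ℕ∞) ≤
        (((3 * C₁ + 2 * C₂ + 1 + Z) * (S D + k) : ℕ) : ℕ∞) := by
      intro j hj
      refine (add_le_add hsp le_rfl).trans ?_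
      have h3 : (Δ.numTrees + 2 * Δ.maxBags * (Δ.numTrees * j) + 1) * Y ≤ Z * k := by
        rw [hZ, mul_right_comm _ Y k]
        refine Nat.mul_le_mul_right _ ?_
        have a1 : Δ.numTrees * 1 ≤ Δ.numTrees * k := Nat.mul_le_mul_left _ hk1
        have a2 : 2 * Δ.maxBags * Δ.numTrees * j ≤ 2 * Δ.maxBags * Δ.numTrees * k :=
          Nat.mul_le_mul_left _ hj
        calc _ = Δ.numTrees * 1 + 2 * Δ.maxBags * Δ.numTrees * j + 1 := by ring
          _ ≤ Δ.numTrees * k + 2 * Δ.maxBags * Δ.numTrees * k + k := by omega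
          _ = _ := by ring
      have h4 : C₁ * (S D + 1) ≤ C₁ * (S D + k) := Nat.mul_le_mul_left _ (by omega)
      have h5 : (3 * C₁ + 2 * C₂ + 1 + Z) * (S D + k) = C₁ * (S D + k) + Z * k +
        ((2 * C₁ + 2 * C₂ + 1) * (S D + k) + Z * S D) := by ring
      have h6 : C₁ * (S D + 1) + (Δ.numTrees + 2 * Δ.maxBags * (Δ.numTrees * j) + 1) * Y ≤
        (3 * C₁ + 2 * C₂ + 1 + Z) * (S D + k) := by omega
      exact_mod_cast h6
    rcases le_or_gt k L.length with h | h
    · exact ((space_mono (hTt k h)).trans (hk k h).2.2).trans (key k le_rfl)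
    -- Past the last result, `TT k` is at most the halting time; the number of rounds is then
    -- `L.length + 1 ≤ k`.
    · exact ((space_mono (hTf k)).trans hspf).trans (key _ h)
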